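/- **Setting.** Let $\lambda$ be the security parameter. Let $n=n(\lambda)$ be polynomially bounded, $t=t(\lambda)\le n/2$, and let $p=p(\lambda)>n$ be a prime, all computable in time polynomial in $\lambda$. Adversaries are probabilistic polynomial-time (PPT) machines, possibly with access to a fixed local device such as a quantum computer; the same kind of adversary is meant in the assumptions and in the conclusion. Honest algorithms and simulators are classical PPT. *Assumptions.* 1. $\mathsf{PKE}=(\mathsf{Setup},\mathsf{KeyGen},\mathsf{KeyVer},\mathsf{Enc},\mathsf{Dec})$ is an efficient public key encryption scheme with message space $\mathbb Z_p$. Here $\mathsf{KeyGen}(\mathsf{pp}',r)$ and $\mathsf{Enc}(\mathsf{pp}',\mathsf{pk},m,r)$ are deterministic given randomness $r$ drawn from $\mathcal{RAND}^{\mathsf{Key}}$ and $\mathcal{RAND}^{\mathsf{Enc}}$, and $\mathsf{Dec}$ returns a message and an additional witness. It satisfies: (a) an honest key pair passes $\mathsf{KeyVer}$ with overwhelming probability; (b) if $\mathsf{KeyVer}(\mathsf{pp}',\mathsf{pk},\mathsf{sk})=1$ then every encryption of $m$ under $\mathsf{pk}$ is decrypted by $\mathsf{sk}$ to $(m,w)$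 with $w\in\mathcal W^{\mathsf{Dec}}$; (c) each $\mathsf{pk}$ has at most one $\mathsf{sk}$ with $\mathsf{KeyVer}(\mathsf{pp}',\mathsf{pk},\mathsf{sk})=1$; (d) multi-key IND-CPA security: for polynomially many honest public keys, encryptions of two message vectors chosen by the adversary (one message per key) are indistinguishable. 2. $\mathcal W^{\mathsf{Dec}}\subseteq\mathcal W^{\mathsf{Dec}}_{zk}\subseteq\mathcal W^{\mathsf{Dec}}_{sound}$, and $\mathsf{NIZK}_0,\mathsf{NIZK}_1,\mathsf{NIZK}_2$ are efficient non-interactive arguments in the common reference string model, correct, adaptively sound and adaptively multi-theorem zero-knowledge, for the following gap languages determined by $\mathsf{pp}'\leftarrow\mathsf{PKE.Setup}(1^\lambda)$. Write $\mathcal L^{\mathsf{SSS}}_{m,t}\subseteq\mathbb Z_p^m$ for the vectors $(f(1),\dots,f(m))$ with $f\in\mathbb Z_p[X]$, $\deg f\le t$. * $\mathcal L^{\mathsf{Key}}$: statements $(\mathsf{pp}',\mathsf{pk})$. The zero-knowledge relation has witnesses $(\mathsf{sk},r)$ with $(\mathsf{pk},\mathsf{sk})=\mathsf{KeyGen}(\mathsf{pp}',r)$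 and $r\in\mathcal{RAND}^{\mathsf{Key}}$; the soundness language requires some $\mathsf{sk}$ with $\mathsf{KeyVer}(\mathsf{pp}',\mathsf{pk},\mathsf{sk})=1$. * $\mathcal L^{\mathsf{Enc}}$: statements $(\mathsf{pp}',m,t,(\mathsf{pk}_i,E_i)_{i\le m})$. The zero-knowledge relation has witnesses $(s_i,r_i)_{i\le m}$ with $E_i=\mathsf{Enc}(\mathsf{pp}',\mathsf{pk}_i,s_i,r_i)$, $r_i\in\mathcal{RAND}^{\mathsf{Enc}}$, $(\mathsf{pp}',\mathsf{pk}_i)\in\mathcal L^{\mathsf{Key}}_{sound}$ and $(s_i)_i\in\mathcal L^{\mathsf{SSS}}_{m,t}$; the soundness language requires valid $\mathsf{sk}_i$ with $\mathsf{Dec}(\mathsf{pp}',\mathsf{pk}_i,\mathsf{sk}_i,E_i)=(s_i,w_i)$, $w_i\in\mathcal W^{\mathsf{Dec}}_{zk}$, $(s_i)_i\in\mathcal L^{\mathsf{SSS}}_{m,t}$. * $\mathcal L^{\mathsf{Dec}}$: statements $(\mathsf{pp}',\mathsf{pk},E,s)$. The zero-knowledge relation has witnesses $(\mathsf{sk},r,w)$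 with $\mathsf{Dec}(\mathsf{pp}',\mathsf{pk},\mathsf{sk},E)=(s,w)$, $w\in\mathcal W^{\mathsf{Dec}}_{zk}$, $(\mathsf{pk},\mathsf{sk})=\mathsf{KeyGen}(\mathsf{pp}',r)$, $r\in\mathcal{RAND}^{\mathsf{Key}}$; the soundness language requires $\mathsf{sk},w$ with $\mathsf{Dec}(\mathsf{pp}',\mathsf{pk},\mathsf{sk},E)=(s,w)$, $w\in\mathcal W^{\mathsf{Dec}}_{sound}$, $\mathsf{KeyVer}(\mathsf{pp}',\mathsf{pk},\mathsf{sk})=1$. *The generic PVSS.* The public parameters are $\mathsf{pp}=(\mathsf{pp}',\mathsf{crs}_0,\mathsf{crs}_1,\mathsf{crs}_2)$, where $\mathsf{crs}_i$ is set up by $\mathsf{NIZK}_i$. A participant generates a $\mathsf{PKE}$ key pair and a $\mathsf{NIZK}_0$ proof for it, which is checked by key verification. To share $s\in\mathbb Z_p$ among $n'$ participants, the dealer chooses a uniformly random polynomial $f$ over $\mathbb Z_p$ with $\deg f\le t$, $f(0)=s$, encrypts $f(i)$ under $\mathsf{pk}_i$ for $1\le i\le n'$, and adds a $\mathsf{NIZK}_1$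 proof. A participant reveals its decrypted share together with a $\mathsf{NIZK}_2$ proof, and any set of more than $t$ shares is combined by Lagrange interpolation at $0$ (smaller sets give $\perp$). *The IND2-privacy game with bit $b$.* The adversary $\mathcal A$ receives $\mathsf{pp}$ and chooses a set $\mathcal C\subseteq[n]$ of corrupted participants; if $|\mathcal C|>t$ the game returns $0$. $\mathcal A$ supplies the public keys and key proofs of the corrupted participants, and the others generate theirs honestly. Let $G$ be the set of participants that pass key verification, renumbered as $1,\dots,n'$; $\mathcal A$ receives the public keys and proofs of $G$. Then $\mathcal A$ may repeatedly run the interactive oracle on secrets $s$ of its choice: $s$ is honestly shared for $G$, $\mathcal A$ receives the transcript, the honest participants of $G$ decrypt, $\mathcal A$ supplies shares and proofs for the corrupted ones, and it receives the result of combining all shares that pass decryption verification. Finally $\mathcal A$ outputs $s^0,s^1\in\mathbb Z_p$, receives an honest sharing of $s^b$ for $G$, and outputs a bit, which is the result of the game. **Theorem.** Under these assumptions the generic PVSS is IND2-private: for every PPT adversary $\mathcal A$, $$\bigl|\Pr[\mathbf{Game}_0(\mathcal A)=1]-\Pr[\mathbf{Game}_1(\mathcal A)=1]\bigr|$$ is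 negligible in $\lambda$. This holds both when the oracle keeps the decrypted shares and decryption proofs of the honest participants to itself, and when it shows them to $\mathcal A$ before $\mathcal A$ supplies those of the corrupted participants. -/

import Mathlib

open Polynomial

noncomputable section

namespace PVSSPrivacy

/-! ## Data: binary trees with natural numbers at the leaves -/

/-- The strings that algorithms exchange: trees whose leaves carry natural numbers. -/
inductive Val : Type
  | num : ℕ → Val
  | pair : Val → Val → Val

namespace Val

/-- The length of a value; numbers are counted in binary. -/
def size : Val → ℕ
  | num n => n.size + 1
  | pair a b => a.size + b.size + 1

def fst : Val → Val
  | num _ => num 0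
  | pair a _ => a

def snd : Val → Val
  | num _ => num 0
  | pair _ b => b

def toNat : Val → ℕ
  | num n => n
  | pair _ _ => 0

def isPair : Val → Bool
  | num _ => false
  | pair _ _ => true

/-- The code of a tuple. -/
def ofList : List Val → Val
  | [] => num 0
  | a :: l => pair a (ofList l)

/-- The entry of a tuple at a position, counted from `0` (and `num 0` beyond its end). -/
def get (v : Val) : ℕ → Val
  | 0 => v.fst
  | i + 1 => v.snd.get i

/-- The code of a bit. -/
def ofBool (b : Bool) : Val := num (if b then 1 else 0)

/-- The code of a value or the symbol `⊥`. -/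
def ofOption : Option Val → Val
  | none => num 0
  | some v => pair (num 0) v

end Val

/-! ## The machine model -/

/-- A computation that may sample, use a local device, and query an external oracle:
`rand n` draws uniformly from `{0, …, n}`. -/
inductive Comp (α : Type) : Type
  | ret : α → Comp α
  | rand : (n : ℕ) → (Fin (n + 1) → Comp α) → Comp α
  | device : Val → (Bool → Comp α) → Comp α
  | query : Val → (Val → Comp α) → Comp α

def Comp.bind {α β : Type} : Comp α → (α → Comp β) → Comp β
  | .ret a, g => g a
  | .rand n f, g => .rand n fun i => (f i).bind g
  | .device v f, g => .device v fun b => (f b).bind g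
  | .query v f, g => .query v fun a => (f a).bind g

/-- The basic instructions, with arithmetic on binary numbers. -/
inductive Op : Type
  | fst | snd | isPair | size | eq | add | sub | mul | div | mod

open Classical in
def Op.apply : Op → Val → Val
  | .fst, x => x.fst
  | .snd, x => x.snd
  | .isPair, x => Val.ofBool x.isPair
  | .size, x => .num x.size
  | .eq, x => Val.ofBool (decide (x.fst = x.snd))
  | .add, x => .num (x.fst.toNat + x.snd.toNat)
  | .sub, x => .num (x.fst.toNat - x.snd.toNat)
  | .mul, x => .num (x.fst.toNat * x.snd.toNat)
  | .div, x => .num (x.fst.toNat / x.snd.toNat)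
  | .mod, x => .num (x.fst.toNat % x.snd.toNat)

/-- Programs. `loop c` expects `(m, y)` and applies `c` to `y` for `m` rounds. -/
inductive Code : Type
  | id : Code
  | const : Val → Code
  | op : Op → Code
  | pair : Code → Code → Code
  | comp : Code → Code → Code
  | ite : Code → Code → Code → Code
  | loop : Code → Code
  | rand : Code
  | device : Code
  | query : Code

/-- `m` rounds of a loop with body `f`; the second components count steps. -/
def iterate (f : Val → Comp (Val × ℕ)) : ℕ → Val → Comp (Val × ℕ)
  | 0, y => .ret (y, 1)
  | m + 1, y => (f y).bind fun r => (iterate f m r.1).bind fun u => .ret (u.1, r.2 + u.2 + 1)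

open Classical in
/-- The execution of a program on an input, returning the output and the number of steps.
A basic instruction on an input of length `ℓ` is charged `(ℓ + 1) ^ 2` steps, so that the step
count dominates the bit complexity of every instruction (schoolbook arithmetic) and the length
of every intermediate value. -/
def Code.run : Code → Val → Comp (Val × ℕ)
  | .id, x => .ret (x, (x.size + 1) ^ 2)
  | .const v, _ => .ret (v, v.size + 1)
  | .op o, x => .ret (o.apply x, (x.size + 1) ^ 2)
  | .pair f g, x => (f.run x).bind fun r => (g.run x).bind fun u =>
      .ret (.pair r.1 u.1, r.2 + u.2 + x.size + 1)
  | .comp g f, x => (f.run x).bind fun r => (g.run r.1).bind fun u => .ret (u.1, r.2 + u.2 + 1)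
  | .ite c f g, x => (c.run x).bind fun r =>
      (if r.1 = .num 0 then g.run x else f.run x).bind fun u =>
        .ret (u.1, r.2 + u.2 + x.size + 1)
  | .loop c, x => (iterate c.run x.fst.toNat x.snd).bind fun u =>
      .ret (u.1, u.2 + (x.size + 1) ^ 2)
  | .rand, x => .rand x.toNat fun i => .ret (.num i, (x.size + 1) ^ 2)
  | .device, x => .device x fun b => .ret (Val.ofBool b, (x.size + 1) ^ 2)
  | .query, x => .query x fun a => .ret (a, (x.size + 1) ^ 2 + a.size + 1)

/-- The program uses neither an oracle nor a device. -/
def Code.Plain : Code → Prop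
  | .pair f g => f.Plain ∧ g.Plain
  | .comp f g => f.Plain ∧ g.Plain
  | .ite c f g => c.Plain ∧ f.Plain ∧ g.Plain
  | .loop c => c.Plain
  | .device => False
  | .query => False
  | _ => True

/-- Whatever the samples and the answers are, there are at most `q` oracle queries, each of
length at most `l`, and at most `T r` steps, where `r` is the total length of the answers
received from the oracle. -/
def Comp.Bounded : Comp (Val × ℕ) → ℕ → ℕ → (ℕ → ℕ) → Prop
  | .ret y, _, _, T => y.2 ≤ T 0
  | .rand _ f, q, l, T => ∀ i, (f i).Bounded q l T
  | .device _ f, q, l, T => ∀ b, (f b).Bounded q l T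
  | .query v f, q, l, T =>
      0 < q ∧ v.size ≤ l ∧ ∀ a, (f a).Bounded (q - 1) l fun r => T (a.size + r)

/-- A local device that a machine may own in addition to its classical instructions, accessed by
commands that return one bit each. With the trivial device a machine is an ordinary probabilistic
machine; with a quantum register, whose commands are the gates of a universal gate set and the
measurement of a qubit, it is a quantum machine. -/
structure Device where
  State : Type
  init : State
  act : State → Val → PMF (Bool × State)

/-- The device that does nothing. -/
def Device.trivial : Device := ⟨Unit, (), fun _ _ => pure (false, ())⟩

/-- A computation run with a device and a stateful oracle. -/
def Comp.exec (D : Device) {σ α : Type} (O : σ → Val → PMF (Val × σ)) :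
    Comp α → D.State → σ → PMF (α × D.State × σ)
  | .ret a, d, s => pure (a, d, s)
  | .rand n f, d, s => (PMF.uniformOfFintype (Fin (n + 1))).bind fun i => (f i).exec D O d s
  | .device v f, d, s => (D.act d v).bind fun u => (f u.1).exec D O u.2 s
  | .query v f, d, s => (O s v).bind fun u => (f u.1).exec D O d u.2

/-- The oracle that answers `0` always. -/
def noOracle : Unit → Val → PMF (Val × Unit) := fun _ _ => pure (.num 0, ())

/-- The output of `c` on security parameter `k` and input `x` with an oracle, together with the
final state of the device. -/
def Code.execO (D : Device) {σ : Type} (O : σ → Val → PMF (Val × σ)) (c : Code) (k : ℕ) (x : Val)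
    (d : D.State) (s : σ) : PMF (Val × D.State) :=
  (Comp.exec D O (c.run (.pair (.num k) x)) d s).map fun u => (u.1.1, u.2.1)

/-- The same without an oracle. -/
def Code.exec (D : Device) (c : Code) (k : ℕ) (x : Val) (d : D.State) : PMF (Val × D.State) :=
  c.execO D noOracle k x d ()

/-- `f` is a probabilistic polynomial-time algorithm: it is computed by a program in a number of
steps polynomial in the security parameter and the length of the input. -/
def IsPPT (f : ℕ → Val → PMF Val) : Prop :=
  ∃ (c : Code) (P : ℕ[X]), c.Plain ∧ ∀ k x,
    (c.run (.pair (.num k) x)).Bounded 0 0 (fun _ => P.eval (k + x.size)) ∧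
    (c.exec Device.trivial k x ()).map Prod.fst = f k x

/-- `f` is a deterministic polynomial-time algorithm. -/
def IsPoly (f : ℕ → Val → Val) : Prop := IsPPT fun k x => pure (f k x)

/-- A polynomial-time adversary without oracle. -/
def Code.PPT (c : Code) : Prop :=
  ∃ P : ℕ[X], ∀ k x,
    (c.run (.pair (.num k) x)).Bounded 0 0 fun _ => P.eval (k + x.size)

/-- A polynomial-time oracle adversary: it makes polynomially many queries of polynomial length
and runs in time polynomial in all that it receives. -/
def Code.PPTOracle (c : Code) : Prop :=
  ∃ Q P : ℕ[X], ∀ k x,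
    (c.run (.pair (.num k) x)).Bounded (Q.eval (k + x.size)) (Q.eval (k + x.size))
      fun r => P.eval (k + x.size + r)

/-- Negligible functions. -/
def Negl (f : ℕ → ℝ) : Prop :=
  Asymptotics.SuperpolynomialDecay Filter.atTop (fun k : ℕ => (k : ℝ)) f

/-- The probability that an experiment returns `1`. -/
def prob (g : PMF Bool) : ℝ := (g true).toReal

/-- Two families of experiments are indistinguishable: the difference of the probabilities that
they return `1` is negligible. -/
def Close (g h : ℕ → PMF Bool) : Prop := Negl fun k => |prob (g k) - prob (h k)|

open Classical in
/-- The output bit of an adversary. -/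
def outBit (v : Val) : Bool := decide (v = .num 1)

/-- Independent samples, one for each entry of a list. -/
def mapAll {α β : Type} (f : α → PMF β) : List α → PMF (List β)
  | [] => pure []
  | a :: l => do
      let b ← f a
      let bs ← mapAll f l
      pure (b :: bs)

/-! ## Parameters and Shamir secret sharing -/

/-- Number of participants, threshold, and modulus, depending on the security parameter. -/
structure Params where
  n : ℕ → ℕ
  t : ℕ → ℕ
  p : ℕ → ℕ
  prime : ∀ k, (p k).Prime
  t_le : ∀ k, 2 * t k ≤ n k
  n_lt : ∀ k, n k < p k

instance (par : Params) (k : ℕ) : Fact (par.p k).Prime := ⟨par.prime k⟩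

instance (par : Params) (k : ℕ) : NeZero (par.p k) := ⟨(par.prime k).ne_zero⟩

namespace Params

variable (par : Params)

/-- There are polynomially many participants, and the parameters are computable in time
polynomial in the security parameter. -/
def Efficient : Prop :=
  (∃ P : ℕ[X], ∀ k, par.n k ≤ P.eval k) ∧
  IsPoly (fun k _ => .num (par.n k)) ∧ IsPoly (fun k _ => .num (par.t k)) ∧
  IsPoly (fun k _ => .num (par.p k))

/-- Secrets and shares. -/
abbrev F (k : ℕ) : Type := ZMod (par.p k)

/-- The code of an element of `ℤ_p` is its representative in `{0, …, p - 1}`. -/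
def enc {k : ℕ} (s : par.F k) : Val := .num s.val

/-- Reading an element of `ℤ_p` from a message. -/
def dec (k : ℕ) (v : Val) : par.F k := (v.toNat : par.F k)

/-- The share at the point `i` of the polynomial with constant term `s` and higher
coefficients `a`. -/
def shareAt {k : ℕ} (s : par.F k) (a : Fin (par.t k) → par.F k) (i : ℕ) : par.F k :=
  s + ∑ j, a j * (i : par.F k) ^ (j.val + 1)

/-- The shares for the participants `1, …, m`. -/
def shares {k : ℕ} (s : par.F k) (a : Fin (par.t k) → par.F k) (m : ℕ) : List (par.F k) :=
  (List.range m).map fun i => par.shareAt s a (i + 1)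

/-- Sharing with a uniformly random polynomial of degree at most `t` and constant term `s`. -/
def sssShare {k : ℕ} (s : par.F k) (m : ℕ) : PMF (List (par.F k)) :=
  (PMF.uniformOfFintype (Fin (par.t k) → par.F k)).map fun a => par.shares s a m

/-- The language of valid share vectors. -/
def validShares (k : ℕ) : Set (List (par.F k)) :=
  {l | ∃ s a, l = par.shares s a l.length}

/-- Lagrange interpolation at `0`. -/
def sssCombine {k : ℕ} (S : Finset ℕ) (s : ℕ → par.F k) : par.F k :=
  ∑ i ∈ S, (∏ j ∈ S.erase i, (j : par.F k) / ((j : par.F k) - (i : par.F k))) * s i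

end Params

/-! ## Public key encryption -/

/-- A public key encryption scheme with message space `ℤ_p`, a key verification algorithm, and a
decryption algorithm that returns an additional witness. `sampleKey` and `sampleEnc` draw the
randomness from the randomness spaces, and `keyGen` and `enc` are deterministic given it. -/
structure PKE (par : Params) where
  setup : ℕ → PMF Val
  randKey : ℕ → Val → Set Val
  sampleKey : ℕ → Val → PMF Val
  sampleKey_mem : ∀ k pp, (sampleKey k pp).support ⊆ randKey k pp
  keyGen : ℕ → Val → Val → Val × Val
  keyVer : ℕ → Val → Val → Val → Bool
  randEnc : ℕ → Val → Set Val
  sampleEnc : ℕ → Val → PMF Val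
  sampleEnc_mem : ∀ k pp, (sampleEnc k pp).support ⊆ randEnc k pp
  enc : (k : ℕ) → Val → Val → par.F k → Val → Val
  wDec : ℕ → Set Val
  dec : (k : ℕ) → Val → Val → Val → Val → par.F k × Val

/-- An adversary against multi-key IND-CPA security; the first stage returns two message vectors
and a state. -/
structure CPAAdversary where
  choose : Code
  guess : Code

def CPAAdversary.PPT (A : CPAAdversary) : Prop := A.choose.PPT ∧ A.guess.PPT

namespace PKE

variable {par : Params} (E : PKE par)

/-- The algorithms of the scheme run in polynomial time. -/
def Efficient : Prop :=
  IsPPT (fun k _ => E.setup k) ∧ IsPPT E.sampleKey ∧ IsPPT E.sampleEnc ∧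
  IsPoly (fun k x =>
    .pair (E.keyGen k (x.get 0) (x.get 1)).1 (E.keyGen k (x.get 0) (x.get 1)).2) ∧
  IsPoly (fun k x => Val.ofBool (E.keyVer k (x.get 0) (x.get 1) (x.get 2))) ∧
  IsPoly (fun k x => E.enc k (x.get 0) (x.get 1) (par.dec k (x.get 2)) (x.get 3)) ∧
  IsPoly (fun k x =>
    .pair (par.enc (E.dec k (x.get 0) (x.get 1) (x.get 2) (x.get 3)).1)
      (E.dec k (x.get 0) (x.get 1) (x.get 2) (x.get 3)).2)

/-- A key pair, with the randomness that produced it. -/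
def sampleKeyPair (k : ℕ) (pp : Val) : PMF ((Val × Val) × Val) :=
  (E.sampleKey k pp).map fun r => (E.keyGen k pp r, r)

def encrypt (k : ℕ) (pp pk : Val) (m : par.F k) : PMF Val :=
  (E.sampleEnc k pp).map fun r => E.enc k pp pk m r

/-- Honest key pairs are valid with overwhelming probability. -/
def KeyCorrect : Prop :=
  Negl fun k => prob do
    let pp ← E.setup k
    let kp ← E.sampleKeyPair k pp
    pure (!(E.keyVer k pp kp.1.1 kp.1.2))

/-- Decryption under a valid key pair recovers the message, with a witness in `wDec`. -/
def EncCorrect : Prop :=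
  ∀ k, ∀ pp ∈ (E.setup k).support, ∀ pk sk, E.keyVer k pp pk sk = true →
    ∀ m, ∀ r ∈ E.randEnc k pp,
      (E.dec k pp pk sk (E.enc k pp pk m r)).1 = m ∧
      (E.dec k pp pk sk (E.enc k pp pk m r)).2 ∈ E.wDec k

/-- A public key has at most one valid secret key. -/
def UniqueKey : Prop :=
  ∀ k, ∀ pp ∈ (E.setup k).support, ∀ pk sk sk',
    E.keyVer k pp pk sk = true → E.keyVer k pp pk sk' = true → sk = sk'

/-- The multi-key IND-CPA game with `N` keys and challenge bit `b`. -/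
def cpaGame (D : Device) (A : CPAAdversary) (N : ℕ) (b : Bool) (k : ℕ) : PMF Bool := do
  let pp ← E.setup k
  let pks ← mapAll (fun _ => (E.sampleKeyPair k pp).map fun kp => kp.1.1) (List.range N)
  let u ← A.choose.exec D k (.pair pp (.ofList pks)) D.init
  let m : ℕ → par.F k := fun i => par.dec k ((u.1.get (if b then 1 else 0)).get i)
  let Es ← mapAll (fun i => E.encrypt k pp (pks.getD i (.num 0)) (m i)) (List.range N)
  let v ← A.guess.exec D k (.pair (u.1.get 2) (.ofList Es)) u.2
  pure (outBit v.1)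

/-- Multi-key IND-CPA security, for polynomially many keys. -/
def MultiKeyINDCPA (D : Device) : Prop :=
  ∀ (N : ℕ[X]) (A : CPAAdversary), A.PPT →
    Close (fun k => E.cpaGame D A (N.eval k) false k) (fun k => E.cpaGame D A (N.eval k) true k)

end PKE

/-! ## Non-interactive zero-knowledge arguments for gap languages -/

/-- A family of gap languages, indexed by a security parameter and a description: the relation
`R` of statements and witnesses for completeness and zero-knowledge, and the language `sound`
for soundness. -/
structure GapLanguage where
  R : ℕ → Val → Val → Val → Prop
  sound : ℕ → Val → Set Val

/-- Non-interactive argument systems in the common reference string model; `setup` takes the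
description of the language. -/
structure NIZK where
  setup : ℕ → Val → PMF Val
  prove : ℕ → Val → Val → Val → PMF Val
  ver : ℕ → Val → Val → Val → Bool

/-- A simulator: `crs` returns a reference string and a trapdoor `ρ`, and `prove` takes the
reference string, `ρ` and a statement. -/
structure Simulator where
  crs : ℕ → Val → PMF (Val × Val)
  prove : ℕ → Val → Val → Val → PMF Val

def Simulator.Efficient (S : Simulator) : Prop :=
  IsPPT (fun k x => (S.crs k x).map fun u => .pair u.1 u.2) ∧
  IsPPT (fun k x => S.prove k (x.get 0) (x.get 1) (x.get 2))

namespace NIZK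

variable (N : NIZK)

def Efficient : Prop :=
  IsPPT N.setup ∧ IsPPT (fun k x => N.prove k (x.get 0) (x.get 1) (x.get 2)) ∧
  IsPoly (fun k x => Val.ofBool (N.ver k (x.get 0) (x.get 1) (x.get 2)))

/-- In the following, `desc k` is the distribution of the description of the language. -/
def Correct (desc : ℕ → PMF Val) (L : GapLanguage) : Prop :=
  ∃ ν : ℕ → ℝ, Negl ν ∧ ∀ k, ∀ d ∈ (desc k).support, ∀ crs ∈ (N.setup k d).support,
    ∀ x w, L.R k d x w → prob ((N.prove k crs x w).map fun π => !(N.ver k crs x π)) ≤ ν k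

open Classical in
/-- Adaptive soundness. -/
def AdaptiveSound (D : Device) (desc : ℕ → PMF Val) (L : GapLanguage) : Prop :=
  ∀ A : Code, A.PPT → Negl fun k => prob do
    let d ← desc k
    let crs ← N.setup k d
    let u ← A.exec D k (.pair d crs) D.init
    pure (decide (u.1.fst ∉ L.sound k d ∧ N.ver k crs u.1.fst u.1.snd = true))

open Classical in
/-- The real experiment: the adversary has access to the prover, which rejects queries that are
not in the relation. -/
def zkReal (D : Device) (desc : ℕ → PMF Val) (L : GapLanguage) (A : Code) (k : ℕ) :
    PMF Bool := do
  let d ← desc k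
  let crs ← N.setup k d
  let O : Unit → Val → PMF (Val × Unit) := fun _ v =>
    if L.R k d v.fst v.snd then
      (N.prove k crs v.fst v.snd).map fun π => (.ofOption (some π), ())
    else pure (.ofOption none, ())
  let u ← A.execO D O k (.pair d crs) D.init ()
  pure (outBit u.1)

open Classical in
/-- The simulated experiment. -/
def zkSim (S : Simulator) (D : Device) (desc : ℕ → PMF Val) (L : GapLanguage) (A : Code) (k : ℕ) :
    PMF Bool := do
  let d ← desc k
  let c ← S.crs k d
  let O : Unit → Val → PMF (Val × Unit) := fun _ v =>
    if L.R k d v.fst v.snd then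
      (S.prove k c.1 c.2 v.fst).map fun π => (.ofOption (some π), ())
    else pure (.ofOption none, ())
  let u ← A.execO D O k (.pair d c.1) D.init ()
  pure (outBit u.1)

/-- Adaptive multi-theorem zero-knowledge. -/
def MultiTheoremZK (D : Device) (desc : ℕ → PMF Val) (L : GapLanguage) : Prop :=
  ∃ S : Simulator, S.Efficient ∧ ∀ A : Code, A.PPTOracle →
    Close (N.zkReal D desc L A) (zkSim S D desc L A)

/-- A secure NIZK for the gap language. -/
def Secure (D : Device) (desc : ℕ → PMF Val) (L : GapLanguage) : Prop :=
  N.Efficient ∧ N.Correct desc L ∧ N.AdaptiveSound D desc L ∧ N.MultiTheoremZK D desc L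

end NIZK

/-! ## Public verifiable secret sharing and its privacy -/

/-- The syntax of a PVSS with secrets and shares in `ℤ_p`. In `combine` the participants are
numbered from `1`. -/
structure PVSS (par : Params) where
  setup : ℕ → PMF Val
  keyGen : ℕ → Val → PMF ((Val × Val) × Val)
  keyVer : ℕ → Val → Val → Val → Bool
  share : (k : ℕ) → Val → List Val → par.F k → PMF (List Val × Val)
  shareVer : (k : ℕ) → Val → List Val → List Val → Val → Bool
  dec : (k : ℕ) → Val → Val → Val → Val → PMF (par.F k × Val)
  decVer : (k : ℕ) → Val → Val → Val → par.F k → Val → Bool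
  combine : (k : ℕ) → Val → Finset ℕ → (ℕ → par.F k) → Option (par.F k)

/-- A participant: number, corruption status, keys (`sk` is meaningless for a corrupted one) and
proof of key generation. -/
structure Party where
  idx : ℕ
  corrupt : Bool
  pk : Val
  sk : Val
  proof : Val

/-- A privacy adversary. Its stages hand a state to each other; `attack` has the oracle. -/
structure PrivacyAdversary where
  corrupt : Code
  keys : Code
  attack : Code
  guess : Code

def PrivacyAdversary.PPT (A : PrivacyAdversary) : Prop :=
  A.corrupt.PPT ∧ A.keys.PPT ∧ A.attack.PPTOracle ∧ A.guess.PPT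

namespace PVSS

variable {par : Params} (V : PVSS par)

/-- Between the two messages of an oracle call: the encrypted shares, and the decrypted shares and
proofs of the honest participants. -/
abbrev Session (par : Params) (k : ℕ) : Type :=
  Option (List Val × List (Option (par.F k × Val)))

open Classical in
/-- The interactive oracle for a list `G` of qualified participants. A call with secret `s` has
two messages. On `(0, s)`, the oracle shares `s`, lets the honest participants decrypt, and sends
the transcript, with the decrypted shares and proofs of the honest participants if `reveal` is
set. On `(1, l)`, where `l` lists shares and proofs for the corrupted participants, it reconstructs
from all shares that pass verification. -/
def oracle (reveal : Bool) (k : ℕ) (pp : Val) (G : List Party) (st : Session par k) (v : Val) :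
    PMF (Val × Session par k) :=
  if v.fst = .num 0 then do
    let tr ← V.share k pp (G.map Party.pk) (par.dec k v.snd)
    let ds ← mapAll (fun q : Party × Val =>
      if q.1.corrupt then pure none
      else (V.dec k pp q.1.pk q.1.sk q.2).map some) (G.zip tr.1)
    let shown : Val := .ofList (ds.map fun o =>
      .ofOption (o.map fun d => .pair (par.enc d.1) d.2))
    pure (.ofList [.ofList tr.1, tr.2, if reveal then shown else .num 0], some (tr.1, ds))
  else
    match st with
    | none => pure (.num 0, none)
    | some (Es, ds) =>
        let ans : ℕ → par.F k × Val := fun i =>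
          match ds.getD (i - 1) none with
          | some d => d
          | none => (par.dec k (v.snd.get (i - 1)).fst, (v.snd.get (i - 1)).snd)
        let S : Finset ℕ := (Finset.Icc 1 G.length).filter fun i =>
          V.decVer k pp ((G.map Party.pk).getD (i - 1) (.num 0)) (Es.getD (i - 1) (.num 0))
            (ans i).1 (ans i).2 = true
        pure (.ofOption ((V.combine k pp S fun i => (ans i).1).map par.enc), none)

open Classical in
/-- The IND2-privacy game with challenge bit `b`. The set of corrupted participants is sent as a
list of flags, and the keys of corrupted participants as a list indexed by `0, …, n - 1`.
Participants that pass key verification are renumbered `1, 2, …` in order. -/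
def privacyGame (reveal : Bool) (D : Device) (A : PrivacyAdversary) (b : Bool) (k : ℕ) :
    PMF Bool := do
  let pp ← V.setup k
  let u₁ ← A.corrupt.exec D k pp D.init
  let C : ℕ → Bool := fun i => decide (u₁.1.fst.get i ≠ .num 0)
  if par.t k < ((List.range (par.n k)).filter C).length then
    pure false
  else do
    let u₂ ← A.keys.exec D k u₁.1.snd u₁.2
    let parties ← mapAll (fun i =>
      if C i then
        pure (Party.mk i true (u₂.1.fst.get i).fst (.num 0) (u₂.1.fst.get i).snd)
      else
        (V.keyGen k pp).map fun kp => Party.mk i false kp.1.1 kp.1.2 kp.2) (List.range (par.n k))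
    let G := parties.filter fun q => V.keyVer k pp q.pk q.proof
    let pub : Val := .ofList (G.map fun q => .ofList [.num q.idx, q.pk, q.proof])
    let u₃ ← A.attack.execO D (V.oracle reveal k pp G) k (.pair u₂.1.snd pub) u₂.2 none
    let tr ← V.share k pp (G.map Party.pk) (par.dec k (u₃.1.get (if b then 1 else 0)))
    let u₄ ← A.guess.exec D k (.ofList [u₃.1.get 2, .ofList tr.1, tr.2]) u₃.2
    pure (outBit u₄.1)

/-- IND2-privacy. -/
def IND2Privacy (reveal : Bool) (D : Device) : Prop :=
  ∀ A : PrivacyAdversary, A.PPT →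
    Close (V.privacyGame reveal D A false) (V.privacyGame reveal D A true)

end PVSS

/-! ## The generic construction -/

section Generic

variable {par : Params} (E : PKE par)

/-- Statements about encrypted shares: `l` lists public keys and ciphertexts. -/
def encStmt (par : Params) (k : ℕ) (pp : Val) (l : List (Val × Val)) : Val :=
  .ofList [pp, .num l.length, .num (par.t k), .ofList (l.map fun e => .pair e.1 e.2)]

/-- Witnesses for encrypted shares: `l` lists shares and encryption randomness. -/
def encWit (par : Params) {k : ℕ} (l : List (par.F k × Val)) : Val :=
  .ofList (l.map fun e => .pair (par.enc e.1) e.2)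

/-- Statements about a decrypted share. -/
def decStmt (par : Params) {k : ℕ} (pp pk c : Val) (s : par.F k) : Val :=
  .ofList [pp, pk, c, par.enc s]

/-- The gap language of valid public keys. -/
def keyLang : GapLanguage where
  R k pp x w := ∃ pk sk r, x = .pair pp pk ∧ w = .pair sk r ∧ r ∈ E.randKey k pp ∧
    (pk, sk) = E.keyGen k pp r
  sound k pp := {x | ∃ pk sk, x = .pair pp pk ∧ E.keyVer k pp pk sk = true}

/-- The gap language of correctly encrypted shares. Entries of `l` are
`(pkᵢ, sᵢ, rᵢ)` for the relation and `(pkᵢ, skᵢ, Eᵢ, sᵢ, wᵢ)` for soundness. -/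
def encLang (Wzk : ℕ → Set Val) : GapLanguage where
  R k pp x w := ∃ l : List (Val × par.F k × Val),
    x = encStmt par k pp (l.map fun e => (e.1, E.enc k pp e.1 e.2.1 e.2.2)) ∧
    w = encWit par (l.map fun e => e.2) ∧
    (∀ e ∈ l, .pair pp e.1 ∈ (keyLang E).sound k pp ∧ e.2.2 ∈ E.randEnc k pp) ∧
    l.map (fun e => e.2.1) ∈ par.validShares k
  sound k pp := {x | ∃ l : List (Val × Val × Val × par.F k × Val),
    x = encStmt par k pp (l.map fun e => (e.1, e.2.2.1)) ∧
    (∀ e ∈ l, E.keyVer k pp e.1 e.2.1 = true ∧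
      E.dec k pp e.1 e.2.1 e.2.2.1 = e.2.2.2 ∧ e.2.2.2.2 ∈ Wzk k) ∧
    l.map (fun e => e.2.2.2.1) ∈ par.validShares k}

/-- The gap language of correctly decrypted shares. -/
def decLang (Wzk Wsound : ℕ → Set Val) : GapLanguage where
  R k pp x u := ∃ pk sk r c s w, x = decStmt par pp pk c s ∧ u = .ofList [sk, r, w] ∧
    E.dec k pp pk sk c = (s, w) ∧ w ∈ Wzk k ∧ r ∈ E.randKey k pp ∧ (pk, sk) = E.keyGen k pp r
  sound k pp := {x | ∃ pk sk c s w, x = decStmt par pp pk c s ∧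
    E.dec k pp pk sk c = (s, w) ∧ w ∈ Wsound k ∧ E.keyVer k pp pk sk = true}

/-- The generic PVSS. Public parameters are `(pp', crs₀, crs₁, crs₂)`; the secret key of a
participant consists of the secret key of the encryption scheme and the randomness of key
generation, which is part of the witness for decryption. -/
def genericPVSS (N₀ N₁ N₂ : NIZK) : PVSS par where
  setup k := do
    let pp' ← E.setup k
    let crs₀ ← N₀.setup k pp'
    let crs₁ ← N₁.setup k pp'
    let crs₂ ← N₂.setup k pp'
    pure (.ofList [pp', crs₀, crs₁, crs₂])
  keyGen k pp := do
    let kp ← E.sampleKeyPair k (pp.get 0)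
    let π ← N₀.prove k (pp.get 1) (.pair (pp.get 0) kp.1.1) (.pair kp.1.2 kp.2)
    pure ((kp.1.1, .pair kp.1.2 kp.2), π)
  keyVer k pp pk π := N₀.ver k (pp.get 1) (.pair (pp.get 0) pk) π
  share k pp pks s := do
    let sh ← par.sssShare s pks.length
    let rs ← mapAll (fun _ => E.sampleEnc k (pp.get 0)) pks
    let Es := (pks.zip (sh.zip rs)).map fun e => E.enc k (pp.get 0) e.1 e.2.1 e.2.2
    let π ← N₁.prove k (pp.get 2) (encStmt par k (pp.get 0) (pks.zip Es))
      (encWit par (sh.zip rs))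
    pure (Es, π)
  shareVer k pp pks Es π := N₁.ver k (pp.get 2) (encStmt par k (pp.get 0) (pks.zip Es)) π
  dec k pp pk sk c := do
    let d := E.dec k (pp.get 0) pk sk.fst c
    let π ← N₂.prove k (pp.get 3) (decStmt par (pp.get 0) pk c d.1) (.ofList [sk.fst, sk.snd, d.2])
    pure (d.1, π)
  decVer k pp pk c s π := N₂.ver k (pp.get 3) (decStmt par (pp.get 0) pk c s) π
  combine k _ S s := if S.card ≤ par.t k then none else some (par.sssCombine S s)

end Generic

end PVSSPrivacy

end

/-!
The proof is a sequence of hybrid experiments, in which the challenge secret is hidden step by step.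

*Ideal reconstruction.* In the privacy game the oracle combines all shares that pass verification.
By soundness of the decryption proofs, and since decryption with any valid secret key inverts
encryption, a share that passes is the one that the dealer computed, up to negligible probability.
More than `t` correct shares interpolate to the shared secret (`Params.sssCombine_eq`), so the
oracle may answer with the secret itself, and secret keys are then needed for proofs only
(`privacyGame_close`; `negl_wrong` is the reduction to soundness).

*Simulated proofs.* By zero-knowledge the proofs may be simulated. This requires that honest
provers hold witnesses for the zero-knowledge relations: `checked_key` and `checked_dec` show it for
keys and decryptions. For sharing proofs the relation asks for valid secret keys of the corrupted
participants too, and `checked_enc` gets them from soundness of the key proofs. For this reason the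
key proofs are the last ones to be simulated. The exchanges are `hybrid_close₀`, `hybrid_close₁` and
`hybrid_close₂`, and the result is `exists_simulated`.

*Encryption and sharing.* Now no secret key is used. Multi-key IND-CPA security allows replacing
the shares of honest participants in the challenge by `0` (`lastHybrid_close`). What is left are the
shares of at most `t` corrupted participants, whose joint distribution does not depend on the secret:
adding a polynomial of degree at most `t` that vanishes at the corrupted points, and whose value at
`0` is the difference of two secrets, turns sharings of one into sharings of the other
(`shamir_privacy`).

Most of the work lies in showing that the reductions are polynomial-time programs of the machine
model. A deterministic function between encodable types is in the class `Det`, and a randomized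
one in the class `PP`, if a program computes it in polynomial time. The classes are closed under
composition, lists, and loops. Moreover a program may answer the oracle queries of another one
(`Comp.handle`, with the simulation `Simulates`), so that the game, which runs the adversary
against its own oracle, is itself a polynomial-time computation with the provers as parameters.
Conversely every computation in the class is a program of the model. To compare two experiments that
run the same adversary, `Rel` says that two computations agree up to a bad event of the outcome.
-/

noncomputable section

namespace PVSSPrivacy

/-! ### The monad of computations -/

namespace Comp

instance : Monad Comp where
  pure := Comp.ret
  bind := Comp.bind

variable {α β γ : Type}

@[simp] theorem bind_ret (c : Comp α) : c.bind Comp.ret = c := by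
  induction c with
  | ret a => rfl
  | rand n f ih | device v f ih | query v f ih => simp only [Comp.bind]; congr 1; funext i; exact ih i

theorem bind_assoc' (c : Comp α) (f : α → Comp β) (g : β → Comp γ) :
    (c.bind f).bind g = c.bind fun a => (f a).bind g := by
  induction c with
  | ret a => rfl
  | rand n f ih | device v f ih | query v f ih => simp only [Comp.bind]; congr 1; funext i; exact ih i

@[simp] theorem ret_bind' (a : α) (f : α → Comp β) : (Comp.ret a).bind f = f a := rfl

theorem bind_def (c : Comp α) (f : α → Comp β) : c >>= f = c.bind f := rfl

instance : LawfulMonad Comp := LawfulMonad.mk'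
  (id_map := fun c => bind_ret c)
  (pure_bind := fun _ _ => rfl)
  (bind_assoc := fun c f g => bind_assoc' c f g)

theorem map_def (f : α → β) (c : Comp α) : f <$> c = c.bind fun a => Comp.ret (f a) := rfl

/-- All outputs of a computation, for whatever samples and answers, satisfy `p`. -/
def All (p : α → Prop) : Comp α → Prop
  | .ret a => p a
  | .rand _ f => ∀ i, (f i).All p
  | .device _ f => ∀ b, (f b).All p
  | .query _ f => ∀ a, (f a).All p

theorem All.imp {p q : α → Prop} (h : ∀ a, p a → q a) {c : Comp α} (hc : c.All p) : c.All q := by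
  induction c with
  | ret a => exact h a hc
  | rand n f ih | device v f ih | query v f ih => exact fun i => ih i (hc i)

theorem All.and {p q : α → Prop} {c : Comp α} (hc : c.All p) (hc' : c.All q) :
    c.All fun a => p a ∧ q a := by
  induction c with
  | ret a => exact ⟨hc, hc'⟩
  | rand n f ih | device v f ih | query v f ih => exact fun i => ih i (hc i) (hc' i)

theorem All.bind {p : α → Prop} {q : β → Prop} {c : Comp α} {g : α → Comp β} (hc : c.All p)
    (hg : ∀ a, p a → (g a).All q) : (c.bind g).All q := by
  induction c with
  | ret a => exact hg a hc
  | rand n f ih | device v f ih | query v f ih => exact fun i => ih i (hc i)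

theorem all_true (c : Comp α) : c.All fun _ => True := by
  induction c with
  | ret a => trivial
  | rand n f ih | device v f ih | query v f ih => exact fun i => ih i

theorem Bounded.mono {c : Comp (Val × ℕ)} {q q' l l' : ℕ} {T T' : ℕ → ℕ} (h : c.Bounded q l T)
    (hq : q ≤ q') (hl : l ≤ l') (hT : ∀ r, T r ≤ T' r) : c.Bounded q' l' T' := by
  induction c generalizing q q' T T' with
  | ret a => exact le_trans h (hT 0)
  | rand n f ih | device v f ih => exact fun i => ih i (h i) hq hT
  | query v f ih =>
    exact ⟨lt_of_lt_of_le h.1 hq, h.2.1.trans hl, fun a => ih a (h.2.2 a) (by omega) fun r => hT _⟩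

theorem Bounded.bind {c : Comp (Val × ℕ)} {g : Val × ℕ → Comp (Val × ℕ)} {q q' l : ℕ}
    {T T' : ℕ → ℕ} {p : Val × ℕ → Prop} (h : c.Bounded q l T) (hp : c.All p) (hT : Monotone T)
    (hT' : Monotone T')
    (hg : ∀ u, p u → (g u).Bounded q' l fun r => u.2 + T' r) :
    (c.bind g).Bounded (q + q') l fun r => T r + T' r := by
  induction c generalizing q T with
  | ret a =>
    refine (hg a hp).mono (by omega) le_rfl fun r => ?_
    have := hT (Nat.zero_le r)
    have h' : a.2 ≤ T 0 := h
    omega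
  | rand n f ih | device v f ih => exact fun i => ih i (h i) (hp i) hT
  | query v f ih =>
    obtain ⟨h1, h2, h3⟩ := h
    refine ⟨by omega, h2, fun a => ?_⟩
    refine (ih a (h3 a) (hp a) fun x y hxy => hT (by omega)).mono (by omega) le_rfl fun r => ?_
    have := hT' (show r ≤ a.size + r by omega)
    simp only; omega

/-- Computations without oracle queries are not affected by the oracle bounds. -/
theorem Bounded.zero {c : Comp (Val × ℕ)} {l l' : ℕ} {T T' : ℕ → ℕ} (h : c.Bounded 0 l T)
    (hT : T 0 ≤ T' 0) : c.Bounded 0 l' T' := by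
  induction c with
  | ret a => exact le_trans h hT
  | rand n f ih | device v f ih => exact fun i => ih i (h i)
  | query v f ih => exact absurd h.1 (lt_irrefl _)

/-! ### Execution -/

variable {σ : Type} (D : Device) (O : σ → Val → PMF (Val × σ))

theorem exec_bind (c : Comp α) (g : α → Comp β) (d : D.State) (s : σ) :
    (c.bind g).exec D O d s = (c.exec D O d s).bind fun u => (g u.1).exec D O u.2.1 u.2.2 := by
  induction c generalizing d s with
  | ret a => simp only [Comp.bind, Comp.exec, PMF.pure_bind, pure]
  | rand n f ih | device v f ih | query v f ih => simp only [Comp.bind, Comp.exec, PMF.bind_bind, ih]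

theorem exec_ret (a : α) (d : D.State) (s : σ) : (Comp.ret a).exec D O d s = PMF.pure (a, d, s) := rfl

theorem exec_map (c : Comp α) (f : α → β) (d : D.State) (s : σ) :
    (f <$> c).exec D O d s = (c.exec D O d s).map fun u => (f u.1, u.2) := by
  rw [map_def, exec_bind]; rfl

theorem All.exec {p : α → Prop} {c : Comp α} (h : c.All p) {d : D.State} {s : σ}
    {u : α × D.State × σ} (hu : u ∈ (c.exec D O d s).support) : p u.1 := by
  induction c generalizing d s with
  | ret a =>
    rw [Comp.exec_ret, PMF.support_pure, Set.mem_singleton_iff] at hu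
    subst hu; exact h
  | rand n f ih =>
    simp only [Comp.exec, PMF.mem_support_bind_iff] at hu
    obtain ⟨i, _, hi⟩ := hu
    exact ih i (h i) hi
  | device v f ih | query v f ih =>
    simp only [Comp.exec, PMF.mem_support_bind_iff] at hu
    obtain ⟨i, _, hi⟩ := hu
    exact ih _ (h _) hi

/-- Two computations behave alike with every device and every oracle. -/
def Equiv (a b : Comp α) : Prop :=
  ∀ (D : Device) (σ : Type) (O : σ → Val → PMF (Val × σ)) (d : D.State) (s : σ),
    a.exec D O d s = b.exec D O d s

theorem Equiv.refl (a : Comp α) : Equiv a a := fun _ _ _ _ _ => rfl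
theorem Equiv.trans {a b c : Comp α} (h : Equiv a b) (h' : Equiv b c) : Equiv a c :=
  fun D σ O d s => (h D σ O d s).trans (h' D σ O d s)

theorem Equiv.bind {a b : Comp α} {f g : α → Comp β} (h : Equiv a b) (h' : ∀ x, Equiv (f x) (g x)) :
    Equiv (a.bind f) (b.bind g) := by
  intro D σ O d s
  rw [exec_bind, exec_bind, h D σ O d s]
  congr 1; funext u; exact h' _ _ _ _ _ _

theorem Equiv.bind_left {a b : Comp α} (h : Equiv a b) {f : α → Comp β} : Equiv (a.bind f) (b.bind f) :=
  h.bind fun _ => Equiv.refl _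

theorem Equiv.map {a b : Comp α} (f : α → β) (h : Equiv a b) : Equiv (f <$> a) (f <$> b) :=
  h.bind fun _ => Equiv.refl _

/-- A computation that leaves the device and the oracle alone and has output distribution `p`. -/
def Is (O : σ → Val → PMF (Val × σ)) (c : Comp α) (p : PMF α) : Prop :=
  ∀ d s, c.exec D O d s = p.map fun a => (a, d, s)

variable {D O}

theorem Is.ret (a : α) : Is D O (Comp.ret a) (PMF.pure a) := fun d s => by
  rw [exec_ret, PMF.pure_map]

theorem exec_bind_of_is {c : Comp α} {p : PMF α} (h : Is D O c p) (g : α → Comp β) (d : D.State)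
    (s : σ) : (c.bind g).exec D O d s = p.bind fun a => (g a).exec D O d s := by
  rw [exec_bind, h d s, PMF.bind_map]; rfl

theorem Is.bind {c : Comp α} {p : PMF α} (h : Is D O c p) {g : α → Comp β} {r : α → PMF β}
    (hg : ∀ a, Is D O (g a) (r a)) : Is D O (c >>= g) (p.bind r) := fun d s => by
  rw [bind_def, exec_bind_of_is h, PMF.map_bind]
  congr 1; funext a; exact hg a d s

theorem Is.map {c : Comp α} {p : PMF α} (h : Is D O c p) (g : α → β) : Is D O (g <$> c) (p.map g) := by
  intro d s
  rw [exec_map, h d s, PMF.map_comp, PMF.map_comp]; rfl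

theorem Is.rand (n : ℕ) : Is D O (Comp.rand n Comp.ret) (PMF.uniformOfFintype (Fin (n + 1))) :=
  fun d s => by simp only [Comp.exec]; rfl

/-- Run a computation on each entry of a list. -/
def mapC (f : α → Comp β) : List α → Comp (List β)
  | [] => Comp.ret []
  | a :: l => (f a).bind fun b => (mapC f l).bind fun bs => Comp.ret (b :: bs)

theorem Is.mapC {f : α → Comp β} {g : α → PMF β} (l : List α) (h : ∀ a ∈ l, Is D O (f a) (g a)) :
    Is D O (mapC f l) (mapAll g l) := by
  induction l with
  | nil => exact Is.ret _
  | cons a l ih =>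
    refine Is.bind (h a (by simp)) fun b => Is.bind (ih fun a ha => h a (by simp [ha])) fun bs => Is.ret _

end Comp

/-! ### Sizes -/

theorem size_le_self (n : ℕ) : n.size ≤ n := Nat.size_le.2 n.lt_two_pow_self

theorem size_add_le (a b : ℕ) : (a + b).size ≤ a.size + b.size + 1 := by
  rw [Nat.size_le]
  have h1 := Nat.lt_size_self a
  have h2 := Nat.lt_size_self b
  have h3 : 2 ^ a.size ≤ 2 ^ (a.size + b.size) := Nat.pow_le_pow_right (by norm_num) (by omega)
  have h4 : 2 ^ b.size ≤ 2 ^ (a.size + b.size) := Nat.pow_le_pow_right (by norm_num) (by omega)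
  rw [pow_succ]; omega

theorem size_mul_le (a b : ℕ) : (a * b).size ≤ a.size + b.size := by
  rcases Nat.eq_zero_or_pos a with rfl | ha
  · simp
  rw [Nat.size_le, pow_add]
  exact Nat.mul_lt_mul'' (Nat.lt_size_self a) (Nat.lt_size_self b)

namespace Val

theorem one_le_size (v : Val) : 1 ≤ v.size := by cases v <;> simp [size]

theorem size_num (n : ℕ) : (num n).size = n.size + 1 := rfl

theorem size_pair (a b : Val) : (pair a b).size = a.size + b.size + 1 := rfl

theorem size_num_le (n : ℕ) : (num n).size ≤ n + 1 := by
  rw [size_num]; have := size_le_self n; omega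

theorem size_fst_le (v : Val) : v.fst.size ≤ v.size := by
  cases v with
  | num n => simp [fst, size]
  | pair a b => simp only [fst, size]; omega

theorem size_snd_le (v : Val) : v.snd.size ≤ v.size := by
  cases v with
  | num n => simp [snd, size]
  | pair a b => simp only [snd, size]; omega

theorem size_toNat_lt (v : Val) : v.toNat.size < v.size := by
  cases v with
  | num n => simp [toNat, size]
  | pair a b => simp [toNat, size]

theorem size_ofBool_le (b : Bool) : (ofBool b).size ≤ 2 := by
  cases b <;> simp [ofBool, size]

theorem size_fst_add_snd (v : Val) : v.fst.size + v.snd.size ≤ v.size + 1 := by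
  cases v with
  | num n => simp [fst, snd, size]
  | pair a b => simp only [fst, snd, size]; omega

end Val

theorem Op.size_apply_le (o : Op) (x : Val) : (o.apply x).size ≤ (x.size + 1) ^ 2 := by
  have h1 := x.one_le_size
  have key : x.size + 3 ≤ (x.size + 1) ^ 2 := by nlinarith
  refine le_trans ?_ key
  have ha := Val.size_toNat_lt x.fst
  have hb := Val.size_toNat_lt x.snd
  have hab := x.size_fst_add_snd
  cases o
  · exact x.size_fst_le.trans (by omega)
  · exact x.size_snd_le.trans (by omega)
  · exact (Val.size_ofBool_le _).trans (by omega)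
  · exact (Val.size_num_le _).trans (by omega)
  · exact (Val.size_ofBool_le _).trans (by omega)
  · have := size_add_le x.fst.toNat x.snd.toNat
    simp only [Op.apply, Val.size_num]; omega
  · have := Nat.size_le_size (Nat.sub_le x.fst.toNat x.snd.toNat)
    simp only [Op.apply, Val.size_num]; omega
  · have := size_mul_le x.fst.toNat x.snd.toNat
    simp only [Op.apply, Val.size_num]; omega
  · have := Nat.size_le_size (Nat.div_le_self x.fst.toNat x.snd.toNat)
    simp only [Op.apply, Val.size_num]; omega
  · have := Nat.size_le_size (Nat.mod_le x.fst.toNat x.snd.toNat)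
    simp only [Op.apply, Val.size_num]; omega

theorem iterate_size {f : Val → Comp (Val × ℕ)} (hf : ∀ y, (f y).All fun r => r.1.size ≤ r.2)
    (m : ℕ) (y : Val) : (iterate f m y).All fun r => r.1.size ≤ r.2 + y.size := by
  induction m generalizing y with
  | zero => exact Nat.le_add_left _ _
  | succ m ih =>
    refine (hf y).bind fun r hr => (ih r.1).bind fun u hu => ?_
    simp only [Comp.All]; omega

/-- The number of steps dominates the length of the output. -/
theorem Code.run_size (c : Code) (x : Val) : (c.run x).All fun r => r.1.size ≤ r.2 := by
  induction c generalizing x with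
  | id => simp only [Code.run, Comp.All]; nlinarith
  | const v => simp only [Code.run, Comp.All]; omega
  | op o => exact Op.size_apply_le o x
  | pair f g hf hg =>
    refine (hf x).bind fun r hr => (hg x).bind fun u hu => ?_
    simp only [Comp.All, Val.size_pair]; omega
  | comp g f hg hf =>
    refine (hf x).bind fun r hr => (hg _).bind fun u hu => ?_
    simp only [Comp.All]; omega
  | ite c f g hc hf hg =>
    refine (hc x).bind fun r hr => ?_
    refine Comp.All.bind (p := fun r => r.1.size ≤ r.2) ?_ fun u hu => ?_
    · split_ifs
      exacts [hg x, hf x]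
    · simp only [Comp.All]; omega
  | loop c hc =>
    refine (iterate_size hc _ _).bind fun u hu => ?_
    have := x.size_snd_le
    simp only [Comp.All]; nlinarith
  | rand =>
    intro i
    have h1 := Nat.size_le_size (show i.val ≤ x.toNat by omega)
    have h2 := x.size_toNat_lt
    simp only [Comp.All, Val.size_num]; nlinarith
  | device => exact fun b => (Val.size_ofBool_le _).trans (by nlinarith [x.one_le_size])
  | query => intro a; simp only [Comp.All]; omega

/-! ### Polynomial bounds -/

theorem poly_mono (P : ℕ[X]) {a b : ℕ} (h : a ≤ b) : P.eval a ≤ P.eval b := by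
  induction P using Polynomial.induction_on' with
  | add p q hp hq => simp only [eval_add]; omega
  | monomial n c => simp only [eval_monomial]; exact Nat.mul_le_mul_left _ (Nat.pow_le_pow_left h n)

/-! ### Encodings -/

/-- A representation of the elements of a type by values. -/
class Enc (α : Type) where
  enc : α → Val

/-- A security parameter, represented by a value of length at least the parameter. All running
times are then bounded in the length of the input alone. -/
structure Sec where
  k : ℕ

open Enc (enc)

section

variable {α β γ δ : Type} [Enc α] [Enc β] [Enc γ] [Enc δ]

instance : Enc Val := ⟨fun v => v⟩
instance : Enc ℕ := ⟨Val.num⟩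
instance : Enc Bool := ⟨Val.ofBool⟩
instance : Enc Sec := ⟨fun K => .num (2 ^ K.k)⟩
instance : Enc (α × β) := ⟨fun x => .pair (enc x.1) (enc x.2)⟩
instance : Enc (List α) := ⟨fun l => .ofList (l.map enc)⟩
instance : Enc (Option α) := ⟨fun o => .ofOption (o.map enc)⟩
instance : Enc Party := ⟨fun q => enc (q.idx, q.corrupt, q.pk, q.sk, q.proof)⟩

/-- The length of the representation. -/
def sz (x : α) : ℕ := (enc x).size

theorem one_le_sz (x : α) : 1 ≤ sz x := Val.one_le_size _
theorem sz_val (v : Val) : sz v = v.size := rfl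
theorem sz_pair (x : α) (y : β) : sz (x, y) = sz x + sz y + 1 := rfl
theorem sz_nil : sz ([] : List α) = 1 := rfl
theorem sz_cons (a : α) (l : List α) : sz (a :: l) = sz a + sz l + 1 := rfl
theorem sz_none : sz (none : Option α) = 1 := rfl
theorem sz_some (a : α) : sz (some a) = sz a + 2 := by
  simp only [sz, enc, Option.map, Val.ofOption, Val.size_pair, Val.size_num, Nat.size_zero]; omega
theorem sz_nat (n : ℕ) : sz n = n.size + 1 := rfl
theorem sz_nat_le (n : ℕ) : sz n ≤ n + 1 := Val.size_num_le n
theorem sz_sec (K : Sec) : sz K = K.k + 2 := by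
  simp only [sz, enc, Val.size_num, Nat.size_pow]
theorem length_lt_sz (l : List α) : l.length < sz l := by
  induction l with
  | nil => simp [sz_nil]
  | cons a l ih => rw [sz_cons, List.length_cons]; have := one_le_sz a; omega

theorem sz_le_of_mem {a : α} {l : List α} (h : a ∈ l) : sz a ≤ sz l := by
  induction l with
  | nil => simp at h
  | cons b l ih =>
    rw [sz_cons]
    rcases List.mem_cons.1 h with rfl | h
    · omega
    · have := ih h; omega

theorem sz_append (l l' : List α) : sz (l ++ l') + 1 = sz l + sz l' := by
  induction l with
  | nil => simp [sz_nil]; omega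
  | cons b l ih => simp only [List.cons_append, sz_cons]; omega

theorem sz_reverse (l : List α) : sz l.reverse = sz l := by
  induction l with
  | nil => rfl
  | cons b l ih =>
    have := sz_append l.reverse [b]
    simp only [List.reverse_cons, sz_cons, sz_nil] at *; omega

theorem sz_list_le {l : List α} {B : ℕ} (h : ∀ a ∈ l, sz a ≤ B) : sz l ≤ l.length * (B + 1) + 1 := by
  induction l with
  | nil => simp [sz_nil]
  | cons a l ih =>
    rw [sz_cons, List.length_cons, Nat.succ_mul]
    have := ih fun a ha => h a (by simp [ha])
    have := h a (by simp)
    omega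

/-- Every run uses neither device nor oracle and ends in an output with `p`. -/
def Comp.PureAll {α : Type} (p : α → Prop) : Comp α → Prop
  | .ret a => p a
  | .rand _ f => ∀ i, (f i).PureAll p
  | .device _ _ => False
  | .query _ _ => False

namespace Comp

variable {α β : Type}

theorem PureAll.imp {p q : α → Prop} (h : ∀ a, p a → q a) {c : Comp α} (hc : c.PureAll p) :
    c.PureAll q := by
  induction c with
  | ret a => exact h a hc
  | rand n f ih => exact fun i => ih i (hc i)
  | device v f ih | query v f ih => exact hc

theorem PureAll.bind {p : α → Prop} {q : β → Prop} {c : Comp α} {g : α → Comp β}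
    (hc : c.PureAll p) (hg : ∀ a, p a → (g a).PureAll q) : (c.bind g).PureAll q := by
  induction c with
  | ret a => exact hg a hc
  | rand n f ih => exact fun i => ih i (hc i)
  | device v f ih | query v f ih => exact hc

theorem PureAll.and {p q : α → Prop} {c : Comp α} (hc : c.PureAll p) (hc' : c.All q) :
    c.PureAll fun a => p a ∧ q a := by
  induction c with
  | ret a => exact ⟨hc, hc'⟩
  | rand n f ih => exact fun i => ih i (hc i) (hc' i)
  | device v f ih | query v f ih => exact hc

theorem PureAll.all {p : α → Prop} {c : Comp α} (hc : c.PureAll p) : c.All p := by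
  induction c with
  | ret a => exact hc
  | rand n f ih => exact fun i => ih i (hc i)
  | device v f ih | query v f ih => exact hc.elim

theorem PureAll.exists {p : α → Prop} {c : Comp α} (hc : c.PureAll p) : ∃ a, p a := by
  induction c with
  | ret a => exact ⟨a, hc⟩
  | rand n f ih => exact ih 0 (hc 0)
  | device v f ih | query v f ih => exact hc.elim

theorem PureAll.bounded {T q l : ℕ} {c : Comp (Val × ℕ)} (hc : c.PureAll fun r => r.2 ≤ T) :
    c.Bounded q l fun _ => T := by
  induction c with
  | ret a => exact hc
  | rand n f ih => exact fun i => ih i (hc i)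
  | device v f ih | query v f ih => exact hc.elim

theorem PureAll.equiv_ret {y : α} {c : Comp α} (hc : c.PureAll fun r => r = y) :
    Equiv c (.ret y) := by
  intro D σ O d s
  induction c with
  | ret a => rw [show a = y from hc]
  | rand n f ih =>
    simp only [Comp.exec]
    rw [show (fun i => (f i).exec D O d s) = fun _ => (Comp.ret y).exec D O d s from
      funext fun i => ih i (hc i), PMF.bind_const]; rfl
  | device v f ih | query v f ih => exact hc.elim

end Comp

/-- The program `c` computes the value `y` from `x` in at most `T` steps, whatever it samples. -/
def Code.Computes (c : Code) (x y : Val) (T : ℕ) : Prop :=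
  (c.run x).PureAll fun r => r.1 = y ∧ r.2 ≤ T

/-- `f` is computed by a program in polynomial time (which may draw samples, but its output does not
depend on them). -/
@[fun_prop]
def Det (f : α → β) : Prop :=
  ∃ (c : Code) (P : ℕ[X]), ∀ x, c.Computes (enc x) (enc (f x)) (P.eval (sz x))

theorem Code.Computes.mono {c : Code} {x y : Val} {T T' : ℕ} (h : c.Computes x y T) (hT : T ≤ T') :
    c.Computes x y T' := Comp.PureAll.imp (fun _ hr => ⟨hr.1, hr.2.trans hT⟩) h

theorem Code.Computes.size_le {c : Code} {x y : Val} {T : ℕ} (h : c.Computes x y T) :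
    y.size ≤ T := by
  obtain ⟨r, ⟨h1, h2⟩, h3⟩ := (Comp.PureAll.and h (c.run_size x)).exists
  subst h1; exact h3.trans h2

theorem Code.Computes.comp {c c' : Code} {x y z : Val} {T T' : ℕ} (h : c.Computes x y T)
    (h' : c'.Computes y z T') : (c'.comp c).Computes x z (T + T' + 1) := by
  refine Comp.PureAll.bind h fun r hr => ?_
  rw [hr.1]
  refine Comp.PureAll.bind h' fun u hu => ⟨hu.1, ?_⟩
  have := hr.2; have := hu.2; simp only; omega

theorem Code.Computes.pair {c c' : Code} {x y z : Val} {T T' : ℕ} (h : c.Computes x y T)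
    (h' : c'.Computes x z T') : (c.pair c').Computes x (.pair y z) (T + T' + x.size + 1) := by
  refine Comp.PureAll.bind h fun r hr => Comp.PureAll.bind h' fun u hu => ⟨?_, ?_⟩
  · rw [hr.1, hu.1]
  · have := hr.2; have := hu.2; simp only; omega

theorem Code.Computes.ite {c f g : Code} {x b y : Val} {T T' : ℕ} (h : c.Computes x b T)
    (hf : b ≠ .num 0 → f.Computes x y T') (hg : b = .num 0 → g.Computes x y T') :
    (c.ite f g).Computes x y (T + T' + x.size + 1) := by
  refine Comp.PureAll.bind h fun r hr => ?_
  refine Comp.PureAll.bind (p := fun r => r.1 = y ∧ r.2 ≤ T') ?_ fun u hu => ⟨hu.1, ?_⟩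
  · rw [hr.1]
    split_ifs with hb
    · exact hg hb
    · exact hf hb
  · have := hr.2; have := hu.2; simp only; omega

theorem Code.computes_op (o : Op) (x : Val) : (Code.op o).Computes x (o.apply x) ((x.size + 1) ^ 2) :=
  ⟨rfl, le_rfl⟩

theorem Code.computes_const (v x : Val) : (Code.const v).Computes x v (v.size + 1) := ⟨rfl, le_rfl⟩

theorem Code.computes_id (x : Val) : Code.id.Computes x x ((x.size + 1) ^ 2) := ⟨rfl, le_rfl⟩

/-! ### Polynomial-time functions -/

namespace Det

theorem sz_le {f : α → β} (h : Det f) : ∃ P : ℕ[X], ∀ x, sz (f x) ≤ P.eval (sz x) := by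
  obtain ⟨c, P, h⟩ := h
  exact ⟨P, fun x => (h x).size_le⟩

@[fun_prop]
theorem id' : Det fun x : α => x :=
  ⟨.id, (X + 1) ^ 2, fun x => by simpa [sz] using Code.computes_id (enc x)⟩

@[fun_prop]
theorem const (b : β) : Det fun _ : α => b :=
  ⟨.const (enc b), C (sz b + 1), fun x => by simpa [sz] using Code.computes_const (enc b) (enc x)⟩

@[fun_prop]
theorem comp {g : β → γ} {f : α → β} (hg : Det g) (hf : Det f) : Det fun x => g (f x) := by
  obtain ⟨c, P, h⟩ := hf
  obtain ⟨c', P', h'⟩ := hg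
  refine ⟨c'.comp c, P + P'.comp P + 1, fun x => ((h x).comp (h' (f x))).mono ?_⟩
  simp only [eval_add, eval_comp, eval_one]
  have := poly_mono P' (h x).size_le
  simp only [sz] at *; omega

@[fun_prop]
theorem pair {f : α → β} {g : α → γ} (hf : Det f) (hg : Det g) : Det fun x => (f x, g x) := by
  obtain ⟨c, P, h⟩ := hf
  obtain ⟨c', P', h'⟩ := hg
  refine ⟨c.pair c', P + P' + X + 1, fun x => ((h x).pair (h' x)).mono ?_⟩
  simp [sz]

/-- An instruction computes a function. -/
theorem of_op {f : α → β} (o : Op) (h : ∀ x, o.apply (enc x) = enc (f x)) : Det f :=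
  ⟨.op o, (X + 1) ^ 2, fun x => by simpa [sz, h] using Code.computes_op o (enc x)⟩

theorem of_enc {f : α → β} (g : α → γ) (hg : Det g) (h : ∀ x, enc (g x) = enc (f x)) : Det f := by
  obtain ⟨c, P, hc⟩ := hg
  exact ⟨c, P, fun x => h x ▸ hc x⟩

/-- A function on `β` may be precomposed with any polynomial-time computation of its encoded
argument. -/
theorem of_arg {f : α → γ} (a : α → β) {g : β → γ} (hg : Det g) (ha : Det a) (h : ∀ x, g (a x) = f x) :
    Det f := by
  rw [show f = fun x => g (a x) from funext fun x => (h x).symm]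
  exact comp hg ha

@[fun_prop]
theorem fst : Det fun x : α × β => x.1 := of_op .fst fun _ => rfl

@[fun_prop]
theorem snd : Det fun x : α × β => x.2 := of_op .snd fun _ => rfl

@[fun_prop]
theorem val_fst {f : α → Val} (hf : Det f) : Det fun x => (f x).fst :=
  comp (g := Val.fst) (of_op .fst fun _ => rfl) hf

@[fun_prop]
theorem val_snd {f : α → Val} (hf : Det f) : Det fun x => (f x).snd :=
  comp (g := Val.snd) (of_op .snd fun _ => rfl) hf

@[fun_prop]
theorem val_pair {f g : α → Val} (hf : Det f) (hg : Det g) : Det fun x => Val.pair (f x) (g x) :=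
  of_enc (fun x => (f x, g x)) (pair hf hg) fun _ => rfl

@[fun_prop]
theorem val_num {f : α → ℕ} (hf : Det f) : Det fun x => Val.num (f x) :=
  of_enc f hf fun _ => rfl

@[fun_prop]
theorem val_ofBool {f : α → Bool} (hf : Det f) : Det fun x => Val.ofBool (f x) :=
  of_enc f hf fun _ => rfl

@[fun_prop]
theorem val_enc {f : α → β} (hf : Det f) : Det fun x => enc (f x) :=
  of_enc f hf fun _ => rfl

@[fun_prop]
theorem val_ofList {f : α → List Val} (hf : Det f) : Det fun x => Val.ofList (f x) :=
  of_enc f hf fun x => by simp [enc]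

@[fun_prop]
theorem val_ofOption {f : α → Option Val} (hf : Det f) : Det fun x => Val.ofOption (f x) :=
  of_enc f hf fun x => by cases f x <;> simp [enc]

@[fun_prop]
theorem val_isPair {f : α → Val} (hf : Det f) : Det fun x => (f x).isPair :=
  comp (g := Val.isPair) (of_op .isPair fun _ => rfl) hf

@[fun_prop]
theorem val_size {f : α → Val} (hf : Det f) : Det fun x => (f x).size :=
  comp (g := Val.size) (of_op .size fun _ => rfl) hf

@[fun_prop]
theorem sz_fun {f : α → β} (hf : Det f) : Det fun x => sz (f x) := val_size (val_enc hf)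

@[fun_prop]
theorem add {f g : α → ℕ} (hf : Det f) (hg : Det g) : Det fun x => f x + g x :=
  comp (g := fun p : ℕ × ℕ => p.1 + p.2) (of_op .add fun _ => rfl) (pair hf hg)

@[fun_prop]
theorem sub {f g : α → ℕ} (hf : Det f) (hg : Det g) : Det fun x => f x - g x :=
  comp (g := fun p : ℕ × ℕ => p.1 - p.2) (of_op .sub fun _ => rfl) (pair hf hg)

@[fun_prop]
theorem mul {f g : α → ℕ} (hf : Det f) (hg : Det g) : Det fun x => f x * g x :=
  comp (g := fun p : ℕ × ℕ => p.1 * p.2) (of_op .mul fun _ => rfl) (pair hf hg)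

@[fun_prop]
theorem mod {f g : α → ℕ} (hf : Det f) (hg : Det g) : Det fun x => f x % g x :=
  comp (g := fun p : ℕ × ℕ => p.1 % p.2) (of_op .mod fun _ => rfl) (pair hf hg)

@[fun_prop]
theorem val_toNat {f : α → Val} (hf : Det f) : Det fun x => (f x).toNat :=
  comp (g := fun v : Val => v.toNat) (of_arg (fun v => Val.pair v (.num 0))
    (g := fun p : Val => p.fst.toNat + p.snd.toNat) (of_op .add fun _ => rfl) (by fun_prop)
    fun v => rfl) hf

open Classical in
@[fun_prop]
theorem val_eq {f g : α → Val} (hf : Det f) (hg : Det g) : Det fun x => decide (f x = g x) :=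
  comp (g := fun p : Val × Val => decide (p.1 = p.2)) (of_op .eq fun _ => rfl) (pair hf hg)

@[fun_prop]
theorem nat_eq {f g : α → ℕ} (hf : Det f) (hg : Det g) : Det fun x => decide (f x = g x) := by
  refine of_enc (fun x => @decide (Val.num (f x) = Val.num (g x)) (Classical.propDecidable _))
    (by fun_prop) fun x => ?_
  congr 1
  simp

@[fun_prop]
theorem sec_k {f : α → Sec} (hf : Det f) : Det fun x => (f x).k :=
  comp (g := Sec.k) (of_arg (fun K : Sec => (sz K, 2)) (g := fun p : ℕ × ℕ => p.1 - p.2)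
    (by fun_prop) (by fun_prop) fun K => by rw [sz_sec]; rfl) hf

theorem bite {b : α → Bool} {f g : α → β} (hb : Det b) (hf : Det f) (hg : Det g) :
    Det fun x => bif b x then f x else g x := by
  obtain ⟨cb, Pb, hb⟩ := hb
  obtain ⟨c, P, hf⟩ := hf
  obtain ⟨c', P', hg⟩ := hg
  refine ⟨cb.ite c c', Pb + (P + P') + X + 1, fun x => ?_⟩
  have h1 := hf x
  have h2 := hg x
  have := (hb x).ite (f := c) (g := c') (y := enc (bif b x then f x else g x))
    (T' := (P + P').eval (sz x)) ?_ ?_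
  · refine this.mono ?_
    simp [sz]
  · intro h
    have hx : b x = true := by
      by_contra hx; rw [Bool.not_eq_true] at hx; exact h (by rw [hx]; rfl)
    rw [hx]; exact h1.mono (by simp)
  · intro h
    have hx : b x = false := by
      by_contra hx; rw [Bool.not_eq_false] at hx; rw [hx] at h; simp [enc, Val.ofBool] at h
    rw [hx]; exact h2.mono (by simp)

@[fun_prop]
theorem ite {b : α → Prop} [DecidablePred b] {f g : α → β} (hb : Det fun x => decide (b x)) (hf : Det f) (hg : Det g) :
    Det fun x => if b x then f x else g x := by
  convert bite hb hf hg using 2 with x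
  by_cases h : b x <;> simp [h]

@[fun_prop]
theorem not {b : α → Bool} (hb : Det b) : Det fun x => !(b x) := by
  convert bite hb (const (α := α) false) (const true) using 2 with x
  cases b x <;> rfl

@[fun_prop]
theorem nat_le {f g : α → ℕ} (hf : Det f) (hg : Det g) : Det fun x => decide (f x ≤ g x) := by
  have : (fun x => decide (f x ≤ g x)) = fun x => decide (f x - g x = 0) := by
    funext x; simp [Nat.sub_eq_zero_iff_le]
  rw [this]; fun_prop

@[fun_prop]
theorem nat_lt {f g : α → ℕ} (hf : Det f) (hg : Det g) : Det fun x => decide (f x < g x) := by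
  have : (fun x => decide (f x < g x)) = fun x => decide (f x + 1 ≤ g x) := rfl
  rw [this]; fun_prop

theorem poly (P : ℕ[X]) : Det fun n : ℕ => P.eval n := by
  induction P using Polynomial.induction_on' with
  | add p q hp hq => simp only [eval_add]; fun_prop
  | monomial n c =>
    simp only [eval_monomial]
    have : Det fun k : ℕ => k ^ n := by
      induction n with
      | zero => simp only [pow_zero]; fun_prop
      | succ n ih => simp only [pow_succ]; fun_prop
    fun_prop

@[fun_prop]
theorem some {f : α → β} (hf : Det f) : Det fun x => Option.some (f x) :=
  of_enc (fun x => Val.pair (.num 0) (enc (f x))) (by fun_prop) fun _ => rfl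

theorem option_elim {o : α → Option β} {f : α → γ} {g : α → β → γ} (ho : Det o := by fun_prop)
    (hf : Det f := by fun_prop) (hg : Det fun p : α × β => g p.1 p.2 := by fun_prop) :
    Det fun x => (o x).elim (f x) (g x) := by
  obtain ⟨co, Po, ho⟩ := ho
  obtain ⟨cf, Pf, hf⟩ := hf
  obtain ⟨cg, Pg, hg⟩ := hg
  refine ⟨.ite (.comp (.op .isPair) co) (cg.comp (.pair .id (.comp (.op .snd) co))) cf,
    Po + (Po + 1) ^ 2 + 1 + ((X + 1) ^ 2 + (Po + (Po + 1) ^ 2 + 1) + X + 1 +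
      Pg.comp (X + Po + 1) + 1 + Pf) + X + 1, fun x => ?_⟩
  have h1 := (ho x).comp (Code.computes_op .isPair _)
  have h2 := (ho x).comp (Code.computes_op .snd _)
  have hs : sz (o x) ≤ Po.eval (sz x) := (ho x).size_le
  have hs2 : (sz (o x) + 1) ^ 2 ≤ (Po.eval (sz x) + 1) ^ 2 := Nat.pow_le_pow_left (by omega) 2
  refine Code.Computes.mono (Code.Computes.ite h1
    (T' := ((sz x + 1) ^ 2 + (Po.eval (sz x) + (Po.eval (sz x) + 1) ^ 2 + 1) + (sz x) + 1 +
      Pg.eval (sz x + Po.eval (sz x) + 1) + 1 + Pf.eval (sz x))) ?_ ?_) ?_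
  · intro hne
    rcases hx : o x with _ | b
    · rw [hx] at hne; exact absurd rfl hne
    · rw [hx] at h2 hs hs2
      have h3 := ((Code.computes_id (enc x)).pair h2).comp (hg (x, b))
      have e : enc ((o x).elim (f x) (g x)) = enc (g x b) := by rw [hx]; rfl
      show Code.Computes _ _ (enc ((o x).elim (f x) (g x))) _
      rw [e]
      refine h3.mono ?_
      have : sz (x, b) ≤ sz x + Po.eval (sz x) + 1 := by
        rw [sz_pair]; rw [sz_some] at hs; omega
      have := poly_mono Pg this
      simp only [sz] at *; omega
  · intro h0
    rcases hx : o x with _ | b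
    · have e : enc ((o x).elim (f x) (g x)) = enc (f x) := by rw [hx]; rfl
      show Code.Computes _ _ (enc ((o x).elim (f x) (g x))) _
      rw [e]
      exact (hf x).mono (by omega)
    · rw [hx] at h0; simp [enc, Op.apply, Val.isPair, Val.ofBool, Val.ofOption] at h0
  · simp only [eval_add, eval_pow, eval_X, eval_one, eval_comp]
    simp only [sz] at *; omega

end Det

end

section
variable {α β γ δ σ : Type} [Enc α] [Enc β] [Enc γ] [Enc δ] [Enc σ]

/-! ### Loops -/

theorem iterate_computes {c : Code} {f : σ → σ} {N T : ℕ} {s : σ}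
    (h : ∀ i < N, c.Computes (enc (f^[i] s)) (enc (f^[i + 1] s)) T) :
    (iterate c.run N (enc s)).PureAll fun r => r.1 = enc (f^[N] s) ∧ r.2 ≤ N * (T + 1) + 1 := by
  induction N generalizing s with
  | zero => exact ⟨rfl, by omega⟩
  | succ N ih =>
    have h0 := h 0 (by omega)
    refine Comp.PureAll.bind h0 fun r hr => ?_
    rw [hr.1]
    have := ih (s := f^[1] s) fun i hi => by
      have := h (i + 1) (by omega)
      rwa [show f^[i + 1] s = f^[i] (f^[1] s) from rfl,
        show f^[i + 1 + 1] s = f^[i + 1] (f^[1] s) from rfl] at this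
    refine Comp.PureAll.bind this fun u hu => ⟨hu.1, ?_⟩
    have := hr.2; have := hu.2
    simp only
    have : (N + 1) * (T + 1) = N * (T + 1) + (T + 1) := by ring
    omega

theorem Det.iterate {f : σ → σ} {N : α → ℕ} {s : α → σ} (hf : Det f) (hN : Det N) (hs : Det s)
    {R : ℕ[X]} (hR : ∀ x, N x ≤ R.eval (sz x)) (hR' : ∀ x, ∀ i ≤ N x, sz (f^[i] (s x)) ≤ R.eval (sz x)) :
    Det fun x => f^[N x] (s x) := by
  obtain ⟨c, P, h⟩ := hf
  obtain ⟨c', P', h'⟩ := Det.pair hN hs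
  refine ⟨.comp (.loop c) c', P' + (R * (P.comp R + 1) + 1 + (P' + 1) ^ 2) + 1, fun x => ?_⟩
  refine ((h' x).comp (y := enc (N x, s x)) (z := enc (f^[N x] (s x)))
    (T' := R.eval (sz x) * (P.eval (R.eval (sz x)) + 1) + 1 + (P'.eval (sz x) + 1) ^ 2) ?_).mono ?_
  · have := iterate_computes (c := c) (f := f) (N := N x) (s := s x) (T := P.eval (R.eval (sz x)))
      fun i hi => by
        rw [Function.iterate_succ_apply']
        exact (h (f^[i] (s x))).mono (poly_mono P (hR' x i hi.le))
    refine Comp.PureAll.bind this fun u hu => ⟨hu.1, ?_⟩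
    have h1 := hu.2
    have h2 := Nat.mul_le_mul_right (P.eval (R.eval (sz x)) + 1) (hR x)
    have h3 : (enc (N x, s x)).size ≤ P'.eval (sz x) := (h' x).size_le
    have h4 := Nat.pow_le_pow_left (show (enc (N x, s x)).size + 1 ≤ P'.eval (sz x) + 1 by omega) 2
    simp only [sz] at *; omega
  · simp [eval_comp]

/-! ### Lists -/

namespace Det

/-- One step of a pass through a list. -/
def listStep (g : α → σ → β → σ) (p : α × List β × σ) : α × List β × σ :=
  match p.2.1 with
  | [] => p
  | b :: l => (p.1, l, g p.1 p.2.2 b)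

omit [Enc α] [Enc β] [Enc σ] in
theorem listStep_iterate (g : α → σ → β → σ) (x : α) (l : List β) (s : σ) (i : ℕ) :
    (listStep g)^[i] (x, l, s) = (x, l.drop i, (l.take i).foldl (g x) s) := by
  induction i generalizing l s with
  | zero => rfl
  | succ i ih =>
    rw [Function.iterate_succ_apply]
    cases l with
    | nil => rw [show listStep g (x, [], s) = (x, [], s) from rfl, ih]; simp
    | cons b l => rw [show listStep g (x, b :: l, s) = (x, l, g x s b) from rfl, ih]; rfl

theorem list_tail {f : α → List β} (hf : Det f) : Det fun x => (f x).tail :=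
  of_enc (fun x => (enc (f x)).snd) (by fun_prop) fun x => by cases f x <;> rfl

theorem list_head? {f : α → List β} (hf : Det f) : Det fun x => (f x).head? :=
  of_enc (fun x => bif (enc (f x)).isPair then Val.pair (.num 0) (enc (f x)).fst else .num 0)
    (bite (by fun_prop) (by fun_prop) (by fun_prop)) fun x => by cases f x <;> rfl

theorem listStep_det {g : α → σ → β → σ} (hg : Det fun p : (α × σ) × β => g p.1.1 p.1.2 p.2) :
    Det (listStep g) := by
  have h1 : Det fun p : α × List β × σ => p.2.1.head? := list_head? (by fun_prop)
  have h2 : Det fun p : α × List β × σ => p.2.1.tail := list_tail (by fun_prop)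
  have h3 : Det fun q : (α × List β × σ) × β => g q.1.1 q.1.2.2 q.2 :=
    comp (g := fun p : (α × σ) × β => g p.1.1 p.1.2 p.2)
      (f := fun q : (α × List β × σ) × β => ((q.1.1, q.1.2.2), q.2)) hg (by fun_prop)
  have h4 : Det fun q : (α × List β × σ) × β => q.1.2.1.tail := comp (f := fun q : (α × List β × σ) × β => q.1) h2 (by fun_prop)
  refine of_arg (fun p => p) (g := fun p : α × List β × σ => p.2.1.head?.elim p
    fun b => (p.1, p.2.1.tail, g p.1 p.2.2 b)) ?_ (by fun_prop) ?_
  · exact option_elim h1 (by fun_prop) (pair (by fun_prop) (pair h4 h3))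
  · rintro ⟨x, l, s⟩
    cases l <;> rfl

theorem sz_drop_le (l : List β) (i : ℕ) : sz (l.drop i) ≤ sz l := by
  induction l generalizing i with
  | nil => simp
  | cons b l ih =>
    cases i with
    | zero => simp
    | succ i => rw [List.drop_succ_cons, sz_cons]; have := ih i; omega

theorem sz_take_le (l : List β) (i : ℕ) : sz (l.take i) ≤ sz l := by
  induction l generalizing i with
  | nil => simp
  | cons b l ih =>
    cases i with
    | zero => simp [sz_nil, one_le_sz]
    | succ i => rw [List.take_succ_cons, sz_cons, sz_cons]; have := ih i; omega

/-- A pass through a list is efficient provided that its states stay short. -/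
theorem foldl {g : α → σ → β → σ} {l : α → List β} {s : α → σ}
    (hg : Det fun p : (α × σ) × β => g p.1.1 p.1.2 p.2) (hl : Det l) (hs : Det s) {R : ℕ[X]}
    (hR : ∀ x i, sz (((l x).take i).foldl (g x) (s x)) ≤ R.eval (sz x)) :
    Det fun x => (l x).foldl (g x) (s x) := by
  obtain ⟨P, hP⟩ := hl.sz_le
  have h1 : Det fun x => (listStep g)^[sz (l x)] (x, l x, s x) := by
    refine iterate (listStep_det hg) (by fun_prop) (by fun_prop) (R := X + P + R + 2) ?_ ?_
    · intro x; have := hP x; simp only [eval_add, eval_X]; omega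
    · intro x i _
      rw [listStep_iterate, sz_pair, sz_pair]
      have := hR x i
      have := hP x
      have := sz_drop_le (l x) i
      simp only [eval_add, eval_X, eval_ofNat]; omega
  have h2 : Det fun x => ((listStep g)^[sz (l x)] (x, l x, s x)).2.2 := by fun_prop
  convert h2 using 2 with x
  rw [listStep_iterate, List.take_of_length_le (length_lt_sz (l x)).le]

@[fun_prop]
theorem list_cons {f : α → β} {g : α → List β} (hf : Det f) (hg : Det g) :
    Det fun x => f x :: g x :=
  of_enc (fun x => Val.pair (enc (f x)) (enc (g x))) (by fun_prop) fun _ => rfl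

omit [Enc β] [Enc γ] in
theorem foldl_cons_eq (l : List γ) (f : γ → Option β) (s : List β) :
    l.foldl (fun s a => (f a).elim s (· :: s)) s = (l.filterMap f).reverse ++ s := by
  induction l generalizing s with
  | nil => rfl
  | cons a l ih =>
    rw [List.foldl_cons, ih, List.filterMap_cons]
    cases f a <;> simp

theorem list_reverse {f : α → List β} (hf : Det f) : Det fun x => (f x).reverse := by
  have : Det fun l : List β => l.reverse := by
    have := foldl (α := List β) (g := fun (_ : List β) (s : List β) b => b :: s) (l := fun l => l)
      (s := fun _ => []) (by fun_prop) (by fun_prop) (by fun_prop) (R := X) fun x i => by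
        have : ∀ l s : List β, l.foldl (fun s b => b :: s) s = l.reverse ++ s := fun l => by
          induction l with
          | nil => simp
          | cons a l ih => intro s; simp [ih]
        rw [this, List.append_nil, sz_reverse, eval_X]
        exact sz_take_le _ _
    convert this using 2 with l
    have : ∀ l s : List β, l.foldl (fun s b => b :: s) s = l.reverse ++ s := fun l => by
      induction l with
      | nil => simp
      | cons a l ih => intro s; simp [ih]
    rw [this, List.append_nil]
  exact comp this hf

theorem list_filterMap {f : α → β → Option γ} {l : α → List β}
    (hf : Det fun p : α × β => f p.1 p.2) (hl : Det l) : Det fun x => (l x).filterMap (f x) := by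
  obtain ⟨P, hP⟩ := hf.sz_le
  obtain ⟨Q, hQ⟩ := hl.sz_le
  have hstep : Det fun p : (α × List γ) × β => (f p.1.1 p.2).elim p.1.2 (· :: p.1.2) := by
    refine option_elim ?_ (by fun_prop) (by fun_prop)
    exact comp (g := fun p : α × β => f p.1 p.2) (f := fun p : (α × List γ) × β => (p.1.1, p.2)) hf
      (by fun_prop)
  have := foldl (g := fun x (s : List γ) b => (f x b).elim s (· :: s)) (s := fun _ : α => [])
    hstep hl (by fun_prop) (R := Q * (P.comp (X + Q + 1) + 1) + 1) fun x i => by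
      rw [foldl_cons_eq, List.append_nil, sz_reverse]
      have h1 : ∀ c ∈ ((l x).take i).filterMap (f x), sz c ≤ P.eval (sz x + Q.eval (sz x) + 1) := by
        intro c hc
        rw [List.mem_filterMap] at hc
        obtain ⟨b, hb, hbc⟩ := hc
        have h2 := hP (x, b)
        simp only [hbc] at h2
        rw [sz_some] at h2
        have h3 := sz_le_of_mem (List.mem_of_mem_take hb)
        have h4 := hQ x
        have := poly_mono P (show sz (x, b) ≤ sz x + Q.eval (sz x) + 1 by rw [sz_pair]; omega)
        omega
      refine (sz_list_le h1).trans ?_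
      simp only [eval_add, eval_mul, eval_comp, eval_X, eval_one]
      have h5 := (List.length_filterMap_le (f x) ((l x).take i))
      have h6 := length_lt_sz (l x)
      have h7 := hQ x
      have h8 := List.length_take_le' i (l x)
      gcongr
      omega
  have := list_reverse this
  convert this using 2 with x
  rw [foldl_cons_eq, List.append_nil, List.reverse_reverse]

theorem list_map {f : α → β → γ} {l : α → List β} (hf : Det fun p : α × β => f p.1 p.2 := by fun_prop)
    (hl : Det l := by fun_prop) : Det fun x => (l x).map (f x) := by
  have := list_filterMap (f := fun x b => Option.some (f x b)) (by fun_prop) hl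
  simpa using this

theorem list_filter {f : α → β → Bool} {l : α → List β} (hf : Det fun p : α × β => f p.1 p.2 := by fun_prop)
    (hl : Det l := by fun_prop) : Det fun x => (l x).filter (f x) := by
  have := list_filterMap (f := fun x b => bif f x b then Option.some b else none)
    (bite hf (by fun_prop) (by fun_prop)) hl
  convert this using 2 with x
  rw [← List.filterMap_eq_filter]
  congr 1
  funext b
  cases h : f x b <;> simp [Option.guard, h]

/-- One step of the construction of an initial segment. -/
def rangeStep (p : ℕ × List ℕ) : ℕ × List ℕ := (p.1 - 1, (p.1 - 1) :: p.2)

theorem rangeStep_iterate (n i : ℕ) (h : i ≤ n) :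
    rangeStep^[i] (n, []) = (n - i, (List.range i).map (· + (n - i))) := by
  induction i with
  | zero => rfl
  | succ i ih =>
    rw [Function.iterate_succ_apply', ih (by omega), rangeStep, List.range_succ_eq_map]
    simp only [List.map_cons, List.map_map, Prod.mk.injEq, List.cons.injEq]
    refine ⟨by omega, by omega, List.map_congr_left fun a _ => ?_⟩
    simp only [Function.comp]; omega

theorem list_range {f : α → ℕ} (hf : Det f) {R : ℕ[X]} (hR : ∀ x, f x ≤ R.eval (sz x)) :
    Det fun x => List.range (f x) := by
  have h1 : Det rangeStep := by unfold rangeStep; fun_prop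
  have h2 : Det fun x => (rangeStep^[f x] (f x, [])).2 := by
    have := iterate (f := rangeStep) (N := f) (s := fun x => (f x, ([] : List ℕ))) h1 hf (by fun_prop)
      (R := R + 1 + (R * (R + 1 + 1) + 1) + 1) (fun x => ?_) fun x i hi => ?_
    · fun_prop
    · have := hR x
      simp only [eval_add, eval_one]; omega
    · rw [rangeStep_iterate _ _ hi, sz_pair]
      have h3 := sz_nat_le (f x - i)
      have h5 := hR x
      have h4 := sz_list_le (l := (List.range i).map (· + (f x - i))) (B := R.eval (sz x) + 1) (by
        simp only [List.mem_map, List.mem_range, forall_exists_index, and_imp]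
        rintro a j hj rfl
        have := sz_nat_le (j + (f x - i)); omega)
      rw [List.length_map, List.length_range] at h4
      have h6 := Nat.mul_le_mul_right (R.eval (sz x) + 1 + 1) (hi.trans h5)
      simp only [eval_add, eval_one, eval_mul]; omega
  convert h2 using 2 with x
  rw [rangeStep_iterate _ _ le_rfl]
  simp

omit [Enc β] in
theorem foldl_count (l : List β) (n : ℕ) : l.foldl (fun s _ => s + 1) n = n + l.length := by
  induction l generalizing n with
  | nil => rfl
  | cons a l ih => rw [List.foldl_cons, ih, List.length_cons]; omega

@[fun_prop]
theorem list_length {f : α → List β} (hf : Det f) : Det fun x => (f x).length := by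
  have : Det fun l : List β => l.length := by
    have := foldl (α := List β) (g := fun (_ : List β) (s : ℕ) _ => s + 1) (l := fun l => l)
      (s := fun _ => 0) (by fun_prop) (by fun_prop) (by fun_prop) (R := X + 1) fun x i => by
        rw [foldl_count, zero_add]
        have h1 := sz_nat_le (x.take i).length
        have h2 := List.length_take_le' i x
        have h3 := length_lt_sz x
        simp only [eval_add, eval_X, eval_one]; omega
    simpa [foldl_count] using this
  exact comp this hf

omit [Enc β] [Enc γ] in
theorem foldl_zip_eq (l : List β) (m : List γ) (s : List (β × γ)) :
    ∃ m', l.foldl (fun (s : List γ × List (β × γ)) b =>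
      s.1.head?.elim s fun c => (s.1.tail, (b, c) :: s.2)) (m, s) = (m', (l.zip m).reverse ++ s) ∧
        m' <:+ m := by
  induction l generalizing m s with
  | nil => exact ⟨m, by simp, List.suffix_refl _⟩
  | cons b l ih =>
    cases m with
    | nil =>
      obtain ⟨m', h, h'⟩ := ih [] s
      exact ⟨m', by simpa using h, h'⟩
    | cons c m =>
      obtain ⟨m', h, h'⟩ := ih m ((b, c) :: s)
      exact ⟨m', by simpa using h, h'.trans (List.suffix_cons c m)⟩

theorem sz_zip_le (l : List β) (m : List γ) : sz (l.zip m) ≤ sz l + sz m := by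
  induction l generalizing m with
  | nil => simp [sz_nil]
  | cons b l ih =>
    cases m with
    | nil => simp [sz_nil]
    | cons c m =>
      have := ih m
      simp only [List.zip_cons_cons, sz_cons, sz_pair]; omega

theorem sz_suffix_le {l m : List β} (h : l <:+ m) : sz l ≤ sz m := by
  obtain ⟨r, rfl⟩ := h
  have := sz_append r l
  have := one_le_sz r
  omega

theorem list_zip {f : α → List β} {g : α → List γ} (hf : Det f) (hg : Det g) :
    Det fun x => (f x).zip (g x) := by
  have : Det fun p : List β × List γ => p.1.zip p.2 := by
    have h2 : Det fun q : List γ × List (β × γ) => q.1.tail := list_tail (by fun_prop)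
    have h3 : Det fun q : List γ × List (β × γ) => q.1.head? := list_head? (by fun_prop)
    have h1 : Det fun q : ((List β × List γ) × (List γ × List (β × γ))) × β =>
        q.1.2.1.head?.elim q.1.2 fun c => (q.1.2.1.tail, (q.2, c) :: q.1.2.2) := by
      refine option_elim (comp h3 (f := fun q : ((List β × List γ) × (List γ × List (β × γ))) × β => q.1.2)
        (by fun_prop)) (by fun_prop) (pair ?_ (by fun_prop))
      exact comp h2 (f := fun q : (((List β × List γ) × (List γ × List (β × γ))) × β) × γ => q.1.1.2)
        (by fun_prop)
    have h4 := foldl (g := fun (_ : List β × List γ) (s : List γ × List (β × γ)) b =>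
      s.1.head?.elim s fun c => (s.1.tail, (b, c) :: s.2)) (l := fun p => p.1)
      (s := fun p => (p.2, [])) h1 (by fun_prop) (by fun_prop) (R := 2 * X) fun x i => by
        obtain ⟨m', h, h'⟩ := foldl_zip_eq (x.1.take i) x.2 []
        rw [h, sz_pair, List.append_nil, sz_reverse]
        have := sz_zip_le (x.1.take i) x.2
        have := sz_suffix_le h'
        have := sz_take_le x.1 i
        have : sz x = sz x.1 + sz x.2 + 1 := rfl
        simp only [eval_mul, eval_X, eval_ofNat]; omega
    have := list_reverse (f := fun p : List β × List γ => (p.1.foldl (fun (s : List γ × List (β × γ)) b =>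
      s.1.head?.elim s fun c => (s.1.tail, (b, c) :: s.2)) (p.2, [])).2) (by fun_prop)
    convert this using 2 with p
    obtain ⟨m', h, h'⟩ := foldl_zip_eq p.1 p.2 []
    rw [h]; simp
  exact comp this (pair hf hg)

theorem option_getD {f : α → Option β} {g : α → β} (hf : Det f) (hg : Det g) :
    Det fun x => (f x).getD (g x) := by
  have := option_elim (g := fun (_ : α) (b : β) => b) hf hg (by fun_prop)
  convert this using 2 with x
  cases f x <;> rfl

theorem list_drop {f : α → List β} {i : α → ℕ} (hf : Det f) (hi : Det i) :
    Det fun x => (f x).drop (i x) := by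
  have h1 : Det fun l : List β => l.tail := list_tail (by fun_prop)
  obtain ⟨P, hP⟩ := hf.sz_le
  have hit : ∀ (l : List β) (i : ℕ), List.tail^[i] l = l.drop i := fun l i => by
    induction i generalizing l with
    | zero => rfl
    | succ i ih => rw [Function.iterate_succ_apply, ih]; simp
  have := iterate (f := List.tail) (N := fun x => if i x ≤ (f x).length then i x else (f x).length)
    (s := f) h1 (by fun_prop) hf (R := P) (fun x => by
      have := hP x
      have := length_lt_sz (f x)
      split_ifs <;> omega) fun x j _ => by
        rw [hit]; exact (sz_drop_le _ _).trans (hP x)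
  convert this using 2 with x
  rw [hit]
  split_ifs with h
  · rfl
  · rw [List.drop_length, List.drop_eq_nil_iff]; omega

theorem list_getD {f : α → List β} {i : α → ℕ} {d : α → β} (hf : Det f) (hi : Det i) (hd : Det d) :
    Det fun x => (f x).getD (i x) (d x) := by
  have := option_getD (list_head? (list_drop hf hi)) hd
  convert this using 2 with x
  rw [List.head?_drop, List.getD_eq_getElem?_getD]

theorem get_eq (v : Val) (i : ℕ) : v.get i = (Val.snd^[i] v).fst := by
  induction i generalizing v with
  | zero => rfl
  | succ i ih => rw [Val.get, ih, Function.iterate_succ_apply]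

theorem snd_iterate {v : Val} {i : ℕ} (h : v.size ≤ i) : Val.snd^[i] v = .num 0 := by
  induction i generalizing v with
  | zero => have := v.one_le_size; omega
  | succ i ih =>
    rw [Function.iterate_succ_apply]
    cases v with
    | num n =>
      cases i with
      | zero => rfl
      | succ i => exact ih (by simp [Val.snd, Val.size])
    | pair a b => exact ih (by have := a.one_le_size; rw [Val.size_pair] at h; simp only [Val.snd]; omega)

@[fun_prop]
theorem val_get {f : α → Val} {i : α → ℕ} (hf : Det f) (hi : Det i) :
    Det fun x => (f x).get (i x) := by
  have h1 : Det Val.snd := val_snd id'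
  obtain ⟨P, hP⟩ := hf.sz_le
  have hsz : ∀ (v : Val) i, (Val.snd^[i] v).size ≤ v.size := fun v i => by
    induction i generalizing v with
    | zero => rfl
    | succ i ih => rw [Function.iterate_succ_apply]; exact (ih _).trans v.size_snd_le
  have := iterate (f := Val.snd) (N := fun x => if i x ≤ (f x).size then i x else (f x).size)
    (s := f) h1 (by fun_prop) hf (R := P) (fun x => by
      have : (f x).size ≤ _ := hP x
      split_ifs <;> omega) fun x j _ => (hsz _ _).trans (hP x)
  have := val_fst this
  convert this using 2 with x
  rw [get_eq]
  split_ifs with h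
  · rfl
  · rw [snd_iterate (v := f x) (by omega), snd_iterate (v := f x) (by omega)]

attribute [fun_prop] list_tail list_head? list_reverse list_zip option_getD list_drop list_getD

@[fun_prop]
theorem party_idx {f : α → Party} (hf : Det f) : Det fun x => (f x).idx :=
  of_enc (fun x => (enc (f x)).fst) (by fun_prop) fun _ => rfl

@[fun_prop]
theorem party_corrupt {f : α → Party} (hf : Det f) : Det fun x => (f x).corrupt :=
  of_enc (fun x => (enc (f x)).snd.fst) (by fun_prop) fun _ => rfl

@[fun_prop]
theorem party_pk {f : α → Party} (hf : Det f) : Det fun x => (f x).pk :=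
  of_enc (fun x => (enc (f x)).snd.snd.fst) (by fun_prop) fun _ => rfl

@[fun_prop]
theorem party_proof {f : α → Party} (hf : Det f) : Det fun x => (f x).proof :=
  of_enc (fun x => (enc (f x)).snd.snd.snd.snd) (by fun_prop) fun _ => rfl

@[fun_prop]
theorem party_mk {i : α → ℕ} {c : α → Bool} {a s p : α → Val} (hi : Det i) (hc : Det c) (ha : Det a)
    (hs : Det s) (hp : Det p) : Det fun x => Party.mk (i x) (c x) (a x) (s x) (p x) :=
  of_enc (fun x => (i x, c x, a x, s x, p x)) (by fun_prop) fun _ => rfl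

end Det
end

/-! ### Resources and behaviour of programs -/

/-- Resource bounds for a run of a program, with a property of all possible outputs. -/
structure Code.Good (c : Code) (x : Val) (q l : ℕ) (T : ℕ → ℕ) (J : Val → Prop) : Prop where
  bounded : (c.run x).Bounded q l T
  all : (c.run x).All fun r => J r.1
  mono : Monotone T

/-- The behaviour of a program, without its step count. -/
def Code.sem (c : Code) (x : Val) : Comp Val := Prod.fst <$> c.run x

namespace Code

variable {c c' f g : Code} {x y : Val} {q q' l l' : ℕ} {T T' : ℕ → ℕ} {J J' : Val → Prop}

theorem Good.imp (h : c.Good x q l T J) (hq : q ≤ q') (hl : l ≤ l') (hT : ∀ r, T r ≤ T' r)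
    (hT' : Monotone T') (hJ : ∀ y, J y → J' y) : c.Good x q' l' T' J' :=
  ⟨h.bounded.mono hq hl hT, h.all.imp fun _ hr => hJ _ hr, hT'⟩

theorem Computes.good {n : ℕ} (h : c.Computes x y n) (q l : ℕ) :
    c.Good x q l (fun _ => n) fun z => z = y :=
  ⟨(h.imp fun _ hr => hr.2).bounded, h.all.imp fun _ hr => hr.1, monotone_const⟩

theorem bounded_ret_add {t q l : ℕ} {c : Comp (Val × ℕ)} {T : ℕ → ℕ} {k : ℕ} {F : Val → Val}
    (h : c.Bounded q l T) (hT : Monotone T) :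
    (c.bind fun r => .ret (F r.1, t + r.2 + k)).Bounded q l fun r => t + T r + k := by
  have := h.bind (q' := 0) (T' := fun _ => t + k) (g := fun r => .ret (F r.1, t + r.2 + k))
    (Comp.all_true c) hT monotone_const (fun u _ => by simp only [Comp.Bounded]; omega)
  exact this.mono (by omega) le_rfl fun r => by omega

theorem Good.comp (h : c.Good x q l T J) (h' : ∀ y, J y → c'.Good y q' l T' J') (hT' : Monotone T') :
    (Code.comp c' c).Good x (q + q') l (fun r => T r + T' r + 1) J' := by
  have m : Monotone fun r => T r + T' r + 1 := fun a b hab =>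
    Nat.add_le_add_right (Nat.add_le_add (h.mono hab) (hT' hab)) 1
  refine ⟨?_, ?_, m⟩
  · have := h.bounded.bind (q' := q') (T' := fun r => T' r + 1)
      (g := fun r => (c'.run r.1).bind fun u => .ret (u.1, r.2 + u.2 + 1)) h.all h.mono
      (fun a b hab => Nat.add_le_add_right (hT' hab) 1) fun u hu =>
        (bounded_ret_add (F := fun v => v) (h' _ hu).bounded (h' _ hu).mono).mono le_rfl le_rfl
          fun r => by omega
    exact this.mono le_rfl le_rfl fun r => by omega
  · exact h.all.bind fun r hr => (h' _ hr).all.bind fun u hu => hu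

theorem Good.pair (h : c.Good x q l T J) (h' : c'.Good x q' l T' J') :
    (Code.pair c c').Good x (q + q') l (fun r => T r + T' r + x.size + 1)
      fun v => ∃ y z, v = .pair y z ∧ J y ∧ J' z := by
  have m : Monotone fun r => T r + T' r + x.size + 1 := fun a b hab =>
    Nat.add_le_add_right (Nat.add_le_add_right (Nat.add_le_add (h.mono hab) (h'.mono hab)) _) 1
  refine ⟨?_, ?_, m⟩
  · have := h.bounded.bind (q' := q') (T' := fun r => T' r + (x.size + 1))
      (g := fun r => (c'.run x).bind fun u => .ret (.pair r.1 u.1, r.2 + u.2 + x.size + 1)) h.all h.mono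
      (fun a b hab => Nat.add_le_add_right (h'.mono hab) _) fun u hu =>
        (bounded_ret_add (F := fun v => Val.pair u.1 v) (t := u.2) (k := x.size + 1)
          h'.bounded h'.mono).mono le_rfl le_rfl fun r => by omega
    exact this.mono le_rfl le_rfl fun r => by omega
  · exact h.all.bind fun r hr => h'.all.bind fun u hu => ⟨_, _, rfl, hr, hu⟩

open Classical in
theorem Good.ite {b : Val} {n : ℕ} (h : c.Computes x b n) (hf : b ≠ .num 0 → f.Good x q l T J)
    (hg : b = .num 0 → g.Good x q l T J) (hT : Monotone T) :
    (Code.ite c f g).Good x q l (fun r => n + T r + x.size + 1) J := by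
  have m : Monotone fun r => n + T r + x.size + 1 := fun a b hab =>
    Nat.add_le_add_right (Nat.add_le_add_right (Nat.add_le_add_left (hT hab) _) _) 1
  have h0 := h.good 0 l
  have key : ∀ r : Val × ℕ, r.1 = b →
      (if r.1 = Val.num 0 then g.run x else f.run x).Bounded q l T ∧
      (if r.1 = Val.num 0 then g.run x else f.run x).All fun r => J r.1 := by
    intro r hr
    rw [hr]
    split_ifs with hb
    exacts [⟨(hg hb).bounded, (hg hb).all⟩, ⟨(hf hb).bounded, (hf hb).all⟩]
  refine ⟨?_, ?_, m⟩
  · have := h0.bounded.bind (q' := q) (T' := fun r => T r + (x.size + 1))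
      (g := fun r => (if r.1 = Val.num 0 then g.run x else f.run x).bind fun u =>
        .ret (u.1, r.2 + u.2 + x.size + 1)) h0.all h0.mono
      (fun a b hab => Nat.add_le_add_right (hT hab) _) fun u hu =>
        (bounded_ret_add (F := fun v => v) (t := u.2) (k := x.size + 1)
          (key u hu).1 hT).mono le_rfl le_rfl fun r => by omega
    exact this.mono (by omega) le_rfl fun r => by omega
  · exact h0.all.bind fun r hr => (key r hr).2.bind fun u hu => hu

theorem good_iterate {N : ℕ} (h : ∀ y, J y → c.Good y q l T J) (hT : Monotone T) (hy : J y) :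
    (iterate c.run N y).Bounded (N * q) l (fun r => N * (T r + 1) + 1) ∧
      (iterate c.run N y).All fun r => J r.1 := by
  induction N generalizing y with
  | zero => exact ⟨by simp [iterate, Comp.Bounded], hy⟩
  | succ N ih =>
    have m : Monotone fun r => N * (T r + 1) + 1 := fun a b hab =>
      Nat.add_le_add_right (Nat.mul_le_mul_left _ (Nat.add_le_add_right (hT hab) 1)) 1
    refine ⟨?_, (h y hy).all.bind fun r hr => (ih hr).2.bind fun u hu => hu⟩
    have := (h y hy).bounded.bind (q' := N * q) (T' := fun r => (N * (T r + 1) + 1) + 1)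
      (g := fun r => (iterate c.run N r.1).bind fun u => .ret (u.1, r.2 + u.2 + 1)) (h y hy).all hT
      (fun a b hab => Nat.add_le_add_right (m hab) _) fun u hu =>
        (bounded_ret_add (F := fun v => v) (t := u.2) (k := 1)
          (ih hu).1 m).mono le_rfl le_rfl fun r => by omega
    refine this.mono (by rw [Nat.succ_mul]; omega) le_rfl fun r => ?_
    rw [Nat.succ_mul]; omega

theorem Good.loop {N : ℕ} (h : ∀ y, J y → c.Good y q l T J) (hT : Monotone T) (hy : J y) :
    (Code.loop c).Good (.pair (.num N) y) (N * q) l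
      (fun r => N * (T r + 1) + 1 + ((Val.pair (.num N) y).size + 1) ^ 2) J := by
  have m : Monotone fun r => N * (T r + 1) + 1 := fun a b hab =>
      Nat.add_le_add_right (Nat.mul_le_mul_left _ (Nat.add_le_add_right (hT hab) 1)) 1
  obtain ⟨h1, h2⟩ := good_iterate (N := N) h hT hy
  refine ⟨?_, h2.bind fun u hu => hu, fun a b hab => Nat.add_le_add_right (m hab) _⟩
  have := bounded_ret_add (F := fun v => v) (t := 0)
    (k := ((Val.pair (.num N) y).size + 1) ^ 2) h1 m
  simp only [zero_add] at this
  exact this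

theorem sem_comp (c c' : Code) (x : Val) : (Code.comp c' c).sem x = (c.sem x).bind c'.sem := by
  simp only [sem, Code.run, Comp.map_def, Comp.bind_assoc', Comp.ret_bind']

theorem sem_pair (c c' : Code) (x : Val) : (Code.pair c c').sem x =
    (c.sem x).bind fun y => (c'.sem x).bind fun z => .ret (.pair y z) := by
  simp only [sem, Code.run, Comp.map_def, Comp.bind_assoc', Comp.ret_bind']

open Classical in
theorem sem_ite (c f g : Code) (x : Val) : (Code.ite c f g).sem x =
    (c.sem x).bind fun y => if y = .num 0 then g.sem x else f.sem x := by
  simp only [sem, Code.run, Comp.map_def, Comp.bind_assoc', Comp.ret_bind']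
  congr 1; funext u; split_ifs <;> rfl

theorem sem_id (x : Val) : Code.id.sem x = .ret x := rfl

/-- The behaviour of repeated execution. -/
def iterSem (f : Val → Comp Val) : ℕ → Val → Comp Val
  | 0, y => .ret y
  | m + 1, y => (f y).bind (iterSem f m)

theorem sem_iterate (c : Code) (m : ℕ) (y : Val) :
    Prod.fst <$> iterate c.run m y = iterSem c.sem m y := by
  induction m generalizing y with
  | zero => rfl
  | succ m ih =>
    have : iterSem c.sem m = fun y => Prod.fst <$> iterate c.run m y := funext fun y => (ih y).symm
    simp only [iterSem, this, sem, iterate, Comp.map_def, Comp.bind_assoc', Comp.ret_bind']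

theorem sem_loop (c : Code) (x : Val) : (Code.loop c).sem x = iterSem c.sem x.fst.toNat x.snd := by
  rw [← sem_iterate]
  simp only [sem, Code.run, Comp.map_def, Comp.bind_assoc', Comp.ret_bind']

theorem Computes.equiv {n : ℕ} (h : c.Computes x y n) : Comp.Equiv (c.sem x) (.ret y) := by
  apply Comp.PureAll.equiv_ret
  exact Comp.PureAll.bind h fun r hr => hr.1

end Code

/-! ### Polynomial-time randomized functions -/

variable {α β γ δ : Type} [Enc α] [Enc β] [Enc γ] [Enc δ]

/-- `F` is realized by a program that runs in polynomial time (also counting the time for reading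
the answers to queries), whose outputs have polynomial length independent of the answers, and
which makes polynomially many queries; there are none if `w = 0`. -/
def PP (w : ℕ) (F : α → Comp β) : Prop :=
  ∃ (c : Code) (P : ℕ[X]), ∀ x,
    c.Good (enc x) (w * P.eval (sz x)) (P.eval (sz x)) (fun r => P.eval (sz x + r))
      (fun y => ∃ b : β, y = enc b ∧ sz b ≤ P.eval (sz x)) ∧
    Comp.Equiv (c.sem (enc x)) (enc <$> F x)

namespace PP

variable {w : ℕ}

theorem mono_eval (P : ℕ[X]) (m : ℕ) : Monotone fun r => P.eval (m + r) :=
  fun _ _ h => poly_mono P (by omega)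

theorem ret {f : α → β} (hf : Det f := by fun_prop) : PP w fun x => Comp.ret (f x) := by
  obtain ⟨c, P, h⟩ := hf
  refine ⟨c, P, fun x => ⟨?_, (h x).equiv⟩⟩
  exact ((h x).good _ _).imp le_rfl le_rfl (fun r => poly_mono P (by omega)) (mono_eval _ _)
    fun y hy => ⟨_, hy, (h x).size_le⟩

theorem of_equiv {F G : α → Comp β} (hF : PP w F) (h : ∀ x, Comp.Equiv (F x) (G x)) : PP w G := by
  obtain ⟨c, P, hc⟩ := hF
  exact ⟨c, P, fun x => ⟨(hc x).1, (hc x).2.trans ((h x).map _)⟩⟩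

theorem of_zero {F : α → Comp β} (hF : PP 0 F) : PP w F := by
  obtain ⟨c, P, hc⟩ := hF
  exact ⟨c, P, fun x => ⟨(hc x).1.imp (by simp) le_rfl (fun _ => le_rfl) (mono_eval _ _)
    fun _ h => h, (hc x).2⟩⟩

theorem comp {F : β → Comp γ} {f : α → β} (hF : PP w F) (hf : Det f := by fun_prop) : PP w fun x => F (f x) := by
  obtain ⟨c', P', h'⟩ := hf
  obtain ⟨c, P, h⟩ := hF
  refine ⟨c.comp c', P' + P.comp (P' + X) + 1, fun x => ⟨?_, ?_⟩⟩
  · have hs : sz (f x) ≤ P'.eval (sz x) := (h' x).size_le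
    refine (((h' x).good 0 (P.eval (sz (f x)))).comp (q' := w * P.eval (sz (f x)))
      (T' := fun r => P.eval (sz (f x) + r))
      (J' := fun y => ∃ b : γ, y = enc b ∧ sz b ≤ P.eval (sz (f x))) ?_
      (mono_eval _ _)).imp ?_ ?_ ?_ (mono_eval _ _) ?_
    · rintro y rfl; exact (h (f x)).1
    · rw [zero_add]
      refine Nat.mul_le_mul_left _ ?_
      have := poly_mono P (show sz (f x) ≤ P'.eval (sz x) + sz x by omega)
      simp only [eval_add, eval_comp, eval_X, eval_one]; omega
    · have := poly_mono P (show sz (f x) ≤ P'.eval (sz x) + sz x by omega)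
      simp only [eval_add, eval_comp, eval_X, eval_one]; omega
    · intro r
      have h1 := poly_mono P' (show sz x ≤ sz x + r by omega)
      have := poly_mono P (show sz (f x) + r ≤ P'.eval (sz x + r) + (sz x + r) by omega)
      simp only [eval_add, eval_comp, eval_X, eval_one]; omega
    · rintro y ⟨b, rfl, hb⟩
      refine ⟨b, rfl, ?_⟩
      have := poly_mono P (show sz (f x) ≤ P'.eval (sz x) + sz x by omega)
      simp only [eval_add, eval_comp, eval_X, eval_one]; omega
  · rw [Code.sem_comp]
    refine (h' x).equiv.bind_left.trans ?_
    exact (h (f x)).2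

theorem bind {F : α → Comp β} {G : α → β → Comp γ} (hF : PP w F)
    (hG : PP w fun p : α × β => G p.1 p.2) : PP w fun x => F x >>= G x := by
  obtain ⟨c, P, h⟩ := hF
  obtain ⟨c', P', h'⟩ := hG
  let R : ℕ[X] := (X + 1) ^ 2 + P + P'.comp (2 * X + P + 1) + X + 3
  refine ⟨c'.comp (.pair .id c), R, fun x => ⟨?_, ?_⟩⟩
  · have hR : ∀ m, R.eval m = (m + 1) ^ 2 + P.eval m + P'.eval (2 * m + P.eval m + 1) + m + 3 := by
      intro m; simp [R, eval_comp]
    have hP0 : ∀ r, P.eval (sz x) ≤ P.eval (sz x + r) := fun r => poly_mono P (by omega)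
    set B := 2 * sz x + P.eval (sz x) + 1 with hB
    have hRx := hR (sz x)
    rw [← hB] at hRx
    have hl1 : P.eval (sz x) ≤ R.eval (sz x) := by omega
    have hl2 : P'.eval B ≤ R.eval (sz x) := by omega
    refine (((Code.computes_id (enc x)).good 0 (R.eval (sz x))).pair
      ((h x).1.imp le_rfl hl1 (fun _ => le_rfl) (mono_eval _ _) fun _ h => h)
        |>.comp (q' := w * P'.eval B) (T' := fun r => P'.eval (B + r))
      (J' := fun y => ∃ b : γ, y = enc b ∧ sz b ≤ P'.eval B) ?_
      (mono_eval _ _)).imp ?_ le_rfl ?_ (mono_eval _ _) ?_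
    · rintro y ⟨_, _, rfl, rfl, b, rfl, hb⟩
      have hs : sz (x, b) ≤ B := by rw [sz_pair]; omega
      refine (h' (x, b)).1.imp (Nat.mul_le_mul_left _ (poly_mono P' hs)) ?_
        (fun r => poly_mono P' (by omega)) (mono_eval _ _) ?_
      · exact (poly_mono P' hs).trans hl2
      · rintro y ⟨c, rfl, hc⟩
        exact ⟨c, rfl, hc.trans (poly_mono P' hs)⟩
    · rw [zero_add, ← Nat.mul_add]
      exact Nat.mul_le_mul_left _ (by omega)
    · intro r
      rw [hR]
      have h1 := poly_mono P' (show B + r ≤ 2 * (sz x + r) + P.eval (sz x + r) + 1 by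
        have := hP0 r; omega)
      have h2 : ((enc x).size + 1) ^ 2 ≤ (sz x + r + 1) ^ 2 :=
        Nat.pow_le_pow_left (by simp only [sz]; omega) 2
      have h3 : (enc x).size = sz x := rfl
      omega
    · rintro y ⟨b, rfl, hb⟩
      exact ⟨b, rfl, hb.trans hl2⟩
  · rw [Code.sem_comp, Code.sem_pair, Code.sem_id, Comp.ret_bind', Comp.bind_assoc']
    refine (h x).2.bind_left.trans ?_
    rw [Comp.map_def, Comp.map_def, Comp.bind_assoc']
    show Comp.Equiv _ (((F x).bind (G x)).bind fun a => Comp.ret (enc a))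
    rw [Comp.bind_assoc']
    exact (Comp.Equiv.refl _).bind fun b => (h' (x, b)).2

theorem map {F : α → Comp β} {f : α → β → γ} (hF : PP w F) (hf : Det fun p : α × β => f p.1 p.2 := by fun_prop) :
    PP w fun x => f x <$> F x := bind hF (ret hf)

theorem ite {b : α → Prop} [DecidablePred b] {F G : α → Comp β} (hF : PP w F) (hG : PP w G)
    (hb : Det fun x => decide (b x) := by fun_prop) : PP w fun x => if b x then F x else G x := by
  obtain ⟨cb, Pb, hb⟩ := hb
  obtain ⟨c, P, h⟩ := hF
  obtain ⟨c', P', h'⟩ := hG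
  refine ⟨cb.ite c c', Pb + P + P' + X + 1, fun x => ⟨?_, ?_⟩⟩
  · have m : Monotone fun r => P.eval (sz x + r) + P'.eval (sz x + r) :=
      fun a b hab => Nat.add_le_add (mono_eval P _ hab) (mono_eval P' _ hab)
    have e : ∀ y, (Pb + P + P' + X + 1 : ℕ[X]).eval y = Pb.eval y + P.eval y + P'.eval y + y + 1 := by
      intro y; simp
    have key := Code.Good.ite (hb x) (f := c) (g := c')
      (q := w * (Pb + P + P' + X + 1 : ℕ[X]).eval (sz x)) (l := (Pb + P + P' + X + 1 : ℕ[X]).eval (sz x))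
      (T := fun r => P.eval (sz x + r) + P'.eval (sz x + r))
      (J := fun y => ∃ b : β, y = enc b ∧ sz b ≤ (Pb + P + P' + X + 1 : ℕ[X]).eval (sz x)) ?_ ?_ m
    · refine key.imp le_rfl le_rfl (fun r => ?_) (mono_eval _ _) fun _ h => h
      have := poly_mono Pb (show sz x ≤ sz x + r by omega)
      have : (enc x).size = sz x := rfl
      rw [e]; omega
    · intro _
      refine (h x).1.imp (Nat.mul_le_mul_left _ (by rw [e]; omega)) (by rw [e]; omega)
        (fun r => by omega) m ?_
      rintro y ⟨b, rfl, hb⟩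
      exact ⟨b, rfl, by rw [e]; omega⟩
    · intro _
      refine (h' x).1.imp (Nat.mul_le_mul_left _ (by rw [e]; omega)) (by rw [e]; omega)
        (fun r => by omega) m ?_
      rintro y ⟨b, rfl, hb⟩
      exact ⟨b, rfl, by rw [e]; omega⟩
  · rw [Code.sem_ite]
    refine (hb x).equiv.bind_left.trans ?_
    rw [Comp.ret_bind']
    by_cases hx : b x
    · simp only [hx, decide_true, if_true]
      rw [if_neg (by simp [enc, Val.ofBool, hx])]
      exact (h x).2
    · simp only [hx, decide_false, if_false]
      rw [if_pos (by simp [enc, Val.ofBool, hx])]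
      exact (h' x).2

theorem bite {b : α → Bool} {F G : α → Comp β} (hF : PP w F) (hG : PP w G) (hb : Det b := by fun_prop) :
    PP w fun x => bif b x then F x else G x := by
  convert ite (b := fun x => b x = true) hF hG (by simpa using hb) using 2 with x
  cases b x <;> rfl

theorem rand {f : α → ℕ} (hf : Det f := by fun_prop) :
    PP w fun x => (fun i : Fin (f x + 1) => i.val) <$> Comp.rand (f x) Comp.ret := by
  have : PP w fun n : ℕ => (fun i : Fin (n + 1) => i.val) <$> Comp.rand n Comp.ret := by
    refine ⟨.rand, (X + 1) ^ 2, fun n => ⟨⟨fun i => ?_, fun i => ?_, mono_eval _ _⟩, ?_⟩⟩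
    · simp only [Comp.Bounded, sz]; simp
    · refine ⟨i.val, rfl, ?_⟩
      have h1 : i.val ≤ n := Nat.lt_succ_iff.1 i.isLt
      have := Nat.size_le_size h1
      simp only [sz_nat, eval_pow, eval_add, eval_X, eval_one]; nlinarith
    · exact Comp.Equiv.refl _
  exact comp this hf

end PP

section

variable {α β γ δ : Type} [Enc α] [Enc β] [Enc γ] [Enc δ] {w : ℕ}

namespace PP

theorem option_elim {o : α → Option β} {F : α → Comp γ} {G : α → β → Comp γ} (hF : PP w F)
    (hG : PP w fun p : α × β => G p.1 p.2) (ho : Det o := by fun_prop) : PP w fun x => (o x).elim (F x) (G x) := by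
  obtain ⟨co, Po, ho⟩ := ho
  obtain ⟨cf, Pf, hf⟩ := hF
  obtain ⟨cg, Pg, hg⟩ := hG
  have e1 : ∀ x, sz (o x) ≤ Po.eval (sz x) := fun x => (ho x).size_le
  let R : ℕ[X] := (Po + (Po + 1) ^ 2 + 1) + (Pf + ((X + 1) ^ 2 + (Po + (Po + 1) ^ 2 + 1) + X + 1 +
      Pg.comp (2 * X + Po + 1) + 1)) + X + 1
  have hR : ∀ m, R.eval m = (Po.eval m + (Po.eval m + 1) ^ 2 + 1) + (Pf.eval m + ((m + 1) ^ 2 +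
      (Po.eval m + (Po.eval m + 1) ^ 2 + 1) + m + 1 + Pg.eval (2 * m + Po.eval m + 1) + 1)) + m + 1 := by
    intro m; simp [R, eval_comp]
  refine ⟨.ite (.comp (.op .isPair) co) (cg.comp (.pair .id (.comp (.op .snd) co))) cf, R,
    fun x => ?_⟩
  have hs := e1 x
  have hs2 : (sz (o x) + 1) ^ 2 ≤ (Po.eval (sz x) + 1) ^ 2 := Nat.pow_le_pow_left (by omega) 2
  have h1 : (Code.comp (.op .isPair) co).Computes (enc x) (Op.isPair.apply (enc (o x)))
      (Po.eval (sz x) + (Po.eval (sz x) + 1) ^ 2 + 1) :=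
    ((ho x).comp (Code.computes_op .isPair _)).mono (by simp only [sz] at *; omega)
  have h2 : (Code.comp (.op .snd) co).Computes (enc x) (Op.snd.apply (enc (o x)))
      (Po.eval (sz x) + (Po.eval (sz x) + 1) ^ 2 + 1) :=
    ((ho x).comp (Code.computes_op .snd _)).mono (by simp only [sz] at *; omega)
  have hRx := hR (sz x)
  set B := 2 * sz x + Po.eval (sz x) + 1 with hB
  refine ⟨?_, ?_⟩
  · have m : Monotone fun r => Pf.eval (sz x + r) + ((sz x + 1) ^ 2 +
        (Po.eval (sz x) + (Po.eval (sz x) + 1) ^ 2 + 1) + sz x + 1 + Pg.eval (B + r) + 1) :=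
      fun a b hab => Nat.add_le_add (mono_eval _ _ hab)
        (Nat.add_le_add_right (Nat.add_le_add_left (mono_eval Pg _ hab) _) 1)
    refine (Code.Good.ite (T := fun r => Pf.eval (sz x + r) + ((sz x + 1) ^ 2 +
        (Po.eval (sz x) + (Po.eval (sz x) + 1) ^ 2 + 1) + sz x + 1 + Pg.eval (B + r) + 1))
      (q := w * R.eval (sz x)) (l := R.eval (sz x))
      (J := fun y => ∃ b : γ, y = enc b ∧ sz b ≤ R.eval (sz x)) h1 ?_ ?_ m).imp le_rfl le_rfl
      (fun r => ?_) (mono_eval _ _) fun _ h => h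
    · intro hne
      rcases hx : o x with _ | b
      · rw [hx] at hne; exact absurd rfl hne
      · rw [hx] at h2 hs
        have hb : sz (x, b) ≤ B := by rw [sz_pair]; rw [sz_some] at hs; omega
        have h3 := ((Code.computes_id (enc x)).pair h2).good 0 (R.eval (sz x))
        have hP := poly_mono Pg hb
        refine (h3.comp (q' := w * Pg.eval B) (T' := fun r => Pg.eval (B + r))
          (J' := fun y => ∃ b : γ, y = enc b ∧ sz b ≤ R.eval (sz x)) ?_ (mono_eval _ _)).imp ?_ le_rfl
            (fun r => ?_) m fun _ h => h
        · rintro _ rfl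
          refine (hg (x, b)).1.imp (Nat.mul_le_mul_left _ hP) (by omega)
            (fun r => poly_mono Pg (by omega)) (mono_eval _ _) ?_
          rintro y ⟨c, rfl, hc⟩
          exact ⟨c, rfl, by omega⟩
        · rw [zero_add]; exact Nat.mul_le_mul_left _ (by omega)
        · simp only [sz] at *; omega
    · intro h0
      rcases hx : o x with _ | b
      · refine (hf x).1.imp (Nat.mul_le_mul_left _ (by omega)) (by omega)
            (fun r => by omega) m ?_
        rintro y ⟨c, rfl, hc⟩
        exact ⟨c, rfl, by omega⟩
      · rw [hx] at h0; simp [enc, Op.apply, Val.isPair, Val.ofBool, Val.ofOption] at h0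
    · rw [hR]
      have i0 : sz x ≤ sz x + r := by omega
      have i1 := poly_mono Po i0
      have i2 := Nat.pow_le_pow_left (show Po.eval (sz x) + 1 ≤ Po.eval (sz x + r) + 1 by omega) 2
      have i3 := Nat.pow_le_pow_left (show sz x + 1 ≤ sz x + r + 1 by omega) 2
      have i4 := poly_mono Pg (show B + r ≤ 2 * (sz x + r) + Po.eval (sz x + r) + 1 by omega)
      simp only [sz] at *; omega
  · rw [Code.sem_ite]
    refine h1.equiv.bind_left.trans ?_
    rw [Comp.ret_bind']
    rcases hx : o x with _ | b
    · rw [if_pos (by rfl)]; simpa [hx] using (hf x).2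
    · rw [if_neg (by simp [enc, Op.apply, Val.isPair, Val.ofBool, Val.ofOption])]
      rw [Code.sem_comp]
      rw [hx] at h2
      refine ((Code.computes_id (enc x)).pair h2).equiv.bind_left.trans ?_
      rw [Comp.ret_bind']
      have e : (o x).elim (F x) (G x) = G x b := by rw [hx]; rfl
      show Comp.Equiv _ (enc <$> (o x).elim (F x) (G x))
      rw [e]
      exact (hg (x, b)).2

theorem mapC {f : α → β → Comp γ} {l : α → List β} (hf : PP w fun p : α × β => f p.1 p.2)
    (hl : Det l := by fun_prop) : PP w fun x => Comp.mapC (f x) (l x) := by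
  obtain ⟨c, Pc, hc⟩ := hf
  obtain ⟨Pl, hPl⟩ := hl.sz_le
  obtain ⟨ci, Pi, hi⟩ : Det fun s : α × List β × List γ => (enc s.2.1).isPair := by fun_prop
  obtain ⟨cp, Pp, hp⟩ : Det fun s : α × (β × List β) × List γ => (s.1, s.2.1.1) := by fun_prop
  obtain ⟨cq, Pq, hq⟩ : Det fun p : (α × (β × List β) × List γ) × γ =>
    (p.1.1, p.1.2.1.2, p.2 :: p.1.2.2) := by fun_prop
  obtain ⟨c0, P0, h0⟩ : Det fun x : α => (sz (l x), (x, l x, ([] : List γ))) := by fun_prop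
  obtain ⟨c2, P2, h2⟩ : Det fun s : α × List β × List γ => s.2.2.reverse := by fun_prop
  let body : Code := .ite ci (cq.comp (.pair .id (c.comp cp))) .id
  let E : ℕ[X] := X + Pl + 1
  let B : ℕ[X] := Pc.comp E
  let M : ℕ[X] := X + Pl + (Pl * (B + 1) + 1) + 2
  let T : ℕ[X] := Pi.comp M + ((X + 1) ^ 2 + ((M + 1) ^ 2 + (Pp.comp M + Pc.comp (E + X) + 1) + M + 1 +
    Pq.comp (M + B + 1) + 1 + (M + 1) ^ 2)) + M + 1
  let R : ℕ[X] := P0 + (Pl * (T + 1) + 1 + (P0 + 1) ^ 2) + 1 + P2.comp M + 1 + Pl * B + B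
  have eE : ∀ m, E.eval m = m + Pl.eval m + 1 := fun m => by simp [E]
  have eB : ∀ m, B.eval m = Pc.eval (E.eval m) := fun m => by simp [B, eval_comp]
  have eM : ∀ m, M.eval m = m + Pl.eval m + (Pl.eval m * (B.eval m + 1) + 1) + 2 :=
    fun m => by simp [M]
  have eT : ∀ m, T.eval m = Pi.eval (M.eval m) + ((m + 1) ^ 2 + ((M.eval m + 1) ^ 2 + (Pp.eval (M.eval m) +
    Pc.eval (E.eval m + m) + 1) + M.eval m + 1 + Pq.eval (M.eval m + B.eval m + 1) + 1 +
    (M.eval m + 1) ^ 2)) + M.eval m + 1 := fun m => by simp [T, eval_comp]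
  have eR : ∀ m, R.eval m = P0.eval m + (Pl.eval m * (T.eval m + 1) + 1 + (P0.eval m + 1) ^ 2) + 1 +
    P2.eval (M.eval m) + 1 + Pl.eval m * B.eval m + B.eval m := fun m => by simp [R, eval_comp]
  refine ⟨c2.comp ((Code.loop body).comp c0), R, fun x => ?_⟩
  -- the bounds at `x`
  have hE := eE (sz x); have hB := eB (sz x); have hM := eM (sz x); have hRx := eR (sz x)
  set e := E.eval (sz x)
  set b := B.eval (sz x)
  set m := M.eval (sz x)
  have hlen := hPl x
  have hmem : ∀ a ∈ l x, sz (x, a) ≤ e := fun a ha => by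
    have := sz_le_of_mem ha
    rw [sz_pair]; omega
  let J : Val → Prop := fun v => ∃ (r : List β) (acc : List γ), v = enc (x, r, acc) ∧ r <:+ l x ∧
    sz acc ≤ ((l x).length - r.length) * (b + 1) + 1
  have hJ : ∀ (r : List β) (acc : List γ), r <:+ l x → sz acc ≤ ((l x).length - r.length) * (b + 1) + 1 →
      sz (x, r, acc) ≤ m := by
    intro r acc h1 h2
    have h3 := Det.sz_suffix_le h1
    have h4 := length_lt_sz (l x)
    have h5 := Nat.mul_le_mul_right (b + 1)
      (show (l x).length - r.length ≤ Pl.eval (sz x) by omega)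
    rw [sz_pair, sz_pair]; omega
  let Tb : ℕ → ℕ := fun r => Pi.eval m + ((m + 1) ^ 2 + (m + 1) ^ 2 + (Pp.eval m + Pc.eval (e + r) + 1) + m + 1 +
    Pq.eval (m + b + 1) + 1) + m + 1
  have mTb : Monotone Tb := fun u v huv => by
    have := mono_eval Pc e huv
    simp only [Tb] at *; omega
  have hbody : ∀ y, J y → body.Good y (w * b) b Tb J := by
    rintro _ ⟨r, acc, rfl, hr, hacc⟩
    have hsz := hJ r acc hr hacc
    have hsq := Nat.pow_le_pow_left (show sz (x, r, acc) + 1 ≤ m + 1 by omega) 2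
    have m1 : Monotone fun r => (m + 1) ^ 2 + (m + 1) ^ 2 + (Pp.eval m + Pc.eval (e + r) + 1) + m + 1 +
        Pq.eval (m + b + 1) + 1 := fun u v huv => by
      have := mono_eval Pc e huv
      simp only at *; omega
    refine (Code.Good.ite (T := fun r => (m + 1) ^ 2 + (m + 1) ^ 2 + (Pp.eval m + Pc.eval (e + r) + 1) + m + 1 +
        Pq.eval (m + b + 1) + 1) (J := J) ((hi (x, r, acc)).mono (poly_mono Pi hsz)) ?_ ?_ m1).imp
        le_rfl le_rfl (fun u => ?_) mTb fun _ h => h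
    · intro hne
      cases r with
      | nil => exact absurd rfl hne
      | cons a r =>
        have ha : a ∈ l x := hr.subset (by simp)
        have hPc := poly_mono Pc (hmem a ha)
        have g1 : (c.comp cp).Good (enc (x, a :: r, acc)) (0 + w * b) b
            (fun r => Pp.eval m + Pc.eval (e + r) + 1) (fun y => ∃ d : γ, y = enc d ∧ sz d ≤ b) := by
          refine Code.Good.comp (T := fun _ => Pp.eval m) (T' := fun r => Pc.eval (e + r))
            (((hp (x, (a, r), acc)).mono (poly_mono Pp hsz)).good 0 b) ?_ (mono_eval _ _)
          rintro _ rfl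
          refine (hc (x, a)).1.imp (Nat.mul_le_mul_left _ (by omega)) (by omega)
            (fun u => poly_mono Pc (by have := hmem a ha; omega)) (mono_eval _ _) ?_
          rintro _ ⟨d, rfl, hd⟩
          exact ⟨d, rfl, by omega⟩
        have g2 := (((Code.computes_id (enc (x, a :: r, acc))).good 0 b).pair g1).comp (c' := cq)
          (q' := 0) (T' := fun _ => Pq.eval (m + b + 1)) (J' := J) ?_ monotone_const
        · refine g2.imp (by omega) le_rfl (fun u => ?_) m1 fun _ h => h
          simp only [sz] at *; omega
        · rintro _ ⟨_, _, rfl, rfl, d, rfl, hd⟩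
          have h5 := (hq ((x, (a, r), acc), d)).good 0 b
          have h6 : sz ((x, (a, r), acc), d) ≤ m + b + 1 := by
            rw [sz_pair]
            have : sz (x, (a, r), acc) = sz (x, a :: r, acc) := rfl
            omega
          refine h5.imp le_rfl le_rfl (fun u => poly_mono Pq h6) monotone_const ?_
          rintro _ rfl
          refine ⟨r, d :: acc, rfl, (List.suffix_cons a r).trans hr, ?_⟩
          have h7 := hr.length_le
          rw [List.length_cons] at h7 hacc
          rw [sz_cons, show (l x).length - r.length = ((l x).length - (r.length + 1)) + 1 by omega,
            Nat.succ_mul]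
          omega
    · intro _
      refine ((Code.computes_id (enc (x, r, acc))).good _ _).imp le_rfl le_rfl (fun u => ?_) m1 ?_
      · simp only [sz] at *; omega
      · rintro _ rfl; exact ⟨r, acc, rfl, hr, hacc⟩
    · simp only [Tb, sz] at *; omega
  have hJ0 : J (enc (x, l x, ([] : List γ))) := ⟨l x, [], rfl, List.suffix_refl _, by simp [sz_nil]⟩
  refine ⟨?_, ?_⟩
  · have hloop := Code.Good.loop (N := sz (l x)) hbody mTb hJ0
    have hz : sz (sz (l x), (x, l x, ([] : List γ))) ≤ P0.eval (sz x) := (h0 x).size_le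
    have hz' := Nat.pow_le_pow_left (show sz (sz (l x), (x, l x, ([] : List γ))) + 1 ≤ P0.eval (sz x) + 1
      by omega) 2
    have m2 : Monotone fun r => sz (l x) * (Tb r + 1) + 1 + (sz (sz (l x), (x, l x, ([] : List γ))) + 1) ^ 2 :=
      hloop.mono
    have g1 := Code.Good.comp ((h0 x).good 0 b) (c' := Code.loop body) (q' := sz (l x) * (w * b))
      (T' := fun r => sz (l x) * (Tb r + 1) + 1 + (sz (sz (l x), (x, l x, ([] : List γ))) + 1) ^ 2)
      (J' := J) (by rintro _ rfl; exact hloop) m2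
    have g2 := g1.comp (c' := c2) (q' := 0) (T' := fun _ => P2.eval m)
      (J' := fun y => ∃ d : List γ, y = enc d ∧ sz d ≤ R.eval (sz x)) ?_ monotone_const
    · refine g2.imp ?_ (by omega) (fun r => ?_) (mono_eval _ _) fun _ h => h
      · have h1 := Nat.mul_le_mul_right (w * b) hlen
        have h2 := Nat.mul_le_mul_left w (show Pl.eval (sz x) * b ≤ R.eval (sz x) by omega)
        have h3 : w * (Pl.eval (sz x) * b) = Pl.eval (sz x) * (w * b) := by ring
        omega
      · rw [eR]
        have i0 : sz x ≤ sz x + r := by omega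
        have i1 := poly_mono P0 i0
        have i2 := Nat.pow_le_pow_left (show P0.eval (sz x) + 1 ≤ P0.eval (sz x + r) + 1 by omega) 2
        have i3 : m ≤ M.eval (sz x + r) := poly_mono M i0
        have i4 := poly_mono P2 i3
        have i5 : Tb r ≤ T.eval (sz x + r) := by
          rw [eT]
          have j1 := poly_mono Pi i3
          have j2 := Nat.pow_le_pow_left (show m + 1 ≤ M.eval (sz x + r) + 1 by omega) 2
          have j3 := poly_mono Pp i3
          have j4 : e ≤ E.eval (sz x + r) := poly_mono E i0
          have j5 := poly_mono Pc (show e + r ≤ E.eval (sz x + r) + (sz x + r) by omega)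
          have j6 : b ≤ B.eval (sz x + r) := poly_mono B i0
          have j7 := poly_mono Pq (show m + b + 1 ≤ M.eval (sz x + r) + B.eval (sz x + r) + 1 by omega)
          simp only [Tb]; omega
        have i6 := poly_mono Pl i0
        have i7 := Nat.mul_le_mul (hlen.trans i6) (Nat.add_le_add_right i5 1)
        omega
    · rintro _ ⟨r, acc, rfl, hr, hacc⟩
      have hsz := hJ r acc hr hacc
      have h5 := poly_mono P2 hsz
      refine ((h2 (x, r, acc)).good 0 b).imp le_rfl le_rfl (fun u => h5) monotone_const ?_
      rintro _ rfl
      exact ⟨_, rfl, (h2 (x, r, acc)).size_le.trans (by omega)⟩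
  · -- behaviour of the loop
    have hstep : ∀ (r : List β) (acc : List γ), Comp.Equiv (body.sem (enc (x, r, acc)))
        (match r with
          | [] => .ret (enc (x, r, acc))
          | a :: r' => (f x a).bind fun d => .ret (enc (x, r', d :: acc))) := by
      intro r acc
      simp only [body]
      rw [Code.sem_ite]
      refine (hi (x, r, acc)).equiv.bind_left.trans ?_
      rw [Comp.ret_bind']
      cases r with
      | nil => rw [if_pos (by rfl)]; exact Comp.Equiv.refl _
      | cons a r =>
        rw [if_neg (by simp [enc, Val.ofBool, Val.isPair, Val.ofList])]
        rw [Code.sem_comp, Code.sem_pair, Code.sem_id, Comp.ret_bind', Code.sem_comp, Comp.bind_assoc']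
        refine (hp (x, (a, r), acc)).equiv.bind_left.bind_left.trans ?_
        rw [Comp.ret_bind']
        refine (hc (x, a)).2.bind_left.trans ?_
        rw [Comp.map_def, Comp.bind_assoc']
        exact (Comp.Equiv.refl _).bind fun d => (hq ((x, (a, r), acc), d)).equiv
    have hiter : ∀ (N : ℕ) (r : List β) (acc : List γ), r.length ≤ N →
        Comp.Equiv (Code.iterSem body.sem N (enc (x, r, acc)))
          ((Comp.mapC (f x) r).bind fun ds => .ret (enc (x, ([] : List β), ds.reverse ++ acc))) := by
      intro N
      induction N with
      | zero =>
        intro r acc hr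
        rw [List.length_eq_zero_iff.1 (Nat.le_zero.1 hr)]
        exact Comp.Equiv.refl _
      | succ N ih =>
        intro r acc hr
        refine (hstep r acc).bind_left.trans ?_
        cases r with
        | nil => exact ih [] acc (by simp)
        | cons a r =>
          simp only [Comp.mapC, Comp.bind_assoc', Comp.ret_bind']
          refine (Comp.Equiv.refl _).bind fun d => (ih r (d :: acc) (by simpa using hr)).trans ?_
          refine (Comp.Equiv.refl _).bind fun ds => ?_
          simp only [List.reverse_cons, List.append_assoc, List.singleton_append]
          exact Comp.Equiv.refl _
    rw [Code.sem_comp, Code.sem_comp]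
    refine (h0 x).equiv.bind_left.bind_left.trans ?_
    rw [Comp.ret_bind', Code.sem_loop]
    refine (hiter (sz (l x)) (l x) [] (length_lt_sz _).le).bind_left.trans ?_
    rw [Comp.bind_assoc', Comp.map_def]
    refine (Comp.Equiv.refl _).bind fun ds => ?_
    rw [Comp.ret_bind']
    refine (h2 (x, ([] : List β), ds.reverse ++ [])).equiv.trans ?_
    simp only [List.append_nil, List.reverse_reverse]
    exact Comp.Equiv.refl _

end PP

end

section

variable {α β γ δ : Type} [Enc α] [Enc β] [Enc γ] [Enc δ] {w : ℕ}

/-! ### Passing between programs and polynomial-time functions -/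

theorem Code.Plain.pureAll {c : Code} (h : c.Plain) (x : Val) : (c.run x).PureAll fun _ => True := by
  induction c generalizing x with
  | id => trivial
  | const v | op o => trivial
  | pair f g hf hg => exact (hf h.1 x).bind fun _ _ => (hg h.2 x).bind fun _ _ => trivial
  | comp g f hg hf => exact (hf h.2 x).bind fun _ _ => (hg h.1 _).bind fun _ _ => trivial
  | ite c f g hc hf hg =>
    refine (hc h.1 x).bind fun _ _ => Comp.PureAll.bind (p := fun _ => True) ?_ fun _ _ => trivial
    split_ifs
    exacts [hg h.2.2 x, hf h.2.1 x]
  | loop c hc =>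
    refine Comp.PureAll.bind (p := fun _ => True) ?_ fun _ _ => trivial
    have : ∀ m y, (iterate c.run m y).PureAll fun _ => True := by
      intro m
      induction m with
      | zero => exact fun _ => trivial
      | succ m ih => exact fun y => (hc h y).bind fun _ _ => (ih _).bind fun _ _ => trivial
    exact this _ _
  | rand => exact fun _ => trivial
  | device | query => exact h.elim

namespace Comp

variable {α β σ : Type}

theorem PureAll.is {D : Device} {O : σ → Val → PMF (Val × σ)} {p : α → Prop} {c : Comp α}
    (h : c.PureAll p) : Is D O c ((c.exec Device.trivial noOracle () ()).map Prod.fst) := by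
  intro d s
  induction c with
  | ret a =>
    show PMF.pure (a, d, s) = PMF.map _ (PMF.map Prod.fst (PMF.pure (a, ((), ()))))
    rw [PMF.pure_map, PMF.pure_map]
  | rand n f ih =>
    simp only [Comp.exec, PMF.map_bind]
    congr 1; funext i
    rw [ih i (h i), PMF.map_comp]
  | device v f ih | query v f ih => exact h.elim

theorem PureAll.of_exec {p : α → Prop} {r : α → Prop} {c : Comp α} (h : c.PureAll p)
    (h' : ∀ u ∈ (c.exec Device.trivial noOracle () ()).support, r u.1) : c.PureAll r := by
  induction c with
  | ret a => exact h' (a, (), ()) (by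
    show _ ∈ (PMF.pure (a, ((), ()))).support
    rw [PMF.support_pure]; rfl)
  | rand n f ih =>
    intro i
    refine ih i (h i) fun u hu => h' u ?_
    simp only [Comp.exec, PMF.mem_support_bind_iff]
    exact ⟨i, by simp, hu⟩
  | device v f ih | query v f ih => exact h.elim

theorem Bounded.all_steps {c : Comp (Val × ℕ)} {l : ℕ} {T : ℕ → ℕ} (h : c.Bounded 0 l T) :
    c.All fun r => r.2 ≤ T 0 := by
  induction c with
  | ret a => exact h
  | rand n f ih | device v f ih => exact fun i => ih i (h i)
  | query v f ih => exact absurd h.1 (lt_irrefl _)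

end Comp

/-- Call a program on a security parameter and an input. -/
def Code.call (c : Code) (p : Sec × Val) : Comp Val := c.sem (.pair (.num p.1.k) p.2)

theorem Code.pp_call {c : Code} {P : ℕ[X]}
    (h : ∀ k x, (c.run (.pair (.num k) x)).Bounded 0 0 fun _ => P.eval (k + x.size)) :
    PP 0 c.call := by
  obtain ⟨c', P', h'⟩ : Det fun p : Sec × Val => Val.pair (.num p.1.k) p.2 := by fun_prop
  refine ⟨c.comp c', P' + P + 1, fun p => ⟨?_, ?_⟩⟩
  · have hs : p.1.k + p.2.size ≤ sz p := by
      have : sz p = sz p.1 + sz p.2 + 1 := rfl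
      have := sz_sec p.1
      have : sz p.2 = p.2.size := rfl
      omega
    have hP := poly_mono P hs
    have g : c.Good (.pair (.num p.1.k) p.2) 0 0 (fun _ => P.eval (sz p))
        fun y => y.size ≤ P.eval (sz p) := by
      refine ⟨(h _ _).mono le_rfl le_rfl fun _ => hP, ?_, monotone_const⟩
      refine ((h p.1.k p.2).all_steps.and (c.run_size _)).imp fun r hr => ?_
      exact hr.2.trans (hr.1.trans hP)
    have g1 := ((h' p).good 0 0).comp (c' := c) (q' := 0) (T' := fun _ => P.eval (sz p))
      (J' := fun y => y.size ≤ P.eval (sz p)) (by rintro _ rfl; exact g) monotone_const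
    refine g1.imp (by omega) (by omega) (fun r => ?_) (PP.mono_eval _ _) fun y hy => ⟨y, rfl, ?_⟩
    · have h1 := poly_mono P' (show sz p ≤ sz p + r by omega)
      have h2 := poly_mono P (show sz p ≤ sz p + r by omega)
      simp only [eval_add, eval_one]; omega
    · rw [sz_val]; simp only [eval_add, eval_one]; omega
  · rw [Code.sem_comp]
    refine (h' p).equiv.bind_left.trans ?_
    show Comp.Equiv _ ((c.call p).bind Comp.ret)
    rw [Comp.bind_ret]
    exact Comp.Equiv.refl _

theorem Code.PPT.pp {c : Code} (h : c.PPT) : PP 0 c.call := by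
  obtain ⟨P, h⟩ := h
  exact Code.pp_call h

theorem Code.exec_call (c : Code) (D : Device) {σ : Type} (O : σ → Val → PMF (Val × σ)) (k : ℕ)
    (x : Val) (d : D.State) (s : σ) :
    c.execO D O k x d s = ((c.call (⟨k⟩, x)).exec D O d s).map fun u => (u.1, u.2.1) := by
  rw [Code.execO, Code.call, Code.sem, Comp.exec_map, PMF.map_comp]; rfl

theorem Code.exec_trivial (c : Code) (k : ℕ) (x : Val) :
    (c.exec Device.trivial k x ()).map Prod.fst =
      (((c.run (.pair (.num k) x)).exec Device.trivial noOracle () ()).map Prod.fst).map Prod.fst := by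
  unfold Code.exec Code.execO
  rw [PMF.map_comp, PMF.map_comp]; rfl

/-- Randomized polynomial-time algorithms are polynomial-time computations that leave device and
oracle alone. -/
theorem IsPPT.pp {f : ℕ → Val → PMF Val} (h : IsPPT f) :
    ∃ F : Sec × Val → Comp Val, PP 0 F ∧ ∀ p (D : Device) (σ : Type) (O : σ → Val → PMF (Val × σ)),
      Comp.Is D O (F p) (f p.1.k p.2) := by
  obtain ⟨c, P, hc, h⟩ := h
  refine ⟨c.call, Code.pp_call fun k x => (h k x).1, fun p D σ O d s => ?_⟩
  rw [Code.call, Code.sem, Comp.exec_map, (hc.pureAll _).is, PMF.map_comp, ← (h p.1.k p.2).2,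
    Code.exec_trivial, PMF.map_comp, PMF.map_comp, PMF.map_comp]
  rfl

theorem IsPoly.det {f : ℕ → Val → Val} (h : IsPoly f) : Det fun p : Sec × Val => f p.1.k p.2 := by
  obtain ⟨c, P, hc, h⟩ := h
  obtain ⟨c', P', h'⟩ : Det fun p : Sec × Val => Val.pair (.num p.1.k) p.2 := by fun_prop
  refine ⟨c.comp c', P' + P + 1, fun p => ?_⟩
  have hs : p.1.k + p.2.size ≤ sz p := by
    have : sz p = sz p.1 + sz p.2 + 1 := rfl
    have := sz_sec p.1
    have : sz p.2 = p.2.size := rfl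
    omega
  have g : c.Computes (.pair (.num p.1.k) p.2) (f p.1.k p.2) (P.eval (sz p)) := by
    have h1 : (c.run (.pair (.num p.1.k) p.2)).PureAll fun r => r.1 = f p.1.k p.2 := by
      refine (hc.pureAll _).of_exec fun u hu => ?_
      have h2 := (h p.1.k p.2).2
      have h3 : u.1.1 ∈ ((c.exec Device.trivial p.1.k p.2 ()).map Prod.fst).support := by
        rw [Code.exec_trivial, PMF.map_comp, PMF.mem_support_map_iff]
        exact ⟨u, hu, rfl⟩
      rw [h2] at h3
      simpa [pure] using h3
    refine (h1.and (h p.1.k p.2).1.all_steps).imp fun r hr => ⟨hr.1, hr.2.trans (poly_mono P hs)⟩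
  exact ((h' p).comp g).mono (by simp)

/-- The security parameter of a program is expanded to its unary representation. -/
theorem exists_expand : ∃ (c : Code) (P : ℕ[X]), ∀ (k : ℕ) (x : Val),
    c.Computes (.pair (.num k) x) (enc ((⟨k⟩ : Sec), x)) (P.eval (k + x.size)) := by
  obtain ⟨c, P, h⟩ : Det fun n : ℕ => n + n := by fun_prop
  let T : ℕ[X] := X * (P.comp (X + 2) + 1) + 1 + (X + 6) ^ 2
  have eT : ∀ m, T.eval m = m * (P.eval (m + 2) + 1) + 1 + (m + 6) ^ 2 := fun m => by simp [T, eval_comp]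
  have e2 : ∀ i, (fun n => n + n)^[i] 1 = 2 ^ i := fun i => by
    induction i with
    | zero => rfl
    | succ i ih => rw [Function.iterate_succ_apply', ih, pow_succ]; ring
  refine ⟨.pair (.comp (.loop c) (.pair (.op .fst) (.const (.num 1)))) (.op .snd),
    ((X + 3) ^ 2 + (2 + 1) + (X + 2) + 1) + T + 1 + (X + 3) ^ 2 + X + 2 + 1, fun k x => ?_⟩
  have hk : (Val.num k).size ≤ k + 1 := Val.size_num_le k
  have hs : (Val.pair (.num k) x).size ≤ k + x.size + 2 := by rw [Val.size_pair]; omega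
  have hsq := Nat.pow_le_pow_left (show (Val.pair (.num k) x).size + 1 ≤ k + x.size + 3 by omega) 2
  have h1 := iterate_computes (c := c) (f := fun n => n + n) (N := k) (s := 1) (T := P.eval (k + 2))
    fun i hi => by
      rw [Function.iterate_succ_apply']
      refine (h _).mono (poly_mono P ?_)
      rw [e2, sz_nat, Nat.size_pow]; omega
  have h2 : (Code.loop c).Computes (.pair (.num k) (.num 1)) (.num (2 ^ k)) (T.eval (k + x.size)) := by
    refine Comp.PureAll.bind h1 fun u hu => ⟨by rw [hu.1, e2]; rfl, ?_⟩
    have h3 : (Val.pair (.num k) (.num 1)).size ≤ k + 5 := by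
      have : (Val.num 1).size = 2 := by simp [Val.size_num]
      rw [Val.size_pair]; omega
    have h4 := Nat.pow_le_pow_left (show (Val.pair (.num k) (.num 1)).size + 1 ≤ k + x.size + 6 by omega) 2
    have h5 := poly_mono P (show k + 2 ≤ k + x.size + 2 by omega)
    have h6 := Nat.mul_le_mul (show k ≤ k + x.size by omega) (Nat.add_le_add_right h5 1)
    have := hu.2
    rw [eT]
    simp only; omega
  refine (((((Code.computes_op .fst _).pair (Code.computes_const (.num 1) _)).comp h2).pair
    (Code.computes_op .snd _))).mono ?_
  have : (Val.num 1).size = 2 := by simp [Val.size_num]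
  simp only [eval_add, eval_pow, eval_X, eval_one, eval_ofNat]; omega

theorem PP.exists_code {F : Sec × Val → Comp β} (hF : PP w F) : ∃ (c : Code) (P : ℕ[X]),
    (∀ k x, (c.run (.pair (.num k) x)).Bounded (w * P.eval (k + x.size)) (P.eval (k + x.size))
      fun r => P.eval (k + x.size + r)) ∧
    ∀ k x, Comp.Equiv (c.call (⟨k⟩, x)) (enc <$> F (⟨k⟩, x)) := by
  obtain ⟨c', P', h'⟩ := exists_expand
  obtain ⟨c, P, h⟩ := hF
  let R : ℕ[X] := P' + P.comp (X + 3) + 1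
  have eR : ∀ m, R.eval m = P'.eval m + P.eval (m + 3) + 1 := fun m => by simp [R, eval_comp]
  refine ⟨c.comp c', R, fun k x => ?_, fun k x => ?_⟩
  · have hs : sz ((⟨k⟩ : Sec), x) = k + x.size + 3 := by
      rw [sz_pair, sz_sec, sz_val]; simp only; omega
    refine (((h' k x).good 0 (P.eval (k + x.size + 3))).comp (q' := w * P.eval (k + x.size + 3))
      (T' := fun r => P.eval (k + x.size + 3 + r)) (J' := fun _ => True) ?_ (mono_eval _ _)).bounded.mono
      ?_ ?_ fun r => ?_
    · rintro _ rfl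
      have := (h (⟨k⟩, x)).1
      rw [hs] at this
      exact this.imp le_rfl le_rfl (fun _ => le_rfl) (mono_eval _ _) fun _ _ => trivial
    · rw [zero_add, eR]; exact Nat.mul_le_mul_left _ (by omega)
    · rw [eR]; omega
    · rw [eR]
      have h1 := poly_mono P' (show k + x.size ≤ k + x.size + r by omega)
      have h2 := poly_mono P (show k + x.size + 3 + r ≤ k + x.size + r + 3 by omega)
      omega
  · rw [Code.call, Code.sem_comp]
    exact (h' k x).equiv.bind_left.trans (h (⟨k⟩, x)).2

/-- A polynomial-time function without queries is the behaviour of an adversary. -/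
theorem PP.exists_ppt {F : Sec × Val → Comp β} (hF : PP 0 F) : ∃ c : Code, c.PPT ∧
    ∀ (D : Device) (k : ℕ) (x : Val) (d : D.State),
      c.exec D k x d = ((F (⟨k⟩, x)).exec D noOracle d ()).map fun u => (enc u.1, u.2.1) := by
  obtain ⟨c, P, h, h'⟩ := hF.exists_code
  refine ⟨c, ⟨P, fun k x => ?_⟩, fun D k x d => ?_⟩
  · have := h k x
    rw [zero_mul] at this
    exact this.zero le_rfl
  · rw [Code.exec, Code.exec_call, h' k x, Comp.exec_map, PMF.map_comp]; rfl

theorem PP.exists_pptOracle {F : Sec × Val → Comp β} (hF : PP 1 F) : ∃ c : Code, c.PPTOracle ∧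
    ∀ (D : Device) (σ : Type) (O : σ → Val → PMF (Val × σ)) (k : ℕ) (x : Val) (d : D.State) (s : σ),
      c.execO D O k x d s = ((F (⟨k⟩, x)).exec D O d s).map fun u => (enc u.1, u.2.1) := by
  obtain ⟨c, P, h, h'⟩ := hF.exists_code
  refine ⟨c, ⟨P, P, fun k x => ?_⟩, fun D σ O k x d s => ?_⟩
  · have := h k x
    rwa [one_mul] at this
  · rw [Code.exec_call, h' k x, Comp.exec_map, PMF.map_comp]; rfl

/-! ### Queries with bounded answers -/

/-- A value, replaced by a trivial one if it is too long. -/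
def clip (n : ℕ) (v : Val) : Val := if v.size ≤ n then v else .num 0

theorem clip_of_le {n : ℕ} {v : Val} (h : v.size ≤ n) : clip n v = v := if_pos h

theorem size_clip_le (n : ℕ) (v : Val) : (clip n v).size ≤ n + 1 := by
  unfold clip
  split_ifs
  · omega
  · simp [Val.size]

/-- A query to the outer oracle. An answer of unexpected length is ignored, so that the time for
what follows does not depend on the answers. -/
theorem PP.query {q : α → Val} (B : ℕ[X]) (hq : Det q := by fun_prop) :
    PP 1 fun x => Comp.query (q x) fun a => Comp.ret (clip (B.eval (sz x)) a.snd) := by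
  obtain ⟨c, P, h⟩ := hq
  obtain ⟨c', P', h'⟩ : Det fun p : α × Val => clip (B.eval (sz p.1)) p.2.snd := by
    unfold clip
    have := Det.poly B
    fun_prop
  let R : ℕ[X] := (X + 1) ^ 2 + P + (P + 1) ^ 2 + P'.comp (X + 1) + 2 * X + 8 + B
  have eR : ∀ m, R.eval m = (m + 1) ^ 2 + P.eval m + (P.eval m + 1) ^ 2 + P'.eval (m + 1) + 2 * m + 8 +
    B.eval m := fun m => by simp [R, eval_comp]
  refine ⟨c'.comp (.pair .id (.comp .query c)), R, fun x => ⟨⟨?_, ?_, mono_eval _ _⟩, ?_⟩⟩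
  · have hx : (enc x).size = sz x := rfl
    have hqs : (q x).size ≤ P.eval (sz x) := (h x).size_le
    have hqs2 := Nat.pow_le_pow_left (show (q x).size + 1 ≤ P.eval (sz x) + 1 by omega) 2
    have m : Monotone fun r => (sz x + 1) ^ 2 + (P.eval (sz x) + 1) ^ 2 + P'.eval (sz x + 1 + r) + sz x + r + 8 :=
      fun u v huv => by have := mono_eval P' (sz x + 1) huv; simp only at *; omega
    have := Comp.Bounded.bind (c := c.run (enc x)) (l := R.eval (sz x)) (q := 0) (q' := 1) (T := fun _ => P.eval (sz x))
      (T' := fun r => (sz x + 1) ^ 2 + (P.eval (sz x) + 1) ^ 2 + P'.eval (sz x + 1 + r) + sz x + r + 8)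
      (p := fun r => r.1 = q x)
      (g := fun r => Comp.query r.1 fun a => (c'.run (.pair (enc x) a)).bind fun u =>
        .ret (u.1, ((enc x).size + 1) ^ 2 + (r.2 + ((r.1.size + 1) ^ 2 + a.size + 1) + 1) + (enc x).size + 1 + u.2 + 1))
      ((h x).good 0 _).bounded ((h x).good 0 0).all monotone_const m ?_
    · have e : (c'.comp (.pair .id (.comp .query c))).run (enc x) =
        (c.run (enc x)).bind (fun r => Comp.query r.1 fun a => (c'.run (.pair (enc x) a)).bind fun u =>
        .ret (u.1, ((enc x).size + 1) ^ 2 + (r.2 + ((r.1.size + 1) ^ 2 + a.size + 1) + 1) + (enc x).size + 1 + u.2 + 1)) := by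
        simp only [Code.run, Comp.bind_assoc', Comp.ret_bind', Comp.bind]
      rw [e]
      refine this.mono (by rw [eR]; omega) le_rfl fun r => ?_
      rw [eR]
      have i0 : sz x ≤ sz x + r := by omega
      have i1 := poly_mono P i0
      have i2 := Nat.pow_le_pow_left (show P.eval (sz x) + 1 ≤ P.eval (sz x + r) + 1 by omega) 2
      have i3 := Nat.pow_le_pow_left (show sz x + 1 ≤ sz x + r + 1 by omega) 2
      have i4 := poly_mono P' (show sz x + 1 + r ≤ sz x + r + 1 by omega)
      omega
    · rintro ⟨u, t⟩ hu
      simp only at hu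
      subst hu
      refine ⟨by omega, by rw [eR]; simp only; omega, fun a => ?_⟩
      refine (Comp.PureAll.bounded (T := t + ((sz x + 1) ^ 2 + (P.eval (sz x) + 1) ^ 2 +
        P'.eval (sz x + 1 + a.size) + sz x + a.size + 8)) ?_).mono le_rfl le_rfl fun r => ?_
      · refine Comp.PureAll.bind (h' (x, a)) fun u hu => ?_
        have h3 := hu.2
        have h4 : sz (x, a) = sz x + 1 + a.size := by rw [sz_pair, sz_val]; omega
        rw [h4] at h3
        simp only [Comp.PureAll, hx]; omega
      · have := poly_mono P' (show sz x + 1 + a.size ≤ sz x + 1 + (a.size + r) by omega)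
        simp only; omega
  · have e : (c'.comp (.pair .id (.comp .query c))).run (enc x) =
        (c.run (enc x)).bind (fun r => Comp.query r.1 fun a => (c'.run (.pair (enc x) a)).bind fun u =>
        .ret (u.1, ((enc x).size + 1) ^ 2 + (r.2 + ((r.1.size + 1) ^ 2 + a.size + 1) + 1) + (enc x).size + 1 + u.2 + 1)) := by
        simp only [Code.run, Comp.bind_assoc', Comp.ret_bind', Comp.bind]
    rw [e]
    refine (Comp.all_true _).bind fun r _ a => ((h' (x, a)).good 0 0).all.bind fun u hu => ?_
    refine ⟨_, hu, ?_⟩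
    have := size_clip_le (B.eval (sz x)) a.snd
    rw [sz_val, eR]; simp only; omega
  · rw [Code.sem_comp, Code.sem_pair, Code.sem_id, Comp.ret_bind', Code.sem_comp]
    refine (h x).equiv.bind_left.bind_left.bind_left.trans ?_
    rw [Comp.ret_bind', Comp.bind_assoc']
    have : Code.query.sem (q x) = Comp.query (q x) Comp.ret := rfl
    have e : enc <$> (Comp.query (q x) fun a => Comp.ret (clip (B.eval (sz x)) a.snd)) =
      (Comp.query (q x) Comp.ret).bind fun a => Comp.ret (clip (B.eval (sz x)) a.snd) := rfl
    rw [e]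
    exact (Comp.Equiv.refl _).bind fun a => (h' (x, a)).equiv

end

/-! ### Programs that answer the queries of other programs -/

/-- Answer the queries of a computation by `h`, which keeps a state. -/
def Comp.handle {α σ : Type} (h : σ → Val → Comp (Val × σ)) : Comp α → σ → Comp (α × σ)
  | .ret a, s => .ret (a, s)
  | .rand n f, s => .rand n fun i => (f i).handle h s
  | .device v f, s => .device v fun b => (f b).handle h s
  | .query v f, s => (h s v).bind fun u => (f u.1).handle h u.2

/-- The program `c` with its queries answered by the program `o`: it maps `(x, st)` to `(y, st')`,
where `st` and `st'` are states of `o`, which maps a query and a state to an answer and a state. -/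
def Code.simulate : Code → Code → Code
  | .id, _ => .id
  | .const v, _ => .pair (.const v) (.op .snd)
  | .op p, _ => .pair (.comp (.op p) (.op .fst)) (.op .snd)
  | .pair f g, o => .comp (.pair (.pair (.op .fst) (.comp (.op .fst) (.op .snd))) (.comp (.op .snd) (.op .snd)))
      (.comp (.pair (.comp (.op .fst) (.op .snd))
        (.comp (g.simulate o) (.pair (.op .fst) (.comp (.op .snd) (.op .snd)))))
        (.pair (.op .fst) (f.simulate o)))
  | .comp g f, o => .comp (g.simulate o) (f.simulate o)
  | .ite c f g, o => .comp (.ite (.comp (.op .fst) (.op .snd))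
      (.comp (f.simulate o) (.pair (.op .fst) (.comp (.op .snd) (.op .snd))))
      (.comp (g.simulate o) (.pair (.op .fst) (.comp (.op .snd) (.op .snd)))))
      (.pair (.op .fst) (c.simulate o))
  | .loop c, o => .comp (.loop (c.simulate o)) (.pair (.comp (.op .fst) (.op .fst))
      (.pair (.comp (.op .snd) (.op .fst)) (.op .snd)))
  | .rand, _ => .pair (.comp .rand (.op .fst)) (.op .snd)
  | .device, _ => .pair (.comp .device (.op .fst)) (.op .snd)
  | .query, o => o

theorem Val.fst_pair (a b : Val) : (Val.pair a b).fst = a := rfl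
theorem Val.snd_pair (a b : Val) : (Val.pair a b).snd = b := rfl

section

variable (o : Code) (S M Z : ℕ)

/-- The second computation arises from the first by answering its queries with `o`, starting from
the state `st`. As long as the states of `o` have length at most `S`, a run of `t ≤ M` steps becomes
a run of at most `K * t * Z + e` steps, not counting those of `o`; this last claim is made under the
hypothesis `H` only. -/
def Simulates (H : Prop) (K : ℕ) : Comp (Val × ℕ) → ℕ → Val → Comp (Val × ℕ) → Prop
  | .ret y, e, st, t₂ => ∃ t', t₂ = .ret (.pair y.1 st, t') ∧ (H → y.2 ≤ M → t' ≤ K * y.2 * Z + e)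
  | .rand n f, e, st, t₂ => ∃ g, t₂ = .rand n g ∧ ∀ i, Simulates H K (f i) e st (g i)
  | .device v f, e, st, t₂ => ∃ g, t₂ = .device v g ∧ ∀ b, Simulates H K (f b) e st (g b)
  | .query v f, e, st, t₂ => ∃ g, t₂ = (o.run (.pair v st)).bind g ∧
      ∀ a st' t, st'.size ≤ S → Simulates H K (f a) (e + t) st' (g (.pair a st', t))

variable {o S M Z}

theorem Simulates.bind {H H' : Prop} {K K' : ℕ} {t₁ t₂ : Comp (Val × ℕ)} {e e' : ℕ} {st : Val}
    {p : Val × ℕ → Prop} {F G : Val × ℕ → Comp (Val × ℕ)} (h : Simulates o S M Z H K t₁ e st t₂)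
    (hp : t₁.All p) (hst : st.size ≤ S)
    (hF : ∀ y t st' t' e₁, p (y, t) → st'.size ≤ S → (H → t ≤ M → t' ≤ K * t * Z + e₁) →
      Simulates o S M Z H' K' (F (y, t)) (e₁ + e') st' (G (.pair y st', t'))) :
    Simulates o S M Z H' K' (t₁.bind F) (e + e') st (t₂.bind G) := by
  induction t₁ generalizing e st t₂ with
  | ret y =>
    obtain ⟨t', rfl, ht⟩ := h
    exact hF _ _ _ _ _ hp hst ht
  | rand n f ih =>
    obtain ⟨g, rfl, hg⟩ := h
    exact ⟨_, rfl, fun i => ih i (hg i) (hp i) hst⟩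
  | device v f ih =>
    obtain ⟨g, rfl, hg⟩ := h
    exact ⟨_, rfl, fun b => ih b (hg b) (hp b) hst⟩
  | query v f ih =>
    obtain ⟨g, rfl, hg⟩ := h
    refine ⟨fun r => (g r).bind G, Comp.bind_assoc' _ _ _, fun a st' t hst' => ?_⟩
    have := ih a (hg a st' t hst') (hp a) hst'
    rwa [show e + e' + t = e + t + e' by omega]

theorem cost_le {K K' n a b t : ℕ} (ha : a ≤ t) (hb : b ≤ t) (ht : 1 ≤ t) :
    K * a * Z + K' * b * Z + n * Z ≤ (K + K' + n) * t * Z := by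
  have h1 : K * a ≤ K * t := Nat.mul_le_mul_left _ ha
  have h2 : K' * b ≤ K' * t := Nat.mul_le_mul_left _ hb
  have h3 : n ≤ n * t := Nat.le_mul_of_pos_right _ ht
  calc K * a * Z + K' * b * Z + n * Z = (K * a + K' * b + n) * Z := by ring
    _ ≤ ((K + K' + n) * t) * Z := Nat.mul_le_mul_right _ (by nlinarith)

theorem sq_le_cost (hZ : Z = (2 * M + S + 10) ^ 2) {a : ℕ} (h : a ≤ 2 * M + S + 10) : a ^ 2 ≤ Z :=
  hZ ▸ Nat.pow_le_pow_left h 2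

theorem le_cost (hZ : Z = (2 * M + S + 10) ^ 2) : 2 * M + S + 10 ≤ Z := hZ ▸ Nat.le_self_pow two_ne_zero _

theorem Simulates.iterate {K : ℕ} {f g : Val → Comp (Val × ℕ)} (hZ : 1 ≤ Z)
    (hf : ∀ y, (f y).All fun r => r.1.size ≤ r.2)
    (h : ∀ x st, st.size ≤ S → Simulates o S M Z (x.size ≤ M) K (f x) 0 st (g (.pair x st)))
    (m : ℕ) (x st : Val) (hst : st.size ≤ S) :
    Simulates o S M Z (x.size ≤ M) (K + 2) (iterate f m x) 0 st (iterate g m (.pair x st)) := by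
  induction m generalizing x st with
  | zero =>
    refine ⟨1, rfl, fun _ _ => ?_⟩
    simp only; nlinarith
  | succ m ih =>
    refine Simulates.bind (e := 0) (e' := 0) (h x st hst) (hf x) hst fun y t st₁ t' e₁ hy hst₁ ht => ?_
    have := Simulates.bind (H' := x.size ≤ M) (K' := K + 2) (e := 0) (e' := e₁ + 0)
      (F := fun u => .ret (u.1, t + u.2 + 1)) (G := fun u => .ret (u.1, t' + u.2 + 1))
      (ih y st₁ hst₁) (Comp.all_true _) hst₁ fun z s st₂ s' e₂ _ hst₂ hs => ⟨_, rfl, fun hx hM => ?_⟩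
    · rwa [zero_add] at this
    · simp only at hM hy ⊢
      have h1 := ht hx (by omega)
      have h2 := hs (by omega) (by omega)
      have h3 : (K + 2) * (t + s + 1) * Z = K * t * Z + (K + 2) * s * Z + (2 * t + K + 2) * Z := by ring
      have h4 : 1 * Z ≤ (2 * t + K + 2) * Z := Nat.mul_le_mul_right _ (by omega)
      omega

open Classical in
/-- Simulation costs a factor that depends on the program only, times the square of the lengths. -/
theorem Code.simulates (c : Code) : ∃ K : ℕ, ∀ (S M Z : ℕ), Z = (2 * M + S + 10) ^ 2 → ∀ x st : Val,
    st.size ≤ S → Simulates o S M Z (x.size ≤ M) K (c.run x) 0 st ((c.simulate o).run (.pair x st)) := by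
  induction c with
  | id =>
    refine ⟨1, fun S M Z hZ x st hst => ⟨_, rfl, fun hx ht => ?_⟩⟩
    have h1 : ((Val.pair x st).size + 1) ^ 2 ≤ Z :=
      sq_le_cost hZ (by rw [Val.size_pair]; omega)
    simp only at ht ⊢
    have h2 : 1 * Z ≤ (x.size + 1) ^ 2 * Z := Nat.mul_le_mul_right _ (Nat.one_le_pow _ _ (by omega))
    simp only [one_mul] at *; omega
  | const v =>
    refine ⟨4, fun S M Z hZ x st hst => ⟨_, rfl, fun hx ht => ?_⟩⟩
    have h1 : ((Val.pair x st).size + 1) ^ 2 ≤ Z :=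
      sq_le_cost hZ (by rw [Val.size_pair]; omega)
    have h0 := le_cost hZ
    have h2 : 4 * 1 * Z ≤ 4 * (v.size + 1) * Z := Nat.mul_le_mul_right _ (by omega)
    have := Val.size_pair x st
    simp only at ht ⊢; omega
  | op p =>
    refine ⟨4, fun S M Z hZ x st hst => ⟨_, rfl, fun hx ht => ?_⟩⟩
    have h1 : ((Val.pair x st).size + 1) ^ 2 ≤ Z :=
      sq_le_cost hZ (by rw [Val.size_pair]; omega)
    have h0 := le_cost hZ
    have h3 : (x.size + 1) ^ 2 ≤ Z := sq_le_cost hZ (by omega)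
    have h2 : 4 * 1 * Z ≤ 4 * (x.size + 1) ^ 2 * Z :=
      Nat.mul_le_mul_right _ (Nat.mul_le_mul_left _ (Nat.one_le_pow _ _ (by omega)))
    have := Val.size_pair x st
    simp only [Op.apply, Val.fst_pair] at ht ⊢; omega
  | pair f g hf hg =>
    obtain ⟨Kf, hf⟩ := hf
    obtain ⟨Kg, hg⟩ := hg
    refine ⟨Kf + Kg + 30, fun S M Z hZ x st hst => ?_⟩
    have e : ((Code.pair f g).simulate o).run (.pair x st) =
        ((f.simulate o).run (.pair x st)).bind fun r =>
          ((g.simulate o).run (.pair x r.1.snd)).bind fun u =>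
            ((Code.pair (.pair (.op .fst) (.comp (.op .fst) (.op .snd)))
              (.comp (.op .snd) (.op .snd))).run (.pair r.1.fst u.1)).bind fun v =>
            .ret (v.1, ((((Val.pair x st).size + 1) ^ 2 + r.2 + (Val.pair x st).size + 1) +
              ((((Val.pair x r.1).size + 1) ^ 2 + (r.1.size + 1) ^ 2 + 1) +
                ((((Val.pair x r.1).size + 1) ^ 2 + (((Val.pair x r.1).size + 1) ^ 2 + (r.1.size + 1) ^ 2 + 1) +
                  (Val.pair x r.1).size + 1) + u.2 + 1) + (Val.pair x r.1).size + 1) + 1) + v.2 + 1) := by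
      simp only [Code.simulate, Code.run, Comp.bind_assoc', Comp.ret_bind', Op.apply, Val.fst_pair, Val.snd_pair]
    rw [e]
    refine Simulates.bind (e := 0) (e' := 0) (hf S M Z hZ x st hst) (f.run_size x) hst
      fun y t st₁ t' e₁ hy hst₁ ht => ?_
    have := Simulates.bind (H' := x.size ≤ M) (K' := Kf + Kg + 30) (e := 0) (e' := e₁ + 0)
      (F := fun u => .ret (.pair y u.1, t + u.2 + x.size + 1))
      (G := fun u => ((Code.pair (.pair (.op .fst) (.comp (.op .fst) (.op .snd)))
              (.comp (.op .snd) (.op .snd))).run (.pair y u.1)).bind fun v =>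
            .ret (v.1, ((((Val.pair x st).size + 1) ^ 2 + t' + (Val.pair x st).size + 1) +
              ((((Val.pair x (.pair y st₁)).size + 1) ^ 2 + ((Val.pair y st₁).size + 1) ^ 2 + 1) +
                ((((Val.pair x (.pair y st₁)).size + 1) ^ 2 + (((Val.pair x (.pair y st₁)).size + 1) ^ 2 +
                  ((Val.pair y st₁).size + 1) ^ 2 + 1) +
                  (Val.pair x (.pair y st₁)).size + 1) + u.2 + 1) + (Val.pair x (.pair y st₁)).size + 1) + 1) + v.2 + 1))
      (hg S M Z hZ x st₁ hst₁) (g.run_size x) hst₁ fun z s st₂ s' e₂ hz hst₂ hs => ⟨_, rfl, fun hx hM => ?_⟩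
    · rwa [zero_add] at this
    · simp only at hM hy hz ⊢
      have h1 := ht hx (by omega)
      have h2 := hs hx (by omega)
      have h0 := le_cost hZ
      have i1 := Val.size_pair x st
      have i2 := Val.size_pair x (.pair y st₁)
      have i3 := Val.size_pair y st₁
      have i4 := Val.size_pair y (.pair z st₂)
      have i5 := Val.size_pair z st₂
      have j1 : ((Val.pair x st).size + 1) ^ 2 ≤ Z := sq_le_cost hZ (by omega)
      have j2 : ((Val.pair x (.pair y st₁)).size + 1) ^ 2 ≤ Z := sq_le_cost hZ (by omega)
      have j3 : ((Val.pair y st₁).size + 1) ^ 2 ≤ Z := sq_le_cost hZ (by omega)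
      have j4 : ((Val.pair y (.pair z st₂)).size + 1) ^ 2 ≤ Z := sq_le_cost hZ (by omega)
      have j5 : ((Val.pair z st₂).size + 1) ^ 2 ≤ Z := sq_le_cost hZ (by omega)
      have h3 := cost_le (Z := Z) (K := Kf) (K' := Kg) (n := 30) (a := t) (b := s)
        (t := t + s + x.size + 1) (by omega) (by omega) (by omega)
      simp only [Op.apply, Val.snd_pair]
      omega
  | comp g f hg hf =>
    obtain ⟨Kf, hf⟩ := hf
    obtain ⟨Kg, hg⟩ := hg
    refine ⟨Kf + Kg + 1, fun S M Z hZ x st hst => ?_⟩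
    refine Simulates.bind (e := 0) (e' := 0) (hf S M Z hZ x st hst) (f.run_size x) hst
      fun y t st₁ t' e₁ hy hst₁ ht => ?_
    have := Simulates.bind (H' := x.size ≤ M) (K' := Kf + Kg + 1) (e := 0) (e' := e₁ + 0)
      (F := fun u => .ret (u.1, t + u.2 + 1)) (G := fun u => .ret (u.1, t' + u.2 + 1))
      (hg S M Z hZ y st₁ hst₁) (g.run_size y) hst₁ fun z s st₂ s' e₂ hz hst₂ hs => ⟨_, rfl, fun hx hM => ?_⟩
    · rwa [zero_add] at this
    · simp only at hM hy hz ⊢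
      have h1 := ht hx (by omega)
      have h2 := hs (by omega) (by omega)
      have h0 := le_cost hZ
      have h3 := cost_le (Z := Z) (K := Kf) (K' := Kg) (n := 1) (a := t) (b := s)
        (t := t + s + 1) (by omega) (by omega) (by omega)
      omega
  | ite c f g hc hf hg =>
    obtain ⟨Kc, hc⟩ := hc
    obtain ⟨Kf, hf⟩ := hf
    obtain ⟨Kg, hg⟩ := hg
    refine ⟨Kc + (Kf + Kg) + 30, fun S M Z hZ x st hst => ?_⟩
    have e : ((Code.ite c f g).simulate o).run (.pair x st) =
        ((c.simulate o).run (.pair x st)).bind fun r =>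
          (if r.1.fst = Val.num 0 then (g.simulate o).run (.pair x r.1.snd)
            else (f.simulate o).run (.pair x r.1.snd)).bind fun u =>
            .ret (u.1, ((((Val.pair x st).size + 1) ^ 2 + r.2 + (Val.pair x st).size + 1) +
              ((((Val.pair x r.1).size + 1) ^ 2 + (r.1.size + 1) ^ 2 + 1) +
                ((((Val.pair x r.1).size + 1) ^ 2 + (((Val.pair x r.1).size + 1) ^ 2 + (r.1.size + 1) ^ 2 + 1) +
                  (Val.pair x r.1).size + 1) + u.2 + 1) + (Val.pair x r.1).size + 1) + 1)) := by
      simp only [Code.simulate, Code.run, Comp.bind_assoc', Comp.ret_bind', Op.apply, Val.fst_pair, Val.snd_pair]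
      congr 1; funext r
      rcases eq_or_ne r.1.fst (Val.num 0) with h | h
      · rw [if_pos h]
        refine (congrArg (Comp.bind · _) (if_pos h)).trans ?_
        simp only [Comp.bind_assoc', Comp.ret_bind']
      · rw [if_neg h]
        refine (congrArg (Comp.bind · _) (if_neg h)).trans ?_
        simp only [Comp.bind_assoc', Comp.ret_bind']
    rw [e]
    refine Simulates.bind (e := 0) (e' := 0) (hc S M Z hZ x st hst) (c.run_size x) hst
      fun y t st₁ t' e₁ hy hst₁ ht => ?_
    have key : ∀ (c' : Code) (K : ℕ), K ≤ Kf + Kg →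
        Simulates o S M Z (x.size ≤ M) K (c'.run x) 0 st₁ ((c'.simulate o).run (.pair x st₁)) →
        Simulates o S M Z (x.size ≤ M) (Kc + (Kf + Kg) + 30)
          ((c'.run x).bind fun u => .ret (u.1, t + u.2 + x.size + 1)) (0 + (e₁ + 0)) st₁
          (((c'.simulate o).run (.pair x st₁)).bind fun u =>
            .ret (u.1, ((((Val.pair x st).size + 1) ^ 2 + t' + (Val.pair x st).size + 1) +
              ((((Val.pair x (.pair y st₁)).size + 1) ^ 2 + ((Val.pair y st₁).size + 1) ^ 2 + 1) +
                ((((Val.pair x (.pair y st₁)).size + 1) ^ 2 + (((Val.pair x (.pair y st₁)).size + 1) ^ 2 +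
                  ((Val.pair y st₁).size + 1) ^ 2 + 1) +
                  (Val.pair x (.pair y st₁)).size + 1) + u.2 + 1) + (Val.pair x (.pair y st₁)).size + 1) + 1))) := by
      intro c' K hK h
      refine Simulates.bind h (c'.run_size x) hst₁ fun z s st₂ s' e₂ hz hst₂ hs => ⟨_, rfl, fun hx hM => ?_⟩
      simp only at hM hy hz ⊢
      have h1 := ht hx (by omega)
      have h2 := hs hx (by omega)
      have h2' : K * s * Z ≤ (Kf + Kg) * s * Z := Nat.mul_le_mul_right _ (Nat.mul_le_mul_right _ hK)
      have h0 := le_cost hZ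
      have i1 := Val.size_pair x st
      have i2 := Val.size_pair x (.pair y st₁)
      have i3 := Val.size_pair y st₁
      have j1 : ((Val.pair x st).size + 1) ^ 2 ≤ Z := sq_le_cost hZ (by omega)
      have j2 : ((Val.pair x (.pair y st₁)).size + 1) ^ 2 ≤ Z := sq_le_cost hZ (by omega)
      have j3 : ((Val.pair y st₁).size + 1) ^ 2 ≤ Z := sq_le_cost hZ (by omega)
      have h3 := cost_le (Z := Z) (K := Kc) (K' := Kf + Kg) (n := 30) (a := t) (b := s)
        (t := t + s + x.size + 1) (by omega) (by omega) (by omega)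
      omega
    by_cases h0 : y = Val.num 0
    · have := key g Kg (by omega) (hg S M Z hZ x st₁ hst₁)
      rw [zero_add] at this
      convert this using 2
      exacts [if_pos h0, if_pos h0]
    · have := key f Kf (by omega) (hf S M Z hZ x st₁ hst₁)
      rw [zero_add] at this
      convert this using 2
      exacts [if_neg h0, if_neg h0]
  | loop c hc =>
    obtain ⟨K, hc⟩ := hc
    refine ⟨K + 2 + 0 + 30, fun S M Z hZ x st hst => ?_⟩
    have h0 := le_cost hZ
    have e : ((Code.loop c).simulate o).run (.pair x st) =
        (iterate (c.simulate o).run x.fst.toNat (.pair x.snd st)).bind fun u =>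
          .ret (u.1, ((((Val.pair x st).size + 1) ^ 2 + (x.size + 1) ^ 2 + 1) +
            ((((Val.pair x st).size + 1) ^ 2 + (x.size + 1) ^ 2 + 1) + ((Val.pair x st).size + 1) ^ 2 +
              (Val.pair x st).size + 1) + (Val.pair x st).size + 1) +
            (u.2 + ((Val.pair x.fst (.pair x.snd st)).size + 1) ^ 2) + 1) := by
      simp only [Code.simulate, Code.run, Comp.bind_assoc', Comp.ret_bind', Op.apply, Val.fst_pair, Val.snd_pair]
    rw [e]
    refine Simulates.bind (e := 0) (e' := 0) (Simulates.iterate (by omega) c.run_size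
      (hc S M Z hZ) x.fst.toNat x.snd st hst) (Comp.all_true _) hst
      fun y t st₁ t' e₁ _ hst₁ ht => ⟨_, rfl, fun hx hM => ?_⟩
    simp only at hM ⊢
    have h2 := ht (x.size_snd_le.trans hx) (by omega)
    have i1 := Val.size_pair x st
    have i2 := Val.size_pair x.fst (.pair x.snd st)
    have i3 := Val.size_pair x.snd st
    have i4 := x.size_fst_le
    have i5 := x.size_snd_le
    have j1 : ((Val.pair x st).size + 1) ^ 2 ≤ Z := sq_le_cost hZ (by omega)
    have j2 : ((Val.pair x.fst (.pair x.snd st)).size + 1) ^ 2 ≤ Z := sq_le_cost hZ (by omega)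
    have j3 : (x.size + 1) ^ 2 ≤ Z := sq_le_cost hZ (by omega)
    have h3 := cost_le (Z := Z) (K := K + 2) (K' := 0) (n := 30) (a := t) (b := 0)
        (t := t + (x.size + 1) ^ 2) (by omega) (by omega)
        (by have := Nat.one_le_pow 2 (x.size + 1) (by omega); omega)
    simp only [zero_mul] at h3
    omega
  | rand | device =>
    refine ⟨4, fun S M Z hZ x st hst => ⟨_, rfl, fun i => ⟨_, rfl, fun hx ht => ?_⟩⟩⟩
    have h1 : ((Val.pair x st).size + 1) ^ 2 ≤ Z :=
      sq_le_cost hZ (by rw [Val.size_pair]; omega)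
    have h0 := le_cost hZ
    have h3 : (x.size + 1) ^ 2 ≤ Z := sq_le_cost hZ (by omega)
    have h2 : 4 * 1 * Z ≤ 4 * (x.size + 1) ^ 2 * Z :=
      Nat.mul_le_mul_right _ (Nat.mul_le_mul_left _ (Nat.one_le_pow _ _ (by omega)))
    have := Val.size_pair x st
    simp only [Op.apply, Val.fst_pair] at ht ⊢; omega
  | query =>
    refine ⟨1, fun S M Z hZ x st hst => ⟨.ret, by simp [Code.simulate], fun a st' t hst' =>
      ⟨t, rfl, fun _ _ => by omega⟩⟩⟩

end

section

/-! ### Cost and behaviour of a simulation -/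

namespace Simulates

variable {o : Code} {S M Z K qo lo A : ℕ} {H : Prop} {To : ℕ → ℕ} {I : Val → Prop}

/-- If the states of `o` stay in an invariant set, a simulated computation is bounded. -/
theorem bounded {t₁ t₂ : Comp (Val × ℕ)} {e q l : ℕ} {st : Val} {T : ℕ → ℕ} (hH : H)
    (hI : ∀ st, I st → st.size ≤ S)
    (ho : ∀ v st, I st → v.size ≤ l → o.Good (.pair v st) qo lo To fun y =>
      ∃ a st', y = .pair a st' ∧ a.size ≤ A ∧ I st')
    (hTo : Monotone To) (h : Simulates o S M Z H K t₁ e st t₂) (hb : t₁.Bounded q l T) (hT : Monotone T)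
    (ha : t₁.All fun r => r.1.size ≤ r.2) (hst : I st) (hM : T (q * A) ≤ M) :
    t₂.Bounded (q * qo) lo (fun r => K * M * Z + e + q * To r) ∧
      t₂.All fun r => ∃ y st', r.1 = .pair y st' ∧ y.size ≤ M ∧ I st' := by
  induction t₁ generalizing e q st T t₂ with
  | ret y =>
    obtain ⟨t', rfl, ht⟩ := h
    have h1 : y.2 ≤ M := le_trans hb ((hT (Nat.zero_le _)).trans hM)
    have h2 : K * y.2 * Z ≤ K * M * Z := Nat.mul_le_mul_right _ (Nat.mul_le_mul_left _ h1)
    refine ⟨?_, _, _, rfl, le_trans ha h1, hst⟩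
    have := ht hH h1
    simp only [Comp.Bounded]; omega
  | rand n f ih | device v f ih =>
    obtain ⟨g, rfl, hg⟩ := h
    exact ⟨fun i => (ih i (hg i) (hb i) hT (ha i) hst hM).1, fun i => (ih i (hg i) (hb i) hT (ha i) hst hM).2⟩
  | query v f ih =>
    obtain ⟨g, rfl, hg⟩ := h
    obtain ⟨hq, hv, hb⟩ := hb
    obtain ⟨q, rfl⟩ : ∃ q', q = q' + 1 := ⟨q - 1, by omega⟩
    have hgood := ho v st hst hv
    have key : ∀ u : Val × ℕ, (∃ a st', u.1 = .pair a st' ∧ a.size ≤ A ∧ I st') →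
        (g u).Bounded (q * qo) lo (fun r => K * M * Z + (e + u.2) + q * To r) ∧
        (g u).All fun r => ∃ y st', r.1 = .pair y st' ∧ y.size ≤ M ∧ I st' := by
      rintro ⟨u, t⟩ ⟨a, st', rfl, hA, hst'⟩
      have := ih a (T := fun r => T (a.size + r)) (hg a st' t (hI _ hst')) (hb a)
        (fun x y hxy => hT (by omega)) (ha a) hst'
        (le_trans (hT (by rw [Nat.succ_mul, Nat.add_sub_cancel]; omega)) hM)
      simpa only [Nat.add_sub_cancel] using this
    refine ⟨?_, hgood.all.bind fun u hu => (key u hu).2⟩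
    have m : Monotone fun r => K * M * Z + e + q * To r :=
      fun x y hxy => Nat.add_le_add_left (Nat.mul_le_mul_left _ (hTo hxy)) _
    have := hgood.bounded.bind (q' := q * qo) hgood.all hTo m fun u hu =>
      (key u hu).1.mono le_rfl le_rfl fun r => by omega
    refine this.mono (by rw [Nat.succ_mul]; omega) le_rfl fun r => ?_
    rw [Nat.succ_mul]; omega

end Simulates

theorem Comp.Equiv.bind_all {α β : Type} {a : Comp α} {p : α → Prop} {f g : α → Comp β} (h : a.All p)
    (h' : ∀ x, p x → Comp.Equiv (f x) (g x)) : Comp.Equiv (a.bind f) (a.bind g) := by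
  induction a with
  | ret a => exact h' a h
  | rand n f ih | device v f ih | query v f ih => intro D σ O d s; simp only [Comp.bind, Comp.exec, ih _ (h _) D σ O]

/-- The handler given by a program. -/
def Code.handler (o : Code) (st v : Val) : Comp (Val × Val) :=
  (fun y => (y.fst, y.snd)) <$> o.sem (.pair v st)

theorem Simulates.equiv {o : Code} {S M Z K l qo lo : ℕ} {H : Prop} {To : ℕ → ℕ} {I : Val → Prop}
    {J : Val → Prop}
    {t₁ t₂ : Comp (Val × ℕ)} {e q : ℕ} {st : Val} {T : ℕ → ℕ}
    (hI : ∀ st, I st → st.size ≤ S)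
    (ho : ∀ v st, I st → v.size ≤ l → o.Good (.pair v st) qo lo To fun y =>
      ∃ a st', y = .pair a st' ∧ J a ∧ I st')
    (h : Simulates o S M Z H K t₁ e st t₂) (hb : t₁.Bounded q l T) (hst : I st) :
    Comp.Equiv (Prod.fst <$> t₂) ((fun p => Val.pair p.1 p.2) <$> (Prod.fst <$> t₁).handle o.handler st) := by
  induction t₁ generalizing e q st T t₂ with
  | ret y =>
    obtain ⟨t', rfl, ht⟩ := h
    exact Comp.Equiv.refl _
  | rand n f ih =>
    obtain ⟨g, rfl, hg⟩ := h
    intro D σ O d s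
    simp only [Comp.map_def, Comp.bind, Comp.handle, Comp.exec]
    congr 1; funext i
    exact ih i (hg i) (hb i) hst D σ O d s
  | device v f ih =>
    obtain ⟨g, rfl, hg⟩ := h
    intro D σ O d s
    simp only [Comp.map_def, Comp.bind, Comp.handle, Comp.exec]
    congr 1; funext i
    exact ih _ (hg _) (hb _) hst D σ O _ s
  | query v f ih =>
    obtain ⟨g, rfl, hg⟩ := h
    obtain ⟨hq, hv, hb⟩ := hb
    simp only [Comp.map_def, Comp.bind, Comp.handle, Code.handler, Code.sem, Comp.bind_assoc']
    refine Comp.Equiv.bind_all (ho v st hst hv).all ?_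
    rintro ⟨u, t⟩ ⟨a, st', rfl, -, hst'⟩
    exact ih a (hg a st' t (hI _ hst')) (hb a) hst'

variable {α σ : Type} [Enc α] [Enc σ]

theorem Comp.handle_enc {o : Code} {h : σ → Val → Comp (Val × σ)}
    (ho : ∀ v s, Comp.Equiv (o.sem (.pair v (enc s))) (enc <$> h s v)) {β : Type} (t : Comp β) (s : σ) :
    Comp.Equiv (t.handle o.handler (enc s)) ((fun p => (p.1, enc p.2)) <$> t.handle h s) := by
  induction t generalizing s with
  | ret y => exact Comp.Equiv.refl _
  | rand n f ih =>
    intro D τ O d s'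
    simp only [Comp.map_def, Comp.bind, Comp.handle, Comp.exec]
    congr 1; funext i
    exact ih i s D τ O d s'
  | device v f ih =>
    intro D τ O d s'
    simp only [Comp.map_def, Comp.bind, Comp.handle, Comp.exec]
    congr 1; funext i
    exact ih _ s D τ O _ s'
  | query v f ih =>
    have h1 := ho v s
    simp only [Comp.map_def, Comp.handle, Comp.bind_assoc', Code.handler, Comp.ret_bind'] at h1 ⊢
    refine h1.bind_left.trans ?_
    simp only [Comp.bind_assoc', Comp.ret_bind']
    exact (Comp.Equiv.refl _).bind fun u => ih u.1 u.2

/-- A polynomial-time oracle program, with its queries answered by a polynomial-time program whose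
state stays small, is a polynomial-time computation. -/
theorem PP.handle {w : ℕ} {c o : Code} (hc : c.PPTOracle) {h : σ → Val → Comp (Val × σ)}
    (ho : ∀ v s, Comp.Equiv (o.sem (.pair v (enc s))) (enc <$> h s v)) (I : ℕ → σ → Prop) (R : ℕ[X])
    (hR : ∀ m s, I m s → sz s ≤ R.eval m)
    (hI : ∀ m s (v : Val), I m s → v.size ≤ m → o.Good (enc (v, s)) (w * R.eval m) (R.eval m)
      (fun r => R.eval (m + r)) fun y => ∃ (a : Val) (s' : σ), y = enc (a, s') ∧ a.size ≤ R.eval m ∧ I m s')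
    {κ : α → Sec} {x : α → Val} {s : α → σ} (hs0 : ∀ a m, sz (s a) ≤ m → I m (s a)) (hκ : Det κ := by fun_prop)
    (hx : Det x := by fun_prop) (hs : Det s := by fun_prop) :
    PP w fun a => (c.call (κ a, x a)).handle h (s a) := by
  obtain ⟨Q, P, hc⟩ := hc
  obtain ⟨K, hK⟩ := c.simulates (o := o)
  obtain ⟨g, G, hg⟩ : Det fun a => ((Val.pair (.num (κ a).k) (x a)), s a) := by fun_prop
  obtain ⟨_, Pκ, hκ⟩ := hκ
  obtain ⟨_, Px, hx⟩ := hx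
  obtain ⟨_, Ps, hs⟩ := hs
  let L : ℕ[X] := Q.comp (Pκ + Px)
  let m : ℕ[X] := L + Ps
  let M : ℕ[X] := G + P.comp (Pκ + Px + L * R.comp m)
  let Z : ℕ[X] := (2 * M + R.comp m + 10) ^ 2
  let W : ℕ[X] := G + (C K * M * Z + L * R.comp (m + X)) + 1 + R.comp m + L * R.comp m + M + 1
  have eL : ∀ n, L.eval n = Q.eval (Pκ.eval n + Px.eval n) := fun n => by simp [L, eval_comp]
  have em : ∀ n, m.eval n = L.eval n + Ps.eval n := fun n => by simp [m]
  have eM : ∀ n, M.eval n = G.eval n + P.eval (Pκ.eval n + Px.eval n + L.eval n * R.eval (m.eval n)) :=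
    fun n => by simp [M, eval_comp]
  have eZ : ∀ n, Z.eval n = (2 * M.eval n + R.eval (m.eval n) + 10) ^ 2 := fun n => by
    simp [Z, eval_comp]
  have eW : ∀ n, W.eval n = G.eval n + (K * M.eval n * Z.eval n + L.eval n * R.eval (m.eval n + n)) + 1 +
    R.eval (m.eval n) + L.eval n * R.eval (m.eval n) + M.eval n + 1 := fun n => by simp [W, eval_comp]
  have main : ∀ a, (c.simulate o).Good (enc ((Val.pair (.num (κ a).k) (x a)), s a))
      (L.eval (sz a) * (w * R.eval (m.eval (sz a)))) (R.eval (m.eval (sz a)))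
      (fun r => K * M.eval (sz a) * Z.eval (sz a) + 0 + L.eval (sz a) * R.eval (m.eval (sz a) + r))
      (fun y => ∃ b : Val × σ, y = enc b ∧ sz b ≤ M.eval (sz a) + R.eval (m.eval (sz a)) + 1) ∧
      Comp.Equiv ((c.simulate o).sem (enc ((Val.pair (.num (κ a).k) (x a)), s a)))
        (enc <$> (c.call (κ a, x a)).handle h (s a)) := by
    intro a
    have h1 : (κ a).k + (x a).size ≤ Pκ.eval (sz a) + Px.eval (sz a) :=
      Nat.add_le_add (le_trans (show (κ a).k ≤ sz (κ a) by have := sz_sec (κ a); omega) (hκ a).size_le) (hx a).size_le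
    have hQ := poly_mono Q h1
    rw [← eL] at hQ
    have h2 : sz (s a) ≤ m.eval (sz a) := by rw [em]; exact le_trans (hs a).size_le (by omega)
    have hb := (hc (κ a).k (x a)).mono hQ hQ (T' := fun r => P.eval (Pκ.eval (sz a) + Px.eval (sz a) + r))
      fun r => poly_mono P (by omega)
    have hst := hs0 a _ h2
    have hs2 : (Val.pair (.num (κ a).k) (x a)).size ≤ M.eval (sz a) := by
      have : (enc ((Val.pair (.num (κ a).k) (x a)), s a)).size ≤ G.eval (sz a) := (hg a).size_le
      have h3 : sz ((Val.pair (.num (κ a).k) (x a)), s a) = (Val.pair (.num (κ a).k) (x a)).size + sz (s a) + 1 := rfl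
      have h4 : (enc ((Val.pair (.num (κ a).k) (x a)), s a)).size = sz ((Val.pair (.num (κ a).k) (x a)), s a) := rfl
      rw [eM]; omega
    have sim := hK (R.eval (m.eval (sz a))) (M.eval (sz a)) (Z.eval (sz a)) (eZ _)
      (.pair (.num (κ a).k) (x a)) (enc (s a)) (hR _ _ hst)
    have hI' : ∀ st, (∃ s, st = enc s ∧ I (m.eval (sz a)) s) → st.size ≤ R.eval (m.eval (sz a)) := by
      rintro _ ⟨s, rfl, hs⟩; exact hR _ _ hs
    have hgood : ∀ v st, (∃ s, st = enc s ∧ I (m.eval (sz a)) s) → v.size ≤ L.eval (sz a) →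
        o.Good (.pair v st) (w * R.eval (m.eval (sz a))) (R.eval (m.eval (sz a)))
          (fun r => R.eval (m.eval (sz a) + r)) fun y => ∃ b st', y = .pair b st' ∧
            b.size ≤ R.eval (m.eval (sz a)) ∧ ∃ s, st' = enc s ∧ I (m.eval (sz a)) s := by
      rintro v _ ⟨s, rfl, hs⟩ hv
      refine (hI _ s v hs (hv.trans (by rw [em]; omega))).imp le_rfl le_rfl (fun _ => le_rfl)
        (mono_eval _ _) ?_
      rintro y ⟨b, s', rfl, hb, hs'⟩
      exact ⟨_, _, rfl, hb, _, rfl, hs'⟩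
    have hbd := sim.bounded (I := fun st => ∃ s, st = enc s ∧ I (m.eval (sz a)) s) hs2 hI' hgood
      (mono_eval _ _) hb (mono_eval _ _) (c.run_size _) ⟨_, rfl, hst⟩ (by rw [eM]; omega)
    refine ⟨⟨hbd.1, hbd.2.imp ?_, fun x y hxy => Nat.add_le_add_left
      (Nat.mul_le_mul_left _ (mono_eval R _ hxy)) _⟩, ?_⟩
    · rintro ⟨_, t⟩ ⟨y, _, rfl, hy, s', rfl, hs'⟩
      refine ⟨(y, s'), rfl, ?_⟩
      have := hR _ _ hs'
      rw [sz_pair, sz_val]; omega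
    · have e1 := sim.equiv (I := fun st => ∃ s, st = enc s ∧ I (m.eval (sz a)) s) hI' hgood hb ⟨_, rfl, hst⟩
      refine e1.trans (((Comp.handle_enc ho _ _).map _).trans ?_)
      simp only [Comp.map_def, Comp.bind_assoc', Comp.ret_bind']
      exact Comp.Equiv.refl _
  refine ⟨(c.simulate o).comp g, W, fun a => ⟨?_, ?_⟩⟩
  · refine (((hg a).good 0 (R.eval (m.eval (sz a)))).comp (by rintro _ rfl; exact (main a).1)
      (main a).1.mono).imp ?_ ?_ (fun r => ?_) (mono_eval _ _) ?_
    · rw [zero_add, eW, show L.eval (sz a) * (w * R.eval (m.eval (sz a))) =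
        w * (L.eval (sz a) * R.eval (m.eval (sz a))) by ring]
      exact Nat.mul_le_mul_left _ (by omega)
    · rw [eW]; omega
    · have i1 := poly_mono G (show sz a ≤ sz a + r by omega)
      have i2 := poly_mono M (show sz a ≤ sz a + r by omega)
      have i3 := poly_mono Z (show sz a ≤ sz a + r by omega)
      have i4 := poly_mono L (show sz a ≤ sz a + r by omega)
      have i5 := poly_mono m (show sz a ≤ sz a + r by omega)
      have i6 := poly_mono R (show m.eval (sz a) + r ≤ m.eval (sz a + r) + (sz a + r) by omega)
      have i7 := Nat.mul_le_mul i4 i6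
      have i8 := Nat.mul_le_mul (Nat.mul_le_mul_left K i2) i3
      rw [eW]; omega
    · rintro y ⟨b, rfl, hb⟩
      exact ⟨b, rfl, hb.trans (by rw [eW]; omega)⟩
  · rw [Code.sem_comp]
    refine (hg a).equiv.bind_left.trans ?_
    exact (main a).2

end

section

/-! ### Oracles whose calls consist of two messages -/

theorem Comp.handle_env {ε σ β : Type} (h : ε → σ → Val → Comp (Val × σ)) (e : ε) (t : Comp β) (s : σ) :
    t.handle (fun (s : ε × σ) v => (h s.1 s.2 v).bind fun u => .ret (u.1, (s.1, u.2))) (e, s) =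
      (t.handle (h e) s).bind fun u => .ret (u.1, (e, u.2)) := by
  induction t generalizing s with
  | ret y => rfl
  | rand n f ih | device v f ih => simp only [Comp.handle, Comp.bind, ih]
  | query v f ih => simp only [Comp.handle, Comp.bind_assoc', Comp.ret_bind', ih]

variable {α ε S ρ : Type} [Enc α] [Enc ε] [Enc S] [Enc ρ]

open Classical in
/-- An oracle whose calls consist of two messages. The first message is answered by `o₀`, which also
opens a session, and the second one is answered by `o₁` given the session, which is then closed. The
state consists of the session and of the first record that `o₁` has made. -/
def Comp.twoPhase (o₀ : Val → Comp (Val × S)) (o₁ : Val × Option S → Val × Option ρ)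
    (s : Option S × Option ρ) (v : Val) : Comp (Val × (Option S × Option ρ)) :=
  if v.fst = .num 0 then (o₀ v).bind fun u => .ret (u.1, (some u.2, s.2))
  else .ret ((o₁ (v, s.1)).1, (none, s.2.or (o₁ (v, s.1)).2))

@[fun_prop]
theorem Det.option_or {f g : α → Option ρ} (hf : Det f) (hg : Det g) : Det fun x => (f x).or (g x) := by
  have h : (fun x => (f x).or (g x)) = fun x => (f x).elim (g x) fun r => Option.some r := by
    funext x; cases f x <;> rfl
  rw [h]
  exact Det.option_elim

open Classical in
theorem PP.handle_twoPhase {w : ℕ} {c : Code} (hc : c.PPTOracle) {o₀ : ε × Val → Comp (Val × S)}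
    {o₁ : ε × (Val × Option S) → Val × Option ρ} (h₀ : PP w o₀) {κ : α → Sec} {x : α → Val} {e : α → ε}
    (h₁ : Det o₁ := by fun_prop) (hκ : Det κ := by fun_prop) (hx : Det x := by fun_prop)
    (he : Det e := by fun_prop) :
    PP w fun a => (c.call (κ a, x a)).handle (Comp.twoPhase (fun v => o₀ (e a, v)) fun p => o₁ (e a, p))
      (none, none) := by
  obtain ⟨c₀, P₀, hc₀⟩ := h₀
  obtain ⟨P₁, hP₁⟩ := h₁.sz_le
  obtain ⟨cT, PT, hT⟩ : Det fun y : Val × (ε × (Option S × Option ρ)) => decide (y.1.fst = .num 0) := by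
    fun_prop
  obtain ⟨cA, PA, hA⟩ : Det fun y : Val × (ε × (Option S × Option ρ)) => (y.2.1, y.1) := by fun_prop
  obtain ⟨cA', PA', hA'⟩ : Det fun y : (Val × (ε × (Option S × Option ρ))) × (Val × S) =>
    (y.2.1, (y.1.2.1, (some y.2.2, y.1.2.2.2))) := by fun_prop
  obtain ⟨cB, PB, hB⟩ : Det fun y : Val × (ε × (Option S × Option ρ)) =>
      ((o₁ (y.2.1, (y.1, y.2.2.1))).1, (y.2.1, ((none : Option S), y.2.2.2.or (o₁ (y.2.1, (y.1, y.2.2.1))).2))) := by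
    fun_prop
  let o : Code := cT.ite (cA'.comp (.pair .id (c₀.comp cA))) cB
  -- the bounds for the session and for the record
  let RS : ℕ[X] := X + P₀.comp (2 * X + 1) + 2
  let RR : ℕ[X] := X + P₁.comp (2 * X + RS + 2)
  let Y : ℕ[X] := 2 * X + RS + RR + 3
  let R : ℕ[X] := PT.comp (X + Y) + PA.comp (X + Y) + P₀.comp (2 * X + 1) + 4 * (Y + 1) ^ 2 +
    PA'.comp (X + Y + P₀.comp (2 * X + 1) + 1) + PB.comp (X + Y) + P₁.comp (2 * X + RS + 2) + 5 * Y + 20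
  have eS : ∀ m, RS.eval m = m + P₀.eval (2 * m + 1) + 2 := fun m => by simp [RS, eval_comp]
  have eR : ∀ m, RR.eval m = m + P₁.eval (2 * m + RS.eval m + 2) := fun m => by simp [RR, eval_comp]
  have eY : ∀ m, Y.eval m = 2 * m + RS.eval m + RR.eval m + 3 := fun m => by simp [Y]
  have eRR : ∀ m, R.eval m = PT.eval (m + Y.eval m) + PA.eval (m + Y.eval m) + P₀.eval (2 * m + 1) +
    4 * (Y.eval m + 1) ^ 2 + PA'.eval (m + Y.eval m + P₀.eval (2 * m + 1) + 1) + PB.eval (m + Y.eval m) +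
    P₁.eval (2 * m + RS.eval m + 2) + 5 * Y.eval m + 20 := fun m => by simp [R, eval_comp]
  let h : ε × (Option S × Option ρ) → Val → Comp (Val × (ε × (Option S × Option ρ))) := fun s v =>
    (Comp.twoPhase (fun v => o₀ (s.1, v)) (fun p => o₁ (s.1, p)) s.2 v).bind fun u => .ret (u.1, (s.1, u.2))
  have main := PP.handle (w := w) (o := o) hc (h := h) (κ := κ) (x := x)
    (s := fun a => (e a, ((none : Option S), (none : Option ρ)))) ?_
    (fun m s => sz s.1 ≤ m ∧ sz s.2.1 ≤ RS.eval m ∧ sz s.2.2 ≤ RR.eval m) R ?_ ?_ (hκ := hκ) ?_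
  · refine (main.map (f := fun a u => (u.1, u.2.2))).of_equiv fun a => ?_
    rw [Comp.handle_env (fun e' => Comp.twoPhase (fun v => o₀ (e', v)) fun p => o₁ (e', p))]
    simp only [Comp.map_def, Comp.bind_assoc', Comp.ret_bind', Prod.mk.eta, Comp.bind_ret]
    exact Comp.Equiv.refl _
  · rintro v ⟨e, sess, r⟩
    show Comp.Equiv (Code.sem _ (enc (v, (e, (sess, r))))) _
    rw [Code.sem_ite]
    refine (hT _).equiv.bind_left.trans ?_
    rw [Comp.ret_bind']
    by_cases hv : v.fst = .num 0
    · simp only [h, Comp.twoPhase, hv, decide_true, if_true]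
      rw [if_neg (by simp [enc, Val.ofBool]), Code.sem_comp, Code.sem_pair, Code.sem_id, Comp.ret_bind',
        Code.sem_comp]
      have hA0 : Comp.Equiv ((cA.sem (enc (v, (e, (sess, r))))).bind c₀.sem) (enc <$> o₀ (e, v)) :=
        (hA (v, (e, (sess, r)))).equiv.bind_left.trans (hc₀ (e, v)).2
      refine hA0.bind_left.bind_left.trans ?_
      simp only [Comp.map_def, Comp.bind_assoc', Comp.ret_bind']
      exact (Comp.Equiv.refl _).bind fun b => (hA' ((v, (e, (sess, r))), b)).equiv
    · simp only [h, Comp.twoPhase, hv, decide_false, if_false]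
      rw [if_pos (by simp [enc, Val.ofBool])]
      exact (hB _).equiv
  · rintro m ⟨e, sess, r⟩ ⟨h1, h2, h3⟩
    simp only at h1 h2 h3
    rw [sz_pair, sz_pair, eRR, eY]; omega
  · rintro m ⟨e, sess, r⟩ v ⟨h1, h2, h3⟩ hv
    simp only at h1 h2 h3
    have hs : sz (v, (e, (sess, r))) ≤ m + Y.eval m := by
      simp only [sz_pair, sz_val, eY]; omega
    have hsz : (enc (v, (e, (sess, r)))).size ≤ m + Y.eval m := hs
    have i1 := poly_mono PT hs
    have i2 := poly_mono PA hs
    have i3 := poly_mono PB hs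
    have hev : sz (e, v) ≤ 2 * m + 1 := by simp only [sz_pair, sz_val]; omega
    have i4 := poly_mono P₀ hev
    have hR : ∀ r, R.eval m ≤ R.eval (m + r) := fun r => poly_mono R (by omega)
    have hYm : m ≤ Y.eval m := by rw [eY]; omega
    have hS2 : 2 * m + RS.eval m + 2 ≤ Y.eval m := by rw [eY]; have := eR m; omega
    have hsq : ((enc (v, (e, (sess, r)))).size + 1) ^ 2 ≤ 4 * (Y.eval m + 1) ^ 2 := by
      refine (Nat.pow_le_pow_left (show (enc (v, (e, (sess, r)))).size + 1 ≤ 2 * (Y.eval m + 1) by omega) 2).trans ?_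
      rw [mul_pow]; exact le_refl _
    let D : ℕ := PA.eval (m + Y.eval m) + 4 * (Y.eval m + 1) ^ 2 +
      PA'.eval (m + Y.eval m + P₀.eval (2 * m + 1) + 1) + PB.eval (m + Y.eval m) + 2 * Y.eval m + 10
    have hD : D = PA.eval (m + Y.eval m) + 4 * (Y.eval m + 1) ^ 2 +
      PA'.eval (m + Y.eval m + P₀.eval (2 * m + 1) + 1) + PB.eval (m + Y.eval m) + 2 * Y.eval m + 10 := rfl
    have m0 : Monotone fun r => D + P₀.eval (2 * m + 1 + r) :=
      fun x y hxy => Nat.add_le_add_left (mono_eval P₀ _ hxy) _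
    refine (Code.Good.ite (q := w * R.eval m) (l := R.eval m) (T := fun r => D + P₀.eval (2 * m + 1 + r))
      (J := fun y => ∃ (a : Val) (s' : ε × (Option S × Option ρ)), y = enc (a, s') ∧ a.size ≤ R.eval m ∧
        sz s'.1 ≤ m ∧ sz s'.2.1 ≤ RS.eval m ∧ sz s'.2.2 ≤ RR.eval m)
      (hT (v, (e, (sess, r)))) (fun _ => ?_) (fun _ => ?_) m0).imp le_rfl le_rfl
      (fun r => ?_) (mono_eval R m) fun _ h => h
    · have g0 : c₀.Good (enc (e, v)) (w * P₀.eval (2 * m + 1)) (P₀.eval (2 * m + 1))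
          (fun r => P₀.eval (2 * m + 1 + r)) fun y => ∃ b : Val × S, y = enc b ∧ sz b ≤ P₀.eval (2 * m + 1) :=
        (hc₀ (e, v)).1.imp (Nat.mul_le_mul_left _ i4) i4 (fun r => poly_mono P₀ (by omega)) (mono_eval _ _)
          fun y ⟨b, hb, hb'⟩ => ⟨b, hb, hb'.trans i4⟩
      have g1 := ((Code.computes_id (enc (v, (e, (sess, r))))).good 0 (P₀.eval (2 * m + 1))).pair
        (((hA (v, (e, (sess, r)))).good 0 (P₀.eval (2 * m + 1))).comp (by rintro _ rfl; exact g0) g0.mono)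
      have g2 := g1.comp (c' := cA') (q' := 0)
        (T' := fun _ => PA'.eval (m + Y.eval m + P₀.eval (2 * m + 1) + 1))
        (J' := fun y => ∃ (a : Val) (s' : ε × (Option S × Option ρ)), y = enc (a, s') ∧ a.size ≤ R.eval m ∧
          sz s'.1 ≤ m ∧ sz s'.2.1 ≤ RS.eval m ∧ sz s'.2.2 ≤ RR.eval m) ?_ monotone_const
      · refine g2.imp ?_ ?_ (fun r => ?_) m0 fun _ h => h
        · rw [eRR]
          simp only [zero_add, add_zero]
          exact Nat.mul_le_mul_left _ (by omega)
        · rw [eRR]; omega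
        · omega
      · rintro y ⟨_, _, rfl, rfl, b, rfl, hb⟩
        have hsb : sz (((v, (e, (sess, r))) : Val × (ε × (Option S × Option ρ))), b) ≤
            m + Y.eval m + P₀.eval (2 * m + 1) + 1 := by rw [sz_pair]; omega
        refine ((hA' ((v, (e, (sess, r))), b)).good 0 _).imp le_rfl le_rfl
          (fun _ => poly_mono PA' hsb) monotone_const ?_
        rintro y rfl
        have hb2 : sz b = b.1.size + sz b.2 + 1 := rfl
        refine ⟨b.1, (e, (some b.2, r)), rfl, ?_, h1, ?_, h3⟩
        · rw [eRR]; omega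
        · rw [sz_some, eS]; omega
    · refine ((hB (v, (e, (sess, r)))).good _ _).imp le_rfl le_rfl (fun r => ?_) m0 ?_
      · omega
      · rintro y rfl
        have hb := hP₁ (e, (v, sess))
        have hb2 : sz (o₁ (e, (v, sess))) = (o₁ (e, (v, sess))).1.size + sz (o₁ (e, (v, sess))).2 + 1 := rfl
        have i5 := poly_mono P₁ (show sz (e, (v, sess)) ≤ 2 * m + RS.eval m + 2 by
          simp only [sz_pair, sz_val]; omega)
        refine ⟨(o₁ (e, (v, sess))).1, (e, (none, r.or (o₁ (e, (v, sess))).2)), rfl, ?_, h1, ?_, ?_⟩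
        · rw [eRR]; omega
        · rw [sz_none, eS]; omega
        · cases r with
          | none => simp only [Option.none_or]; rw [eR]; omega
          | some r => simpa only [Option.some_or] using h3
    · have j0 := poly_mono PT (show m + Y.eval m ≤ m + r + Y.eval (m + r) by
        have := poly_mono Y (show m ≤ m + r by omega); omega)
      have j1 := poly_mono PA (show m + Y.eval m ≤ m + r + Y.eval (m + r) by
        have := poly_mono Y (show m ≤ m + r by omega); omega)
      have j2 := poly_mono PB (show m + Y.eval m ≤ m + r + Y.eval (m + r) by
        have := poly_mono Y (show m ≤ m + r by omega); omega)
      have j3 := poly_mono Y (show m ≤ m + r by omega)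
      have j4 := poly_mono P₀ (show 2 * m + 1 + r ≤ 2 * (m + r) + 1 by omega)
      have j5 := poly_mono PA' (show m + Y.eval m + P₀.eval (2 * m + 1) + 1 ≤
        m + r + Y.eval (m + r) + P₀.eval (2 * (m + r) + 1) + 1 by
          have := poly_mono P₀ (show 2 * m + 1 ≤ 2 * (m + r) + 1 by omega); omega)
      have j6 := Nat.mul_le_mul_left 4 (Nat.pow_le_pow_left (Nat.add_le_add_right j3 1) 2)
      rw [eRR]; omega
  · intro a m hm
    simp only [sz_pair, sz_none] at hm ⊢
    refine ⟨by omega, ?_, ?_⟩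
    · rw [eS]; omega
    · rw [eR]; omega

end

/-! ### Comparing executions -/

/-- Oracles without a state. -/
abbrev Oracle := Unit → Val → PMF (Val × Unit)

namespace Comp

variable {α β γ σ τ : Type} {D : Device} {O O' : Oracle}

/-- All outputs that occur with positive probability satisfy `p`. -/
def Sup (D : Device) (O : Oracle) (p : α → Prop) (c : Comp α) : Prop :=
  ∀ d, ∀ u ∈ (c.exec D O d ()).support, p u.1

theorem All.sup {p : α → Prop} {c : Comp α} (h : c.All p) : c.Sup D O p := fun _ _ hu => h.exec D O hu

theorem Sup.ret {p : α → Prop} {a : α} (h : p a) : (Comp.ret a).Sup D O p := All.sup (c := .ret a) h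

theorem Sup.imp {p q : α → Prop} {c : Comp α} (h : c.Sup D O p) (hpq : ∀ a, p a → q a) : c.Sup D O q :=
  fun d u hu => hpq _ (h d u hu)

theorem Sup.bind {p : α → Prop} {q : β → Prop} {c : Comp α} {f : α → Comp β} (h : c.Sup D O p)
    (hf : ∀ a, p a → (f a).Sup D O q) : (c.bind f).Sup D O q := by
  intro d u hu
  rw [exec_bind, PMF.mem_support_bind_iff] at hu
  obtain ⟨w, hw, hu⟩ := hu
  exact hf _ (h d w hw) _ u hu

theorem Sup.map {p : β → Prop} {c : Comp α} {f : α → β} (h : c.Sup D O fun a => p (f a)) :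
    (f <$> c).Sup D O p := by
  rw [map_def]; exact h.bind fun a ha => .ret ha

theorem sup_true (c : Comp α) : c.Sup D O fun _ => True := fun _ _ _ => trivial

theorem Is.sup {p : PMF α} {q : α → Prop} {c : Comp α} (h : Is D O c p) (hq : ∀ a ∈ p.support, q a) :
    c.Sup D O q := by
  intro d u hu
  rw [h d (), PMF.support_map] at hu
  obtain ⟨a, ha, rfl⟩ := hu
  exact hq a ha

theorem Sup.mapC {p : α → β → Prop} {f : α → Comp β} {l : List α}
    (h : ∀ a ∈ l, (f a).Sup D O (p a)) : (mapC f l).Sup D O (List.Forall₂ p l) := by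
  induction l with
  | nil => exact .ret .nil
  | cons a l ih =>
    exact (h a (by simp)).bind fun b hb => (ih fun a ha => h a (by simp [ha])).bind fun bs hbs =>
      .ret (.cons hb hbs)

theorem Sup.handle {h : σ → Val → Comp (Val × σ)} {I : σ → Prop}
    (hI : ∀ s v, I s → (h s v).Sup D O fun u => I u.2) (t : Comp β) {s : σ} (hs : I s) :
    (t.handle h s).Sup D O fun u => I u.2 := by
  induction t generalizing s with
  | ret a => exact .ret hs
  | rand n f ih =>
    intro d u hu
    simp only [Comp.handle, Comp.exec, PMF.mem_support_bind_iff] at hu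
    obtain ⟨i, _, hu⟩ := hu
    exact ih i hs _ u hu
  | device v f ih =>
    intro d u hu
    simp only [Comp.handle, Comp.exec, PMF.mem_support_bind_iff] at hu
    obtain ⟨i, _, hu⟩ := hu
    exact ih _ hs _ u hu
  | query v f ih => exact (hI s v hs).bind fun u hu => ih _ hu

/-- Two computations behave alike as long as their output does not satisfy `B`. -/
def Rel (D : Device) (O O' : Oracle) (B : α → Prop) (c c' : Comp α) : Prop :=
  ∀ d u, ¬ B u.1 → c.exec D O d () u = c'.exec D O' d () u

theorem Rel.refl {B : α → Prop} (c : Comp α) : Rel D O O B c c := fun _ _ _ => rfl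

theorem Rel.ret {B : α → Prop} (a : α) : Rel D O O' B (.ret a) (.ret a) := fun _ _ _ => rfl

theorem Rel.of_is {B : α → Prop} {c c' : Comp α} {p : PMF α} (h : Is D O c p) (h' : Is D O' c' p) :
    Rel D O O' B c c' := fun d u _ => by rw [h d (), h' d ()]

theorem Rel.exec_eq {c c' : Comp α} (h : Rel D O O' (fun _ => False) c c') (d : D.State) :
    c.exec D O d () = c'.exec D O' d () := PMF.ext fun u => h d u id

theorem Rel.bind {B : α → Prop} {B' : β → Prop} {p : α → Prop} {c c' : Comp α} {f f' : α → Comp β}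
    (h : Rel D O O' B c c') (hp : c.Sup D O p) (hf : ∀ a, p a → ¬ B a → Rel D O O' B' (f a) (f' a))
    (hB : ∀ a, B a → (f a).All B' ∧ (f' a).All B') : Rel D O O' B' (c.bind f) (c'.bind f') := by
  intro d u hu
  rw [exec_bind, exec_bind, PMF.bind_apply, PMF.bind_apply]
  refine tsum_congr fun w => ?_
  by_cases hw : B w.1
  · have h1 : (f w.1).exec D O w.2.1 w.2.2 u = 0 := by
      rw [PMF.apply_eq_zero_iff]
      exact fun hu' => hu ((hB _ hw).1.exec D O hu')
    have h2 : (f' w.1).exec D O' w.2.1 w.2.2 u = 0 := by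
      rw [PMF.apply_eq_zero_iff]
      exact fun hu' => hu ((hB _ hw).2.exec D O' hu')
    rw [h1, h2, mul_zero, mul_zero]
  · rw [← h d w hw]
    by_cases h0 : c.exec D O d () w = 0
    · rw [h0, zero_mul, zero_mul]
    · rw [hf w.1 (hp d w h0) hw w.2.1 u hu]

theorem Rel.bind_same {B' : β → Prop} {p : α → Prop} {c c' : Comp α} {f f' : α → Comp β}
    (h : Rel D O O' (fun _ => False) c c') (hp : c.Sup D O p)
    (hf : ∀ a, p a → Rel D O O' B' (f a) (f' a)) : Rel D O O' B' (c.bind f) (c'.bind f') :=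
  h.bind hp (fun a ha _ => hf a ha) fun _ h => h.elim

theorem Rel.mapC {f f' : α → Comp β} {l : List α}
    (h : ∀ a ∈ l, Rel D O O' (fun _ => False) (f a) (f' a)) :
    Rel D O O' (fun _ => False) (mapC f l) (mapC f' l) := by
  induction l with
  | nil => exact .ret _
  | cons a l ih =>
    exact (h a (by simp)).bind_same (sup_true _) fun b _ => (ih fun a ha => h a (by simp [ha])).bind_same
      (sup_true _) fun bs _ => .ret _

theorem All.handle {h : σ → Val → Comp (Val × σ)} {B : σ → Prop} (hB : ∀ s v, B s → (h s v).All fun u => B u.2)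
    (t : Comp β) {s : σ} (hs : B s) : (t.handle h s).All fun u => B u.2 := by
  induction t generalizing s with
  | ret a => exact hs
  | rand n f ih | device v f ih => exact fun i => ih i hs
  | query v f ih => exact (hB s v hs).bind fun u hu => ih _ hu

/-- Two ways of answering queries that agree until a bad state is reached. -/
theorem Rel.handle {h h' : σ → Val → Comp (Val × σ)} {B I : σ → Prop}
    (hI : ∀ s v, I s → (h s v).Sup D O fun u => I u.2)
    (hB : ∀ s v, B s → ((h s v).All fun u => B u.2) ∧ (h' s v).All fun u => B u.2)
    (hh : ∀ s v, I s → ¬ B s → Rel D O O' (fun u => B u.2) (h s v) (h' s v))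
    (t : Comp β) {s : σ} (hs : I s) (hs' : ¬ B s) :
    Rel D O O' (fun u => B u.2) (t.handle h s) (t.handle h' s) := by
  induction t generalizing s with
  | ret a => exact .ret _
  | rand n f ih =>
    intro d u hu
    simp only [Comp.handle, Comp.exec, PMF.bind_apply]
    exact tsum_congr fun i => by rw [ih i hs hs' d u hu]
  | device v f ih =>
    intro d u hu
    simp only [Comp.handle, Comp.exec, PMF.bind_apply]
    exact tsum_congr fun w => by rw [ih w.1 hs hs' w.2 u hu]
  | query v f ih =>
    exact (hh s v hs hs').bind (hI s v hs) (fun u hu hu' => ih u.1 hu hu') fun u hu =>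
      ⟨All.handle (fun s v h => (hB s v h).1) _ hu, All.handle (fun s v h => (hB s v h).2) _ hu⟩

/-- Running a computation with a stateful oracle is answering its queries by a handler with the same
behaviour. -/
theorem exec_handle {h : τ → Val → Comp (Val × τ)} {Q : σ → Val → PMF (Val × σ)} {φ : τ → σ}
    {I : τ → Prop} (hI : ∀ s v, I s → (h s v).Sup D O fun u => I u.2)
    (hh : ∀ s v d, I s → ((h s v).exec D O d ()).map (fun u => ((u.1.1, φ u.1.2), u.2.1)) =
      (Q (φ s) v).map fun w => (w, d)) (t : Comp β) (d : D.State) (s : τ) (hs : I s) :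
    t.exec D Q d (φ s) = ((t.handle h s).exec D O d ()).map fun u => (u.1.1, u.2.1, φ u.1.2) := by
  induction t generalizing d s with
  | ret a => rw [Comp.handle, exec_ret, exec_ret, PMF.pure_map]
  | rand n f ih | device v f ih => simp only [Comp.handle, Comp.exec, PMF.map_bind, ih _ _ _ hs]
  | query v f ih =>
    have h1 : (Q (φ s) v).bind (fun u => (f u.1).exec D Q d u.2) =
        ((Q (φ s) v).map fun w => (w, d)).bind fun u => (f u.1.1).exec D Q u.2 u.1.2 := by
      rw [PMF.bind_map]; rfl
    simp only [Comp.handle, Comp.exec]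
    rw [h1, ← hh s v d hs, PMF.bind_map, exec_bind, PMF.map_bind]
    ext y
    rw [PMF.bind_apply, PMF.bind_apply]
    refine tsum_congr fun u => ?_
    by_cases h0 : (h s v).exec D O d () u = 0
    · rw [h0, zero_mul, zero_mul]
    · rw [Function.comp_apply, ih _ _ _ (hI s v hs d u h0)]

end Comp

/-! ### The privacy game as a computation -/

variable {par : Params} {E : PKE par} {N₀ N₁ N₂ : NIZK} {SE : Sec × Val → Comp Val}
  {SK : Sec × Val → Comp ((Val × Val) × Val)} {Nb : ℕ[X]} {A : PrivacyAdversary} {reveal b : Bool}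
  {D : Device} {O O' : Oracle} {P₀ P₁ P₂ : ProofSystem} {Wzk Wsound : ℕ → Set Val}

/-- The number of participants as a function of the unary security parameter. -/
def Params.count (par : Params) (K : Sec) : ℕ := par.n K.k
/-- The threshold as a function of the unary security parameter. -/
def Params.thr (par : Params) (K : Sec) : ℕ := par.t K.k
/-- The modulus as a function of the unary security parameter. -/
def Params.modulus (par : Params) (K : Sec) : ℕ := par.p K.k

/-- Encryption as a function of the tuple of its arguments. -/
def PKE.encF {par : Params} (E : PKE par) (a : Sec × Val) : Val :=
  E.enc a.1.k (a.2.get 0) (a.2.get 1) (par.dec a.1.k (a.2.get 2)) (a.2.get 3)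

/-- Proof verification as a function of the tuple of its arguments. -/
def NIZK.verF (N : NIZK) (a : Sec × Val) : Bool :=
  N.ver a.1.k (a.2.get 0) (a.2.get 1) (a.2.get 2)

/-- The share at `i` modulo `p` for the secret `s` and the higher coefficients `cs`. -/
def horner (p s : ℕ) (cs : List ℕ) (i : ℕ) : ℕ := (cs.foldr (fun a acc => (a + acc) * i % p) 0 + s) % p

/-- An encrypted share: recipient, ciphertext and share. -/
abbrev Item := Party × (Val × ℕ)

/-- An oracle session: the secret, and the encrypted shares, with a decryption proof for honest
participants. -/
abbrev Sess := ℕ × List (Item × Option Val)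

/-- The statement that an item decrypts to `y`. -/
def Item.stmt (pub : Val) (it : Item) (y : ℕ) : Val := .ofList [pub.get 0, it.1.pk, it.2.1, .num y]

/-- The provers that the game calls: the first one gets the number and the public key of an honest
participant, the second one a statement and a witness, and the third one an encrypted share. -/
structure Provers where
  key : ℕ × Val → Comp Val
  enc : Val × Val → Comp Val
  dec : Item → Comp Val

section

variable (E N₀ N₂ SE A reveal)

/-- Random coefficients for sharing. -/
def coeffs (par : Params) (K : Sec) : Comp (List ℕ) :=
  Comp.mapC (fun _ => (fun i : Fin (par.modulus K - 1 + 1) => i.val) <$> Comp.rand (par.modulus K - 1) .ret)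
    (List.range (par.thr K))

/-- The shares for `m` participants. -/
def shareList (par : Params) (K : Sec) (s : ℕ) (cs : List ℕ) (m : ℕ) : List ℕ :=
  (List.range m).map fun i => horner (par.modulus K) s cs (i + 1)

/-- The ciphertexts of shares with given randomness. -/
def encShares (K : Sec) (pub : Val) (G : List Party) (sh : List ℕ) (rs : List Val) : List Item :=
  (G.zip (sh.zip rs)).map fun e =>
    (e.1, (E.encF (K, .ofList [pub.get 0, e.1.pk, .num e.2.1, e.2.2]), e.2.1))

/-- The statement about a list of encrypted shares. -/
def sharingStmt (par : Params) (K : Sec) (pub : Val) (its : List Item) : Val :=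
  .ofList [pub.get 0, .num its.length, .num (par.thr K), .ofList (its.map fun it => .pair it.1.pk it.2.1)]

/-- The witness for a list of encrypted shares. -/
def sharingWit (sh : List ℕ) (rs : List Val) : Val := .ofList ((sh.zip rs).map fun e => .pair (.num e.1) e.2)

/-- Honest sharing of `s` for the participants `G`. -/
def deal (K : Sec) (π : Provers) (pub : Val) (G : List Party) (s : ℕ) : Comp (List Item × Val) :=
  coeffs par K >>= fun cs => Comp.mapC (fun _ => SE (K, pub.get 0)) G >>= fun rs =>
    (fun pf => (encShares E K pub G (shareList par K s cs G.length) rs, pf)) <$>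
      π.enc (sharingStmt par K pub (encShares E K pub G (shareList par K s cs G.length) rs),
        sharingWit (shareList par K s cs G.length) rs)

/-- What an oracle call shows of decrypted shares. -/
def shownShares (l : List (Item × Option Val)) : Val :=
  .ofList (l.map fun e => .ofOption (e.2.map fun pf => .pair (.num e.1.2.2) pf))

/-- The answer to the first message of an oracle call, with the session. The honest participants
announce the shares that the dealer has computed. -/
def openCall (K : Sec) (π : Provers) (pub : Val) (G : List Party) (v : Val) : Comp (Val × Sess) :=
  deal E SE K π pub G (v.snd.toNat % par.modulus K) >>= fun tr =>
    (fun ds => (.ofList [.ofList (tr.1.map fun it => it.2.1), tr.2,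
        if reveal then shownShares (tr.1.zip ds) else .num 0],
      (v.snd.toNat % par.modulus K, tr.1.zip ds))) <$>
    Comp.mapC (fun it : Item => bif it.1.corrupt then Comp.ret none else some <$> π.dec it) tr.1

/-- The share and the proof that are contributed by the participant at position `j`. -/
def contribution (K : Sec) (par : Params) (v : Val) (e : Item × Option Val) (j : ℕ) : ℕ × Val :=
  e.2.elim ((v.snd.get j).fst.toNat % par.modulus K, (v.snd.get j).snd) fun pf => (e.1.2.2, pf)

/-- The contributions that pass verification. Entries are the item, the share, and the proof. -/
def passing (K : Sec) (par : Params) (pub v : Val) (l : List (Item × Option Val)) : List (Item × (ℕ × Val)) :=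
  ((l.zip (List.range l.length)).map fun e => (e.1.1, contribution K par v e.1 e.2)).filter fun e =>
    N₂.verF (K, .ofList [pub.get 3, e.1.stmt pub e.2.1, e.2.2])

/-- The ideal answer to the second message of an oracle call, which is the secret if enough
contributions pass verification, and a record of the first wrong contribution that passes. -/
def closeCall (K : Sec) (par : Params) (pub : Val) (a : Val × Option Sess) : Val × Option (Val × Val) :=
  a.2.elim (.num 0, none) fun ss =>
    (if (passing N₂ K par pub a.1 ss.2).length ≤ par.thr K then .ofOption none else .ofOption (some (.num ss.1)),
      (((passing N₂ K par pub a.1 ss.2).filter fun e => !decide (e.2.1 = e.1.2.2)).head?).map fun e =>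
        (e.1.stmt pub e.2.1, e.2.2))

open Classical in
/-- The flags of corrupted participants. -/
def corruptFlag (v : Val) (i : ℕ) : Bool := !(decide (v.get i = .num 0))

/-- The part of the game before the oracle phase. The result is `none` if too many participants
are corrupted, and otherwise the state of the adversary and the qualified participants. -/
def keyStage (K : Sec) (π : Provers) (pub : Val) (pks : List Val) : Comp (Option (Val × List Party)) :=
  A.corrupt.call (K, pub) >>= fun u₁ =>
    if par.thr K < ((List.range (par.count K)).filter fun i => corruptFlag u₁.fst i).length then .ret none
    else A.keys.call (K, u₁.snd) >>= fun u₂ =>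
      (fun ps => some (u₂.snd, ps.filter fun q =>
        N₀.verF (K, .ofList [pub.get 1, .pair (pub.get 0) q.pk, q.proof]))) <$>
      Comp.mapC (fun i => bif corruptFlag u₁.fst i then
          Comp.ret (Party.mk i true (u₂.fst.get i).fst (.num 0) (u₂.fst.get i).snd)
        else (fun pf => Party.mk i false (pks.getD i (.num 0)) (.num 0) pf) <$>
          π.key (i, pks.getD i (.num 0))) (List.range (par.count K))

/-- The public keys that the adversary sees. -/
def pubKeys (G : List Party) : Val := .ofList (G.map fun q => .ofList [.num q.idx, q.pk, q.proof])

/-- The oracle phase. -/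
def attackStage (K : Sec) (π : Provers) (pub : Val) (o : Val × List Party) :
    Comp (Val × (Option Sess × Option (Val × Val))) :=
  (A.attack.call (K, .pair o.1 (pubKeys o.2))).handle
    (Comp.twoPhase (openCall E SE reveal K π pub o.2) (closeCall N₂ K par pub)) (none, none)

/-- The challenge secret. -/
def challengeSecret (par : Params) (K : Sec) (b : Bool) (u : Val) : ℕ :=
  (u.get (if b then 1 else 0)).toNat % par.modulus K

/-- The part of the game after the oracle phase. -/
def guessStage (b : Bool) (K : Sec) (π : Provers) (pub : Val) (G : List Party) (u : Val) : Comp Val :=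
  deal E SE K π pub G (challengeSecret par K b u) >>= fun tr =>
    A.guess.call (K, .ofList [u.get 2, .ofList (tr.1.map fun it => it.2.1), tr.2])

/-- Output of the adversary, record of a wrong share, list of qualified participants. -/
abbrev Outcome := Val × (Option (Val × Val) × List Party)

/-- The privacy game with ideal reconstruction. Besides the output of the adversary, it returns
the record of a wrong share and the list of qualified participants. -/
def game (b : Bool) (K : Sec) (π : Provers) (pub : Val) (pks : List Val) :
    Comp Outcome :=
  keyStage (par := par) N₀ A K π pub pks >>= fun o =>
    o.elim (.ret (.num 0, (none, []))) fun o =>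
      attackStage E N₂ SE A reveal K π pub o >>= fun u =>
        (fun g => (g, (u.2.2, o.2))) <$> guessStage E SE A b K π pub o.2 u.1

end

/-! ### The privacy game runs in polynomial time -/

section

variable {α : Type} [Enc α] {w : ℕ}

/-- What the game needs of the schemes. -/
structure Feasible (E : PKE par) (N₀ N₂ : NIZK) (SE : Sec × Val → Comp Val) : Prop where
  count : Det par.count
  count_le : ∃ P : ℕ[X], ∀ K, par.count K ≤ P.eval (sz K)
  thr : Det par.thr
  modulus : Det par.modulus
  enc : Det E.encF
  ver₀ : Det N₀.verF
  ver₂ : Det N₂.verF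
  sample : PP 0 SE

theorem horner_lt {p : ℕ} (hp : 0 < p) (s : ℕ) (cs : List ℕ) (i : ℕ) : horner p s cs i < p := Nat.mod_lt _ hp

theorem Det.horner (F : Feasible E N₀ N₂ SE) {K : α → Sec} {s : α → ℕ} {cs : α → List ℕ} {i : α → ℕ}
    (hK : Det K := by fun_prop) (hs : Det s := by fun_prop) (hcs : Det cs := by fun_prop)
    (hi : Det i := by fun_prop) :
    Det fun x => horner (par.modulus (K x)) (s x) (cs x) (i x) := by
  have hm := F.modulus
  obtain ⟨P, hP⟩ := (show Det fun x => par.modulus (K x) by fun_prop).sz_le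
  have h : Det fun x => (cs x).reverse.foldl (fun acc a => (a + acc) * i x % par.modulus (K x)) 0 := by
    refine foldl (g := fun x acc a => (a + acc) * i x % par.modulus (K x)) (by fun_prop) (by fun_prop)
      (by fun_prop) (R := P + 2) fun x j => ?_
    have hlt : ∀ l : List ℕ, l.foldl (fun acc a => (a + acc) * i x % par.modulus (K x)) 0 ≤ par.modulus (K x) := by
      intro l
      induction l using List.reverseRecOn with
      | nil => exact Nat.zero_le _
      | append_singleton l a _ =>
        rw [List.foldl_append]
        exact (Nat.mod_lt _ (par.prime _).pos).le
    have h1 := Nat.size_le_size (hlt (((cs x).reverse).take j))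
    have h2 := hP x
    rw [sz_nat] at h2 ⊢
    simp only [eval_add, eval_ofNat]; omega
  unfold PVSSPrivacy.horner
  simp only [List.foldl_reverse] at h
  fun_prop

theorem Det.range_thr (F : Feasible E N₀ N₂ SE) {K : α → Sec} (hK : Det K := by fun_prop) :
    Det fun x => List.range (par.thr (K x)) := by
  obtain ⟨P, hP⟩ := F.count_le
  have h := F.thr
  refine comp (g := fun K => List.range (par.thr K)) (list_range h (R := P) fun K => ?_) hK
  have h1 : 2 * par.thr K ≤ par.count K := par.t_le K.k
  have := hP K
  omega

theorem Det.range_count (F : Feasible E N₀ N₂ SE) {K : α → Sec} (hK : Det K := by fun_prop) :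
    Det fun x => List.range (par.count (K x)) := by
  obtain ⟨P, hP⟩ := F.count_le
  exact comp (g := fun K => List.range (par.count K)) (list_range F.count hP) hK

theorem Det.range_length {β : Type} [Enc β] {l : α → List β} (hl : Det l := by fun_prop) :
    Det fun x => List.range (l x).length := by
  obtain ⟨P, hP⟩ := hl.sz_le
  have := list_length hl
  exact list_range (by fun_prop) (R := P) fun x => (length_lt_sz (l x)).le.trans (hP x)

theorem Det.shareList (F : Feasible E N₀ N₂ SE) {K : α → Sec} {s : α → ℕ} {cs : α → List ℕ} {G : α → List Party}
    (hK : Det K := by fun_prop) (hs : Det s := by fun_prop) (hcs : Det cs := by fun_prop)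
    (hG : Det G := by fun_prop) :
    Det fun x => shareList par (K x) (s x) (cs x) (G x).length := by
  refine list_map (f := fun x i => PVSSPrivacy.horner (par.modulus (K x)) (s x) (cs x) (i + 1)) (hf := ?_)
    (hl := range_length hG)
  exact Det.horner F (K := fun p : α × ℕ => K p.1)

theorem Det.encShares (F : Feasible E N₀ N₂ SE) {K : α → Sec} {pub : α → Val} {sh : α → List ℕ}
    {G : α → List Party} {rs : α → List Val} (hK : Det K := by fun_prop) (hpub : Det pub := by fun_prop)
    (hG : Det G := by fun_prop) (hsh : Det sh := by fun_prop) (hrs : Det rs := by fun_prop) :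
    Det fun x => encShares E (K x) (pub x) (G x) (sh x) (rs x) := by
  have := F.enc
  refine list_map (f := fun x (e : Party × (ℕ × Val)) =>
    (e.1, (E.encF (K x, .ofList [(pub x).get 0, e.1.pk, .num e.2.1, e.2.2]), e.2.1)))

theorem Det.sharingStmt (F : Feasible E N₀ N₂ SE) {K : α → Sec} {pub : α → Val} {its : α → List Item}
    (hK : Det K := by fun_prop) (hpub : Det pub := by fun_prop) (hi : Det its := by fun_prop) :
    Det fun x => sharingStmt par (K x) (pub x) (its x) := by
  have := F.thr
  have h1 := list_length hi
  have h2 : Det fun x => (its x).map fun it => Val.pair it.1.pk it.2.1 :=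
    list_map (f := fun _ (it : Item) => Val.pair it.1.pk it.2.1)
  unfold PVSSPrivacy.sharingStmt
  fun_prop

@[fun_prop]
theorem Det.sharingWit {sh : α → List ℕ} {rs : α → List Val} (hsh : Det sh) (hrs : Det rs) :
    Det fun x => sharingWit (sh x) (rs x) := by
  have h2 : Det fun x => ((sh x).zip (rs x)).map fun e => Val.pair (.num e.1) e.2 :=
    list_map (f := fun _ (e : ℕ × Val) => Val.pair (.num e.1) e.2)
  unfold PVSSPrivacy.sharingWit
  fun_prop

theorem PP.coeffs (F : Feasible E N₀ N₂ SE) {K : α → Sec} (hK : Det K := by fun_prop) :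
    PP w fun x => coeffs par (K x) := by
  have := F.modulus
  exact PP.mapC (f := fun x (_ : ℕ) => (fun i : Fin (par.modulus (K x) - 1 + 1) => i.val) <$>
    Comp.rand (par.modulus (K x) - 1) .ret) PP.rand (hl := Det.range_thr F)

theorem PP.sample (F : Feasible E N₀ N₂ SE) {K : α → Sec} {pub : α → Val} {G : α → List Party}
    (hK : Det K := by fun_prop) (hpub : Det pub := by fun_prop) (hG : Det G := by fun_prop) :
    PP w fun x => Comp.mapC (fun _ => SE (K x, (pub x).get 0)) (G x) :=
  PP.mapC (f := fun x (_ : Party) => SE (K x, (pub x).get 0)) (F.sample.of_zero.comp (by fun_prop))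

theorem PP.deal (F : Feasible E N₀ N₂ SE) {K : α → Sec} {π : α → Provers} {pub : α → Val} {G : α → List Party}
    {s : α → ℕ} (hπ : PP w fun p : α × (Val × Val) => (π p.1).enc p.2) (hK : Det K := by fun_prop)
    (hpub : Det pub := by fun_prop) (hG : Det G := by fun_prop) (hs : Det s := by fun_prop) :
    PP w fun x => deal E SE (K x) (π x) (pub x) (G x) (s x) := by
  refine PP.bind (PP.coeffs F) (PP.bind (PP.sample F (K := fun p : α × List ℕ => K p.1)
    (pub := fun p => pub p.1) (G := fun p => G p.1)) ?_)
  have h1 : Det fun p : (α × List ℕ) × List Val => shareList par (K p.1.1) (s p.1.1) p.1.2 (G p.1.1).length :=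
    Det.shareList F
  have h2 : Det fun p : (α × List ℕ) × List Val => encShares E (K p.1.1) (pub p.1.1) (G p.1.1)
      (shareList par (K p.1.1) (s p.1.1) p.1.2 (G p.1.1).length) p.2 :=
    Det.encShares F (hsh := h1)
  have h3 := Det.sharingStmt F (K := fun p : (α × List ℕ) × List Val => K p.1.1)
    (pub := fun p => pub p.1.1) (hi := h2)
  refine PP.map (f := fun (p : (α × List ℕ) × List Val) (pf : Val) => (encShares E (K p.1.1) (pub p.1.1) (G p.1.1)
      (shareList par (K p.1.1) (s p.1.1) p.1.2 (G p.1.1).length) p.2, pf))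
    (F := fun p : (α × List ℕ) × List Val => (π p.1.1).enc (sharingStmt par (K p.1.1) (pub p.1.1)
      (encShares E (K p.1.1) (pub p.1.1) (G p.1.1)
      (shareList par (K p.1.1) (s p.1.1) p.1.2 (G p.1.1).length) p.2),
      sharingWit (shareList par (K p.1.1) (s p.1.1) p.1.2 (G p.1.1).length) p.2)) ?_ (hf := ?_)
  · exact hπ.comp (f := fun p : (α × List ℕ) × List Val => (p.1.1, (sharingStmt par (K p.1.1) (pub p.1.1)
      (encShares E (K p.1.1) (pub p.1.1) (G p.1.1)
      (shareList par (K p.1.1) (s p.1.1) p.1.2 (G p.1.1).length) p.2),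
      sharingWit (shareList par (K p.1.1) (s p.1.1) p.1.2 (G p.1.1).length) p.2)))
  · exact (Det.comp h2 Det.fst).pair Det.snd

@[fun_prop]
theorem Det.item_stmt {pub : α → Val} {it : α → Item} {y : α → ℕ} (hp : Det pub) (hi : Det it) (hy : Det y) :
    Det fun x => (it x).stmt (pub x) (y x) := by
  unfold Item.stmt
  fun_prop

theorem Det.shownShares {l : α → List (Item × Option Val)} (hl : Det l := by fun_prop) :
    Det fun x => shownShares (l x) := by
  have h : Det fun e : Item × Option Val => e.2.map fun pf => Val.pair (.num e.1.2.2) pf := by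
    have := Det.option_elim (o := fun e : Item × Option Val => e.2) (f := fun _ => (none : Option Val))
      (g := fun e pf => Option.some (Val.pair (.num e.1.2.2) pf))
    convert this using 2 with e
    cases e.2 <;> rfl
  have h2 : Det fun x => (l x).map fun e => Val.ofOption (e.2.map fun pf => .pair (.num e.1.2.2) pf) :=
    list_map (f := fun _ (e : Item × Option Val) => Val.ofOption (e.2.map fun pf => .pair (.num e.1.2.2) pf))
      (hf := val_ofOption (comp h snd))
  unfold PVSSPrivacy.shownShares
  fun_prop

theorem PP.openCall (F : Feasible E N₀ N₂ SE) {K : α → Sec} {π : α → Provers} {pub : α → Val}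
    {G : α → List Party} {v : α → Val} (hπ : PP w fun p : α × (Val × Val) => (π p.1).enc p.2)
    (hπ' : PP w fun p : α × Item => (π p.1).dec p.2) (hK : Det K := by fun_prop) (hpub : Det pub := by fun_prop)
    (hG : Det G := by fun_prop) (hv : Det v := by fun_prop) :
    PP w fun x => openCall E SE reveal (K x) (π x) (pub x) (G x) (v x) := by
  have hm := F.modulus
  refine PP.bind (PP.deal F hπ) ?_
  have h0 : PP w fun p : α × (List Item × Val) => Comp.mapC (fun it : Item =>
      bif it.1.corrupt then Comp.ret none else some <$> (π p.1).dec it) p.2.1 := by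
    refine PP.mapC (f := fun (p : α × (List Item × Val)) (it : Item) =>
      bif it.1.corrupt then Comp.ret none else some <$> (π p.1).dec it) ?_
    refine PP.bite PP.ret ?_
    exact PP.map (f := fun (p : (α × (List Item × Val)) × Item) (y : Val) => some y)
      (hπ'.comp (f := fun p : (α × (List Item × Val)) × Item => (p.1.1, p.2)))
  refine PP.map (f := fun (p : α × (List Item × Val)) (ds : List (Option Val)) =>
    ((Val.ofList [.ofList (p.2.1.map fun it => it.2.1), p.2.2,
        if reveal then shownShares (p.2.1.zip ds) else .num 0],
      ((v p.1).snd.toNat % par.modulus (K p.1), p.2.1.zip ds)) : Val × Sess)) h0 (hf := ?_)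
  have h1 : Det fun p : (α × (List Item × Val)) × List (Option Val) => p.1.2.1.map fun it => it.2.1 :=
    Det.list_map (f := fun _ (it : Item) => it.2.1)
  have h2 : Det fun p : (α × (List Item × Val)) × List (Option Val) => shownShares (p.1.2.1.zip p.2) :=
    Det.shownShares
  cases reveal <;> simp only [if_true, Bool.false_eq_true, if_false] <;> fun_prop

theorem Det.passing (F : Feasible E N₀ N₂ SE) {K : α → Sec} {pub v : α → Val} {l : α → List (Item × Option Val)}
    (hK : Det K := by fun_prop) (hpub : Det pub := by fun_prop) (hv : Det v := by fun_prop)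
    (hl : Det l := by fun_prop) :
    Det fun x => passing N₂ (K x) par (pub x) (v x) (l x) := by
  have hm := F.modulus
  have hver := F.ver₂
  have h1 := range_length hl
  have h2 : Det fun p : α × ((Item × Option Val) × ℕ) =>
      contribution (K p.1) par (v p.1) p.2.1 p.2.2 := by
    exact Det.option_elim (o := fun p : α × ((Item × Option Val) × ℕ) => p.2.1.2)
      (f := fun p => (((v p.1).snd.get p.2.2).fst.toNat % par.modulus (K p.1), ((v p.1).snd.get p.2.2).snd))
      (g := fun p pf => (p.2.1.1.2.2, pf))
  refine list_filter (f := fun x (e : Item × (ℕ × Val)) =>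
    N₂.verF (K x, .ofList [(pub x).get 3, e.1.stmt (pub x) e.2.1, e.2.2])) (hl := ?_)
  exact list_map (f := fun x (e : (Item × Option Val) × ℕ) => (e.1.1, contribution (K x) par (v x) e.1 e.2))

theorem Det.closeCall (F : Feasible E N₀ N₂ SE) {K : α → Sec} {pub : α → Val} {a : α → Val × Option Sess}
    (hK : Det K := by fun_prop) (hpub : Det pub := by fun_prop) (ha : Det a := by fun_prop) :
    Det fun x => closeCall N₂ (K x) par (pub x) (a x) := by
  have ht := F.thr
  refine Det.option_elim (o := fun x => (a x).2) (f := fun _ => ((Val.num 0, none) : Val × Option (Val × Val)))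
    (g := fun x (ss : Sess) =>
      (if (PVSSPrivacy.passing N₂ (K x) par (pub x) (a x).1 ss.2).length ≤ par.thr (K x) then Val.ofOption none
        else .ofOption (Option.some (Val.num ss.1)),
      (((PVSSPrivacy.passing N₂ (K x) par (pub x) (a x).1 ss.2).filter fun e => !decide (e.2.1 = e.1.2.2)).head?).map fun e =>
        (e.1.stmt (pub x) e.2.1, e.2.2))) (hg := ?_)
  have hp : Det fun p : α × Sess => PVSSPrivacy.passing N₂ (K p.1) par (pub p.1) (a p.1).1 p.2.2 :=
    Det.passing F
  have h1 := list_length hp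
  have h2 : Det fun p : α × Sess => ((PVSSPrivacy.passing N₂ (K p.1) par (pub p.1) (a p.1).1 p.2.2).filter
      fun e => !decide (e.2.1 = e.1.2.2)).head? :=
    list_head? (list_filter (f := fun _ (e : Item × (ℕ × Val)) => !decide (e.2.1 = e.1.2.2)))
  have h3 : Det fun p : α × Sess => (((PVSSPrivacy.passing N₂ (K p.1) par (pub p.1) (a p.1).1 p.2.2).filter
      fun e => !decide (e.2.1 = e.1.2.2)).head?).map fun e => (e.1.stmt (pub p.1) e.2.1, e.2.2) := by
    have := Det.option_elim (f := fun _ => (none : Option (Val × Val)))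
      (g := fun (p : α × Sess) (e : Item × (ℕ × Val)) => Option.some (e.1.stmt (pub p.1) e.2.1, e.2.2)) (ho := h2)
    convert this using 2 with p
    cases ((PVSSPrivacy.passing N₂ (K p.1) par (pub p.1) (a p.1).1 p.2.2).filter
      fun e => !decide (e.2.1 = e.1.2.2)).head? <;> rfl
  fun_prop

@[fun_prop]
theorem Det.pubKeys {G : α → List Party} (hG : Det G) : Det fun x => pubKeys (G x) := by
  have h : Det fun x => (G x).map fun q => Val.ofList [.num q.idx, q.pk, q.proof] :=
    list_map (f := fun _ (q : Party) => Val.ofList [.num q.idx, q.pk, q.proof])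
  unfold PVSSPrivacy.pubKeys
  fun_prop

@[fun_prop]
theorem Det.corruptFlag {v : α → Val} {i : α → ℕ} (hv : Det v) (hi : Det i) :
    Det fun x => corruptFlag (v x) (i x) := by
  have := val_get hv hi
  unfold PVSSPrivacy.corruptFlag
  fun_prop

theorem PP.keyStage (F : Feasible E N₀ N₂ SE) (hA : A.PPT) {K : α → Sec} {π : α → Provers} {pub : α → Val}
    {pks : α → List Val} (hπ : PP w fun p : α × (ℕ × Val) => (π p.1).key p.2) (hK : Det K := by fun_prop)
    (hpub : Det pub := by fun_prop) (hpks : Det pks := by fun_prop) :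
    PP w fun x => keyStage (par := par) N₀ A (K x) (π x) (pub x) (pks x) := by
  have ht := F.thr
  have hver := F.ver₀
  refine PP.bind (hA.1.pp.of_zero.comp (f := fun x => (K x, pub x))) ?_
  have h1 : Det fun p : α × Val => (List.range (par.count (K p.1))).filter fun i => corruptFlag p.2.fst i :=
    Det.list_filter (f := fun (p : α × Val) i => corruptFlag p.2.fst i)
      (hl := Det.range_count F)
  have h2 := Det.list_length h1
  refine PP.ite PP.ret (PP.bind (hA.2.1.pp.of_zero.comp
    (f := fun p : α × Val => (K p.1, p.2.snd))) ?_)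
  have h3 : PP w fun p : (α × Val) × Val => Comp.mapC (fun i => bif corruptFlag p.1.2.fst i then
          Comp.ret (Party.mk i true (p.2.fst.get i).fst (.num 0) (p.2.fst.get i).snd)
        else (fun pf => Party.mk i false ((pks p.1.1).getD i (.num 0)) (.num 0) pf) <$>
          (π p.1.1).key (i, (pks p.1.1).getD i (.num 0))) (List.range (par.count (K p.1.1))) := by
    refine PP.mapC (f := fun (p : (α × Val) × Val) i => bif corruptFlag p.1.2.fst i then
          Comp.ret (Party.mk i true (p.2.fst.get i).fst (.num 0) (p.2.fst.get i).snd)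
        else (fun pf => Party.mk i false ((pks p.1.1).getD i (.num 0)) (.num 0) pf) <$>
          (π p.1.1).key (i, (pks p.1.1).getD i (.num 0))) ?_ (hl := Det.range_count F)
    refine PP.bite PP.ret ?_
    refine PP.map (f := fun (q : ((α × Val) × Val) × ℕ) pf =>
      Party.mk q.2 false ((pks q.1.1.1).getD q.2 (.num 0)) (.num 0) pf) (hπ.comp
      (f := fun q : ((α × Val) × Val) × ℕ => (q.1.1.1, (q.2, (pks q.1.1.1).getD q.2 (.num 0))))) (hf := ?_)
    fun_prop
  refine PP.map (f := fun (p : (α × Val) × Val) (ps : List Party) => some (p.2.snd, ps.filter fun q =>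
        N₀.verF (K p.1.1, .ofList [(pub p.1.1).get 1, .pair ((pub p.1.1).get 0) q.pk, q.proof]))) h3 (hf := ?_)
  have h4 : Det fun r : ((α × Val) × Val) × List Party => r.2.filter fun q =>
      N₀.verF (K r.1.1.1, .ofList [(pub r.1.1.1).get 1, .pair ((pub r.1.1.1).get 0) q.pk, q.proof]) :=
    Det.list_filter (f := fun (r : ((α × Val) × Val) × List Party) (q : Party) =>
      N₀.verF (K r.1.1.1, .ofList [(pub r.1.1.1).get 1, .pair ((pub r.1.1.1).get 0) q.pk, q.proof]))
  fun_prop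

theorem PP.attackStage (F : Feasible E N₀ N₂ SE) (hA : A.PPT) {K : α → Sec} {π : α → Provers} {pub : α → Val}
    {o : α → Val × List Party} (hπ : PP w fun p : α × (Val × Val) => (π p.1).enc p.2)
    (hπ' : PP w fun p : α × Item => (π p.1).dec p.2) (hK : Det K := by fun_prop) (hpub : Det pub := by fun_prop)
    (ho : Det o := by fun_prop) :
    PP w fun x => attackStage E N₂ SE A reveal (K x) (π x) (pub x) (o x) :=
  PP.handle_twoPhase hA.2.2.1 (o₀ := fun p : α × Val => PVSSPrivacy.openCall E SE reveal (K p.1) (π p.1) (pub p.1) (o p.1).2 p.2)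
    (o₁ := fun p : α × (Val × Option Sess) => closeCall N₂ (K p.1) par (pub p.1) p.2)
    (PP.openCall F
      (hπ.comp (f := fun q : (α × Val) × (Val × Val) => (q.1.1, q.2)))
      (hπ'.comp (f := fun q : (α × Val) × Item => (q.1.1, q.2))))
    (h₁ := Det.closeCall F) (he := Det.id')

theorem Det.challengeSecret (F : Feasible E N₀ N₂ SE) {K : α → Sec} {b : Bool} {u : α → Val}
    (hK : Det K := by fun_prop) (hu : Det u := by fun_prop) :
    Det fun x => challengeSecret par (K x) b (u x) := by
  have := F.modulus
  have := val_get hu (const (if b then 1 else 0))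
  unfold PVSSPrivacy.challengeSecret
  fun_prop

theorem PP.guessStage (F : Feasible E N₀ N₂ SE) (hA : A.PPT) {b : Bool} {K : α → Sec} {π : α → Provers}
    {pub : α → Val} {G : α → List Party} {u : α → Val} (hπ : PP w fun p : α × (Val × Val) => (π p.1).enc p.2)
    (hK : Det K := by fun_prop) (hpub : Det pub := by fun_prop) (hG : Det G := by fun_prop)
    (hu : Det u := by fun_prop) :
    PP w fun x => guessStage E SE A b (K x) (π x) (pub x) (G x) (u x) := by
  refine PP.bind (PP.deal F (hs := Det.challengeSecret F) hπ) ?_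
  have h : Det fun p : α × (List Item × Val) => p.2.1.map fun it => it.2.1 :=
    Det.list_map (f := fun _ (it : Item) => it.2.1)
  exact hA.2.2.2.pp.of_zero.comp (f := fun p : α × (List Item × Val) =>
    (K p.1, .ofList [(u p.1).get 2, .ofList (p.2.1.map fun it => it.2.1), p.2.2]))

/-- The game is a polynomial-time computation if the provers are. -/
theorem PP.game (F : Feasible E N₀ N₂ SE) (hA : A.PPT) {b : Bool} {K : α → Sec} {π : α → Provers}
    {pub : α → Val} {pks : α → List Val} (hπ₀ : PP w fun p : α × (ℕ × Val) => (π p.1).key p.2)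
    (hπ₁ : PP w fun p : α × (Val × Val) => (π p.1).enc p.2) (hπ₂ : PP w fun p : α × Item => (π p.1).dec p.2)
    (hK : Det K := by fun_prop) (hpub : Det pub := by fun_prop) (hpks : Det pks := by fun_prop) :
    PP w fun x => game E N₀ N₂ SE A reveal b (K x) (π x) (pub x) (pks x) := by
  refine PP.bind (PP.keyStage F hA hπ₀) (PP.option_elim PP.ret ?_)
  refine PP.bind (PP.attackStage F hA (K := fun p : (α × Option (Val × List Party)) × (Val × List Party) => K p.1.1)
    (π := fun p => π p.1.1) (pub := fun p => pub p.1.1) (o := fun p => p.2) (hπ₁.comp (f := fun q :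
      ((α × Option (Val × List Party)) × (Val × List Party)) × (Val × Val) => (q.1.1.1, q.2)))
      (hπ₂.comp (f := fun q :
      ((α × Option (Val × List Party)) × (Val × List Party)) × Item => (q.1.1.1, q.2)))) ?_
  refine PP.map (f := fun (p : ((α × Option (Val × List Party)) × (Val × List Party)) ×
    (Val × (Option Sess × Option (Val × Val)))) (g : Val) => (g, (p.2.2.2, p.1.2.2))) ?_
  exact PP.guessStage F hA (K := fun p : ((α × Option (Val × List Party)) × (Val × List Party)) ×
    (Val × (Option Sess × Option (Val × Val))) => K p.1.1.1) (π := fun p => π p.1.1.1)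
    (pub := fun p => pub p.1.1.1) (G := fun p => p.1.2.2) (u := fun p => p.2.1)
    (hπ₁.comp (f := fun q : (((α × Option (Val × List Party)) × (Val × List Party)) ×
      (Val × (Option Sess × Option (Val × Val)))) × (Val × Val) => (q.1.1.1.1, q.2)))

end

/-! ### Exchanging provers in the game -/

namespace Comp

variable {α β : Type}

theorem Bounded.exec_eq {c : Comp (Val × ℕ)} {l : ℕ} {T : ℕ → ℕ} (h : c.Bounded 0 l T) (d : D.State) :
    c.exec D O d () = c.exec D O' d () := by
  induction c generalizing d with
  | ret a => rfl
  | rand n f ih | device v f ih => simp only [Comp.exec, fun i => ih i (h i)]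
  | query v f ih => exact absurd h.1 (lt_irrefl _)

theorem Rel.of_all {B : α → Prop} {c c' : Comp α} (h : c.All B) (h' : c'.All B) : Rel D O O' B c c' := by
  intro d u hu
  rw [(PMF.apply_eq_zero_iff _ _).2 fun hu' => hu (h.exec D O hu'),
    (PMF.apply_eq_zero_iff _ _).2 fun hu' => hu (h'.exec D O' hu')]

end Comp

open PVSSPrivacy.Comp

theorem Code.PPT.rel {c : Code} (h : c.PPT) {B : Val → Prop} (p : Sec × Val) :
    Rel D O O' B (c.call p) (c.call p) := by
  obtain ⟨P, h⟩ := h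
  intro d u _
  rw [Code.call, Code.sem, Comp.exec_map, Comp.exec_map, (h p.1.k p.2).exec_eq]

/-- The computation `SE` samples the randomness of encryption. -/
def Samples (E : PKE par) (SE : Sec × Val → Comp Val) : Prop :=
  ∀ (p : Sec × Val) (D : Device) (O : Oracle), Is D O (SE p) (E.sampleEnc p.1.k p.2)

/-- The distribution of the coefficients for sharing. -/
def coeffsPMF (par : Params) (K : Sec) : PMF (List ℕ) :=
  mapAll (fun _ => (PMF.uniformOfFintype (Fin (par.modulus K - 1 + 1))).map fun i => i.val)
    (List.range (par.thr K))

theorem coeffs_is (K : Sec) : Is D O (coeffs par K) (coeffsPMF par K) :=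
  Is.mapC _ fun _ _ => Is.map (Is.rand _) _

theorem coeffs_sup (K : Sec) : (coeffs par K).Sup D O fun cs => cs.length = par.thr K :=
  (Sup.mapC (p := fun _ _ => True) fun _ _ => sup_true _).imp fun _ hcs => by
    rw [← hcs.length_eq, List.length_range]

theorem Samples.is (h : Samples E SE) (K : Sec) (pp : Val) (G : List Party) :
    Is D O (Comp.mapC (fun _ => SE (K, pp)) G) (mapAll (fun _ => E.sampleEnc K.k pp) G) :=
  Is.mapC _ fun _ _ => h _ _ _

theorem Samples.sup (h : Samples E SE) (K : Sec) (pp : Val) (G : List Party) :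
    (Comp.mapC (fun _ => SE (K, pp)) G).Sup D O fun rs =>
      rs.length = G.length ∧ ∀ r ∈ rs, r ∈ E.randEnc K.k pp := by
  refine (Sup.mapC (p := fun _ r => r ∈ E.randEnc K.k pp) fun i _ =>
    (h _ _ _).sup fun r hr => E.sampleEnc_mem _ _ hr).imp fun cs hcs => ⟨hcs.length_eq.symm, ?_⟩
  intro c hc
  obtain ⟨i, hi, rfl⟩ := List.mem_iff_getElem.1 hc
  exact hcs.get (by rw [hcs.length_eq]; exact hi) hi

/-- Coefficients and randomness that occur in an honest sharing. -/
structure Dealt (E : PKE par) (K : Sec) (pub : Val) (G : List Party) (cs : List ℕ) (rs : List Val) : Prop where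
  length_cs : cs.length = par.thr K
  length_rs : rs.length = G.length
  mem : ∀ r ∈ rs, r ∈ E.randEnc K.k (pub.get 0)

theorem deal_sup (hSE : Samples E SE) (K : Sec) (π : Provers) (pub : Val) (G : List Party) (s : ℕ) :
    (deal E SE K π pub G s).Sup D O fun tr => ∃ cs rs, Dealt E K pub G cs rs ∧
      tr.1 = encShares E K pub G (shareList par K s cs G.length) rs :=
  (coeffs_sup K).bind fun cs hcs => (hSE.sup K _ G).bind fun rs hrs => Sup.map <|
    (sup_true _).imp fun _ _ => ⟨cs, rs, ⟨hcs, hrs.1, hrs.2⟩, rfl⟩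

theorem deal_rel (hSE : Samples E SE) {K : Sec} {π π' : Provers} {pub : Val} {G : List Party} {s : ℕ}
    (h : ∀ cs rs, Dealt E K pub G cs rs → Rel D O O' (fun _ => False)
      (π.enc (sharingStmt par K pub (encShares E K pub G (shareList par K s cs G.length) rs),
        sharingWit (shareList par K s cs G.length) rs))
      (π'.enc (sharingStmt par K pub (encShares E K pub G (shareList par K s cs G.length) rs),
        sharingWit (shareList par K s cs G.length) rs))) :
    Rel D O O' (fun _ => False) (deal E SE K π pub G s) (deal E SE K π' pub G s) :=
  (Rel.of_is (coeffs_is K) (coeffs_is K)).bind_same (coeffs_sup K) fun cs hcs =>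
    (Rel.of_is (hSE.is K _ G) (hSE.is K _ G)).bind_same (hSE.sup K _ G) fun rs hrs =>
      (h cs rs ⟨hcs, hrs.1, hrs.2⟩).bind_same (sup_true _) fun _ _ => Rel.ret _

/-- An item of an honest sharing for `G`. -/
structure Honest (E : PKE par) (K : Sec) (pub : Val) (G : List Party) (it : Item) : Prop where
  mem : it.1 ∈ G
  lt : it.2.2 < par.modulus K
  enc : ∃ r ∈ E.randEnc K.k (pub.get 0), it.2.1 = E.encF (K, .ofList [pub.get 0, it.1.pk, .num it.2.2, r])

theorem Dealt.honest {K : Sec} {pub : Val} {G : List Party} {cs : List ℕ} {rs : List Val} {s : ℕ}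
    (h : Dealt E K pub G cs rs) {it : Item}
    (hit : it ∈ encShares E K pub G (shareList par K s cs G.length) rs) : Honest E K pub G it := by
  obtain ⟨⟨q, y, r⟩, he, rfl⟩ := List.mem_map.1 hit
  have h1 := (List.of_mem_zip he).1
  have h2 := List.of_mem_zip (List.of_mem_zip he).2
  refine ⟨h1, ?_, r, h.mem r h2.2, rfl⟩
  obtain ⟨i, _, rfl⟩ := List.mem_map.1 h2.1
  exact horner_lt (par.prime K.k).pos _ _ _

theorem openCall_rel (hSE : Samples E SE) {K : Sec} {π π' : Provers} {pub : Val} {G : List Party} {v : Val}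
    (h₁ : ∀ s cs rs, Dealt E K pub G cs rs → Rel D O O' (fun _ => False)
      (π.enc (sharingStmt par K pub (encShares E K pub G (shareList par K s cs G.length) rs),
        sharingWit (shareList par K s cs G.length) rs))
      (π'.enc (sharingStmt par K pub (encShares E K pub G (shareList par K s cs G.length) rs),
        sharingWit (shareList par K s cs G.length) rs)))
    (h₂ : ∀ it, Honest E K pub G it → it.1.corrupt = false → Rel D O O' (fun _ => False) (π.dec it) (π'.dec it)) :
    Rel D O O' (fun _ => False) (openCall E SE reveal K π pub G v) (openCall E SE reveal K π' pub G v) := by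
  refine (deal_rel hSE (h₁ _)).bind_same (deal_sup hSE K π pub G _) ?_
  rintro tr ⟨cs, rs, hd, htr⟩
  refine (Rel.mapC fun it hit => ?_).bind_same (sup_true _) fun _ _ => Rel.ret _
  rw [htr] at hit
  cases hc : it.1.corrupt with
  | true => exact Rel.ret _
  | false => exact (h₂ it (hd.honest hit) hc).bind_same (sup_true _) fun _ _ => Rel.ret _

/-- The properties of the list of qualified participants. -/
structure Qualified (par : Params) (N₀ : NIZK) (K : Sec) (pub : Val) (pks : List Val) (G : List Party) : Prop where
  sub : (G.map Party.idx).Sublist (List.range (par.count K))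
  pk : ∀ q ∈ G, q.corrupt = false → q.pk = pks.getD q.idx (.num 0)
  ver : ∀ q ∈ G, N₀.verF (K, .ofList [pub.get 1, .pair (pub.get 0) q.pk, q.proof]) = true
  corrupt_le : (G.filter Party.corrupt).length ≤ par.thr K

theorem Qualified.idx_lt {K : Sec} {pub : Val} {pks : List Val} {G : List Party}
    (h : Qualified par N₀ K pub pks G) {q : Party} (hq : q ∈ G) : q.idx < par.count K :=
  List.mem_range.1 (h.sub.subset (List.mem_map_of_mem hq))

theorem qualified_filter {K : Sec} {pub : Val} {pks : List Val} {C : ℕ → Bool} {ps : List Party}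
    (hC : ((List.range (par.count K)).filter C).length ≤ par.thr K)
    (h : List.Forall₂ (fun i (q : Party) => q.idx = i ∧ q.corrupt = C i ∧
      (q.corrupt = false → q.pk = pks.getD i (.num 0))) (List.range (par.count K)) ps) :
    Qualified par N₀ K pub pks (ps.filter fun q =>
      N₀.verF (K, .ofList [pub.get 1, .pair (pub.get 0) q.pk, q.proof])) := by
  have key : ∀ {l : List ℕ} {ps : List Party}, List.Forall₂ (fun i (q : Party) => q.idx = i ∧ q.corrupt = C i ∧
      (q.corrupt = false → q.pk = pks.getD i (.num 0))) l ps →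
      ps.map Party.idx = l ∧ (ps.filter Party.corrupt).length = (l.filter C).length ∧
        ∀ q ∈ ps, q.corrupt = false → q.pk = pks.getD q.idx (.num 0) := by
    intro l ps h
    induction h with
    | nil => simp
    | @cons i q l ps hq _ ih =>
      obtain ⟨rfl, h2, h3⟩ := hq
      refine ⟨by rw [List.map_cons, ih.1], ?_, ?_⟩
      · rw [List.filter_cons, List.filter_cons, h2]
        cases C q.idx <;> simp [ih.2.1]
      · intro q' hq'
        rcases List.mem_cons.1 hq' with rfl | hq'
        exacts [h3, ih.2.2 q' hq']
  obtain ⟨h1, h2, h3⟩ := key h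
  refine ⟨?_, fun q hq => h3 q (List.mem_filter.1 hq).1, fun q hq => (List.mem_filter.1 hq).2, ?_⟩
  · rw [← h1]; exact List.filter_sublist.map _
  · refine le_trans (List.Sublist.length_le ?_) (h2.le.trans hC)
    exact List.filter_sublist.filter _

theorem keyStage_sup (K : Sec) (π : Provers) (pub : Val) (pks : List Val) :
    (keyStage (par := par) N₀ A K π pub pks).Sup D O fun o => ∀ r, o = some r →
      Qualified par N₀ K pub pks r.2 := by
  refine (sup_true _).bind fun u₁ _ => ?_
  split_ifs with hC
  · exact .ret (by simp)
  · refine (sup_true _).bind fun u₂ _ => Sup.map <| (Sup.mapC (p := fun i (q : Party) => q.idx = i ∧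
      q.corrupt = corruptFlag u₁.fst i ∧ (q.corrupt = false → q.pk = pks.getD i (.num 0))) fun i _ => ?_).imp ?_
    · cases hi : corruptFlag u₁.fst i with
      | true => exact .ret (by simp)
      | false => exact Sup.map ((sup_true _).imp fun _ _ => by simp)
    · rintro ps hps r hr
      obtain rfl := Option.some.inj hr
      exact qualified_filter (not_lt.1 hC) hps

theorem keyStage_rel (hA : A.PPT) {K : Sec} {π π' : Provers} {pub : Val} {pks : List Val}
    (h : ∀ i < par.count K, Rel D O O' (fun _ => False) (π.key (i, pks.getD i (.num 0)))
      (π'.key (i, pks.getD i (.num 0)))) :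
    Rel D O O' (fun _ => False) (keyStage (par := par) N₀ A K π pub pks)
      (keyStage (par := par) N₀ A K π' pub pks) := by
  refine (hA.1.rel _).bind_same (sup_true _) fun u₁ _ => ?_
  split_ifs with hC
  · exact .ret _
  · refine (hA.2.1.rel _).bind_same (sup_true _) fun u₂ _ => (Rel.mapC fun i hi => ?_).bind_same
      (sup_true _) fun _ _ => Rel.ret _
    cases corruptFlag u₁.fst i with
    | true => exact .ret _
    | false => exact (h i (List.mem_range.1 hi)).bind_same (sup_true _) fun _ _ => Rel.ret _

theorem twoPhase_rel {S ρ : Type} {o₀ o₀' : Val → Comp (Val × S)} {o₁ : Val × Option S → Val × Option ρ}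
    (h : ∀ v, Rel D O O' (fun _ => False) (o₀ v) (o₀' v)) (s : Option S × Option ρ) (v : Val) :
    Rel D O O' (fun _ => False) (twoPhase o₀ o₁ s v) (twoPhase o₀' o₁ s v) := by
  unfold twoPhase
  split_ifs
  · exact (h v).bind_same (sup_true _) fun _ _ => Rel.ret _
  · exact Rel.ret _

/-- Provers can be exchanged in the game if they behave alike on the inputs that occur, except for
lists of qualified participants that satisfy `B`. -/
theorem game_rel (hSE : Samples E SE) (hA : A.PPT) {B : List Party → Prop} {b : Bool} {K : Sec}
    {π π' : Provers} {pub : Val} {pks : List Val}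
    (h₀ : ∀ i < par.count K, Rel D O O' (fun _ => False) (π.key (i, pks.getD i (.num 0)))
      (π'.key (i, pks.getD i (.num 0))))
    (h₁ : ∀ G, Qualified par N₀ K pub pks G → ¬ B G → ∀ s cs rs, Dealt E K pub G cs rs →
      Rel D O O' (fun _ => False)
      (π.enc (sharingStmt par K pub (encShares E K pub G (shareList par K s cs G.length) rs),
        sharingWit (shareList par K s cs G.length) rs))
      (π'.enc (sharingStmt par K pub (encShares E K pub G (shareList par K s cs G.length) rs),
        sharingWit (shareList par K s cs G.length) rs)))
    (h₂ : ∀ G, Qualified par N₀ K pub pks G → ∀ it, Honest E K pub G it → it.1.corrupt = false →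
      Rel D O O' (fun _ => False) (π.dec it) (π'.dec it)) :
    Rel D O O' (fun u => B u.2.2) (game E N₀ N₂ SE A reveal b K π pub pks)
      (game E N₀ N₂ SE A reveal b K π' pub pks) := by
  refine (keyStage_rel hA h₀).bind_same (keyStage_sup K π pub pks) fun o ho => ?_
  cases o with
  | none => exact Rel.ret _
  | some o =>
    have hG := ho o rfl
    by_cases hB : B o.2
    · have hall : ∀ (c : Comp (Val × (Option Sess × Option (Val × Val)))) (f : Val → Comp Val),
          (c >>= fun u => (fun g => ((g, (u.2.2, o.2)) : Outcome)) <$> f u.1).All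
            fun u => B u.2.2 := fun c f =>
        (all_true c).bind fun u _ => (all_true _).bind fun _ _ => hB
      exact Rel.of_all (hall _ _) (hall _ _)
    · have h1 := h₁ o.2 hG hB
      refine Rel.bind_same (p := fun _ => True) ?_ (sup_true _) fun u _ => ?_
      · exact Rel.handle (B := fun _ => False) (I := fun _ => True) (fun _ _ _ => (sup_true _))
          (fun _ _ h => h.elim) (fun s v _ _ => twoPhase_rel
            (fun v => openCall_rel hSE h1 (h₂ o.2 hG)) s v) _ trivial id
      · refine Rel.bind_same (p := fun _ => True) ?_ (sup_true _) fun _ _ => Rel.ret _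
        exact (deal_rel hSE (h1 _)).bind_same (sup_true _) fun _ _ => hA.2.2.2.rel _

/-! ### Probabilities and negligible functions -/

/-- The probability of an event. -/
def pr {α : Type} (p : PMF α) (S : α → Prop) : ℝ := (p.toOuterMeasure {a | S a}).toReal

section

variable {α β γ : Type}

theorem outer_ne_top (p : PMF α) (S : Set α) : p.toOuterMeasure S ≠ ⊤ := by
  refine ne_top_of_le_ne_top ENNReal.one_ne_top ?_
  rw [PMF.toOuterMeasure_apply, ← p.tsum_coe]
  exact ENNReal.tsum_le_tsum fun a => Set.indicator_le_self _ _ a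

theorem prob_map (p : PMF α) (f : α → Bool) : prob (p.map f) = pr p fun a => f a = true := by
  rw [prob, pr, ← PMF.toOuterMeasure_apply_singleton, PMF.toOuterMeasure_map_apply]
  rfl

theorem prob_eq_pr (p : PMF Bool) : prob p = pr p fun a => a = true := by
  rw [prob, pr, ← PMF.toOuterMeasure_apply_singleton]; rfl

theorem bind_congr_support {p : PMF α} {f g : α → PMF β} (h : ∀ a ∈ p.support, f a = g a) :
    p.bind f = p.bind g := by
  ext y
  rw [PMF.bind_apply, PMF.bind_apply]
  refine tsum_congr fun a => ?_
  by_cases h0 : p a = 0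
  · rw [h0, zero_mul, zero_mul]
  · rw [h a h0]

theorem bind_ext {p : PMF α} {f g : α → PMF β} (h : ∀ a, f a = g a) : p.bind f = p.bind g := congrArg _ (funext h)

theorem pr_nonneg (p : PMF α) (S : α → Prop) : 0 ≤ pr p S := ENNReal.toReal_nonneg

theorem pr_map (p : PMF α) (f : α → β) (S : β → Prop) : pr (p.map f) S = pr p fun a => S (f a) := by
  rw [pr, pr, PMF.toOuterMeasure_map_apply]; rfl

theorem pr_mono {p : PMF α} {S T : α → Prop} (h : ∀ a ∈ p.support, S a → T a) : pr p S ≤ pr p T :=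
  ENNReal.toReal_mono (outer_ne_top _ _) (PMF.toOuterMeasure_mono _ fun a ha => h a ha.2 ha.1)

theorem pr_congr {p : PMF α} {S T : α → Prop} (h : ∀ a ∈ p.support, S a ↔ T a) : pr p S = pr p T :=
  le_antisymm (pr_mono fun a ha => (h a ha).1) (pr_mono fun a ha => (h a ha).2)

theorem pr_or_le (p : PMF α) (S T : α → Prop) : pr p (fun a => S a ∨ T a) ≤ pr p S + pr p T := by
  rw [pr, pr, pr, ← ENNReal.toReal_add (outer_ne_top _ _) (outer_ne_top _ _)]
  exact ENNReal.toReal_mono (ENNReal.add_ne_top.2 ⟨outer_ne_top _ _, outer_ne_top _ _⟩)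
    (MeasureTheory.measure_union_le _ _)

theorem pr_false (p : PMF α) : pr p (fun _ => False) = 0 := by simp [pr]

theorem pr_le_of_never {p : PMF α} {S : α → Prop} (h : ∀ a ∈ p.support, ¬ S a) {r : ℝ} (hr : 0 ≤ r) : pr p S ≤ r :=
  (pr_mono (T := fun _ => False) h).trans ((pr_false p).trans_le hr)

/-- A conditional estimate. -/
theorem pr_bind_le {p : PMF α} {f : α → PMF β} {g : α → PMF γ} {S : β → Prop} {T : γ → Prop} {c : ℕ}
    (h : ∀ a ∈ p.support, pr (f a) S ≤ c * pr (g a) T) : pr (p.bind f) S ≤ c * pr (p.bind g) T := by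
  have h' : ∀ a ∈ p.support, (f a).toOuterMeasure {a | S a} ≤ c * (g a).toOuterMeasure {a | T a} := by
    intro a ha
    have := h a ha
    rw [pr, pr, ← ENNReal.toReal_natCast, ← ENNReal.toReal_mul,
      ENNReal.toReal_le_toReal (outer_ne_top _ _) (ENNReal.mul_ne_top (ENNReal.natCast_ne_top _) (outer_ne_top _ _))] at this
    exact this
  rw [pr, pr, ← ENNReal.toReal_natCast, ← ENNReal.toReal_mul,
      ENNReal.toReal_le_toReal (outer_ne_top _ _) (ENNReal.mul_ne_top (ENNReal.natCast_ne_top _) (outer_ne_top _ _)),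
      PMF.toOuterMeasure_bind_apply, PMF.toOuterMeasure_bind_apply, ← ENNReal.tsum_mul_left]
  refine ENNReal.tsum_le_tsum fun a => ?_
  by_cases ha : p a = 0
  · simp [ha]
  · calc p a * (f a).toOuterMeasure {a | S a} ≤ p a * (c * (g a).toOuterMeasure {a | T a}) :=
        mul_le_mul_right (h' a ha) _
      _ = c * (p a * (g a).toOuterMeasure {a | T a}) := by ring

theorem pr_bind_const_le {p : PMF α} {f : α → PMF β} {S : β → Prop} {T : α → Prop}
    (h : ∀ a ∈ p.support, ∀ b ∈ (f a).support, S b → T a) : pr (p.bind f) S ≤ pr p T := by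
  have h1 : pr (p.bind f) S ≤ (1 : ℕ) * pr (p.bind fun a => (PMF.pure a)) T := by
    refine pr_bind_le fun a ha => ?_
    rw [Nat.cast_one, one_mul]
    by_cases hT : T a
    · have e : pr (PMF.pure a) T = 1 := by
        have : {x | T x} ∩ (PMF.pure a).support = {a} := by
          ext x; simp only [PMF.support_pure, Set.mem_inter_iff, Set.mem_ofPred_eq, Set.mem_singleton_iff]
          exact ⟨fun h => h.2, fun h => ⟨h ▸ hT, h⟩⟩
        rw [pr, ← PMF.toOuterMeasure_apply_inter_support, this, PMF.toOuterMeasure_apply_singleton]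
        simp
      rw [e, pr]
      refine ENNReal.toReal_le_of_le_ofReal zero_le_one ?_
      rw [PMF.toOuterMeasure_apply, ENNReal.ofReal_one, ← (f a).tsum_coe]
      exact ENNReal.tsum_le_tsum fun b => Set.indicator_le_self _ _ b
    · have : pr (f a) S ≤ pr (f a) fun _ => False := pr_mono fun b hb hS => hT (h a ha b hb hS)
      rw [pr_false] at this
      exact this.trans (pr_nonneg _ _)
  simpa [PMF.bind_pure] using h1

/-- Two distributions that agree off `B` assign almost the same probability to every event. -/
theorem abs_pr_sub_le {p q : PMF α} {B : α → Prop} (h : ∀ a, ¬ B a → p a = q a) (S : α → Prop) :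
    |pr p S - pr q S| ≤ pr p B := by
  have key : ∀ (p q : PMF α), (∀ a, ¬ B a → p a = q a) → pr p S ≤ pr q S + pr p B := by
    intro p q h
    have h1 : pr p (fun a => S a ∧ ¬ B a) = pr q fun a => S a ∧ ¬ B a := by
      rw [pr, pr, PMF.toOuterMeasure_apply, PMF.toOuterMeasure_apply]
      congr 2; funext a
      by_cases ha : S a ∧ ¬ B a
      · rw [Set.indicator_of_mem (by exact ha), Set.indicator_of_mem (by exact ha), h a ha.2]
      · rw [Set.indicator_of_notMem (by exact ha), Set.indicator_of_notMem (by exact ha)]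
    calc pr p S ≤ pr p (fun a => (S a ∧ ¬ B a) ∨ B a) := pr_mono fun a _ ha => by tauto
      _ ≤ pr p (fun a => S a ∧ ¬ B a) + pr p B := pr_or_le _ _ _
      _ ≤ pr q S + pr p B := by rw [h1]; gcongr; exact pr_mono fun a _ ha => ha.1
  have hB : pr q B = pr p B := by
    have : ∀ p : PMF α, p.toOuterMeasure {a | B a} + p.toOuterMeasure {a | ¬ B a} = 1 := by
      intro p
      rw [PMF.toOuterMeasure_apply, PMF.toOuterMeasure_apply, ← ENNReal.tsum_add, ← p.tsum_coe]
      refine tsum_congr fun a => ?_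
      exact Set.indicator_self_add_compl_apply {a | B a} p a
    have h1 : p.toOuterMeasure {a | ¬ B a} = q.toOuterMeasure {a | ¬ B a} := by
      rw [PMF.toOuterMeasure_apply, PMF.toOuterMeasure_apply]
      congr 1; funext a
      by_cases ha : B a
      · rw [Set.indicator_of_notMem (by simpa using ha), Set.indicator_of_notMem (by simpa using ha)]
      · rw [Set.indicator_of_mem (by exact ha), Set.indicator_of_mem (by exact ha), h a ha]
    have h2 := (this p).trans (this q).symm
    rw [h1] at h2
    rw [pr, pr, (ENNReal.add_left_inj (outer_ne_top _ _)).1 h2]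
  rw [abs_sub_le_iff]
  have h1 := key p q h
  have h2 := key q p fun a ha => (h a ha).symm
  rw [hB] at h2
  constructor <;> linarith

/-- The version for distributions that depend on a random context. -/
theorem abs_pr_bind_sub_le {p : PMF α} {F G : α → PMF β} {B : α → β → Prop}
    (h : ∀ a ∈ p.support, ∀ b, ¬ B a b → F a b = G a b) (S : α → β → Prop) :
    |pr (p.bind fun a => (F a).map (Prod.mk a)) (fun u => S u.1 u.2) -
      pr (p.bind fun a => (G a).map (Prod.mk a)) (fun u => S u.1 u.2)| ≤
      pr (p.bind fun a => (F a).map (Prod.mk a)) fun u => B u.1 u.2 := by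
  have e : ∀ (F : α → PMF β) a b, (p.bind fun a => (F a).map (Prod.mk a)) (a, b) = p a * F a b := by
    intro F a b
    rw [PMF.bind_apply, tsum_eq_single a]
    · congr 1
      rw [PMF.map_apply, tsum_eq_single b]
      · simp
      · intro b' hb'; simp [Ne.symm hb']
    · intro a' ha'
      rw [PMF.map_apply]
      simp [Ne.symm ha']
  refine abs_pr_sub_le (fun u hu => ?_) _
  obtain ⟨a, b⟩ := u
  rw [e, e]
  by_cases ha : p a = 0
  · rw [ha, zero_mul, zero_mul]
  · rw [h a ha b hu]

theorem pr_uniform {n : ℕ} {S : Fin (n + 1) → Prop} {i : Fin (n + 1)} (hi : S i) :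
    1 ≤ ((n + 1 : ℕ) : ℝ) * pr (PMF.uniformOfFintype (Fin (n + 1))) S := by
  have h1 : (PMF.uniformOfFintype (Fin (n + 1))).toOuterMeasure {i} ≤
      (PMF.uniformOfFintype (Fin (n + 1))).toOuterMeasure {a | S a} :=
    MeasureTheory.measure_mono fun a ha => by rw [Set.mem_singleton_iff.1 ha]; exact hi
  have h2 := ENNReal.toReal_mono (outer_ne_top _ _) h1
  rw [PMF.toOuterMeasure_apply_singleton, PMF.uniformOfFintype_apply, ENNReal.toReal_inv,
    Fintype.card_fin, ENNReal.toReal_natCast] at h2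
  have h3 : (0 : ℝ) < ((n + 1 : ℕ) : ℝ) := by positivity
  calc (1 : ℝ) = ((n + 1 : ℕ) : ℝ) * ((n + 1 : ℕ) : ℝ)⁻¹ := (mul_inv_cancel₀ h3.ne').symm
    _ ≤ _ := mul_le_mul_of_nonneg_left h2 h3.le

theorem pr_le_one (p : PMF α) (S : α → Prop) : pr p S ≤ 1 := by
  refine ENNReal.toReal_le_of_le_ofReal zero_le_one ?_
  rw [PMF.toOuterMeasure_apply, ENNReal.ofReal_one, ← p.tsum_coe]
  exact ENNReal.tsum_le_tsum fun b => Set.indicator_le_self _ _ b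

/-! ### Independent samples -/

theorem mapAll_nil (f : α → PMF β) : mapAll f [] = PMF.pure [] := rfl

theorem mapAll_cons (f : α → PMF β) (a : α) (l : List α) :
    mapAll f (a :: l) = (f a).bind fun b => (mapAll f l).bind fun bs => PMF.pure (b :: bs) := rfl

theorem mapAll_congr {f g : α → PMF β} {l : List α} (h : ∀ a ∈ l, f a = g a) : mapAll f l = mapAll g l := by
  induction l with
  | nil => rfl
  | cons a l ih => rw [mapAll_cons, mapAll_cons, h a (by simp), ih fun a ha => h a (by simp [ha])]

theorem mapAll_map (f : α → PMF β) (g : β → γ) (l : List α) :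
    mapAll (fun a => (f a).map g) l = (mapAll f l).map (List.map g) := by
  induction l with
  | nil => rw [mapAll_nil, mapAll_nil, PMF.pure_map, List.map_nil]
  | cons a l ih =>
    simp only [mapAll_cons, ih, PMF.map_bind, PMF.bind_map, PMF.pure_map, List.map_cons]; rfl

theorem mapAll_list_map (f : β → PMF γ) (g : α → β) (l : List α) :
    mapAll f (l.map g) = mapAll (fun a => f (g a)) l := by
  induction l with
  | nil => rfl
  | cons a l ih => rw [List.map_cons, mapAll_cons, mapAll_cons, ih]

theorem mapAll_support {f : α → PMF β} {l : List α} {bs : List β} (h : bs ∈ (mapAll f l).support) :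
    List.Forall₂ (fun a b => b ∈ (f a).support) l bs := by
  induction l generalizing bs with
  | nil =>
    rw [mapAll_nil, PMF.support_pure, Set.mem_singleton_iff] at h
    subst h; exact .nil
  | cons a l ih =>
    simp only [mapAll_cons, PMF.mem_support_bind_iff, PMF.support_pure, Set.mem_singleton_iff] at h
    obtain ⟨b, hb, bs', hbs, rfl⟩ := h
    exact .cons hb (ih hbs)

theorem pr_mapAll_le (f : α → PMF β) (S : β → Prop) {c : ℝ} (h : ∀ a, pr (f a) S ≤ c) (l : List α) :
    pr (mapAll f l) (fun bs => ∃ b ∈ bs, S b) ≤ l.length * c := by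
  induction l with
  | nil =>
    rw [mapAll_nil]
    refine (pr_mono (T := fun _ => False) fun a ha => ?_).trans (by rw [pr_false]; simp)
    rw [PMF.support_pure, Set.mem_singleton_iff] at ha
    subst ha; simp
  | cons a l ih =>
    have e : mapAll f (a :: l) = ((f a).bind fun b => (mapAll f l).map (Prod.mk b)).map
        fun u => u.1 :: u.2 := by
      simp only [mapAll_cons, PMF.map_bind, PMF.map_comp]; rfl
    have e2 : (f a).bind (fun b => (mapAll f l).map (Prod.mk b)) =
        (mapAll f l).bind fun bs => (f a).map fun b => (b, bs) := by
      simp only [PMF.map]; exact PMF.bind_comm _ _ _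
    rw [e, pr_map]
    refine (pr_mono (T := fun u => S u.1 ∨ ∃ b ∈ u.2, S b) fun u _ hu => by simpa using hu).trans
      ((pr_or_le _ _ _).trans ?_)
    have h1 : pr ((f a).bind fun b => (mapAll f l).map (Prod.mk b)) (fun u => S u.1) ≤ pr (f a) S :=
      pr_bind_const_le fun b _ u hu hS => by
        rw [PMF.support_map] at hu
        obtain ⟨bs, _, rfl⟩ := hu; exact hS
    have h2 : pr ((f a).bind fun b => (mapAll f l).map (Prod.mk b)) (fun u => ∃ b ∈ u.2, S b) ≤
        pr (mapAll f l) fun bs => ∃ b ∈ bs, S b := by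
      rw [e2]
      exact pr_bind_const_le fun b _ u hu hS => by
        rw [PMF.support_map] at hu
        obtain ⟨bs, _, rfl⟩ := hu; exact hS
    have := h a
    rw [List.length_cons, Nat.cast_succ]; linarith

/-- Independent samples, of which those with the (distinct) numbers occurring in a list are used. -/
theorem mapAll_pick {δ : Type} (f : ℕ → PMF β) (idx : α → ℕ) (h : α → β → PMF δ) (d : β) {L : List ℕ}
    (hL : L.Nodup) {G : List α} (hG : (G.map idx).Sublist L) (look : List β → ℕ → β)
    (hlook : ∀ bs, bs.length = L.length → ∀ i (hi : i < L.length), look bs L[i] = bs.getD i d) :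
    (mapAll f L).bind (fun bs => mapAll (fun q => h q (look bs (idx q))) G) =
      mapAll (fun q => (f (idx q)).bind (h q)) G := by
  induction L generalizing G look with
  | nil =>
    have : G = [] := by simpa using hG
    subst this
    simp [mapAll_nil]
  | cons i L ih =>
    have hL' := List.nodup_cons.1 hL
    have hl2 : ∀ b bs, bs.length = L.length → ∀ j (hj : j < L.length), look (b :: bs) L[j] = bs.getD j d := by
      intro b bs hbs j hj
      have := hlook (b :: bs) (by simp [hbs]) (j + 1) (by simp [hj])
      simpa using this
    have hl0 : ∀ b bs, bs.length = L.length → look (b :: bs) i = b := by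
      intro b bs hbs
      have := hlook (b :: bs) (by simp [hbs]) 0 (by simp)
      simpa using this
    -- the values that `look` returns, as a function of the tail alone
    have hlk : ∀ (b : β) (bs : List β), bs.length = L.length → ∀ q : α, idx q ∈ L →
        look (b :: bs) (idx q) = look (d :: bs) (idx q) := by
      intro b bs hbs q hq
      obtain ⟨j, hj, hj'⟩ := List.mem_iff_getElem.1 hq
      rw [← hj', hl2 b bs hbs j hj, hl2 d bs hbs j hj]
    have hsup : ∀ bs ∈ (mapAll f L).support, bs.length = L.length := fun bs hbs =>
      (mapAll_support hbs).length_eq.symm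
    have ih' := fun (G : List α) (hG : (G.map idx).Sublist L) =>
      ih hL'.2 hG (fun bs => look (d :: bs)) fun bs hbs j hj => hl2 d bs hbs j hj
    rw [mapAll_cons, PMF.bind_bind]
    simp only [PMF.bind_bind, PMF.pure_bind]
    have skip : ∀ (G : List α), (G.map idx).Sublist L → ∀ b, (mapAll f L).bind (fun bs =>
        mapAll (fun q => h q (look (b :: bs) (idx q))) G) = mapAll (fun q => (f (idx q)).bind (h q)) G := by
      intro G hG b
      rw [← ih' G hG]
      refine bind_congr_support fun bs hbs => mapAll_congr fun q hq => ?_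
      rw [hlk b bs (hsup bs hbs) q (hG.subset (List.mem_map_of_mem hq))]
    generalize hM : G.map idx = M at hG
    cases hG with
    | cons _ hG =>
      subst hM
      simp only [skip G hG, PMF.bind_const]
    | @cons_cons l₁ _ _ hG =>
      obtain ⟨q, G, rfl, hq, hG'⟩ := List.map_eq_cons_iff.1 hM
      subst hG'
      rw [mapAll_cons, hq, PMF.bind_bind]
      refine bind_ext fun b => ?_
      simp only [mapAll_cons]
      rw [bind_congr_support (g := fun bs => (h q b).bind fun y => (mapAll (fun q => h q (look (b :: bs) (idx q))) G).bind
        fun ys => PMF.pure (y :: ys)) fun bs hbs => by rw [hq, hl0 b bs (hsup bs hbs)]]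
      rw [PMF.bind_comm]
      refine bind_ext fun y => ?_
      rw [← PMF.bind_bind, skip G hG b]

end

/-! ### Negligible functions -/

theorem Negl.add {f g : ℕ → ℝ} (hf : Negl f) (hg : Negl g) : Negl fun k => f k + g k :=
  Asymptotics.SuperpolynomialDecay.add hf hg

theorem Negl.mono {f g : ℕ → ℝ} (hf : Negl f) (h : ∀ k, |g k| ≤ f k) : Negl g :=
  Asymptotics.SuperpolynomialDecay.trans_abs_le hf fun k => (h k).trans (le_abs_self _)

theorem Negl.zero : Negl fun _ => 0 := by
  have : Negl (0 : ℕ → ℝ) := Asymptotics.superpolynomialDecay_zero _ _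
  exact this

theorem Negl.poly_mul {f : ℕ → ℝ} (P : ℕ[X]) (hf : Negl f) : Negl fun k => (P.eval k : ℕ) * f k := by
  have := Asymptotics.SuperpolynomialDecay.polynomial_mul hf (P.map (Nat.castRingHom ℝ))
  refine this.congr fun k => ?_
  rw [Polynomial.eval_natCast_map]; simp

theorem Close.trans {f g h : ℕ → PMF Bool} (h₁ : Close f g) (h₂ : Close g h) : Close f h := by
  refine (h₁.add h₂).mono fun k => ?_
  rw [abs_abs]
  exact abs_sub_le _ _ _

theorem Close.symm {f g : ℕ → PMF Bool} (h : Close f g) : Close g f := by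
  refine h.mono fun k => ?_
  rw [abs_abs, abs_sub_comm]

theorem Close.of_eq {f g : ℕ → PMF Bool} (h : ∀ k, f k = g k) : Close f g := by
  refine Negl.zero.mono fun k => ?_
  rw [h k]; simp

/-! ### Proof systems and zero-knowledge -/

theorem IsPPT.size_le {f : ℕ → Val → PMF Val} (h : IsPPT f) :
    ∃ P : ℕ[X], ∀ k x, ∀ y ∈ (f k x).support, y.size ≤ P.eval (k + x.size) := by
  obtain ⟨c, P, _, h⟩ := h
  refine ⟨P, fun k x y hy => ?_⟩
  rw [← (h k x).2, Code.exec_trivial, PMF.map_comp, PMF.mem_support_map_iff] at hy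
  obtain ⟨u, hu, rfl⟩ := hy
  obtain ⟨h1, h2⟩ := ((h k x).1.all_steps.and (c.run_size _)).exec _ _ hu
  exact h2.trans h1

/-- What an honest party does with a non-interactive proof system: how the reference string comes
about, together with a trapdoor, and how proofs are computed from it, given the description of the
language, the string with the trapdoor, and the statement with the witness. -/
structure ProofSystem where
  crs : ℕ → Val → PMF (Val × Val)
  prove : Sec → Val → Val × Val → Val × Val → Comp Val

/-- The algorithms of a proof system run in polynomial time. -/
def ProofSystem.Feasible (P : ProofSystem) : Prop :=
  (∃ C : Sec × Val → Comp (Val × Val), PP 0 C ∧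
    ∀ p (D : Device) (O : Oracle), Is D O (C p) (P.crs p.1.k p.2)) ∧
  (PP 0 fun a : (Sec × Val) × ((Val × Val) × (Val × Val)) => P.prove a.1.1 a.1.2 a.2.1 a.2.2) ∧
  ∀ K d c a, ∃ p, ∀ (D : Device) (O : Oracle), Is D O (P.prove K d c a) p

/-- The actual proof system; `F` computes proofs. -/
def NIZK.system (N : NIZK) (F : Sec × Val → Comp Val) : ProofSystem where
  crs k d := (N.setup k d).map fun c => (c, .num 0)
  prove K _ c a := F (K, .ofList [c.1, a.1, a.2])

/-- The simulated proof system; `F` computes simulated proofs. -/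
def Simulator.system (S : Simulator) (F : Sec × Val → Comp Val) : ProofSystem where
  crs := S.crs
  prove K _ c a := F (K, .ofList [c.1, c.2, a.1])

open Classical in
/-- A proof system that refuses to prove anything without a witness. -/
def ProofSystem.checked (L : GapLanguage) (P : ProofSystem) : ProofSystem where
  crs := P.crs
  prove K d c a := if L.R K.k d a.1 a.2 then P.prove K d c a else .ret (.num 0)

/-- The computation `F` calls the prover of `N`. -/
def NIZK.ProvedBy (N : NIZK) (F : Sec × Val → Comp Val) : Prop :=
  ∀ p (D : Device) (O : Oracle), Is D O (F p)
    (N.prove p.1.k (p.2.get 0) (p.2.get 1) (p.2.get 2))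

theorem NIZK.Efficient.exists_prover {N : NIZK} (hN : N.Efficient) : ∃ F : Sec × Val → Comp Val,
    N.ProvedBy F ∧ (N.system F).Feasible := by
  obtain ⟨C, hC, hC'⟩ := hN.1.pp
  obtain ⟨F, hF, hF'⟩ := hN.2.1.pp
  refine ⟨F, fun p D O => hF' p D _ O, ⟨fun p => (fun c => (c, .num 0)) <$> C p, ?_, ?_⟩, ?_,
    fun K d c a => ⟨_, fun D O => hF' _ D _ O⟩⟩
  · exact hC.map (f := fun _ c => (c, Val.num 0))
  · exact fun p D O => Is.map (hC' p D _ O) _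
  · exact hF.comp (f := fun a : (Sec × Val) × ((Val × Val) × (Val × Val)) =>
      (a.1.1, Val.ofList [a.2.1.1, a.2.2.1, a.2.2.2]))

theorem Simulator.Efficient.exists_prover {S : Simulator} (hS : S.Efficient) : ∃ F : Sec × Val → Comp Val,
    (∀ p (D : Device) (O : Oracle),
      Is D O (F p) (S.prove p.1.k (p.2.get 0) (p.2.get 1) (p.2.get 2))) ∧ (S.system F).Feasible := by
  obtain ⟨C, hC, hC'⟩ := hS.1.pp
  obtain ⟨F, hF, hF'⟩ := hS.2.pp
  refine ⟨F, fun p D O => hF' p D _ O, ⟨fun p => (fun c => (c.fst, c.snd)) <$> C p, ?_, ?_⟩, ?_,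
    fun K d c a => ⟨_, fun D O => hF' _ D _ O⟩⟩
  · exact hC.map (f := fun _ c => (c.fst, c.snd))
  · intro p D O
    have := Is.map (hC' p D _ O) fun c => (c.fst, c.snd)
    rw [PMF.map_comp] at this
    have e : (fun c : Val => (c.fst, c.snd)) ∘ (fun u : Val × Val => Val.pair u.1 u.2) = _root_.id := rfl
    rw [e, PMF.map_id] at this
    exact this
  · exact hF.comp (f := fun a : (Sec × Val) × ((Val × Val) × (Val × Val)) =>
      (a.1.1, Val.ofList [a.2.1.1, a.2.1.2, a.2.2.1]))

/-- Run a computation and turn its output into a bit. -/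
def runBit (D : Device) (c : Comp Val) : PMF Bool := (c.exec D noOracle D.init ()).map fun u => outBit u.1

/-- No polynomial-time game `T` that calls a prover can tell the two proof systems apart. -/
def ProofSystem.Interchangeable (D : Device) (desc : ℕ → PMF Val) (P Q : ProofSystem) : Prop :=
  ∀ T : Sec × Val → (Val × Val → Comp Val) → Comp Val,
    (∀ p : (Sec × Val) × (Val × Val) → Comp Val, PP 1 p → PP 1 fun e => T e fun a => p (e, a)) →
    (∀ e p p' (O O' : Oracle), (∀ a, Rel D O O' (fun _ => False) (p a) (p' a)) →
      Rel D O O' (fun _ => False) (T e p) (T e p')) →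
    Close
      (fun k => (desc k).bind fun d => (P.crs k d).bind fun c =>
        runBit D (T (⟨k⟩, .pair d c.1) (P.prove ⟨k⟩ d c)))
      (fun k => (desc k).bind fun d => (Q.crs k d).bind fun c =>
        runBit D (T (⟨k⟩, .pair d c.1) (Q.prove ⟨k⟩ d c)))

open Classical in
/-- The actual prover and the simulator, both refusing to prove without a witness, are
interchangeable: the game answers its own calls by queries. As programs pay for reading answers but
cannot bound them, the answers are cut off at a length that proofs never exceed. -/
theorem zk_interchangeable {D : Device} {N : NIZK} {desc : ℕ → PMF Val} {L : GapLanguage} {S : Simulator}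
    (hN : N.Efficient) (hS : S.Efficient)
    (hzk : ∀ A : Code, A.PPTOracle → Close (N.zkReal D desc L A) (NIZK.zkSim S D desc L A))
    {FN FS : Sec × Val → Comp Val}
    (hFN : N.ProvedBy FN)
    (hFS : ∀ p (D : Device) (O : Oracle),
      Is D O (FS p) (S.prove p.1.k (p.2.get 0) (p.2.get 1) (p.2.get 2))) :
    ((N.system FN).checked L).Interchangeable D desc ((S.system FS).checked L) := by
  intro T hT hrel
  obtain ⟨PN, hPN⟩ := hN.2.1.size_le
  obtain ⟨PC, hPC⟩ := hS.1.size_le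
  obtain ⟨PS, hPS⟩ := hS.2.size_le
  -- a bound on the lengths of actual and simulated proofs
  let B : ℕ[X] := PN.comp (X + 4) + PS.comp (X + PC + 4)
  have eB : ∀ n, B.eval n = PN.eval (n + 4) + PS.eval (n + PC.eval n + 4) := fun n => by simp [B, eval_comp]
  let q : (Sec × Val) × (Val × Val) → Comp Val := fun x =>
    Comp.query (Val.pair x.2.1 x.2.2) fun a => Comp.ret (clip (B.eval (sz x)) a.snd)
  have hq : PP 1 q := PP.query (q := fun x : (Sec × Val) × (Val × Val) => Val.pair x.2.1 x.2.2) B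
  obtain ⟨c, hc, hc'⟩ := (hT q hq).exists_pptOracle
  have clip0 : ∀ n, clip n (.num 0) = .num 0 := fun n => by unfold clip; split_ifs <;> rfl
  -- the oracle of the zero-knowledge game behaves like the checked prover
  have key : ∀ (k : ℕ) (d : Val) (c : Val) (p : Val × Val → PMF Val) (F : Val × Val → Comp Val)
      (O : Oracle),
      (∀ v, O () v = if L.R k d v.fst v.snd then (p (v.fst, v.snd)).map fun π => (.ofOption (some π), ())
        else pure (.ofOption none, ())) →
      (∀ a, ∀ π ∈ (p a).support, π.size ≤ B.eval (sz (((⟨k⟩, Val.pair d c), a) : (Sec × Val) × (Val × Val)))) →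
      (∀ a, Is D noOracle (F a) (p a)) → ∀ a,
      Rel D O noOracle (fun _ => False) (q ((⟨k⟩, Val.pair d c), a))
        (if L.R k d a.1 a.2 then F a else .ret (.num 0)) := by
    intro k d c p F O hO hp hF a
    refine Rel.of_is (p := if L.R k d a.1 a.2 then p a else PMF.pure (.num 0)) ?_ ?_
    · rintro d' ⟨⟩
      simp only [q, Comp.exec]
      rw [hO, Val.fst_pair, Val.snd_pair]
      split_ifs with hR
      · rw [PMF.bind_map]
        ext y
        rw [PMF.map, PMF.bind_apply, PMF.bind_apply]
        refine tsum_congr fun π => ?_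
        by_cases h0 : p a π = 0
        · rw [h0, zero_mul, zero_mul]
        · have h1 : (Val.ofOption (some π)).snd = π := rfl
          simp only [Function.comp_apply, h1]
          rw [clip_of_le (hp a π h0)]; rfl
      · have h1 : (Val.ofOption none).snd = .num 0 := rfl
        simp only [pure, PMF.pure_bind, PMF.pure_map, h1, clip0]
    · split_ifs with hR
      exacts [hF a, Is.ret _]
  have hrun : ∀ (k : ℕ) (d c' : Val) (p : Val × Val → Comp Val) (O : Oracle),
      (∀ a, Rel D O noOracle (fun _ => False) (q ((⟨k⟩, Val.pair d c'), a)) (p a)) →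
      (c.execO D O k (.pair d c') D.init ()).map (fun u => outBit u.1) = runBit D (T (⟨k⟩, .pair d c') p) := by
    intro k d c' p O h
    rw [hc', PMF.map_comp, (hrel (⟨k⟩, .pair d c') _ p O noOracle h).exec_eq]; rfl
  have hsz : ∀ (k : ℕ) (d c : Val) (a : Val × Val),
      sz (((⟨k⟩, Val.pair d c), a) : (Sec × Val) × (Val × Val)) =
        k + 2 + (d.size + c.size + 1) + 1 + (a.1.size + a.2.size + 1) + 1 := fun k d c a => by
    obtain ⟨a₁, a₂⟩ := a
    simp only [sz_pair, sz_sec, sz_val, Val.size_pair]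
  have hlist : ∀ x y z : Val, (Val.ofList [x, y, z]).size = x.size + y.size + z.size + 4 := fun x y z => by
    simp only [Val.ofList, Val.size_pair, Val.size_num, Nat.size_zero]; omega
  have main := hzk c hc
  have e1 : N.zkReal D desc L c = fun k => (desc k).bind fun d => ((N.system FN).crs k d).bind fun c =>
        runBit D (T (⟨k⟩, .pair d c.1) (((N.system FN).checked L).prove ⟨k⟩ d c)) := by
    funext k
    show (desc k).bind _ = _
    refine bind_ext fun d => ?_
    show (N.setup k d).bind _ = _
    rw [NIZK.system, PMF.bind_map]
    refine bind_ext fun cr => ?_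
    refine Eq.trans ?_ (hrun k d cr _
      (fun _ v => if L.R k d v.fst v.snd then
        (N.prove k cr v.fst v.snd).map fun π => (.ofOption (some π), ()) else pure (.ofOption none, ()))
      (key k d cr (fun a => N.prove k cr a.1 a.2) _ _ (fun v => rfl) ?_ ?_))
    · rfl
    · intro a π hπ
      have h1 := hPN k (.ofList [cr, a.1, a.2]) π hπ
      refine h1.trans ((poly_mono PN ?_).trans (by rw [eB]; exact Nat.le_add_right _ _))
      rw [hsz, hlist]; omega
    · exact fun a => hFN (⟨k⟩, .ofList [cr, a.1, a.2]) D noOracle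
  have e2 : NIZK.zkSim S D desc L c = fun k => (desc k).bind fun d => ((S.system FS).crs k d).bind fun c =>
        runBit D (T (⟨k⟩, .pair d c.1) (((S.system FS).checked L).prove ⟨k⟩ d c)) := by
    funext k
    show (desc k).bind _ = _
    refine bind_ext fun d => ?_
    show (S.crs k d).bind _ = (S.crs k d).bind _
    ext y
    rw [PMF.bind_apply, PMF.bind_apply]
    refine tsum_congr fun cr => ?_
    by_cases h0 : S.crs k d cr = 0
    · rw [h0, zero_mul, zero_mul]
    congr 1
    refine congrArg (fun p : PMF Bool => p y) ?_
    refine Eq.trans ?_ (hrun k d cr.1 _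
      (fun _ v => if L.R k d v.fst v.snd then
        (S.prove k cr.1 cr.2 v.fst).map fun π => (.ofOption (some π), ()) else pure (.ofOption none, ()))
      (key k d cr.1 (fun a => S.prove k cr.1 cr.2 a.1) _ _ (fun v => rfl) ?_ ?_))
    · rfl
    · intro a π hπ
      have h1 := hPS k (.ofList [cr.1, cr.2, a.1]) π hπ
      have h2 := hPC k d (.pair cr.1 cr.2) (by rw [PMF.support_map]; exact ⟨cr, h0, rfl⟩)
      rw [Val.size_pair] at h2
      have h3 := poly_mono PC (show k + d.size ≤ sz (((⟨k⟩, Val.pair d cr.1), a) : (Sec × Val) × (Val × Val)) by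
        rw [hsz]; omega)
      refine h1.trans ((poly_mono PS ?_).trans (by rw [eB]; exact Nat.le_add_left _ _))
      rw [hlist]; rw [hsz] at h3 ⊢; omega
    · exact fun a => hFS (⟨k⟩, .ofList [cr.1, cr.2, a.1]) D noOracle
  rwa [e1, e2] at main

/-- The proof system of a simulator: it is feasible, ignores witnesses, and is interchangeable with
the actual one. -/
theorem NIZK.MultiTheoremZK.exists_simulation {D : Device} {N : NIZK} {desc : ℕ → PMF Val} {L : GapLanguage}
    (h : N.MultiTheoremZK D desc L) (hN : N.Efficient) {FN : Sec × Val → Comp Val}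
    (hFN : N.ProvedBy FN) :
    ∃ Q : ProofSystem, Q.Feasible ∧ (∀ K d c x w w', Q.prove K d c (x, w) = Q.prove K d c (x, w')) ∧
      ((N.system FN).checked L).Interchangeable D desc (Q.checked L) := by
  obtain ⟨S, hS, hzk⟩ := h
  obtain ⟨FS, hFS, hF⟩ := hS.exists_prover
  exact ⟨S.system FS, hF, fun _ _ _ _ _ _ => rfl, zk_interchangeable hN hS hzk hFN hFS⟩

/-! ### The hybrid experiments -/

/-- The additional witness of decryption as a function of the tuple of its arguments. -/
def PKE.witF {par : Params} (E : PKE par) (a : Sec × Val) : Val :=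
  (E.dec a.1.k (a.2.get 0) (a.2.get 1) (a.2.get 2) (a.2.get 3)).2

/-- Key pairs with the randomness that produced them. -/
abbrev Keys := List ((Val × Val) × Val)

/-- The key pair at a position. -/
def Keys.at (kps : Keys) (i : ℕ) : (Val × Val) × Val := kps.getD i ((.num 0, .num 0), .num 0)

/-- The public keys in a list of key pairs. -/
def Keys.public (kps : Keys) : List Val := kps.map fun kp => kp.1.1

theorem Keys.public_getD (kps : Keys) (i : ℕ) : kps.public.getD i (.num 0) = (kps.at i).1.1 := by
  rw [Keys.public, Keys.at, ← List.getD_map (f := fun kp : (Val × Val) × Val => kp.1.1)]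

/-- The public parameters. -/
def publicParams (pp c₀ c₁ c₂ : Val) : Val := .ofList [pp, c₀, c₁, c₂]

/-- The schemes and samplers are efficient computations. -/
structure Setting {par : Params} (E : PKE par) (N₀ N₂ : NIZK) (SE : Sec × Val → Comp Val)
    (SK : Sec × Val → Comp ((Val × Val) × Val)) (Nb : ℕ[X]) : Prop extends Feasible E N₀ N₂ SE where
  samples : Samples E SE
  key : PP 0 SK
  key_is : ∀ p (D : Device) (O : Oracle), Is D O (SK p) (E.sampleKeyPair p.1.k p.2)
  wit : Det E.witF
  le : ∀ k, par.n k ≤ Nb.eval k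

theorem exists_setting {par : Params} {E : PKE par} {N₀ N₂ : NIZK} (hpar : par.Efficient) (hE : E.Efficient)
    (h₀ : N₀.Efficient) (h₂ : N₂.Efficient) : ∃ SE SK Nb, Setting E N₀ N₂ SE SK Nb := by
  obtain ⟨⟨Nb, hNb⟩, hn, ht, hp⟩ := hpar
  obtain ⟨_, hK, hS, hG, _, hEnc, hDec⟩ := hE
  obtain ⟨SK, hSK, hSK'⟩ := hK.pp
  obtain ⟨SE, hSE, hSE'⟩ := hS.pp
  have toNat : ∀ f : ℕ → ℕ, IsPoly (fun k _ => .num (f k)) → Det fun K : Sec => f K.k := fun f h => by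
    have := h.det
    have h2 : Det fun K : Sec => (K, Val.num 0) := by fun_prop
    have h3 := Det.comp this h2
    have h4 : Det fun K : Sec => (Val.num (f K.k)).toNat := by fun_prop
    exact h4
  have hver : ∀ N : NIZK, N.Efficient → Det N.verF := fun N h => by
    have h1 := h.2.2.det
    have h2 : Det fun p : Sec × Val => decide ((Val.ofBool (N.ver p.1.k (p.2.get 0) (p.2.get 1) (p.2.get 2))).toNat = 1) := by
      fun_prop
    convert h2 using 2 with p
    unfold NIZK.verF
    cases N.ver p.1.k (p.2.get 0) (p.2.get 1) (p.2.get 2) <;> simp [Val.ofBool, Val.toNat]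
  refine ⟨SE, fun p => (fun r => ((E.keyGen p.1.k p.2 r), r)) <$> SK p, Nb,
    ⟨⟨toNat _ hn, ⟨Nb, fun K => (hNb K.k).trans (poly_mono Nb ?_)⟩, toNat _ ht, toNat _ hp, hEnc.det,
      hver _ h₀, hver _ h₂, hSE⟩,
    fun p D O => hSE' p D _ O, ?_, fun p D O => Is.map (hSK' p D _ O) _, ?_, hNb⟩⟩
  · rw [sz_sec]; omega
  · have h1 := hG.det
    have h2 : Det fun p : (Sec × Val) × Val => (p.1.1, Val.ofList [p.1.2, p.2]) := by fun_prop
    have h3 := Det.comp h1 h2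
    have h4 : Det fun p : (Sec × Val) × Val => (((Val.pair (E.keyGen p.1.1.k p.1.2 p.2).1
      (E.keyGen p.1.1.k p.1.2 p.2).2).fst, (Val.pair (E.keyGen p.1.1.k p.1.2 p.2).1
      (E.keyGen p.1.1.k p.1.2 p.2).2).snd), p.2) := by
      have h3' : Det fun p : (Sec × Val) × Val => Val.pair (E.keyGen p.1.1.k p.1.2 p.2).1
        (E.keyGen p.1.1.k p.1.2 p.2).2 := h3
      fun_prop
    exact hSK.map (f := fun (p : Sec × Val) r => ((E.keyGen p.1.k p.2 r), r)) h4
  · have h1 := hDec.det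
    have h2 : Det fun p : Sec × Val => (Val.pair (par.enc (E.dec p.1.k (p.2.get 0) (p.2.get 1) (p.2.get 2) (p.2.get 3)).1)
        (E.dec p.1.k (p.2.get 0) (p.2.get 1) (p.2.get 2) (p.2.get 3)).2).snd := by fun_prop
    exact h2

theorem Det.poly_eval (P : ℕ[X]) : Det fun K : Sec => P.eval K.k := by
  induction P using Polynomial.induction_on' with
  | add p q hp hq =>
    simp only [eval_add]; fun_prop
  | monomial n a =>
    simp only [eval_monomial]
    have : Det fun K : Sec => K.k ^ n := by
      induction n with
      | zero => simp only [pow_zero]; fun_prop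
      | succ n ih => simp only [pow_succ]; fun_prop
    fun_prop

section

variable (E N₀ N₂ SE SK Nb A reveal)

/-- Sampling key pairs for all participants (and possibly more). -/
def keyPairs (K : Sec) (pp : Val) : Comp Keys := Comp.mapC (fun _ => SK (K, pp)) (List.range (Nb.eval K.k))

/-- The distribution of the key pairs. -/
def keysPMF (k : ℕ) (pp : Val) : PMF Keys := mapAll (fun _ => E.sampleKeyPair k pp) (List.range (Nb.eval k))

/-- The provers of the game, which know the witnesses, from provers for the three languages. -/
def provers (K : Sec) (pub : Val) (kps : Keys) (p₀ p₁ p₂ : Val × Val → Comp Val) : Provers where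
  key a := p₀ (.pair (pub.get 0) a.2, .pair (kps.at a.1).1.2 (kps.at a.1).2)
  enc := p₁
  dec it := p₂ (it.stmt pub it.2.2, .ofList [(kps.at it.1.idx).1.2, (kps.at it.1.idx).2,
    E.witF (K, .ofList [pub.get 0, it.1.pk, (kps.at it.1.idx).1.2, it.2.1])])

/-- The privacy game with given key pairs and provers. -/
def play (b : Bool) (K : Sec) (pub : Val) (kps : Keys) (p₀ p₁ p₂ : Val × Val → Comp Val) :
    Comp Outcome :=
  game E N₀ N₂ SE A reveal b K (provers E K pub kps p₀ p₁ p₂) pub kps.public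

/-- The random choices before the game: the parameters of encryption, key pairs, and reference
strings with trapdoors. -/
structure World where
  pp : Val
  keys : Keys
  crs₀ : Val × Val
  crs₁ : Val × Val
  crs₂ : Val × Val

/-- The public parameters. -/
def World.pub (x : World) : Val := publicParams x.pp x.crs₀.1 x.crs₁.1 x.crs₂.1

/-- The distribution of the random choices before the game. -/
def world (P₀ P₁ P₂ : ProofSystem) (k : ℕ) : PMF World :=
  (E.setup k).bind fun pp => (keysPMF E Nb k pp).bind fun kps => (P₀.crs k pp).bind fun c₀ =>
    (P₁.crs k pp).bind fun c₁ => (P₂.crs k pp).bind fun c₂ => PMF.pure ⟨pp, kps, c₀, c₁, c₂⟩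

/-- The game in a world. -/
def World.play (P₀ P₁ P₂ : ProofSystem) (b : Bool) (k : ℕ) (x : World) :
    Comp Outcome :=
  PVSSPrivacy.play E N₀ N₂ SE A reveal b ⟨k⟩ x.pub x.keys (P₀.prove ⟨k⟩ x.pp x.crs₀)
    (P₁.prove ⟨k⟩ x.pp x.crs₁) (P₂.prove ⟨k⟩ x.pp x.crs₂)

/-- The privacy game with ideal reconstruction and with given proof systems. -/
def hybrid (D : Device) (P₀ P₁ P₂ : ProofSystem) (b : Bool) (k : ℕ) : PMF Bool :=
  (world E Nb P₀ P₁ P₂ k).bind fun x =>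
    runBit D (Prod.fst <$> x.play E N₀ N₂ SE A reveal P₀ P₁ P₂ b k)

end

section

variable {α : Type} [Enc α] {w : ℕ}

@[fun_prop]
theorem Det.publicParams {f g h i : α → Val} (hf : Det f) (hg : Det g) (hh : Det h) (hi : Det i) :
    Det fun x => publicParams (f x) (g x) (h x) (i x) := by
  unfold PVSSPrivacy.publicParams
  fun_prop

@[fun_prop]
theorem Det.keys_at {f : α → Keys} {i : α → ℕ} (hf : Det f) (hi : Det i) : Det fun x => (f x).at (i x) :=
  list_getD hf hi (by fun_prop)

@[fun_prop]
theorem Det.keys_public {f : α → Keys} (hf : Det f) : Det fun x => (f x).public :=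
  list_map (f := fun _ (kp : (Val × Val) × Val) => kp.1.1)

theorem PP.keyPairs (F : Setting E N₀ N₂ SE SK Nb) {K : α → Sec} {pp : α → Val} (hK : Det K := by fun_prop)
    (hp : Det pp := by fun_prop) :
    PP w fun x => keyPairs SK Nb (K x) (pp x) := by
  refine PP.mapC (f := fun x (_ : ℕ) => SK (K x, pp x)) (F.key.of_zero.comp (f := fun p : α × ℕ => (K p.1, pp p.1))) (hl := ?_)
  refine Det.comp (g := fun K : Sec => List.range (Nb.eval K.k)) (Det.list_range (R := Nb) (Det.poly_eval Nb)
    fun K => poly_mono Nb ?_) hK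
  rw [sz_sec]; omega

theorem keyPairs_is {D : Device} {O : Oracle} (F : Setting E N₀ N₂ SE SK Nb)
    (K : Sec) (pp : Val) : Is D O (keyPairs SK Nb K pp) (keysPMF E Nb K.k pp) :=
  Is.mapC _ fun _ _ => F.key_is _ _ _

theorem PP.key_prover {p₀ : α → Val × Val → Comp Val} {K : α → Sec} {pub : α → Val} {kps : α → Keys}
    {p₁ p₂ : α → Val × Val → Comp Val} (h : PP w fun x : α × (Val × Val) => p₀ x.1 x.2)
    (hpub : Det pub := by fun_prop) (hk : Det kps := by fun_prop) :
    PP w fun x : α × (ℕ × Val) => (provers E (K x.1) (pub x.1) (kps x.1) (p₀ x.1) (p₁ x.1) (p₂ x.1)).key x.2 :=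
  h.comp (f := fun x : α × (ℕ × Val) => (x.1, (Val.pair ((pub x.1).get 0) x.2.2,
    Val.pair ((kps x.1).at x.2.1).1.2 ((kps x.1).at x.2.1).2)))

theorem PP.dec_prover (F : Setting E N₀ N₂ SE SK Nb) {p₀ p₁ p₂ : α → Val × Val → Comp Val} {K : α → Sec}
    {pub : α → Val} {kps : α → Keys} (h : PP w fun x : α × (Val × Val) => p₂ x.1 x.2)
    (hK : Det K := by fun_prop) (hpub : Det pub := by fun_prop) (hk : Det kps := by fun_prop) :
    PP w fun x : α × Item => (provers E (K x.1) (pub x.1) (kps x.1) (p₀ x.1) (p₁ x.1) (p₂ x.1)).dec x.2 := by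
  have := F.wit
  exact h.comp (f := fun x : α × Item => (x.1, (x.2.stmt (pub x.1) x.2.2.2,
    Val.ofList [((kps x.1).at x.2.1.idx).1.2, ((kps x.1).at x.2.1.idx).2,
    E.witF (K x.1, .ofList [(pub x.1).get 0, x.2.1.pk, ((kps x.1).at x.2.1.idx).1.2, x.2.2.1])])))

theorem PP.play (F : Setting E N₀ N₂ SE SK Nb) (hA : A.PPT) {b : Bool} {p₀ p₁ p₂ : α → Val × Val → Comp Val}
    {K : α → Sec} {pub : α → Val} {kps : α → Keys} (h₀ : PP w fun x : α × (Val × Val) => p₀ x.1 x.2)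
    (h₁ : PP w fun x : α × (Val × Val) => p₁ x.1 x.2) (h₂ : PP w fun x : α × (Val × Val) => p₂ x.1 x.2)
    (hK : Det K := by fun_prop) (hpub : Det pub := by fun_prop) (hk : Det kps := by fun_prop) :
    PP w fun x => play E N₀ N₂ SE A reveal b (K x) (pub x) (kps x) (p₀ x) (p₁ x) (p₂ x) :=
  PP.game F.toFeasible hA (PP.key_prover h₀) h₁ (PP.dec_prover F h₂)

theorem runBit_bind {D : Device} {β : Type} {c : Comp β} {p : PMF β} (h : Is D noOracle c p) (f : β → Comp Val) :
    runBit D (c >>= f) = p.bind fun a => runBit D (f a) := by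
  rw [runBit, bind_def, exec_bind_of_is h, PMF.map_bind]; rfl

theorem hybrid_eq (D : Device) (P₀ P₁ P₂ : ProofSystem) (b : Bool) (k : ℕ) :
    hybrid E N₀ N₂ SE Nb A reveal D P₀ P₁ P₂ b k =
      (E.setup k).bind fun pp => (keysPMF E Nb k pp).bind fun kps => (P₀.crs k pp).bind fun c₀ =>
        (P₁.crs k pp).bind fun c₁ => (P₂.crs k pp).bind fun c₂ =>
          runBit D (Prod.fst <$> play E N₀ N₂ SE A reveal b ⟨k⟩ (publicParams pp c₀.1 c₁.1 c₂.1) kps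
            (P₀.prove ⟨k⟩ pp c₀) (P₁.prove ⟨k⟩ pp c₁) (P₂.prove ⟨k⟩ pp c₂)) := by
  simp only [hybrid, world, PMF.bind_bind, PMF.pure_bind]
  rfl

theorem play_rel_all {D : Device} {O O' : Oracle} (F : Setting E N₀ N₂ SE SK Nb) (hA : A.PPT)
    {b : Bool} {K : Sec} {pub : Val} {kps : Keys} {p₀ p₁ p₂ p₀' p₁' p₂' : Val × Val → Comp Val}
    (h₀ : ∀ a, Rel D O O' (fun _ => False) (p₀ a) (p₀' a)) (h₁ : ∀ a, Rel D O O' (fun _ => False) (p₁ a) (p₁' a))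
    (h₂ : ∀ a, Rel D O O' (fun _ => False) (p₂ a) (p₂' a)) :
    Rel D O O' (fun _ => False) (play E N₀ N₂ SE A reveal b K pub kps p₀ p₁ p₂)
      (play E N₀ N₂ SE A reveal b K pub kps p₀' p₁' p₂') :=
  game_rel (B := fun _ => False) F.samples hA (fun _ _ => h₀ _) (fun _ _ _ _ _ _ _ => h₁ _) fun _ _ _ _ _ => h₂ _

/-- Key pairs and two reference strings. -/
abbrev Materials := Keys × ((Val × Val) × (Val × Val))

/-- Key pairs, with reference strings for the proof systems `P` and `Q`. -/
def materials (E : PKE par) (Nb : ℕ[X]) (P Q : ProofSystem) (k : ℕ) (pp : Val) : PMF Materials :=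
  (keysPMF E Nb k pp).bind fun kps => (P.crs k pp).bind fun c => (Q.crs k pp).bind fun c' => PMF.pure (kps, (c, c'))

variable {P Q R R' : ProofSystem}

theorem exists_materials (F : Setting E N₀ N₂ SE SK Nb) (hP : P.Feasible) (hQ : Q.Feasible) :
    ∃ G : Sec × Val → Comp Materials, PP 0 G ∧
      ∀ p (D : Device) (O : Oracle), Is D O (G p) (materials E Nb P Q p.1.k p.2) := by
  obtain ⟨⟨C, hC, hC'⟩, _⟩ := hP
  obtain ⟨⟨C', hQ, hQ'⟩, _⟩ := hQ
  exact ⟨fun p => keyPairs SK Nb p.1 p.2 >>= fun kps => C p >>= fun c => C' p >>= fun c' => .ret (kps, (c, c')),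
    PP.bind (PP.keyPairs F) (PP.bind (hC.comp (f := fun y : (Sec × Val) × Keys => y.1))
      (PP.bind (hQ.comp (f := fun y : ((Sec × Val) × Keys) × (Val × Val) => y.1.1)) PP.ret)),
    fun p D O => (keyPairs_is F _ _).bind fun _ => (hC' _ _ _).bind fun _ => (hQ' _ _ _).bind fun _ => Is.ret _⟩

/-- Exchange of proof systems in a game that is played with key pairs and two more reference
strings. -/
theorem exchange (F : Setting E N₀ N₂ SE SK Nb) (h : R.Interchangeable D E.setup R') (hP : P.Feasible)
    (hQ : Q.Feasible) (T : (Sec × Val) × Materials → (Val × Val → Comp Val) → Comp Val)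
    (hT : ∀ p : ((Sec × Val) × Materials) × (Val × Val) → Comp Val, PP 1 p → PP 1 fun x => T x fun a => p (x, a))
    (hrel : ∀ x p p' (O O' : Oracle), (∀ a, Rel D O O' (fun _ => False) (p a) (p' a)) →
      Rel D O O' (fun _ => False) (T x p) (T x p')) :
    Close
      (fun k => (E.setup k).bind fun pp => (materials E Nb P Q k pp).bind fun m => (R.crs k pp).bind fun d =>
        runBit D (T ((⟨k⟩, .pair pp d.1), m) (R.prove ⟨k⟩ pp d)))
      (fun k => (E.setup k).bind fun pp => (materials E Nb P Q k pp).bind fun m => (R'.crs k pp).bind fun d =>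
        runBit D (T ((⟨k⟩, .pair pp d.1), m) (R'.prove ⟨k⟩ pp d))) := by
  obtain ⟨G, hG, hG'⟩ := exists_materials F hP hQ
  have h := h (fun e p => G (e.1, e.2.fst) >>= fun m => T (e, m) p) ?_ ?_
  · simp only [runBit_bind (hG' _ _ _)] at h
    convert h using 4 with k k
    all_goals exact PMF.bind_comm _ _ _
  · intro p hp
    exact PP.bind (hG.of_zero.comp (f := fun y : Sec × Val => (y.1, y.2.fst))) (hT (fun y => p (y.1.1, y.2)) (hp.comp
      (f := fun y : ((Sec × Val) × Materials) × (Val × Val) => (y.1.1, y.2))))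
  · intro e p p' O O' h
    exact (Rel.of_is (hG' _ _ _) (hG' _ _ _)).bind_same (sup_true _) fun _ _ => hrel _ _ _ _ _ h

theorem ProofSystem.Feasible.prove_pp (hP : P.Feasible) {K : α → Sec} {d : α → Val} {c : α → Val × Val}
    (hK : Det K := by fun_prop) (hd : Det d := by fun_prop) (hc : Det c := by fun_prop) :
    PP w fun x : α × (Val × Val) => P.prove (K x.1) (d x.1) (c x.1) x.2 :=
  hP.2.1.of_zero.comp (f := fun x : α × (Val × Val) => ((K x.1, d x.1), (c x.1, x.2)))

theorem ProofSystem.Feasible.rel (hP : P.Feasible) {O O' : Oracle} {K : Sec} {d : Val}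
    {c a : Val × Val} : Rel D O O' (fun _ => False) (P.prove K d c a) (P.prove K d c a) :=
  let ⟨_, h⟩ := hP.2.2 K d c a
  Rel.of_is (h D O) (h D O')

/-- Interchangeable proof systems may be exchanged for key proofs. -/
theorem hybrid_close₀ (F : Setting E N₀ N₂ SE SK Nb) (hA : A.PPT) (h : R.Interchangeable D E.setup R')
    (hP : P.Feasible) (hQ : Q.Feasible) : Close (hybrid E N₀ N₂ SE Nb A reveal D R P Q b)
      (hybrid E N₀ N₂ SE Nb A reveal D R' P Q b) := by
  have h := exchange F h hP hQ (fun x p => Prod.fst <$> play E N₀ N₂ SE A reveal b x.1.1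
      (publicParams x.1.2.fst x.1.2.snd x.2.2.1.1 x.2.2.2.1) x.2.1 p (P.prove x.1.1 x.1.2.fst x.2.2.1)
      (Q.prove x.1.1 x.1.2.fst x.2.2.2))
    (fun p hp => PP.map (f := fun _ u => u.1) (PP.play F hA hp
      (hP.prove_pp (K := fun x : (Sec × Val) × Materials => x.1.1)
        (d := fun x => x.1.2.fst) (c := fun x => x.2.2.1))
      (hQ.prove_pp (K := fun x : (Sec × Val) × Materials => x.1.1)
        (d := fun x => x.1.2.fst) (c := fun x => x.2.2.2))))
    (fun x p p' O O' h => (play_rel_all F hA h (fun _ => hP.rel) fun _ => hQ.rel).bind_same (sup_true _)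
      fun _ _ => Rel.ret _)
  have key : ∀ R : ProofSystem, hybrid E N₀ N₂ SE Nb A reveal D R P Q b = fun k =>
      (E.setup k).bind fun pp => (materials E Nb P Q k pp).bind fun m => (R.crs k pp).bind fun d =>
          runBit D (Prod.fst <$> play E N₀ N₂ SE A reveal b ⟨k⟩ (publicParams pp d.1 m.2.1.1 m.2.2.1) m.1
            (R.prove ⟨k⟩ pp d) (P.prove ⟨k⟩ pp m.2.1) (Q.prove ⟨k⟩ pp m.2.2)) := fun R => by
    funext k
    simp only [hybrid_eq, materials, PMF.bind_bind, PMF.pure_bind, PMF.bind_comm (R.crs _ _)]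
  rw [key, key]
  exact h

/-- Interchangeable proof systems may be exchanged for sharing proofs. -/
theorem hybrid_close₁ (F : Setting E N₀ N₂ SE SK Nb) (hA : A.PPT) (h : R.Interchangeable D E.setup R')
    (hP : P.Feasible) (hQ : Q.Feasible) : Close (hybrid E N₀ N₂ SE Nb A reveal D P R Q b)
      (hybrid E N₀ N₂ SE Nb A reveal D P R' Q b) := by
  have h := exchange F h hP hQ (fun x p => Prod.fst <$> play E N₀ N₂ SE A reveal b x.1.1
      (publicParams x.1.2.fst x.2.2.1.1 x.1.2.snd x.2.2.2.1) x.2.1 (P.prove x.1.1 x.1.2.fst x.2.2.1) p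
      (Q.prove x.1.1 x.1.2.fst x.2.2.2))
    (fun p hp => PP.map (f := fun _ u => u.1) (PP.play F hA
      (hP.prove_pp (K := fun x : (Sec × Val) × Materials => x.1.1)
        (d := fun x => x.1.2.fst) (c := fun x => x.2.2.1)) hp
      (hQ.prove_pp (K := fun x : (Sec × Val) × Materials => x.1.1)
        (d := fun x => x.1.2.fst) (c := fun x => x.2.2.2))))
    (fun x p p' O O' h => (play_rel_all F hA (fun _ => hP.rel) h fun _ => hQ.rel).bind_same (sup_true _)
      fun _ _ => Rel.ret _)
  have key : ∀ R : ProofSystem, hybrid E N₀ N₂ SE Nb A reveal D P R Q b = fun k =>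
      (E.setup k).bind fun pp => (materials E Nb P Q k pp).bind fun m => (R.crs k pp).bind fun d =>
          runBit D (Prod.fst <$> play E N₀ N₂ SE A reveal b ⟨k⟩ (publicParams pp m.2.1.1 d.1 m.2.2.1) m.1
            (P.prove ⟨k⟩ pp m.2.1) (R.prove ⟨k⟩ pp d) (Q.prove ⟨k⟩ pp m.2.2)) := fun R => by
    funext k
    simp only [hybrid_eq, materials, PMF.bind_bind, PMF.pure_bind, PMF.bind_comm (R.crs _ _)]
  rw [key, key]
  exact h

/-- Interchangeable proof systems may be exchanged for decryption proofs. -/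
theorem hybrid_close₂ (F : Setting E N₀ N₂ SE SK Nb) (hA : A.PPT) (h : R.Interchangeable D E.setup R')
    (hP : P.Feasible) (hQ : Q.Feasible) : Close (hybrid E N₀ N₂ SE Nb A reveal D P Q R b)
      (hybrid E N₀ N₂ SE Nb A reveal D P Q R' b) := by
  have h := exchange F h hP hQ (fun x p => Prod.fst <$> play E N₀ N₂ SE A reveal b x.1.1
      (publicParams x.1.2.fst x.2.2.1.1 x.2.2.2.1 x.1.2.snd) x.2.1 (P.prove x.1.1 x.1.2.fst x.2.2.1)
      (Q.prove x.1.1 x.1.2.fst x.2.2.2) p)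
    (fun p hp => PP.map (f := fun _ u => u.1) (PP.play F hA
      (hP.prove_pp (K := fun x : (Sec × Val) × Materials => x.1.1)
        (d := fun x => x.1.2.fst) (c := fun x => x.2.2.1))
      (hQ.prove_pp (K := fun x : (Sec × Val) × Materials => x.1.1)
        (d := fun x => x.1.2.fst) (c := fun x => x.2.2.2)) hp))
    (fun x p p' O O' h => (play_rel_all F hA (fun _ => hP.rel) (fun _ => hQ.rel) h).bind_same (sup_true _)
      fun _ _ => Rel.ret _)
  have key : ∀ R : ProofSystem, hybrid E N₀ N₂ SE Nb A reveal D P Q R b = fun k =>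
      (E.setup k).bind fun pp => (materials E Nb P Q k pp).bind fun m => (R.crs k pp).bind fun d =>
          runBit D (Prod.fst <$> play E N₀ N₂ SE A reveal b ⟨k⟩ (publicParams pp m.2.1.1 m.2.2.1 d.1) m.1
            (P.prove ⟨k⟩ pp m.2.1) (Q.prove ⟨k⟩ pp m.2.2) (R.prove ⟨k⟩ pp d)) := fun R => by
    funext k
    simp only [hybrid_eq, materials, PMF.bind_bind, PMF.pure_bind]
  rw [key, key]
  exact h

end

/-! ### Exchanging experiments up to bad events -/

/-- The distribution of the output of a computation. -/
def Comp.out {α : Type} (D : Device) (c : Comp α) : PMF α := (c.exec D noOracle D.init ()).map Prod.fst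

theorem Comp.Rel.out {α : Type} {D : Device} {B : α → Prop} {c c' : Comp α}
    (h : Rel D noOracle noOracle B c c') {a : α} (ha : ¬ B a) : c.out D a = c'.out D a := by
  rw [Comp.out, Comp.out, PMF.map_apply, PMF.map_apply]
  refine tsum_congr fun u => ?_
  by_cases hu : a = u.1
  · rw [if_pos hu, if_pos hu, h _ _ (hu ▸ ha)]
  · rw [if_neg hu, if_neg hu]

theorem pr_out {α : Type} {D : Device} (c : Comp α) (S : α → Prop) :
    pr (c.out D) S = pr (c.exec D noOracle D.init ()) fun u => S u.1 := pr_map _ _ _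

theorem runBit_fst {α : Type} {D : Device} (c : Comp (Val × α)) :
    runBit D (Prod.fst <$> c) = (c.out D).map fun u => outBit u.1 := by
  rw [runBit, exec_map, Comp.out, PMF.map_comp, PMF.map_comp]; rfl

section

variable {P₀' P₁' P₂' : ProofSystem}

/-- Properties of the random choices before the game that hold with certainty. -/
structure World.Possible (E : PKE par) (Nb : ℕ[X]) (k : ℕ) (x : World) : Prop where
  pp : x.pp ∈ (E.setup k).support
  length : x.keys.length = Nb.eval k
  keys : ∀ kp ∈ x.keys, kp.2 ∈ E.randKey k x.pp ∧ kp.1 = E.keyGen k x.pp kp.2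

/-- All key pairs are valid. -/
def World.Valid (E : PKE par) (k : ℕ) (x : World) : Prop :=
  ∀ kp ∈ x.keys, E.keyVer k x.pp kp.1.1 kp.1.2 = true

theorem keysPMF_support {k : ℕ} {pp : Val} {kps : Keys} (h : kps ∈ (keysPMF E Nb k pp).support) :
    kps.length = Nb.eval k ∧ ∀ kp ∈ kps, kp.2 ∈ E.randKey k pp ∧ kp.1 = E.keyGen k pp kp.2 := by
  have h := mapAll_support h
  have hl := h.length_eq
  rw [List.length_range] at hl
  refine ⟨hl.symm, fun kp hkp => ?_⟩
  obtain ⟨i, hi, rfl⟩ := List.mem_iff_getElem.1 hkp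
  have h1 := h.get (i := i) (by rw [List.length_range, hl]; exact hi) hi
  rw [PKE.sampleKeyPair, PMF.support_map] at h1
  obtain ⟨r, hr, h1⟩ := h1
  have h2 : kps[i] = (E.keyGen k pp r, r) := h1.symm
  rw [h2]
  exact ⟨E.sampleKey_mem k pp hr, rfl⟩

theorem world_support {k : ℕ} {x : World} (h : x ∈ (world E Nb P₀ P₁ P₂ k).support) : x.Possible E Nb k := by
  simp only [world, PMF.mem_support_bind_iff, PMF.support_pure, Set.mem_singleton_iff] at h
  obtain ⟨pp, hpp, kps, hk, c₀, -, c₁, -, c₂, -, rfl⟩ := h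
  exact ⟨hpp, (keysPMF_support hk).1, (keysPMF_support hk).2⟩

theorem World.Possible.at_mem {k : ℕ} {x : World} (h : x.Possible E Nb k) {i : ℕ} (hi : i < Nb.eval k) :
    x.keys.at i ∈ x.keys := by
  rw [Keys.at, List.getD_eq_getElem _ _ (by rw [h.length]; exact hi)]
  exact List.getElem_mem _

/-- With overwhelming probability all key pairs are valid. -/
theorem negl_invalid (hkey : E.KeyCorrect) :
    Negl fun k => pr (world E Nb P₀ P₁ P₂ k) fun x => ¬ x.Valid E k := by
  refine (hkey.poly_mul Nb).mono fun k => ?_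
  rw [abs_of_nonneg (pr_nonneg _ _), prob_eq_pr]
  refine pr_bind_le fun pp _ => ?_
  refine (pr_bind_const_le (T := fun kps => ∃ kp ∈ kps, ¬ E.keyVer k pp kp.1.1 kp.1.2 = true)
    fun kps _ x hx hx' => ?_).trans ?_
  · simp only [PMF.mem_support_bind_iff, PMF.support_pure, Set.mem_singleton_iff] at hx
    obtain ⟨c₀, -, c₁, -, c₂, -, rfl⟩ := hx
    simpa [World.Valid] using hx'
  · have h := pr_mapAll_le (fun _ : ℕ => E.sampleKeyPair k pp) (fun kp => ¬ E.keyVer k pp kp.1.1 kp.1.2 = true)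
      (fun _ => le_rfl) (List.range (Nb.eval k))
    rw [List.length_range] at h
    refine h.trans (le_of_eq ?_)
    congr 1
    have h2 : (E.sampleKeyPair k pp >>= fun kp => pure (!(E.keyVer k pp kp.1.1 kp.1.2))) =
        (E.sampleKeyPair k pp).map fun kp => !(E.keyVer k pp kp.1.1 kp.1.2) := rfl
    rw [h2, pr_map]
    exact pr_congr fun kp _ => by simp

/-- The random choices before the game together with its output. -/
def trial (E : PKE par) (N₀ N₂ : NIZK) (SE : Sec × Val → Comp Val) (Nb : ℕ[X]) (A : PrivacyAdversary)
    (reveal : Bool) (D : Device) (P₀ P₁ P₂ : ProofSystem) (b : Bool) (k : ℕ) :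
    PMF (World × Outcome) :=
  (world E Nb P₀ P₁ P₂ k).bind fun x =>
    ((x.play E N₀ N₂ SE A reveal P₀ P₁ P₂ b k).out D).map (Prod.mk x)

theorem hybrid_eq_trial (k : ℕ) : hybrid E N₀ N₂ SE Nb A reveal D P₀ P₁ P₂ b k =
    (trial E N₀ N₂ SE Nb A reveal D P₀ P₁ P₂ b k).map fun u => outBit u.2.1 := by
  simp only [hybrid, trial, runBit_fst, PMF.map_bind, PMF.map_comp]
  rfl

/-- Hybrid experiments with the same reference strings are indistinguishable if the provers behave
alike off a bad event of negligible probability. -/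
theorem hybrid_close_of_bad {B : ℕ → World → Outcome → Prop}
    (h₀ : P₀'.crs = P₀.crs) (h₁ : P₁'.crs = P₁.crs) (h₂ : P₂'.crs = P₂.crs)
    (h : ∀ k (x : World), x.Possible E Nb k → Rel D noOracle noOracle (B k x)
      (x.play E N₀ N₂ SE A reveal P₀ P₁ P₂ b k) (x.play E N₀ N₂ SE A reveal P₀' P₁' P₂' b k))
    (hB : Negl fun k => pr (trial E N₀ N₂ SE Nb A reveal D P₀ P₁ P₂ b k) fun u => B k u.1 u.2) :
    Close (hybrid E N₀ N₂ SE Nb A reveal D P₀ P₁ P₂ b) (hybrid E N₀ N₂ SE Nb A reveal D P₀' P₁' P₂' b) := by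
  refine hB.mono fun k => ?_
  rw [abs_abs, hybrid_eq_trial, hybrid_eq_trial, prob_map, prob_map]
  have hw : world E Nb P₀' P₁' P₂' k = world E Nb P₀ P₁ P₂ k := by
    rw [world, world, h₀, h₁, h₂]
  rw [trial, trial, hw]
  exact abs_pr_bind_sub_le (S := fun _ u => outBit u.1 = true) (B := B k)
    fun x hx u hu => (h k x (world_support hx)).out hu

/-! ### Provers with certified witnesses -/

theorem Params.enc_natCast {par : Params} {k y : ℕ} (h : y < par.p k) : par.enc (y : par.F k) = .num y :=
  congrArg Val.num (ZMod.val_natCast_of_lt h)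

@[simp] theorem World.pub_zero (x : World) : x.pub.get 0 = x.pp := rfl

/-- Honest participants hold witnesses for their key proofs. -/
theorem checked_key (F : Setting E N₀ N₂ SE SK Nb) (hA : A.PPT) (h₁ : P₁.Feasible) (h₂ : P₂.Feasible) (h₀ : P₀.Feasible) :
    Close (hybrid E N₀ N₂ SE Nb A reveal D P₀ P₁ P₂ b)
      (hybrid E N₀ N₂ SE Nb A reveal D (P₀.checked (keyLang E)) P₁ P₂ b) := by
  refine hybrid_close_of_bad (B := fun _ _ _ => False) rfl rfl rfl (fun k x hx => ?_) ?_
  · refine game_rel (B := fun _ => False) F.samples hA (fun i hi => ?_) (fun _ _ _ _ _ _ _ => h₁.rel)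
      fun _ _ _ _ _ => h₂.rel
    have hR : (keyLang E).R k x.pp (.pair (x.pub.get 0) (x.keys.public.getD i (.num 0)))
        (.pair (x.keys.at i).1.2 (x.keys.at i).2) := by
      obtain ⟨h3, h4⟩ := hx.keys _ (hx.at_mem (lt_of_lt_of_le hi (F.le k)))
      exact ⟨_, _, _, by rw [Keys.public_getD, World.pub_zero], rfl, h3, h4⟩
    simp only [provers, ProofSystem.checked, if_pos hR]
    exact h₀.rel
  · simpa only [pr_false] using Negl.zero

theorem Honest.dec_R (henc : E.EncCorrect) {Wzk Wsound : ℕ → Set Val} (hW : ∀ k, E.wDec k ⊆ Wzk k) {k : ℕ}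
    {x : World} (hx : x.Possible E Nb k) (hv : x.Valid E k) {G : List Party} {it : Item}
    (hi : Honest E ⟨k⟩ x.pub G it) (hlt : it.1.idx < Nb.eval k)
    (hpk : it.1.pk = x.keys.public.getD it.1.idx (.num 0)) :
    (decLang E Wzk Wsound).R k x.pp (it.stmt x.pub it.2.2) (.ofList [(x.keys.at it.1.idx).1.2,
      (x.keys.at it.1.idx).2, E.witF (⟨k⟩, .ofList [x.pub.get 0, it.1.pk, (x.keys.at it.1.idx).1.2, it.2.1])]) := by
  have hm := hx.at_mem hlt
  obtain ⟨h3, h4⟩ := hx.keys _ hm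
  have h5 := hv _ hm
  obtain ⟨r, hr, hc⟩ := hi.enc
  rw [Keys.public_getD] at hpk
  rw [World.pub_zero] at hr
  obtain ⟨h6, h7⟩ := henc k x.pp hx.pp _ _ h5 (it.2.2 : par.F k) r hr
  have hc' : it.2.1 = E.enc k x.pp (x.keys.at it.1.idx).1.1 (it.2.2 : par.F k) r := by
    rw [hc, hpk]; rfl
  refine ⟨it.1.pk, _, _, it.2.1, (it.2.2 : par.F k), _, ?_, rfl, ?_, ?_, h3, ?_⟩
  · rw [decStmt, Params.enc_natCast hi.lt]; rfl
  · refine Prod.ext ?_ rfl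
    rw [hpk, hc']; exact h6
  · refine hW k ?_
    have : E.witF (⟨k⟩, .ofList [x.pub.get 0, it.1.pk, (x.keys.at it.1.idx).1.2, it.2.1]) =
        (E.dec k x.pp (x.keys.at it.1.idx).1.1 (x.keys.at it.1.idx).1.2
          (E.enc k x.pp (x.keys.at it.1.idx).1.1 (it.2.2 : par.F k) r)).2 := by
      rw [hc', hpk]; rfl
    rw [this]; exact h7
  · rw [hpk, ← h4]

theorem negl_trial_invalid (hkey : E.KeyCorrect) : Negl fun k =>
    pr (trial E N₀ N₂ SE Nb A reveal D P₀ P₁ P₂ b k) fun u => ¬ u.1.Valid E k := by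
  refine (negl_invalid (P₀ := P₀) (P₁ := P₁) (P₂ := P₂) (Nb := Nb) hkey).mono fun k => ?_
  rw [abs_of_nonneg (pr_nonneg _ _)]
  refine pr_bind_const_le fun x _ u hu hS => ?_
  rw [PMF.support_map] at hu
  obtain ⟨_, _, rfl⟩ := hu; exact hS

/-- Decryption proofs of honest participants have witnesses if all key pairs are valid. -/
theorem checked_dec (F : Setting E N₀ N₂ SE SK Nb) (hA : A.PPT) (hkey : E.KeyCorrect) (henc : E.EncCorrect)
    {Wzk Wsound : ℕ → Set Val} (hW : ∀ k, E.wDec k ⊆ Wzk k) (h₀ : P₀.Feasible) (h₁ : P₁.Feasible) (h₂ : P₂.Feasible) :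
    Close (hybrid E N₀ N₂ SE Nb A reveal D P₀ P₁ P₂ b)
      (hybrid E N₀ N₂ SE Nb A reveal D P₀ P₁ (P₂.checked (decLang E Wzk Wsound)) b) := by
  refine hybrid_close_of_bad (B := fun k x _ => ¬ x.Valid E k) rfl rfl rfl (fun k x hx => ?_)
    (negl_trial_invalid hkey)
  by_cases hv : x.Valid E k
  · refine fun d u _ => game_rel (B := fun _ => False) F.samples hA (fun _ _ => h₀.rel)
      (fun _ _ _ _ _ _ _ => h₁.rel) (fun G hG it hi hc => ?_) d u id
    have hR := hi.dec_R (Wsound := Wsound) henc hW hx hv ((hG.idx_lt hi.mem).trans_le (F.le k)) (hG.pk _ hi.mem hc)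
    simp only [provers, ProofSystem.checked, if_pos hR]
    exact h₂.rel
  · exact fun d u hu => (hu hv).elim

/-- Evaluation with natural numbers modulo `p` agrees with evaluation over `ℤ_p`. -/
theorem horner_cast (K : Sec) {s : ℕ} {cs : List ℕ} (hcs : cs.length = par.thr K) (i : ℕ) :
    (horner (par.modulus K) s cs i : par.F K.k) =
      par.shareAt (s : par.F K.k) (fun j => (cs.getD j.val 0 : par.F K.k)) i := by
  have key : ∀ l : List ℕ, ((l.foldr (fun a acc => (a + acc) * i % par.modulus K) 0 : ℕ) : par.F K.k) =
      ∑ j ∈ Finset.range l.length, (l.getD j 0 : par.F K.k) * (i : par.F K.k) ^ (j + 1) := by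
    intro l
    induction l with
    | nil => simp
    | cons a l ih =>
      rw [List.foldr_cons, List.length_cons, Finset.sum_range_succ']
      have : (((a + l.foldr (fun a acc => (a + acc) * i % par.modulus K) 0) * i % par.modulus K : ℕ) : par.F K.k) =
          ((a + l.foldr (fun a acc => (a + acc) * i % par.modulus K) 0) * i : ℕ) := ZMod.natCast_mod _ _
      rw [this]
      push_cast
      rw [ih]
      simp only [List.getD_cons_succ, List.getD_cons_zero, pow_succ, add_mul, Finset.sum_mul, mul_assoc]
      ring
  have : (horner (par.modulus K) s cs i : par.F K.k) =
      ((cs.foldr (fun a acc => (a + acc) * i % par.modulus K) 0 + s : ℕ) : par.F K.k) := ZMod.natCast_mod _ _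
  rw [this, Nat.cast_add, key, Params.shareAt, add_comm, hcs, Finset.sum_range]
  rfl

/-- The witness for an honest sharing is correct if all public keys are valid. -/
theorem Dealt.enc_R {Wzk : ℕ → Set Val} {K : Sec} {pub : Val} {G : List Party} {cs : List ℕ} {rs : List Val}
    (h : Dealt E K pub G cs rs) (hG : ∀ q ∈ G, .pair (pub.get 0) q.pk ∈ (keyLang E).sound K.k (pub.get 0)) (s : ℕ) :
    (encLang E Wzk).R K.k (pub.get 0)
      (sharingStmt par K pub (encShares E K pub G (shareList par K s cs G.length) rs))
      (sharingWit (shareList par K s cs G.length) rs) := by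
  have hl : (shareList par K s cs G.length).length = G.length := by simp [shareList]
  have hlt : ∀ y ∈ shareList par K s cs G.length, y < par.p K.k := fun y hy => by
    obtain ⟨i, _, rfl⟩ := List.mem_map.1 hy
    exact horner_lt (par.prime K.k).pos _ _ _
  refine ⟨(G.zip ((shareList par K s cs G.length).zip rs)).map fun e => (e.1.pk, (e.2.1 : par.F K.k), e.2.2), ?_, ?_, ?_, ?_⟩
  · rw [sharingStmt, encStmt, encShares]
    simp only [List.map_map, List.length_map]
    rfl
  · rw [sharingWit, encWit]
    have e : ((shareList par K s cs G.length).zip rs) = (G.zip ((shareList par K s cs G.length).zip rs)).map Prod.snd := by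
      rw [List.map_snd_zip]
      rw [List.length_zip, hl, h.length_rs, min_self]
    conv_lhs => rw [e]
    simp only [List.map_map]
    congr 1
    refine List.map_congr_left fun x hx => ?_
    have h1 := hlt _ (List.of_mem_zip (List.of_mem_zip hx).2).1
    simp only [Function.comp_apply]
    rw [Params.enc_natCast h1]
  · intro e he
    obtain ⟨x, hx, rfl⟩ := List.mem_map.1 he
    exact ⟨hG _ (List.of_mem_zip hx).1, h.mem _ (List.of_mem_zip (List.of_mem_zip hx).2).2⟩
  · refine ⟨(s : par.F K.k), fun j => (cs.getD j.val 0 : par.F K.k), ?_⟩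
    have e : ((G.zip ((shareList par K s cs G.length).zip rs)).map fun e => (e.1.pk, (e.2.1 : par.F K.k), e.2.2)).map
        (fun e => e.2.1) = (shareList par K s cs G.length).map fun y : ℕ => (y : par.F K.k) := by
      have e1 : shareList par K s cs G.length =
          ((G.zip ((shareList par K s cs G.length).zip rs)).map Prod.snd).map Prod.fst := by
        rw [List.map_snd_zip, List.map_fst_zip]
        · rw [hl, h.length_rs]
        · rw [List.length_zip, hl, h.length_rs, min_self]
      conv_rhs => rw [e1]
      simp only [List.map_map]
      rfl
    rw [e, List.length_map, hl, Params.shares, shareList, List.map_map]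
    exact List.map_congr_left fun i _ => horner_cast K h.length_cs _

open Classical in
/-- With overwhelming probability all participants that pass key verification have valid public
keys: a participant chosen at random from those that pass would otherwise break soundness. -/
theorem negl_unsound_key (F : Setting E N₀ N₂ SE SK Nb) (hA : A.PPT)
    (hsound : N₀.AdaptiveSound D E.setup (keyLang E)) {FN : Sec × Val → Comp Val}
    (hF : (N₀.system FN).Feasible) (h₁ : P₁.Feasible) (h₂ : P₂.Feasible) :
    Negl fun k => pr (trial E N₀ N₂ SE Nb A reveal D (N₀.system FN) P₁ P₂ b k) fun u =>
      ∃ q ∈ u.2.2.2, .pair u.1.pp q.pk ∉ (keyLang E).sound k u.1.pp := by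
  obtain ⟨G, hG, hG'⟩ := exists_materials F h₁ h₂
  let pick : List Party → ℕ → Val → Val := fun G i pp =>
    .pair (.pair pp (G.getD i ⟨0, true, .num 0, .num 0, .num 0⟩).pk) (G.getD i ⟨0, true, .num 0, .num 0, .num 0⟩).proof
  let pub : Val → Val → Materials → Val := fun pp c m => publicParams pp c m.2.1.1 m.2.2.1
  let adv : Sec × Val → Comp Val := fun e => G (e.1, e.2.fst) >>= fun m =>
    keyStage (par := par) N₀ A e.1 (provers E e.1 (pub e.2.fst e.2.snd m) m.1
      ((N₀.system FN).prove e.1 e.2.fst (e.2.snd, .num 0)) (P₁.prove e.1 e.2.fst m.2.1) (P₂.prove e.1 e.2.fst m.2.2))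
      (pub e.2.fst e.2.snd m) m.1.public >>= fun o =>
    (fun i : Fin (par.count e.1 + 1) => i.val) <$> Comp.rand (par.count e.1) .ret >>= fun i =>
    .ret (o.elim (.num 0) fun o => pick o.2 i e.2.fst)
  have hadv : PP 0 adv := by
    have := F.count
    exact PP.bind (hG.comp (f := fun y : Sec × Val => (y.1, y.2.fst)))
      (PP.bind (PP.keyStage F.toFeasible hA (PP.key_prover (K := fun y : (Sec × Val) × Materials => y.1.1)
        (pub := fun y => pub y.1.2.fst y.1.2.snd y.2) (kps := fun y => y.2.1)
        (p₀ := fun y => (N₀.system FN).prove y.1.1 y.1.2.fst (y.1.2.snd, .num 0))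
        (p₁ := fun y => P₁.prove y.1.1 y.1.2.fst y.2.2.1) (p₂ := fun y => P₂.prove y.1.1 y.1.2.fst y.2.2.2)
        (hF.prove_pp (K := fun y : (Sec × Val) × Materials => y.1.1)
          (d := fun y => y.1.2.fst) (c := fun y => (y.1.2.snd, .num 0)))))
      (PP.bind PP.rand (PP.ret (hf := Det.option_elim
        (g := fun (y : (((Sec × Val) × Materials) × Option (Val × List Party)) × ℕ)
          (o : Val × List Party) => pick o.2 y.2 y.1.1.1.2.fst)))))
  obtain ⟨c, hc, hc'⟩ := hadv.exists_ppt
  refine ((hsound c hc).poly_mul (Nb + 1)).mono fun k => ?_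
  rw [abs_of_nonneg (pr_nonneg _ _)]
  -- it remains to show the estimate with the number of participants as a factor
  suffices h : pr (trial E N₀ N₂ SE Nb A reveal D (N₀.system FN) P₁ P₂ b k) (fun u =>
      ∃ q ∈ u.2.2.2, .pair u.1.pp q.pk ∉ (keyLang E).sound k u.1.pp) ≤ ((par.n k + 1 : ℕ) : ℝ) * prob ((E.setup k).bind fun d =>
      (N₀.setup k d).bind fun crs => (c.exec D k (.pair d crs) D.init).bind fun u =>
        PMF.pure (decide (u.1.fst ∉ (keyLang E).sound k d ∧ N₀.ver k crs u.1.fst u.1.snd = true))) by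
    refine h.trans (mul_le_mul_of_nonneg_right ?_ ENNReal.toReal_nonneg)
    rw [eval_add, eval_one]
    exact_mod_cast Nat.succ_le_succ (F.le k)
  rw [prob_eq_pr]
  simp only [trial, world, PMF.bind_bind, PMF.pure_bind]
  refine pr_bind_le fun pp _ => ?_
  rw [PMF.bind_comm, NIZK.system, PMF.bind_map]
  refine pr_bind_le fun crs _ => ?_
  have hex : (c.exec D k (.pair pp crs) D.init) = (materials E Nb P₁ P₂ k pp).bind fun m =>
      ((keyStage (par := par) N₀ A ⟨k⟩ (provers E ⟨k⟩ (pub pp crs m) m.1 ((N₀.system FN).prove ⟨k⟩ pp (crs, .num 0))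
        (P₁.prove ⟨k⟩ pp m.2.1) (P₂.prove ⟨k⟩ pp m.2.2)) (pub pp crs m) m.1.public).exec D noOracle D.init ()).bind
      fun u => (PMF.uniformOfFintype (Fin (par.n k + 1))).bind fun i =>
        PMF.pure (u.1.elim (.num 0) fun o => pick o.2 i.val pp, u.2.1) := by
    rw [hc']
    simp only [adv]
    rw [bind_def, exec_bind_of_is (hG' _ _ _), PMF.map_bind]
    refine bind_ext fun m => ?_
    rw [bind_def, exec_bind, PMF.map_bind]
    refine bind_ext fun u => ?_
    rw [bind_def, exec_bind_of_is (Is.map (Is.rand _) _), PMF.map_bind, PMF.bind_map]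
    refine bind_ext fun i => ?_
    rw [Function.comp_apply, exec_ret, PMF.pure_map]
    rfl
  rw [hex]
  simp only [materials, PMF.bind_bind, PMF.pure_bind]
  refine pr_bind_le fun kps _ => pr_bind_le fun c₁ _ => pr_bind_le fun c₂ _ => ?_
  rw [pr_map, pr_out, World.play, play, game, bind_def, exec_bind]
  refine pr_bind_le fun u hu => ?_
  have hq := keyStage_sup _ _ _ _ _ u hu
  obtain ⟨o, d⟩ := u
  cases o with
  | none =>
    refine pr_le_of_never (fun v hv hv' => ?_) (mul_nonneg (by positivity) (pr_nonneg _ _))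
    simp only [Option.elim, exec_ret, PMF.support_pure, Set.mem_singleton_iff] at hv
    subst hv
    simp at hv'
  | some o =>
    have hq := hq o rfl
    by_cases hbad : ∃ q ∈ o.2, .pair pp q.pk ∉ (keyLang E).sound k pp
    · obtain ⟨q, hqG, hqb⟩ := hbad
      obtain ⟨i, hi, rfl⟩ := List.mem_iff_getElem.1 hqG
      have hlen : o.2.length ≤ par.n k := by
        have := hq.sub.length_le
        rwa [List.length_map, List.length_range] at this
      refine (pr_le_one _ _).trans ((pr_uniform (i := ⟨i, by omega⟩) (S := fun j => (fun j : Fin (par.n k + 1) =>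
        decide ((pick o.2 j.val pp).fst ∉ (keyLang E).sound k pp ∧
          N₀.ver k crs (pick o.2 j.val pp).fst (pick o.2 j.val pp).snd = true)) j = true) ?_).trans ?_)
      · have hv := hq.ver _ (List.getElem_mem hi)
        simp only [pick, List.getD_eq_getElem _ _ hi, decide_eq_true_eq]
        exact ⟨hqb, hv⟩
      · exact mul_le_mul_of_nonneg_left (pr_map (PMF.uniformOfFintype (Fin (par.n k + 1))) (fun j =>
          decide ((pick o.2 j.val pp).fst ∉ (keyLang E).sound k pp ∧
          N₀.ver k crs (pick o.2 j.val pp).fst (pick o.2 j.val pp).snd = true)) fun a => a = true).ge (by positivity)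
    · refine pr_le_of_never (fun v hv hv' => ?_) (mul_nonneg (by positivity) (pr_nonneg _ _))
      have hall : ∀ (c : Comp (Val × (Option Sess × Option (Val × Val)))) (f : Val → Comp Val),
          (c >>= fun u => (fun g => ((g, (u.2.2, o.2)) : Outcome)) <$> f u.1).All
            fun u => u.2.2 = o.2 := fun c f =>
        (all_true c).bind fun u _ => (all_true _).bind fun _ _ => rfl
      have h3 := (hall _ _).exec D noOracle hv
      rw [h3] at hv'
      exact hbad hv'

/-- The dealer holds a witness unless a proof for a bad key passes: the relation of sharing proofs
requires that every public key, also of a corrupted participant, has a valid secret key. -/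
theorem checked_enc (F : Setting E N₀ N₂ SE SK Nb) (hA : A.PPT)
    (hsound : N₀.AdaptiveSound D E.setup (keyLang E)) {FN : Sec × Val → Comp Val}
    (hF : (N₀.system FN).Feasible) (h₁ : P₁.Feasible) (h₂ : P₂.Feasible) {Wzk : ℕ → Set Val} :
    Close (hybrid E N₀ N₂ SE Nb A reveal D (N₀.system FN) P₁ P₂ b)
      (hybrid E N₀ N₂ SE Nb A reveal D (N₀.system FN) (P₁.checked (encLang E Wzk)) P₂ b) := by
  refine hybrid_close_of_bad (B := fun k x u => ∃ q ∈ u.2.2, .pair x.pp q.pk ∉ (keyLang E).sound k x.pp)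
    rfl rfl rfl (fun k x hx => ?_) ?_
  swap
  · exact negl_unsound_key F hA hsound hF h₁ h₂
  unfold World.play play
  refine game_rel (B := fun G => ∃ q ∈ G, .pair x.pp q.pk ∉ (keyLang E).sound k x.pp) F.samples hA
    (fun _ _ => ?_) (fun G _ hB s cs rs hd => ?_) fun _ _ _ _ _ => ?_
  · exact hF.rel (d := x.pp)
  rotate_left
  · exact h₂.rel
  have hR := hd.enc_R (Wzk := Wzk) (fun q hq => not_not.1 fun h => hB ⟨q, hq, h⟩) s
  have e : ((P₁.checked (encLang E Wzk)).prove ⟨k⟩ x.pp x.crs₁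
      (sharingStmt par ⟨k⟩ x.pub (encShares E ⟨k⟩ x.pub G (shareList par ⟨k⟩ s cs G.length) rs),
        sharingWit (shareList par ⟨k⟩ s cs G.length) rs)) = P₁.prove ⟨k⟩ x.pp x.crs₁
      (sharingStmt par ⟨k⟩ x.pub (encShares E ⟨k⟩ x.pub G (shareList par ⟨k⟩ s cs G.length) rs),
        sharingWit (shareList par ⟨k⟩ s cs G.length) rs) := if_pos hR
  simp only [provers]
  rw [e]
  exact h₁.rel

end

/-! ### Random polynomials -/

theorem uniform_map_equiv {α β : Type} [Fintype α] [Nonempty α] [Fintype β] [Nonempty β] (e : α ≃ β) :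
    (PMF.uniformOfFintype α).map e = PMF.uniformOfFintype β := by
  ext y
  rw [PMF.map_apply, tsum_eq_single (e.symm y)]
  · simp [Fintype.card_congr e]
  · intro a ha
    rw [if_neg]
    rintro rfl
    simp at ha

theorem uniform_prod {α β : Type} [Fintype α] [Nonempty α] [Fintype β] [Nonempty β] :
    ((PMF.uniformOfFintype α).bind fun a => (PMF.uniformOfFintype β).map (Prod.mk a)) =
      PMF.uniformOfFintype (α × β) := by
  ext ⟨a, b⟩
  rw [PMF.bind_apply, tsum_eq_single a]
  · rw [PMF.map_apply, tsum_eq_single b]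
    · simp only [if_true, PMF.uniformOfFintype_apply, Fintype.card_prod, Nat.cast_mul]
      exact (ENNReal.mul_inv (Or.inr (ENNReal.natCast_ne_top _)) (Or.inl (ENNReal.natCast_ne_top _))).symm
    · intro b' hb'; simp [Ne.symm hb']
  · intro a' ha'
    rw [PMF.map_apply]
    simp [Ne.symm ha']

theorem mapAll_uniform {α β : Type} [Fintype α] [Nonempty α] (l : List β) :
    mapAll (fun _ => PMF.uniformOfFintype α) l = (PMF.uniformOfFintype (Fin l.length → α)).map List.ofFn := by
  induction l with
  | nil =>
    rw [mapAll_nil]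
    have : (PMF.uniformOfFintype (Fin ([] : List β).length → α)).map List.ofFn =
        (PMF.uniformOfFintype (Fin ([] : List β).length → α)).map fun _ => [] := by
      congr 1
    rw [this]; exact (PMF.map_const _ _).symm
  | cons b l ih =>
    rw [mapAll_cons, ih]
    have h := uniform_map_equiv (Fin.consEquiv fun _ : Fin (l.length + 1) => α)
    have h' : (PMF.uniformOfFintype (Fin (b :: l).length → α)) = PMF.uniformOfFintype (Fin (l.length + 1) → α) := rfl
    rw [h', ← h, ← uniform_prod]
    simp only [PMF.map_bind, PMF.map_comp, PMF.bind_map]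
    refine bind_ext fun a => ?_
    rw [PMF.map]
    refine bind_ext fun f => ?_
    simp only [Function.comp_apply]
    exact congrArg PMF.pure (by
      show a :: List.ofFn f = List.ofFn (Fin.cons a f)
      rw [List.ofFn_succ]; rfl)

theorem uniform_zmod {p : ℕ} [NeZero p] : (PMF.uniformOfFintype (Fin (p - 1 + 1))).map (fun i => i.val) =
    (PMF.uniformOfFintype (ZMod p)).map ZMod.val := by
  cases p with
  | zero => exact absurd rfl (NeZero.ne 0)
  | succ p =>
    have h := uniform_map_equiv (β := ZMod (p + 1)) (Equiv.refl (Fin (p + 1)))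
    rw [← h, PMF.map_comp]
    rfl

/-- Coefficient lists represent uniformly distributed coefficient vectors. -/
theorem coeffsPMF_eq (K : Sec) : coeffsPMF par K =
    (PMF.uniformOfFintype (Fin (par.t K.k) → par.F K.k)).map fun a => List.ofFn fun j => (a j).val := by
  have h : coeffsPMF par K = mapAll (fun _ => (PMF.uniformOfFintype (ZMod (par.p K.k))).map ZMod.val)
      (List.range (par.t K.k)) := mapAll_congr fun _ _ => uniform_zmod (p := par.p K.k)
  rw [h, mapAll_map, mapAll_uniform, PMF.map_comp]
  have : ∀ n m (h : n = m), (PMF.uniformOfFintype (Fin n → ZMod (par.p K.k))).map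
      (List.map ZMod.val ∘ List.ofFn) = (PMF.uniformOfFintype (Fin m → ZMod (par.p K.k))).map
      fun a => List.ofFn fun j => (a j).val := by
    rintro n m rfl
    congr 1
    funext a
    rw [Function.comp_apply, List.map_ofFn]; rfl
  exact this _ _ List.length_range

theorem horner_ofFn (K : Sec) {s : ℕ} (a : Fin (par.t K.k) → par.F K.k) (i : ℕ) :
    horner (par.modulus K) s (List.ofFn fun j => (a j).val) i = (par.shareAt (s : par.F K.k) a i).val := by
  have h := horner_cast K (s := s) (cs := List.ofFn fun j => (a j).val) (List.length_ofFn) i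
  have h2 : (fun j : Fin (par.t K.k) => (((List.ofFn fun j => (a j).val).getD j.val 0 : ℕ) : par.F K.k)) = a := by
    funext j
    rw [List.getD_eq_getElem _ _ (by simp)]
    simp
  rw [h2] at h
  rw [← h]
  exact (ZMod.val_natCast_of_lt (horner_lt (par.prime K.k).pos _ _ _)).symm

/-- There is a polynomial of degree at most `t` with prescribed value at `0` that vanishes at up to
`t` given positions other than `0`. -/
theorem exists_shift (k : ℕ) (δ : par.F k) (J : Finset ℕ) (hJ : J.card ≤ par.t k) (hJ' : ∀ j ∈ J, j < par.n k) :
    ∃ g : Fin (par.t k) → par.F k, ∀ j ∈ J, par.shareAt δ g (j + 1) = 0 := by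
  have hne : ∀ j ∈ J, ((j + 1 : ℕ) : par.F k) ≠ 0 := by
    intro j hj h
    have h1 := (ZMod.natCast_eq_zero_iff _ _).1 h
    have h2 := Nat.le_of_dvd (Nat.succ_pos _) h1
    have := hJ' j hj
    have := par.n_lt k
    omega
  let f : (par.F k)[X] := C δ * ∏ j ∈ J, (1 - C ((j + 1 : ℕ) : par.F k)⁻¹ * X)
  have hdeg : f.natDegree ≤ par.t k := by
    refine (natDegree_C_mul_le _ _).trans ((natDegree_prod_le _ _).trans ((Finset.sum_le_card_nsmul _ _ 1 fun j _ => ?_).trans ?_))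
    · refine (natDegree_sub_le _ _).trans (max_le (by simp) ((natDegree_C_mul_le _ _).trans natDegree_X_le))
    · simpa using hJ
  have h0 : f.coeff 0 = δ := by
    rw [coeff_zero_eq_eval_zero]
    simp [f, eval_prod]
  refine ⟨fun j => f.coeff (j.val + 1), fun j hj => ?_⟩
  have h1 : f.eval ((j + 1 : ℕ) : par.F k) = 0 := by
    simp only [f, eval_mul, eval_C, eval_prod]
    rw [Finset.prod_eq_zero hj, mul_zero]
    simp only [eval_sub, eval_one, eval_mul, eval_C, eval_X]
    rw [inv_mul_cancel₀ (hne j hj), sub_self]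
  rw [eval_eq_sum_range' (n := par.t k + 1) (by omega), Finset.sum_range_succ', h0, pow_zero, mul_one, Finset.sum_range] at h1
  rw [Params.shareAt, add_comm]
  exact h1

/-- Privacy of Shamir secret sharing: up to `t` shares are independent of the secret. -/
theorem shamir_privacy {β : Type} (K : Sec) {m : ℕ} (hm : m ≤ par.n K.k) (J : Finset ℕ) (hJ : J.card ≤ par.t K.k)
    (hJ' : ∀ j ∈ J, j < m) (Φ : List ℕ → PMF β)
    (hΦ : ∀ l l' : List ℕ, l.length = m → l'.length = m → (∀ j ∈ J, l.getD j 0 = l'.getD j 0) → Φ l = Φ l') (s s' : ℕ) :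
    ((coeffsPMF par K).bind fun cs => Φ (shareList par K s cs m)) =
      (coeffsPMF par K).bind fun cs => Φ (shareList par K s' cs m) := by
  obtain ⟨g, hg⟩ := exists_shift K.k ((s' : par.F K.k) - (s : par.F K.k)) J hJ fun j hj => (hJ' j hj).trans_le hm
  rw [coeffsPMF_eq, PMF.bind_map, PMF.bind_map]
  have h := uniform_map_equiv (Equiv.addRight g)
  conv_rhs => rw [← h, PMF.bind_map]
  refine bind_ext fun a => hΦ _ _ (by simp [shareList]) (by simp [shareList]) fun j hj => ?_
  have hj' := hJ' j hj
  have e : ∀ s (a : Fin (par.t K.k) → par.F K.k), (shareList par K s (List.ofFn fun j => (a j).val) m).getD j 0 =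
      (par.shareAt (s : par.F K.k) a (j + 1)).val := fun s a => by
    rw [List.getD_eq_getElem _ _ (by simpa [shareList] using hj')]
    simp only [shareList, List.getElem_map, List.getElem_range, horner_ofFn]
  rw [e]
  refine Eq.trans ?_ (e _ _).symm
  have h2 := hg j hj
  simp only [Params.shareAt, Equiv.coe_addRight, Pi.add_apply, add_mul, Finset.sum_add_distrib] at h2 ⊢
  congr 1
  linear_combination -h2

/-! ### The adversary against the encryption scheme -/

theorem map_fst_encShares {par : Params} {E : PKE par} {K : Sec} {pub : Val} {G : List Party} {sh : List ℕ}
    {rs : List Val} (hsh : sh.length = G.length) (hrs : rs.length = G.length) :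
    (encShares E K pub G sh rs).map Prod.fst = G := by
  rw [encShares, List.map_map]
  have e : (Prod.fst ∘ fun e : Party × (ℕ × Val) => ((e.1, (E.encF (K, .ofList [pub.get 0, e.1.pk, .num e.2.1, e.2.2]),
      e.2.1)) : Item)) = Prod.fst := rfl
  rw [e, List.map_fst_zip]
  rw [List.length_zip, hsh, hrs, min_self]

section

variable {α β γ δ : Type}

theorem mapAll_zip_map (f : α → PMF β) (g : α × β → γ) (l : List α) :
    (mapAll f l).map (fun bs => (l.zip bs).map g) = mapAll (fun a => (f a).map fun b => g (a, b)) l := by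
  induction l with
  | nil => rw [mapAll_nil, mapAll_nil, PMF.pure_map]; rfl
  | cons a l ih =>
    simp only [mapAll_cons, ← ih, PMF.map_bind, PMF.bind_map, PMF.pure_map]
    rfl

theorem mapAll_zip_zip (p : PMF β) (g : α × (δ × β) → γ) (l : List α) (sh : List δ) (h : sh.length = l.length) :
    (mapAll (fun _ => p) l).map (fun bs => (l.zip (sh.zip bs)).map g) =
      mapAll (fun e : α × δ => p.map fun b => g (e.1, (e.2, b))) (l.zip sh) := by
  induction l generalizing sh with
  | nil => rw [List.zip_nil_left, mapAll_nil, mapAll_nil, PMF.pure_map]; rfl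
  | cons a l ih =>
    obtain _ | ⟨s, sh⟩ := sh
    · simp at h
    · rw [List.zip_cons_cons]
      simp only [mapAll_cons, ← ih sh (by simpa using h), PMF.map_bind, PMF.bind_map, PMF.pure_map]
      rfl

end

theorem Val.get_num (n i : ℕ) : (Val.num n).get i = .num 0 := by
  cases i with
  | zero => rfl
  | succ i =>
    show (Val.num 0).get i = _
    induction i with
    | zero => rfl
    | succ i ih => exact ih

theorem Val.get_ofList (l : List Val) (i : ℕ) : (Val.ofList l).get i = l.getD i (.num 0) := by
  induction l generalizing i with
  | nil => rw [Val.ofList, Val.get_num]; simp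
  | cons a l ih =>
    cases i with
    | zero => rfl
    | succ i => exact ih i

theorem Val.length_le_size (l : List Val) : l.length ≤ (Val.ofList l).size := by
  induction l with
  | nil => exact Nat.zero_le _
  | cons a l ih => rw [Val.ofList, Val.size_pair, List.length_cons]; omega

section

variable (E N₀ N₂ SE Nb A reveal D P₀ P₁ P₂)

/-- The provers of the game without witnesses. -/
def simProvers (K : Sec) (pp : Val) (c₀ c₁ c₂ : Val × Val) : Provers :=
  provers E K (publicParams pp c₀.1 c₁.1 c₂.1) [] (P₀.prove K pp c₀) (P₁.prove K pp c₁) (P₂.prove K pp c₂)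

/-- The encryption of a share; with `β`, the shares of honest participants are replaced by `0`. -/
def ciphertext (K : Sec) (pp : Val) (β : Bool) (e : Party × ℕ) : PMF Val :=
  E.encrypt K.k pp e.1.pk (if β && !e.1.corrupt then 0 else (e.2 : par.F K.k))

/-- The end of the game, from the public keys and ciphertexts of the challenge. -/
def finish (par : Params) (P₁ : ProofSystem) (A : PrivacyAdversary) (K : Sec) (pp : Val) (c₁ : Val × Val) (a : Val)
    (l : List (Val × Val)) : Comp Val :=
  P₁.prove K pp c₁ (.ofList [pp, .num l.length, .num (par.thr K), .ofList (l.map fun e => .pair e.1 e.2)], .num 0) >>=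
    fun pf => A.guess.call (K, .ofList [a, .ofList (l.map Prod.snd), pf])

/-- The distribution of the result of the game after the oracle phase. -/
def finalStage (K : Sec) (pp : Val) (c₁ : Val × Val) (β : Bool) (s : ℕ) (G : List Party) (a : Val)
    (d : D.State) : PMF Bool :=
  (coeffsPMF par K).bind fun cs =>
    (mapAll (ciphertext E K pp β) (G.zip (shareList par K s cs G.length))).bind fun es =>
      ((finish par P₁ A K pp c₁ a ((G.map Party.pk).zip es)).exec D noOracle d ()).map fun u => outBit u.1

/-- The last hybrid experiments: all proofs are simulated, and in the challenge the shares of honest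
participants are replaced by `0` if `β` is set. -/
def lastHybrid (β b : Bool) (k : ℕ) : PMF Bool :=
  (E.setup k).bind fun pp => (keysPMF E Nb k pp).bind fun kps => (P₀.crs k pp).bind fun c₀ =>
    (P₁.crs k pp).bind fun c₁ => (P₂.crs k pp).bind fun c₂ =>
      ((keyStage (par := par) N₀ A ⟨k⟩ (simProvers E P₀ P₁ P₂ ⟨k⟩ pp c₀ c₁ c₂)
        (publicParams pp c₀.1 c₁.1 c₂.1) kps.public).exec D noOracle D.init ()).bind fun o =>
        o.1.elim (PMF.pure false) fun r =>
          ((attackStage E N₂ SE A reveal ⟨k⟩ (simProvers E P₀ P₁ P₂ ⟨k⟩ pp c₀ c₁ c₂)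
            (publicParams pp c₀.1 c₁.1 c₂.1) r).exec D noOracle o.2.1 ()).bind fun u =>
            finalStage E A D P₁ ⟨k⟩ pp c₁ β (challengeSecret par ⟨k⟩ b u.1.1) r.2 (u.1.1.get 2) u.2.1

/-- The message vector for the challenge. -/
def cpaMessages (K : Sec) (l : List (Party × ℕ)) : Val :=
  .ofList ((List.range (Nb.eval K.k)).map fun i =>
    .num ((l.filter fun e => decide (e.1.idx = i)).head?.elim 0 Prod.snd))

/-- What the second stage has to know of a participant: the ciphertext is given for a corrupted
participant. -/
def cpaEntry (e : Party × Val) : Val := .ofList [e.1.pk, .num e.1.idx, .ofBool e.1.corrupt, e.2]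

/-- The state between the stages. -/
def cpaState (pp : Val) (c₁ : Val × Val) (a : Val) (l : List (Party × Val)) : Val :=
  .ofList [pp, c₁.1, c₁.2, a, .num l.length, .ofList (l.map cpaEntry)]

/-- The challenge of the first stage, which encrypts the shares of the corrupted participants, and
leaves the other ones to the encryption game. -/
def cpaChallenge (K : Sec) (pp : Val) (c₁ : Val × Val) (s : ℕ) (G : List Party) (a : Val) : Comp Val :=
  coeffs par K >>= fun cs =>
    (fun parts => .ofList [cpaMessages Nb K (G.zip (shareList par K s cs G.length)), .num 0,
      cpaState pp c₁ a (G.zip parts)]) <$>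
    Comp.mapC (fun q : Party × ℕ => bif q.1.corrupt then
        (fun y => E.encF (K, .ofList [pp, q.1.pk, .num q.2, y])) <$> SE (K, pp)
      else .ret (.num 0)) (G.zip (shareList par K s cs G.length))

/-- The first stage plays the game up to the challenge. -/
def cpaChoose (C₀ C₁ C₂ : Sec × Val → Comp (Val × Val)) (b : Bool) (x : Sec × Val) : Comp Val :=
  C₀ (x.1, x.2.fst) >>= fun c₀ => C₁ (x.1, x.2.fst) >>= fun c₁ => C₂ (x.1, x.2.fst) >>= fun c₂ =>
  keyStage (par := par) N₀ A x.1 (simProvers E P₀ P₁ P₂ x.1 x.2.fst c₀ c₁ c₂) (publicParams x.2.fst c₀.1 c₁.1 c₂.1)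
    ((List.range (Nb.eval x.1.k)).map fun i => x.2.snd.get i) >>= fun o =>
  o.elim (.ret (.num 0)) fun r =>
    attackStage E N₂ SE A reveal x.1 (simProvers E P₀ P₁ P₂ x.1 x.2.fst c₀ c₁ c₂)
      (publicParams x.2.fst c₀.1 c₁.1 c₂.1) r >>= fun u =>
    cpaChallenge E SE Nb x.1 x.2.fst c₁ (challengeSecret par x.1 b u.1) r.2 (u.1.get 2)

/-- The public key and the ciphertext of a participant, from an entry of the state and the
ciphertexts of the encryption game. -/
def cpaPick (Es e : Val) : Val × Val :=
  (e.get 0, bif decide ((e.get 2).toNat = 0) then Es.get (e.get 1).toNat else e.get 3)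

/-- The public keys and ciphertexts of the challenge, from the state of the first stage and the
ciphertexts of the encryption game. -/
def cpaParse (st Es : Val) (m : ℕ) : List (Val × Val) :=
  (List.range (if (st.get 4).toNat ≤ m then (st.get 4).toNat else m)).map fun j => cpaPick Es ((st.get 5).get j)

open Classical in
/-- The second stage completes the game. -/
def cpaGuess (x : Sec × Val) : Comp Val :=
  if x.2.fst = .num 0 then .ret (.num 0) else
    finish par P₁ A x.1 (x.2.fst.get 0) (x.2.fst.get 1, x.2.fst.get 2) (x.2.fst.get 3)
      (cpaParse x.2.fst x.2.snd x.2.size)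

end

theorem provers_eq (h₀ : ∀ K d c x w w', P₀.prove K d c (x, w) = P₀.prove K d c (x, w'))
    (h₂ : ∀ K d c x w w', P₂.prove K d c (x, w) = P₂.prove K d c (x, w')) (K : Sec) (pp : Val) (kps : Keys)
    (c₀ c₁ c₂ : Val × Val) : provers E K (publicParams pp c₀.1 c₁.1 c₂.1) kps (P₀.prove K pp c₀) (P₁.prove K pp c₁)
      (P₂.prove K pp c₂) = simProvers E P₀ P₁ P₂ K pp c₀ c₁ c₂ := by
  unfold simProvers provers
  congr 1
  · exact funext fun a => h₀ _ _ _ _ _ _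
  · exact funext fun a => h₂ _ _ _ _ _ _

theorem guessStage_eq (F : Setting E N₀ N₂ SE SK Nb)
    (h₁ : ∀ K d c x w w', P₁.prove K d c (x, w) = P₁.prove K d c (x, w')) (K : Sec) (pp : Val)
    (c₀ c₁ c₂ : Val × Val) (G : List Party) (u : Val) (d : D.State) :
    ((guessStage E SE A b K (simProvers E P₀ P₁ P₂ K pp c₀ c₁ c₂) (publicParams pp c₀.1 c₁.1 c₂.1) G u).exec
      D noOracle d ()).map (fun u => outBit u.1) =
      finalStage E A D P₁ K pp c₁ false (challengeSecret par K b u) G (u.get 2) d := by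
  rw [guessStage, deal, bind_assoc, bind_def, exec_bind_of_is (coeffs_is K), PMF.map_bind, finalStage]
  refine bind_ext fun cs => ?_
  generalize challengeSecret par K b u = s
  have hl : (shareList par K s cs G.length).length = G.length := by simp [shareList]
  have hct : mapAll (ciphertext E K pp false) (G.zip (shareList par K s cs G.length)) =
      (mapAll (fun _ => E.sampleEnc K.k pp) G).map fun rs =>
        (encShares E K (publicParams pp c₀.1 c₁.1 c₂.1) G (shareList par K s cs G.length) rs).map fun it => it.2.1 := by
    have h := mapAll_zip_zip (E.sampleEnc K.k pp) (fun e : Party × (ℕ × Val) =>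
      E.encF (K, .ofList [pp, e.1.pk, .num e.2.1, e.2.2])) G (shareList par K s cs G.length) hl
    have h2 : (fun rs => (encShares E K (publicParams pp c₀.1 c₁.1 c₂.1) G (shareList par K s cs G.length) rs).map
        fun it => it.2.1) = fun rs => (G.zip ((shareList par K s cs G.length).zip rs)).map
          fun e : Party × (ℕ × Val) => E.encF (K, .ofList [pp, e.1.pk, .num e.2.1, e.2.2]) := by
      funext rs
      rw [encShares, List.map_map]; rfl
    rw [h2, h]
    refine mapAll_congr fun e _ => ?_
    simp only [ciphertext, PKE.encrypt, Bool.false_and, Bool.false_eq_true, if_false]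
    rfl
  rw [hct, bind_assoc, bind_def, exec_bind_of_is (F.samples.is K _ G), PMF.map_bind, PMF.bind_map]
  refine bind_congr_support fun rs hrs => ?_
  have hrs' := (mapAll_support hrs).length_eq
  rw [Function.comp_apply]
  set its := encShares E K (publicParams pp c₀.1 c₁.1 c₂.1) G (shareList par K s cs G.length) rs with hits
  have hG : G = its.map Prod.fst := (map_fst_encShares hl hrs'.symm).symm
  have hz : (G.map Party.pk).zip (its.map fun it => it.2.1) = its.map fun it => (it.1.pk, it.2.1) := by
    conv_lhs => rw [hG]
    rw [List.map_map, List.zip_map']; rfl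
  rw [hz]
  congr 1
  have hpf : ∀ x w, (simProvers E P₀ P₁ P₂ K pp c₀ c₁ c₂).enc (x, w) = P₁.prove K pp c₁ (x, .num 0) :=
    fun x w => h₁ _ _ _ _ _ _
  rw [hpf, map_def, bind_def, bind_assoc', finish, bind_def, sharingStmt]
  simp only [ret_bind', List.map_map, List.length_map]
  rfl

/-- Without witnesses in the proofs, the game is the last hybrid experiment. -/
theorem hybrid_eq_last (F : Setting E N₀ N₂ SE SK Nb)
    (h₀ : ∀ K d c x w w', P₀.prove K d c (x, w) = P₀.prove K d c (x, w'))
    (h₁ : ∀ K d c x w w', P₁.prove K d c (x, w) = P₁.prove K d c (x, w'))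
    (h₂ : ∀ K d c x w w', P₂.prove K d c (x, w) = P₂.prove K d c (x, w')) (k : ℕ) :
    hybrid E N₀ N₂ SE Nb A reveal D P₀ P₁ P₂ b k = lastHybrid E N₀ N₂ SE Nb A reveal D P₀ P₁ P₂ false b k := by
  rw [hybrid_eq, lastHybrid]
  refine bind_ext fun pp => bind_ext fun kps => bind_ext fun c₀ =>
    bind_ext fun c₁ => bind_ext fun c₂ => ?_
  rw [play, provers_eq h₀ h₂, runBit, exec_map, PMF.map_comp, game, bind_def, exec_bind, PMF.map_bind]
  refine bind_ext fun o => ?_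
  obtain ⟨o, d, _⟩ := o
  cases o with
  | none =>
    simp only [Option.elim, exec_ret, PMF.pure_map]
    simp [outBit]
  | some r =>
    simp only [Option.elim]
    rw [bind_def, exec_bind, PMF.map_bind]
    refine bind_ext fun u => ?_
    rw [← guessStage_eq F h₁ ⟨k⟩ pp c₀ c₁ c₂, exec_map, PMF.map_comp]
    rfl

theorem cpaParse_eq (pp : Val) (c₁ : Val × Val) (a : Val) (l : List (Party × Val)) (Es : Val) {m : ℕ}
    (hm : l.length ≤ m) : cpaParse (cpaState pp c₁ a l) Es m =
      l.map fun e => (e.1.pk, if e.1.corrupt then e.2 else Es.get e.1.idx) := by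
  have h4 : ((cpaState pp c₁ a l).get 4).toNat = l.length := rfl
  have h5 : (cpaState pp c₁ a l).get 5 = .ofList (l.map cpaEntry) := rfl
  rw [cpaParse, h4, h5, if_pos hm]
  refine List.ext_getElem (by simp) fun j h1 h2 => ?_
  have hj : j < l.length := by simpa using h1
  rw [List.getElem_map, List.getElem_range, Val.get_ofList, List.getD_eq_getElem _ _ (by simpa using hj),
    List.getElem_map, List.getElem_map]
  refine Prod.ext rfl ?_
  show (bif decide ((Val.ofBool l[j].1.corrupt).toNat = 0) then _ else _) = _
  cases l[j].1.corrupt <;> rfl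

theorem PP.simProvers_key {α : Type} [Enc α] {w : ℕ} (h₀ : P₀.Feasible) {K : α → Sec} {pp : α → Val}
    {c₀ c₁ c₂ : α → Val × Val} (hK : Det K := by fun_prop) (hp : Det pp := by fun_prop)
    (hc₀ : Det c₀ := by fun_prop) (hc₁ : Det c₁ := by fun_prop) (hc₂ : Det c₂ := by fun_prop) :
    PP w fun x : α × (ℕ × Val) =>
      (simProvers E P₀ P₁ P₂ (K x.1) (pp x.1) (c₀ x.1) (c₁ x.1) (c₂ x.1)).key x.2 :=
  PP.key_prover (K := K) (pub := fun x => publicParams (pp x) (c₀ x).1 (c₁ x).1 (c₂ x).1) (kps := fun _ => [])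
    (p₀ := fun x => P₀.prove (K x) (pp x) (c₀ x)) (p₁ := fun x => P₁.prove (K x) (pp x) (c₁ x))
    (p₂ := fun x => P₂.prove (K x) (pp x) (c₂ x)) (h₀.prove_pp)

theorem PP.simProvers_dec {α : Type} [Enc α] {w : ℕ} (F : Setting E N₀ N₂ SE SK Nb) (h₂ : P₂.Feasible)
    {K : α → Sec} {pp : α → Val} {c₀ c₁ c₂ : α → Val × Val} (hK : Det K := by fun_prop)
    (hp : Det pp := by fun_prop) (hc₀ : Det c₀ := by fun_prop) (hc₁ : Det c₁ := by fun_prop)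
    (hc₂ : Det c₂ := by fun_prop) :
    PP w fun x : α × Item =>
      (simProvers E P₀ P₁ P₂ (K x.1) (pp x.1) (c₀ x.1) (c₁ x.1) (c₂ x.1)).dec x.2 :=
  PP.dec_prover F (K := K) (pub := fun x => publicParams (pp x) (c₀ x).1 (c₁ x).1 (c₂ x).1) (kps := fun _ => [])
    (p₀ := fun x => P₀.prove (K x) (pp x) (c₀ x)) (p₁ := fun x => P₁.prove (K x) (pp x) (c₁ x))
    (p₂ := fun x => P₂.prove (K x) (pp x) (c₂ x)) (h₂.prove_pp)

theorem PP.finish (F : Setting E N₀ N₂ SE SK Nb) (hA : A.PPT) (h₁ : P₁.Feasible) {α : Type} [Enc α] {w : ℕ}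
    {K : α → Sec} {pp a : α → Val} {c₁ : α → Val × Val} {l : α → List (Val × Val)} (hK : Det K := by fun_prop)
    (hp : Det pp := by fun_prop) (ha : Det a := by fun_prop) (hc : Det c₁ := by fun_prop)
    (hl : Det l := by fun_prop) : PP w fun x => finish par P₁ A (K x) (pp x) (c₁ x) (a x) (l x) := by
  have ht := F.thr
  have h3 : Det fun x => (l x).map fun e => Val.pair e.1 e.2 :=
    Det.list_map (f := fun _ (e : Val × Val) => Val.pair e.1 e.2)
  have h4 : Det fun y : α × Val => (l y.1).map Prod.snd :=
    Det.list_map (f := fun _ (e : Val × Val) => e.2)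
  refine PP.bind (h₁.2.1.of_zero.comp (f := fun x => ((K x, pp x), (c₁ x, (Val.ofList [pp x, .num (l x).length,
    .num (par.thr (K x)), .ofList ((l x).map fun e => .pair e.1 e.2)], Val.num 0))))) ?_
  exact hA.2.2.2.pp.of_zero.comp (f := fun y : α × Val => (K y.1, Val.ofList [a y.1, .ofList ((l y.1).map Prod.snd), y.2]))

theorem PP.cpaGuess (F : Setting E N₀ N₂ SE SK Nb) (hA : A.PPT) (h₁ : P₁.Feasible) :
    PP 0 (cpaGuess (par := par) A P₁) := by
  classical
  refine PP.ite PP.ret (PP.finish F hA h₁ (hl := ?_))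
  have hpick : Det fun y : Val × Val => cpaPick y.1 y.2 := by
    have h : Det fun y : Val × Val => bif decide ((y.2.get 2).toNat = 0) then y.1.get (y.2.get 1).toNat else y.2.get 3 :=
      Det.bite (by fun_prop) (by fun_prop) (by fun_prop)
    unfold PVSSPrivacy.cpaPick
    fun_prop
  refine Det.list_map (f := fun (x : Sec × Val) j => cpaPick x.2.snd ((x.2.fst.get 5).get j))
    (hf := Det.comp hpick (f := fun p : (Sec × Val) × ℕ => (p.1.2.snd, (p.1.2.fst.get 5).get p.2)) (by fun_prop))
    (hl := Det.list_range (R := X) (by fun_prop) fun x => ?_)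
  rw [eval_X, sz_pair, sz_val]
  split_ifs <;> omega

theorem Det.cpaMessages {α : Type} [Enc α] {K : α → Sec} {l : α → List (Party × ℕ)} (hK : Det K := by fun_prop)
    (hl : Det l := by fun_prop) :
    Det fun x => cpaMessages Nb (K x) (l x) := by
  have hrange : Det fun K : Sec => List.range (Nb.eval K.k) := Det.list_range (R := Nb) (Det.poly_eval Nb)
    fun K => poly_mono Nb (by rw [sz_sec]; omega)
  have h1 : Det fun y : α × ℕ => (l y.1).filter fun e => decide (e.1.idx = y.2) :=
    Det.list_filter (f := fun (y : α × ℕ) (e : Party × ℕ) => decide (e.1.idx = y.2))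
  have h2 := Det.list_head? h1
  exact Det.val_ofList (Det.list_map (f := fun x i => Val.num (((l x).filter fun e => decide (e.1.idx = i)).head?.elim 0
    Prod.snd)) (hf := Det.val_num (Det.option_elim (ho := h2))) (hl := Det.comp hrange hK))

theorem Det.cpaState {α : Type} [Enc α] {pp a : α → Val} {c₁ : α → Val × Val} {l : α → List (Party × Val)}
    (hp : Det pp := by fun_prop) (hc : Det c₁ := by fun_prop) (ha : Det a := by fun_prop)
    (hl : Det l := by fun_prop) :
    Det fun x => cpaState (pp x) (c₁ x) (a x) (l x) := by
  have h1 : Det fun x => (l x).map cpaEntry :=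
    Det.list_map (f := fun _ e => cpaEntry e) (hf := by unfold cpaEntry; fun_prop)
  unfold PVSSPrivacy.cpaState
  fun_prop

theorem PP.cpaChallenge (F : Setting E N₀ N₂ SE SK Nb) {α : Type} [Enc α] {w : ℕ} {K : α → Sec} {pp a : α → Val}
    {c₁ : α → Val × Val} {s : α → ℕ} {G : α → List Party} (hK : Det K := by fun_prop)
    (hp : Det pp := by fun_prop) (ha : Det a := by fun_prop) (hc : Det c₁ := by fun_prop)
    (hs : Det s := by fun_prop) (hG : Det G := by fun_prop) :
    PP w fun x => cpaChallenge E SE Nb (K x) (pp x) (c₁ x) (s x) (G x) (a x) := by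
  have hE := F.enc
  have hl : Det fun y : α × List ℕ => (G y.1).zip (shareList par (K y.1) (s y.1) y.2 (G y.1).length) := by
    have := Det.shareList F.toFeasible (K := fun y : α × List ℕ => K y.1) (s := fun y => s y.1) (cs := fun y => y.2)
      (G := fun y => G y.1)
    fun_prop
  have hm := Det.cpaMessages (Nb := Nb) (K := fun y : α × List ℕ => K y.1) (hl := hl)
  refine PP.bind (PP.coeffs F.toFeasible) (PP.map (f := fun (y : α × List ℕ) parts => Val.ofList [cpaMessages Nb (K y.1)
    ((G y.1).zip (shareList par (K y.1) (s y.1) y.2 (G y.1).length)), .num 0,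
      PVSSPrivacy.cpaState (pp y.1) (c₁ y.1) (a y.1) ((G y.1).zip parts)]) (PP.mapC ?_) (hf := ?_))
  · exact PP.bite (PP.map (f := fun (q : (α × List ℕ) × (Party × ℕ)) y =>
      E.encF (K q.1.1, .ofList [pp q.1.1, q.2.1.pk, .num q.2.2, y])) (F.sample.of_zero.comp
      (f := fun q : (α × List ℕ) × (Party × ℕ) => (K q.1.1, pp q.1.1)))) PP.ret
  · have := Det.cpaState (pp := fun z : (α × List ℕ) × List Val => pp z.1.1) (a := fun z => a z.1.1) (c₁ := fun z => c₁ z.1.1)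
      (l := fun z => (G z.1.1).zip z.2)
    have hm' := Det.comp hm (f := fun z : (α × List ℕ) × List Val => z.1) (by fun_prop)
    fun_prop

/-- The parameters of a computation that plays the game: its input, and the reference strings with
their trapdoors. -/
abbrev CpaData := (((Sec × Val) × (Val × Val)) × (Val × Val)) × (Val × Val)

theorem PP.cpaChoose (F : Setting E N₀ N₂ SE SK Nb) (hA : A.PPT) (h₀ : P₀.Feasible) (h₁ : P₁.Feasible)
    (h₂ : P₂.Feasible) {C₀ C₁ C₂ : Sec × Val → Comp (Val × Val)} (hC₀ : PP 0 C₀) (hC₁ : PP 0 C₁) (hC₂ : PP 0 C₂) :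
    PP 0 (cpaChoose E N₀ N₂ SE Nb A reveal P₀ P₁ P₂ C₀ C₁ C₂ b) := by
  have hrange : Det fun K : Sec => List.range (Nb.eval K.k) := Det.list_range (R := Nb) (Det.poly_eval Nb)
    fun K => poly_mono Nb (by rw [sz_sec]; omega)
  have hpks : Det fun x : CpaData =>
      (List.range (Nb.eval x.1.1.1.1.k)).map fun i => x.1.1.1.2.snd.get i :=
    Det.list_map (f := fun (x : CpaData) i => x.1.1.1.2.snd.get i)
      (hl := Det.comp hrange (f := fun x : CpaData => x.1.1.1.1) (by fun_prop))
  refine PP.bind (hC₀.comp (f := fun x : Sec × Val => (x.1, x.2.fst))) (PP.bind (hC₁.comp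
    (f := fun x : (Sec × Val) × (Val × Val) => (x.1.1, x.1.2.fst))) (PP.bind (hC₂.comp
    (f := fun x : ((Sec × Val) × (Val × Val)) × (Val × Val) => (x.1.1.1, x.1.1.2.fst))) (PP.bind (PP.keyStage
      F.toFeasible hA (PP.simProvers_key h₀
      (K := fun x : CpaData => x.1.1.1.1) (pp := fun x => x.1.1.1.2.fst)
      (c₀ := fun x => x.1.1.2) (c₁ := fun x => x.1.2) (c₂ := fun x => x.2))) (PP.option_elim PP.ret (PP.bind (PP.attackStage
      F.toFeasible hA ?_ ?_) (PP.cpaChallenge F (hs := Det.challengeSecret F.toFeasible)))))))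
  · exact h₁.2.1.of_zero.comp (f := fun q : ((CpaData × Option (Val × List Party)) ×
      (Val × List Party)) × (Val × Val) =>
      ((q.1.1.1.1.1.1.1, q.1.1.1.1.1.1.2.fst), (q.1.1.1.1.2, (q.2.1, q.2.2))))
  · exact PP.simProvers_dec F h₂ (K := fun q : (CpaData × Option (Val × List Party)) ×
      (Val × List Party) => q.1.1.1.1.1.1) (pp := fun q => q.1.1.1.1.1.2.fst) (c₀ := fun q => q.1.1.1.1.2)
      (c₁ := fun q => q.1.1.1.2) (c₂ := fun q => q.1.1.2)

theorem card_positions {α : Type} (l : List α) (c : α → Bool) :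
    ((Finset.range l.length).filter fun j => (l.map c).getD j false).card = (l.filter c).length := by
  rw [Finset.card_filter]
  induction l with
  | nil => rfl
  | cons a l ih =>
    rw [List.length_cons, Finset.sum_range_succ']
    simp only [List.map_cons, List.getD_cons_succ, List.getD_cons_zero, ih]
    cases h : c a <;> simp [h]

theorem mapAll_eq_map {α β : Type} (f : α → PMF β) (l : List α) : mapAll f l = mapAll id (l.map f) :=
  (mapAll_list_map id f l).symm

theorem cpaMessages_get (K : Sec) {l : List (Party × ℕ)} (hl : (l.map fun e => e.1.idx).Nodup)
    {e : Party × ℕ} (he : e ∈ l) (hi : e.1.idx < Nb.eval K.k) : (cpaMessages Nb K l).get e.1.idx = .num e.2 := by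
  rw [cpaMessages, Val.get_ofList, List.getD_eq_getElem _ _ (by simpa using hi), List.getElem_map, List.getElem_range]
  have : l.filter (fun e' => decide (e'.1.idx = e.1.idx)) = [e] := by
    induction l with
    | nil => simp at he
    | cons a l ih =>
      rw [List.map_cons, List.nodup_cons] at hl
      rcases List.mem_cons.1 he with rfl | he'
      · rw [List.filter_cons_of_pos (by simp), List.filter_eq_nil_iff.2]
        intro x hx hxe
        exact hl.1 (List.mem_map.2 ⟨x, hx, by simpa using hxe⟩)
      · rw [List.filter_cons_of_neg, ih hl.2 he']
        intro h
        exact hl.1 (List.mem_map.2 ⟨e, he', (of_decide_eq_true h).symm⟩)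
  rw [this]
  rfl

/-- The first stage leaves the ciphertexts of honest participants open. -/
def partPMF (E : PKE par) (K : Sec) (pp : Val) (q : Party × ℕ) : PMF Val :=
  if q.1.corrupt then E.encrypt K.k pp q.1.pk (q.2 : par.F K.k) else PMF.pure (.num 0)

theorem cpaChallenge_is (F : Setting E N₀ N₂ SE SK Nb) (K : Sec) (pp : Val) (c₁ : Val × Val) (s : ℕ)
    (G : List Party) (a : Val) : Is D noOracle (cpaChallenge E SE Nb K pp c₁ s G a)
      ((coeffsPMF par K).bind fun cs => (mapAll (partPMF E K pp) (G.zip (shareList par K s cs G.length))).map fun parts =>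
        .ofList [cpaMessages Nb K (G.zip (shareList par K s cs G.length)), .num 0, cpaState pp c₁ a (G.zip parts)]) := by
  refine Is.bind (coeffs_is K) fun cs => Is.map (Is.mapC _ fun q _ => ?_) _
  rw [partPMF]
  cases q.1.corrupt with
  | true => exact Is.map (F.samples (K, pp) D noOracle) _
  | false => exact Is.ret _

/-- The second stage completes the challenge of the first stage. -/
theorem cpa_challenge (F : Setting E N₀ N₂ SE SK Nb) {K : Sec} {pp pub : Val} {pks : List Val} (c₁ : Val × Val) (s : ℕ)
    {G : List Party} (hG : Qualified par N₀ K pub pks G) (a : Val) (β : Bool) (d : D.State) :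
    ((cpaChallenge E SE Nb K pp c₁ s G a).exec D noOracle d ()).bind (fun u =>
      (mapAll (fun i => E.encrypt K.k pp (pks.getD i (.num 0)) (par.dec K.k ((u.1.get (if β then 1 else 0)).get i)))
        (List.range (Nb.eval K.k))).bind fun Es =>
          ((cpaGuess (par := par) A P₁ (K, .pair (u.1.get 2) (.ofList Es))).exec D noOracle u.2.1 ()).map fun v =>
            outBit v.1) = finalStage E A D P₁ K pp c₁ β s G a d := by
  rw [cpaChallenge_is F K pp c₁ s G a d (), PMF.bind_map, PMF.bind_bind, finalStage]
  refine bind_ext fun cs => ?_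
  rw [PMF.bind_map]
  have hlen : (shareList par K s cs G.length).length = G.length := by simp [shareList]
  set Z := G.zip (shareList par K s cs G.length) with hZ
  have hZG : Z.map Prod.fst = G := List.map_fst_zip hlen.ge
  have hidx : Z.map (fun e => e.1.idx) = G.map Party.idx := by rw [← hZG, List.map_map]; rfl
  have hnd : (Z.map fun e => e.1.idx).Nodup := hidx ▸ hG.sub.nodup List.nodup_range
  have hlt : ∀ e ∈ Z, e.1 ∈ G ∧ e.1.idx < Nb.eval K.k := fun e he =>
    have h := hZG ▸ List.mem_map_of_mem (f := Prod.fst) he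
    ⟨h, (hG.idx_lt h).trans_le (F.le K.k)⟩
  set g : List Val → PMF Bool := fun es =>
    ((finish par P₁ A K pp c₁ a ((G.map Party.pk).zip es)).exec D noOracle d ()).map fun u => outBit u.1 with hg
  set f : ℕ → PMF Val := fun i => E.encrypt K.k pp (pks.getD i (.num 0)) (par.dec K.k
    (((Val.ofList [cpaMessages Nb K Z, .num 0, .num 0]).get (if β then 1 else 0)).get i)) with hf
  set pick : List Val → (Party × ℕ) × Val → Val := fun Es e =>
    if e.1.1.corrupt then e.2 else Es.getD e.1.1.idx (.num 0) with hpick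
  set H : Party × ℕ → Val → PMF Val := fun q y =>
    if q.1.corrupt then E.encrypt K.k pp q.1.pk (q.2 : par.F K.k) else PMF.pure y with hH
  have h1 : ∀ Es : List Val, (mapAll (partPMF E K pp) Z).map (fun parts => (Z.zip parts).map (pick Es)) =
      mapAll (fun q => H q (Es.getD q.1.idx (.num 0))) Z := fun Es => by
    rw [mapAll_zip_map]
    refine mapAll_congr fun q _ => ?_
    simp only [partPMF, hH, hpick]
    cases q.1.corrupt with
    | true => exact PMF.map_id _
    | false => exact PMF.pure_map _ _
  have h2 : (mapAll f (List.range (Nb.eval K.k))).bind (fun Es => mapAll (fun q => H q (Es.getD q.1.idx (.num 0))) Z) =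
      mapAll (ciphertext E K pp β) Z := by
    rw [mapAll_pick f (fun q : Party × ℕ => q.1.idx) H (.num 0) List.nodup_range
      (hidx ▸ hG.sub.trans (List.range_sublist.2 (F.le K.k))) (fun Es i => Es.getD i (.num 0))
      fun Es _ i hi => by rw [List.getElem_range]]
    refine mapAll_congr fun q hq => ?_
    obtain ⟨hqG, hql⟩ := hlt q hq
    simp only [hH, ciphertext]
    cases hc : q.1.corrupt with
    | true => simp
    | false =>
      simp only [Bool.false_eq_true, if_false, PMF.bind_pure, hf, Bool.not_false, Bool.and_true]
      rw [← hG.pk _ hqG hc]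
      cases β with
      | false =>
        have := cpaMessages_get K hnd hq hql
        show E.encrypt _ _ _ (par.dec K.k ((cpaMessages Nb K Z).get q.1.idx)) = _
        rw [this]
        rfl
      | true =>
        show E.encrypt _ _ _ (par.dec K.k ((Val.num 0).get q.1.idx)) = _
        rw [Val.get_num]
        simp [Params.dec, Val.toNat]
  rw [← h2, PMF.bind_bind]
  simp only [← h1, PMF.bind_map]
  rw [PMF.bind_comm (mapAll f _)]
  refine bind_congr_support fun parts hparts => ?_
  have hpl : parts.length = G.length := by
    rw [← (mapAll_support hparts).length_eq, ← hZG, List.length_map]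
  have hf' : ∀ i, E.encrypt K.k pp (pks.getD i (.num 0)) (par.dec K.k (((Val.ofList [cpaMessages Nb K Z, .num 0,
      cpaState pp c₁ a (G.zip parts)]).get (if β then 1 else 0)).get i)) = f i := fun i => by
    cases β <;> rfl
  simp only [Function.comp_apply, hf']
  refine bind_ext fun Es => ?_
  have hst : (Val.ofList [cpaMessages Nb K Z, .num 0, cpaState pp c₁ a (G.zip parts)]).get 2 =
      cpaState pp c₁ a (G.zip parts) := rfl
  rw [hst, cpaGuess, if_neg (by simp [Val.fst, cpaState, Val.ofList])]
  simp only [Val.fst, Val.snd]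
  have hsz : (G.zip parts).length ≤ (Val.pair (cpaState pp c₁ a (G.zip parts)) (Val.ofList Es)).size := by
    have h := Val.length_le_size ((G.zip parts).map cpaEntry)
    simp only [cpaState, Val.ofList, Val.size_pair]
    rw [List.length_map] at h
    omega
  rw [cpaParse_eq _ _ _ _ _ hsz]
  simp only [hg]
  have hz : (G.zip parts).map (fun e => (e.1.pk, if e.1.corrupt then e.2 else (Val.ofList Es).get e.1.idx)) =
      (G.map Party.pk).zip ((Z.zip parts).map (pick Es)) := by
    have aux : ∀ (Z : List (Party × ℕ)) (parts : List Val), ((Z.map Prod.fst).zip parts).map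
        (fun e => (e.1.pk, if e.1.corrupt then e.2 else (Val.ofList Es).get e.1.idx)) =
          ((Z.map Prod.fst).map Party.pk).zip ((Z.zip parts).map (pick Es)) := by
      intro Z
      induction Z with
      | nil => simp
      | cons q Z ih =>
        intro parts
        cases parts with
        | nil => simp
        | cons y parts =>
          exact congrArg₂ List.cons (by simp only [hpick, Val.get_ofList]) (ih parts)
    have h := aux Z parts
    rwa [hZG] at h
  rw [hz]
  rfl

/-- The keys of the encryption game become those of the honest participants. With the message vectors
`(shares, zeros)` its two games are the last hybrids. -/
theorem cpaGame_eq (F : Setting E N₀ N₂ SE SK Nb) {C₀ C₁ C₂ : Sec × Val → Comp (Val × Val)}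
    (hC₀ : ∀ p (D : Device) (O : Oracle), Is D O (C₀ p) (P₀.crs p.1.k p.2))
    (hC₁ : ∀ p (D : Device) (O : Oracle), Is D O (C₁ p) (P₁.crs p.1.k p.2))
    (hC₂ : ∀ p (D : Device) (O : Oracle), Is D O (C₂ p) (P₂.crs p.1.k p.2))
    {B : CPAAdversary} (hch : ∀ k x d, B.choose.exec D k x d = ((cpaChoose E N₀ N₂ SE Nb A reveal P₀ P₁ P₂ C₀ C₁ C₂ b
      (⟨k⟩, x)).exec D noOracle d ()).map fun u => (u.1, u.2.1))
    (hgu : ∀ k x d, B.guess.exec D k x d = ((cpaGuess (par := par) A P₁ (⟨k⟩, x)).exec D noOracle d ()).map fun u =>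
      (u.1, u.2.1)) (β : Bool) (k : ℕ) :
    E.cpaGame D B (Nb.eval k) β k = lastHybrid E N₀ N₂ SE Nb A reveal D P₀ P₁ P₂ β b k := by
  have hpk : ∀ pp, mapAll (fun _ => (E.sampleKeyPair k pp).map fun kp => kp.1.1) (List.range (Nb.eval k)) =
      (keysPMF E Nb k pp).map Keys.public := fun pp => by
    show _ = (mapAll _ _).map (List.map fun kp : (Val × Val) × Val => kp.1.1)
    rw [mapAll_map]
  show (E.setup k).bind (fun pp => PMF.bind _ _) = _
  refine bind_ext fun pp => ?_
  rw [hpk, PMF.bind_map]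
  refine bind_congr_support fun kps hkps => ?_
  have hl : kps.public.length = Nb.eval k := by
    rw [Keys.public, List.length_map, ← (mapAll_support hkps).length_eq, List.length_range]
  have hr : (List.range (Nb.eval k)).map (fun i => (Val.ofList kps.public).get i) = kps.public := by
    refine List.ext_getElem (by simp [hl]) fun i h1 h2 => ?_
    rw [List.getElem_map, List.getElem_range, Val.get_ofList, List.getD_eq_getElem _ _ h2]
  show (B.choose.exec D k (.pair pp (.ofList kps.public)) D.init).bind (fun u => PMF.bind _ fun Es => PMF.bind _ _) = _
  rw [hch, PMF.bind_map, cpaChoose, bind_def, exec_bind_of_is (hC₀ _ _ _), PMF.bind_bind]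
  refine bind_ext fun c₀ => ?_
  rw [bind_def, exec_bind_of_is (hC₁ _ _ _), PMF.bind_bind]
  refine bind_ext fun c₁ => ?_
  rw [bind_def, exec_bind_of_is (hC₂ _ _ _), PMF.bind_bind]
  refine bind_ext fun c₂ => ?_
  simp only [Val.fst, Val.snd, hr]
  rw [bind_def, exec_bind, PMF.bind_bind]
  refine bind_congr_support fun o ho => ?_
  have hG := keyStage_sup _ _ _ _ _ _ ho
  obtain ⟨o, d, _⟩ := o
  cases o with
  | none =>
    simp only [Option.elim, exec_ret, PMF.pure_bind, Function.comp_apply]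
    have h2 : (Val.num 0).get 2 = .num 0 := rfl
    simp only [h2, hgu, PMF.bind_map]
    have h3 : ∀ Es d, ((cpaGuess (par := par) A P₁ (⟨k⟩, .pair (.num 0) (.ofList Es))).exec D noOracle d ()).bind
        ((fun v => pure (outBit v.1)) ∘ fun u => (u.1, u.2.1)) = PMF.pure false := fun Es d => by
      have h4 : cpaGuess (par := par) A P₁ (⟨k⟩, .pair (.num 0) (.ofList Es)) = .ret (.num 0) := if_pos rfl
      rw [h4, exec_ret, PMF.pure_bind]
      simp [outBit]
      rfl
    simp only [h3, PMF.bind_const]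
  | some r =>
    simp only [Option.elim]
    rw [bind_def, exec_bind, PMF.bind_bind]
    refine bind_ext fun u => ?_
    rw [← cpa_challenge F c₁ _ (hG r rfl)]
    congr 1
    funext v
    show PMF.bind _ _ = PMF.bind _ _
    congr 1
    funext Es
    rw [hgu, PMF.bind_map]
    rfl

/-- If the shares of the honest participants are not encrypted, at most `t` shares matter, and these
do not depend on the secret. -/
theorem ciphertexts_independent {β : Type} {K : Sec} {pub : Val} {pks : List Val} {G : List Party}
    (hG : Qualified par N₀ K pub pks G) (pp : Val) (W : List Val → PMF β) (s s' : ℕ) :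
    ((coeffsPMF par K).bind fun cs => (mapAll (ciphertext E K pp true) (G.zip (shareList par K s cs G.length))).bind W) =
      (coeffsPMF par K).bind fun cs =>
        (mapAll (ciphertext E K pp true) (G.zip (shareList par K s' cs G.length))).bind W := by
  have hl : G.length ≤ par.n K.k := by
    have := hG.sub.length_le
    rwa [List.length_map, List.length_range] at this
  refine shamir_privacy K hl ((Finset.range G.length).filter fun j => (G.map Party.corrupt).getD j false)
    ((card_positions G Party.corrupt).trans_le hG.corrupt_le)
    (fun j hj => Finset.mem_range.1 (Finset.mem_filter.1 hj).1)
    (fun sh => (mapAll (ciphertext E K pp true) (G.zip sh)).bind W) (fun l l' hl hl' h => ?_) s s'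
  have key : mapAll (ciphertext E K pp true) (G.zip l) = mapAll (ciphertext E K pp true) (G.zip l') := by
    rw [mapAll_eq_map, mapAll_eq_map (ciphertext E K pp true) (G.zip l')]
    congr 1
    refine List.ext_getElem (by simp [hl, hl']) fun j h1 h2 => ?_
    have hj : j < G.length := by simp at h1; exact h1.1
    simp only [List.getElem_map, List.getElem_zip, ciphertext, Bool.true_and]
    cases hc : G[j].corrupt with
    | false => rfl
    | true =>
      have := h j (Finset.mem_filter.2 ⟨Finset.mem_range.2 hj, by
        rw [List.getD_eq_getElem _ _ (by simpa using hj), List.getElem_map]; exact hc⟩)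
      rw [List.getD_eq_getElem _ _ (by omega), List.getD_eq_getElem _ _ (by omega)] at this
      rw [this]
  exact congrArg (fun p : PMF (List Val) => p.bind W) key

/-- Without the shares of honest participants the challenge does not depend on the secret. -/
theorem lastHybrid_eq (k : ℕ) : lastHybrid E N₀ N₂ SE Nb A reveal D P₀ P₁ P₂ true false k =
    lastHybrid E N₀ N₂ SE Nb A reveal D P₀ P₁ P₂ true true k := by
  unfold lastHybrid
  refine bind_ext fun pp => bind_ext fun kps => bind_ext fun c₀ =>
    bind_ext fun c₁ => bind_ext fun c₂ => bind_congr_support fun o ho => ?_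
  have hG := keyStage_sup _ _ _ _ _ _ ho
  obtain ⟨o, d, _⟩ := o
  cases o with
  | none => rfl
  | some r =>
    simp only [Option.elim]
    refine bind_ext fun u => ?_
    unfold finalStage
    exact ciphertexts_independent (hG r rfl) pp _ _ _

/-- The encryption game decides whether the shares of honest participants matter. -/
theorem lastHybrid_close (F : Setting E N₀ N₂ SE SK Nb) (hA : A.PPT) (h₀ : P₀.Feasible) (h₁ : P₁.Feasible)
    (h₂ : P₂.Feasible) (hcpa : E.MultiKeyINDCPA D) :
    Close (lastHybrid E N₀ N₂ SE Nb A reveal D P₀ P₁ P₂ false false)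
      (lastHybrid E N₀ N₂ SE Nb A reveal D P₀ P₁ P₂ false true) := by
  obtain ⟨C₀, hC₀, hC₀'⟩ := h₀.1
  obtain ⟨C₁, hC₁, hC₁'⟩ := h₁.1
  obtain ⟨C₂, hC₂, hC₂'⟩ := h₂.1
  obtain ⟨cg, hcg, hcg'⟩ := (PP.cpaGuess F hA h₁).exists_ppt
  have key : ∀ b, Close (lastHybrid E N₀ N₂ SE Nb A reveal D P₀ P₁ P₂ false b)
      (lastHybrid E N₀ N₂ SE Nb A reveal D P₀ P₁ P₂ true b) := fun b => by
    obtain ⟨cc, hcc, hcc'⟩ := (PP.cpaChoose (reveal := reveal) (b := b) F hA h₀ h₁ h₂ hC₀ hC₁ hC₂).exists_ppt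
    have h := hcpa Nb ⟨cc, cg⟩ ⟨hcc, hcg⟩
    simp only [cpaGame_eq (reveal := reveal) (B := ⟨cc, cg⟩) F hC₀' hC₁' hC₂' (hcc' D) (hcg' D)] at h
    exact h
  refine (key false).trans (.trans (.of_eq fun k => ?_) (key true).symm)
  exact lastHybrid_eq k

/-! ### Reconstruction -/

/-- More than `t` shares determine the secret. -/
theorem Params.sssCombine_eq (k : ℕ) (s : par.F k) (a : Fin (par.t k) → par.F k) {S : Finset ℕ}
    (hS : ∀ i ∈ S, i ≤ par.n k) (hcard : par.t k < S.card) {r : ℕ → par.F k} (hr : ∀ i ∈ S, r i = par.shareAt s a i) :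
    par.sssCombine S r = s := by
  let f : (par.F k)[X] := C s + ∑ j : Fin (par.t k), C (a j) * X ^ (j.val + 1)
  have heval : ∀ x : par.F k, f.eval x = s + ∑ j, a j * x ^ (j.val + 1) := fun x => by
    simp [f, eval_finsetSum]
  have hinj : Set.InjOn (fun i : ℕ => (i : par.F k)) S := fun i hi j hj hij => by
    have h := (ZMod.natCast_eq_natCast_iff' _ _ _).1 hij
    have hlt := par.n_lt k
    rwa [Nat.mod_eq_of_lt ((hS i hi).trans_lt hlt), Nat.mod_eq_of_lt ((hS j hj).trans_lt hlt)] at h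
  have hdeg : f.degree < S.card := by
    refine lt_of_le_of_lt (degree_le_of_natDegree_le (n := par.t k) ?_) (by exact_mod_cast hcard)
    refine (natDegree_add_le _ _).trans (max_le (by simp) (natDegree_sum_le_of_forall_le _ _ fun j _ => ?_))
    exact (natDegree_C_mul_X_pow_le _ _).trans j.isLt
  have h := Lagrange.eq_interpolate_of_eval_eq r hinj hdeg fun i hi => by
    rw [hr i hi, heval]; rfl
  have h0 := congrArg (eval 0) h
  rw [heval, Lagrange.interpolate_apply, eval_finsetSum] at h0
  simp only [ne_eq, Nat.succ_ne_zero, not_false_eq_true, zero_pow, mul_zero, Finset.sum_const_zero, add_zero] at h0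
  rw [h0, Params.sssCombine]
  refine Finset.sum_congr rfl fun i _ => ?_
  rw [eval_mul, eval_C, Lagrange.basis, eval_prod, mul_comm]
  congr 1
  refine Finset.prod_congr rfl fun j _ => ?_
  rw [Lagrange.basisDivisor, eval_mul, eval_C, eval_sub, eval_X, eval_C, zero_sub, mul_neg, ← neg_mul, ← inv_neg,
    neg_sub, mul_comm, div_eq_mul_inv]

variable (E N₂)

/-- The contribution of the participant with number `i` in a reconstruction. -/
def answer (k : ℕ) (v : Val) (ds : List (Option (par.F k × Val))) (i : ℕ) : par.F k × Val :=
  match ds.getD (i - 1) none with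
  | some d => d
  | none => (par.dec k (v.snd.get (i - 1)).fst, (v.snd.get (i - 1)).snd)

open Classical in
/-- The participants whose contributions pass verification. -/
def accepted (k : ℕ) (pub v : Val) (pks Es : List Val) (ds : List (Option (par.F k × Val))) : Finset ℕ :=
  (Finset.Icc 1 pks.length).filter fun i =>
    N₂.ver k (pub.get 3) (decStmt par (pub.get 0) (pks.getD (i - 1) (.num 0)) (Es.getD (i - 1) (.num 0))
      (answer k v ds i).1) (answer k v ds i).2 = true

/-- The result of a reconstruction. -/
def reconstruct (k : ℕ) (pub v : Val) (pks Es : List Val) (ds : List (Option (par.F k × Val))) : Val :=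
  .ofOption ((if (accepted N₂ k pub v pks Es ds).card ≤ par.t k then none
    else some (par.sssCombine (accepted N₂ k pub v pks Es ds) fun i => (answer k v ds i).1)).map par.enc)

/-- The shares and proofs that the honest participants contribute in a session. -/
def Sess.shown (par : Params) (k : ℕ) (ss : Sess) : List (Option (par.F k × Val)) :=
  ss.2.map fun e => e.2.map fun pf => ((e.1.2.2 : par.F k), pf)

variable {E N₂}

/-- Unless a wrong share has passed verification, the result of a reconstruction is as in the ideal
game. -/
theorem reconstruct_eq {K : Sec} {pub v : Val} {G : List Party} {cs : List ℕ} {rs : List Val}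
    (hd : Dealt E K pub G cs rs) {ss : Sess}
    (hl : ss.2.map Prod.fst = encShares E K pub G (shareList par K ss.1 cs G.length) rs) (hs : ss.1 < par.p K.k)
    (hn : G.length ≤ par.n K.k) (hgood : (closeCall N₂ K par pub (v, some ss)).2 = none) :
    reconstruct N₂ K.k pub v (G.map Party.pk) (ss.2.map fun e => e.1.2.1) (ss.shown par K.k) =
      (closeCall N₂ K par pub (v, some ss)).1 := by
  obtain ⟨s, l⟩ := ss
  simp only at hl hs ⊢
  have hshl : (shareList par K s cs G.length).length = G.length := by simp [shareList]
  have hlen : l.length = G.length := by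
    have := congrArg List.length hl
    simpa [encShares, hshl, hd.length_rs] using this
  have hent : ∀ j (hj : j < l.length), (l[j].1).1 = G[j]'(hlen ▸ hj) ∧
      (l[j].1).2.2 = horner (par.modulus K) s cs (j + 1) := fun j hj => by
    have h1 : l[j].1 = (encShares E K pub G (shareList par K s cs G.length) rs)[j]'(by
        rw [← hl, List.length_map]; exact hj) := by
      simp only [← hl, List.getElem_map]
    rw [h1]
    simp [encShares, shareList]
  have hhl : ∀ i, horner (par.modulus K) s cs i < par.p K.k := fun i => horner_lt (par.prime K.k).pos _ _ _
  -- the contributions in the two games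
  have hans : ∀ j (hj : j < l.length), (contribution K par v l[j] j).1 < par.p K.k ∧
      answer K.k v (Sess.shown par K.k (s, l)) (j + 1) =
        (((contribution K par v l[j] j).1 : par.F K.k), (contribution K par v l[j] j).2) := fun j hj => by
    have hg : (Sess.shown par K.k (s, l)).getD j none = l[j].2.map fun pf => (((l[j].1).2.2 : par.F K.k), pf) := by
      rw [Sess.shown, List.getD_eq_getElem _ _ (by simpa using hj), List.getElem_map]
    rw [answer, Nat.add_sub_cancel, hg, contribution]
    cases l[j].2 with
    | none => exact ⟨Nat.mod_lt _ (par.prime K.k).pos, Prod.ext (ZMod.natCast_mod _ _).symm rfl⟩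
    | some pf => exact ⟨by simpa [(hent j hj).2] using hhl (j + 1), rfl⟩
  set L := (l.zip (List.range l.length)).map fun e => (e.1.1, contribution K par v e.1 e.2) with hL
  set c : Item × (ℕ × Val) → Bool := fun e => N₂.verF (K, .ofList [pub.get 3, e.1.stmt pub e.2.1, e.2.2]) with hc
  have hLl : L.length = l.length := by simp [hL]
  have hLj : ∀ j (hj : j < l.length), L[j]'(hLl ▸ hj) = (l[j].1, contribution K par v l[j] j) := fun j hj => by
    simp [hL]
  have hpass : passing N₂ K par pub v l = L.filter c := rfl
  have hS : accepted N₂ K.k pub v (G.map Party.pk) (l.map fun e => e.1.2.1) (Sess.shown par K.k (s, l)) =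
      ((Finset.range L.length).filter fun j => (L.map c).getD j false).map (addRightEmbedding 1) := by
    ext i
    simp only [accepted, Finset.mem_filter, Finset.mem_Icc, Finset.mem_map, Finset.mem_range, addRightEmbedding_apply,
      List.length_map]
    have key : ∀ j (hj : j < l.length), N₂.ver K.k (pub.get 3) (decStmt par (pub.get 0) ((G.map Party.pk).getD j (.num 0))
        ((l.map fun e => e.1.2.1).getD j (.num 0)) (answer K.k v (Sess.shown par K.k (s, l)) (j + 1)).1)
        (answer K.k v (Sess.shown par K.k (s, l)) (j + 1)).2 = (L.map c).getD j false := fun j hj => by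
      obtain ⟨h1, h2⟩ := hans j hj
      rw [h2, List.getD_eq_getElem (List.map c L) _ (by simpa [hLl] using hj), List.getElem_map, hLj j hj, hc,
        List.getD_eq_getElem _ _ (by simpa [← hlen] using hj), List.getD_eq_getElem _ _ (by simpa using hj),
        List.getElem_map, List.getElem_map, decStmt, Params.enc_natCast h1, ← (hent j hj).1]
      rfl
    constructor
    · rintro ⟨⟨h1, h2⟩, h3⟩
      refine ⟨i - 1, ⟨by omega, ?_⟩, by omega⟩
      rw [← key (i - 1) (by omega), Nat.sub_add_cancel h1]
      exact h3
    · rintro ⟨j, ⟨h1, h2⟩, rfl⟩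
      refine ⟨⟨by omega, by omega⟩, ?_⟩
      rw [Nat.add_sub_cancel, key j (by omega)]
      exact h2
  have hcard : (accepted N₂ K.k pub v (G.map Party.pk) (l.map fun e => e.1.2.1) (Sess.shown par K.k (s, l))).card =
      (passing N₂ K par pub v l).length := by
    rw [hS, Finset.card_map, card_positions, hpass]
  rw [reconstruct, closeCall, Option.elim, hcard]
  have ht : par.thr K = par.t K.k := rfl
  rw [ht]
  split_ifs with hle
  · rfl
  · have hright : ∀ e ∈ passing N₂ K par pub v l, e.2.1 = e.1.2.2 := by
      have h1 : ((passing N₂ K par pub v l).filter fun e => !decide (e.2.1 = e.1.2.2)).head? = none := by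
        simpa [closeCall] using hgood
      rw [List.head?_eq_none_iff, List.filter_eq_nil_iff] at h1
      intro e he
      simpa using h1 e he
    have hcomb := Params.sssCombine_eq K.k (s : par.F K.k) (fun j => (cs.getD j.val 0 : par.F K.k))
      (S := accepted N₂ K.k pub v (G.map Party.pk) (l.map fun e => e.1.2.1) (Sess.shown par K.k (s, l)))
      (r := fun i => (answer K.k v (Sess.shown par K.k (s, l)) i).1) (fun i hi => ?_) (by omega) fun i hi => ?_
    · simp only [Option.map_some, hcomb, Params.enc_natCast hs]
    · have := (Finset.mem_Icc.1 (Finset.mem_filter.1 hi).1).2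
      rw [List.length_map] at this
      omega
    · rw [hS] at hi
      obtain ⟨j, hj, rfl⟩ := Finset.mem_map.1 hi
      obtain ⟨hj1, hj2⟩ := Finset.mem_filter.1 hj
      have hj : j < l.length := hLl ▸ Finset.mem_range.1 hj1
      rw [List.getD_eq_getElem _ _ (by simpa [hLl] using hj), List.getElem_map, hLj j hj] at hj2
      have hm : (l[j].1, contribution K par v l[j] j) ∈ passing N₂ K par pub v l := by
        rw [hpass, List.mem_filter]
        exact ⟨hLj j hj ▸ List.getElem_mem _, hj2⟩
      have := hright _ hm
      simp only at this
      rw [addRightEmbedding_apply, (hans j hj).2]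
      simp only [this, (hent j hj).2]
      exact horner_cast K hd.length_cs _

/-! ### The privacy game as an experiment of the same form -/

section

variable (E N₀ N₁ N₂)

/-- The distribution of an honest sharing. -/
def dealPMF (K : Sec) (pub : Val) (G : List Party) (s : ℕ) : PMF (List Item × Val) :=
  (coeffsPMF par K).bind fun cs => (mapAll (fun _ => E.sampleEnc K.k (pub.get 0)) G).bind fun rs =>
    (N₁.prove K.k (pub.get 2) (sharingStmt par K pub (encShares E K pub G (shareList par K s cs G.length) rs))
      (sharingWit (shareList par K s cs G.length) rs)).map fun pf =>
        (encShares E K pub G (shareList par K s cs G.length) rs, pf)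

variable {E N₀ N₁ N₂}

theorem share_eq (K : Sec) (pub : Val) (G : List Party) (s : ℕ) :
    (genericPVSS E N₀ N₁ N₂).share K.k pub (G.map Party.pk) (s : par.F K.k) =
      (dealPMF E N₁ K pub G s).map fun tr => (tr.1.map fun it => it.2.1, tr.2) := by
  rw [dealPMF, coeffsPMF_eq, PMF.bind_map, PMF.map_bind]
  show (par.sssShare (s : par.F K.k) (G.map Party.pk).length).bind _ = _
  rw [Params.sssShare, PMF.bind_map, List.length_map]
  refine bind_ext fun a => ?_
  rw [Function.comp_apply, Function.comp_apply]
  show PMF.bind (mapAll (fun _ => E.sampleEnc K.k (pub.get 0)) (G.map Party.pk)) _ = _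
  rw [mapAll_list_map, PMF.map_bind]
  refine bind_congr_support fun rs hrs => ?_
  have hrs := (mapAll_support hrs).length_eq
  set sh := par.shares (s : par.F K.k) a G.length with hsh
  have hl : sh.length = G.length := by simp [hsh, Params.shares]
  have h1 : shareList par K s (List.ofFn fun j => (a j).val) G.length = sh.map ZMod.val := by
    rw [hsh, Params.shares, List.map_map]
    exact List.map_congr_left fun i _ => horner_ofFn K a (i + 1)
  set its := encShares E K pub G (shareList par K s (List.ofFn fun j => (a j).val) G.length) rs with hits
  have h2 : ((G.map Party.pk).zip (sh.zip rs)).map (fun e => E.enc K.k (pub.get 0) e.1 e.2.1 e.2.2) =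
      its.map fun it => it.2.1 := by
    rw [hits, encShares, h1, List.zip_map_left, List.zip_map_left, List.zip_map_right, List.map_map, List.map_map,
      List.map_map]
    refine List.map_congr_left fun e _ => ?_
    have : par.dec K.k (.num e.2.1.val) = e.2.1 := ZMod.natCast_zmod_val _
    simp only [Function.comp_apply, PKE.encF, Prod.map, id]
    conv_lhs => rw [← this]
    rfl
  have hlen : its.length = G.length := by
    rw [hits, encShares, h1]
    simp [hl, ← hrs]
  have h3 : encStmt par K.k (pub.get 0) ((G.map Party.pk).zip (its.map fun it => it.2.1)) = sharingStmt par K pub its := by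
    have hG : G = its.map Prod.fst :=
      (map_fst_encShares (by rw [h1, List.length_map, hl]) hrs.symm).symm
    have hz : (G.map Party.pk).zip (its.map fun it => it.2.1) = its.map fun it => (it.1.pk, it.2.1) := by
      conv_lhs => rw [hG]
      rw [List.map_map, List.zip_map']; rfl
    rw [hz, encStmt, sharingStmt, List.map_map, List.length_map]
    rfl
  have h4 : encWit par (sh.zip rs) = sharingWit (shareList par K s (List.ofFn fun j => (a j).val) G.length) rs := by
    rw [encWit, sharingWit, h1, List.zip_map_left, List.map_map]
    rfl
  show PMF.bind (N₁.prove K.k (pub.get 2) (encStmt par K.k (pub.get 0) ((G.map Party.pk).zip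
    (((G.map Party.pk).zip (sh.zip rs)).map fun e => E.enc K.k (pub.get 0) e.1 e.2.1 e.2.2))) (encWit par (sh.zip rs)))
      (fun π => PMF.pure (((G.map Party.pk).zip (sh.zip rs)).map fun e => E.enc K.k (pub.get 0) e.1 e.2.1 e.2.2, π)) = _
  rw [h2, h3, h4, PMF.map_comp]
  rfl

/-- The parties of the privacy game have secret keys. -/
def fillKey (kps : Keys) (q : Party) : Party :=
  if q.corrupt then q else { q with sk := .pair (kps.at q.idx).1.2 (kps.at q.idx).2 }

theorem fillKey_pk (kps : Keys) (q : Party) : (fillKey kps q).pk = q.pk := by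
  unfold fillKey; split_ifs <;> rfl

theorem fillKey_corrupt (kps : Keys) (q : Party) : (fillKey kps q).corrupt = q.corrupt := by
  unfold fillKey; split_ifs <;> rfl

/-- A session of the game as a session of the oracle. -/
def Sess.view (par : Params) (k : ℕ) (ss : Sess) : List Val × List (Option (par.F k × Val)) :=
  (ss.2.map fun e => e.1.2.1, ss.shown par k)

theorem oracle_close {reveal : Bool} (k : ℕ) (pub : Val) (kps : Keys) (G : List Party) (o : Option Sess) {v : Val}
    (hv : v.fst ≠ .num 0) :
    (genericPVSS E N₀ N₁ N₂).oracle reveal k pub (G.map (fillKey kps)) (o.map (Sess.view par k)) v =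
      PMF.pure (o.elim (.num 0) fun ss => reconstruct N₂ k pub v (G.map Party.pk) (ss.2.map fun e => e.1.2.1)
        (ss.shown par k), none) := by
  have hpk : (G.map (fillKey kps)).map Party.pk = G.map Party.pk := by
    rw [List.map_map]
    exact List.map_congr_left fun q _ => fillKey_pk kps q
  cases o with
  | none => exact if_neg hv
  | some ss =>
    refine (if_neg hv).trans ?_
    have hl : (G.map (fillKey kps)).length = (G.map Party.pk).length := by simp
    show PMF.pure _ = PMF.pure _
    congr 2
    simp only [hpk, hl]
    rfl

end

theorem Comp.Is.support {α : Type} {D : Device} {c : Comp α} {p : PMF α} (h : Is D noOracle c p) {q : α → Prop}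
    (hq : c.Sup D noOracle q) {a : α} (ha : a ∈ p.support) : q a :=
  hq D.init (a, D.init, ()) (by rw [h, PMF.support_map]; exact ⟨a, ha, rfl⟩)

/-- The provers call the algorithms of the proof systems. -/
structure Actual (E : PKE par) (N₀ N₁ N₂ : NIZK) (K : Sec) (pub : Val) (kps : Keys) (π : Provers) : Prop where
  key : ∀ i pk (D : Device) (O : Oracle), Is D O (π.key (i, pk))
    (N₀.prove K.k (pub.get 1) (.pair (pub.get 0) pk) (.pair (kps.at i).1.2 (kps.at i).2))
  enc : ∀ x w (D : Device) (O : Oracle), Is D O (π.enc (x, w)) (N₁.prove K.k (pub.get 2) x w)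
  dec : ∀ (it : Item) (D : Device) (O : Oracle), Is D O (π.dec it)
    (N₂.prove K.k (pub.get 3) (it.stmt pub it.2.2) (.ofList [(kps.at it.1.idx).1.2, (kps.at it.1.idx).2,
      E.witF (K, .ofList [pub.get 0, it.1.pk, (kps.at it.1.idx).1.2, it.2.1])]))

theorem deal_is (hSE : Samples E SE) {K : Sec} {pub : Val} {kps : Keys} {π : Provers}
    (hπ : Actual E N₀ N₁ N₂ K pub kps π) (G : List Party) (s : ℕ) {O : Oracle} :
    Is D O (deal E SE K π pub G s) (dealPMF E N₁ K pub G s) :=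
  Is.bind (coeffs_is K) fun _ => Is.bind (hSE.is K _ G) fun _ => Is.map (hπ.enc _ _ _ _) _

theorem dealPMF_support (hSE : Samples E SE) {K : Sec} {pub : Val} {kps : Keys} {π : Provers}
    (hπ : Actual E N₀ N₁ N₂ K pub kps π) {G : List Party} {s : ℕ} {tr : List Item × Val}
    (h : tr ∈ (dealPMF E N₁ K pub G s).support) : ∃ cs rs, Dealt E K pub G cs rs ∧
      tr.1 = encShares E K pub G (shareList par K s cs G.length) rs :=
  (deal_is (D := Device.trivial) hSE hπ G s).support (deal_sup hSE K π pub G s) h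

/-- An honest participant decrypts a share to what the dealer has encrypted. -/
theorem honest_dec (henc : E.EncCorrect) {k : ℕ} {x : World} (hx : x.Possible E Nb k) (hv : x.Valid E k)
    {G : List Party} {it : Item} (hi : Honest E ⟨k⟩ x.pub G it) (hc : it.1.corrupt = false)
    (hlt : it.1.idx < Nb.eval k) (hpk : it.1.pk = x.keys.public.getD it.1.idx (.num 0)) :
    (genericPVSS E N₀ N₁ N₂).dec k x.pub (fillKey x.keys it.1).pk (fillKey x.keys it.1).sk it.2.1 =
      (N₂.prove k (x.pub.get 3) (it.stmt x.pub it.2.2) (.ofList [(x.keys.at it.1.idx).1.2, (x.keys.at it.1.idx).2,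
        E.witF (⟨k⟩, .ofList [x.pub.get 0, it.1.pk, (x.keys.at it.1.idx).1.2, it.2.1])])).map
        fun pf => ((it.2.2 : par.F k), pf) := by
  have h5 := hv _ (hx.at_mem hlt)
  obtain ⟨r, hr, hct⟩ := hi.enc
  rw [Keys.public_getD] at hpk
  have hsk : (fillKey x.keys it.1).sk = .pair (x.keys.at it.1.idx).1.2 (x.keys.at it.1.idx).2 := by
    rw [fillKey, hc]; rfl
  have h6 : (E.dec k x.pp it.1.pk (x.keys.at it.1.idx).1.2 it.2.1).1 = (it.2.2 : par.F k) := by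
    rw [hpk]
    have := (henc k x.pp hx.pp _ _ h5 (it.2.2 : par.F k) r hr).1
    rw [hct, hpk]
    exact this
  rw [fillKey_pk, hsk]
  show PMF.bind (N₂.prove k (x.pub.get 3) (decStmt par x.pp it.1.pk it.2.1
    (E.dec k x.pp it.1.pk (x.keys.at it.1.idx).1.2 it.2.1).1) _) (fun π => PMF.pure
      ((E.dec k x.pp it.1.pk (x.keys.at it.1.idx).1.2 it.2.1).1, π)) = _
  rw [h6, decStmt, Params.enc_natCast hi.lt]
  rfl

/-- The ideal answer to the first message of an oracle call is the actual one. -/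
theorem oracle_open (henc : E.EncCorrect) (F : Setting E N₀ N₂ SE SK Nb) {k : ℕ} {x : World} (hx : x.Possible E Nb k)
    (hv : x.Valid E k) {G : List Party} (hG : Qualified par N₀ ⟨k⟩ x.pub x.keys.public G) {π : Provers}
    (hπ : Actual E N₀ N₁ N₂ ⟨k⟩ x.pub x.keys π) {v : Val} (hv0 : v.fst = .num 0) (st : PVSS.Session par k) (d : D.State) :
    ((openCall E SE reveal ⟨k⟩ π x.pub G v).exec D noOracle d ()).map
        (fun u => ((u.1.1, some (u.1.2.view par k)), u.2.1)) =
      ((genericPVSS E N₀ N₁ N₂).oracle reveal k x.pub (G.map (fillKey x.keys)) st v).map fun w => (w, d) := by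
  set f : Item → PMF (Option Val) := fun it => if it.1.corrupt then PMF.pure none else
    (N₂.prove k (x.pub.get 3) (it.stmt x.pub it.2.2) (.ofList [(x.keys.at it.1.idx).1.2, (x.keys.at it.1.idx).2,
        E.witF (⟨k⟩, .ofList [x.pub.get 0, it.1.pk, (x.keys.at it.1.idx).1.2, it.2.1])])).map some with hf
  set s := v.snd.toNat % par.modulus ⟨k⟩ with hs
  have his : Is D noOracle (openCall E SE reveal ⟨k⟩ π x.pub G v) ((dealPMF E N₁ ⟨k⟩ x.pub G s).bind fun tr =>
      (mapAll f tr.1).map fun ds => (.ofList [.ofList (tr.1.map fun it => it.2.1), tr.2,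
        if reveal then shownShares (tr.1.zip ds) else .num 0], (s, tr.1.zip ds))) := by
    refine Is.bind (deal_is F.samples hπ G s) fun tr => Is.map (Is.mapC _ fun it _ => ?_) _
    simp only [hf]
    cases it.1.corrupt with
    | true => exact Is.ret _
    | false => exact Is.map (hπ.dec it _ _) _
  have hsec : par.dec k v.snd = (s : par.F k) := (ZMod.natCast_mod _ _).symm
  have hpk : (G.map (fillKey x.keys)).map Party.pk = G.map Party.pk := by
    rw [List.map_map]
    exact List.map_congr_left fun q _ => fillKey_pk x.keys q
  have hopen : (genericPVSS E N₀ N₁ N₂).oracle reveal k x.pub (G.map (fillKey x.keys)) st v =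
      ((genericPVSS E N₀ N₁ N₂).share k x.pub ((G.map (fillKey x.keys)).map Party.pk) (par.dec k v.snd)).bind fun tr =>
        (mapAll (fun q : Party × Val => if q.1.corrupt then PMF.pure none
          else ((genericPVSS E N₀ N₁ N₂).dec k x.pub q.1.pk q.1.sk q.2).map some) ((G.map (fillKey x.keys)).zip tr.1)).bind
        fun ds => PMF.pure (.ofList [.ofList tr.1, tr.2, if reveal then .ofList (ds.map fun o =>
          .ofOption (o.map fun d => .pair (par.enc d.1) d.2)) else .num 0], some (tr.1, ds)) := if_pos hv0
  rw [his d (), PMF.map_comp, hopen, hpk, hsec, share_eq ⟨k⟩, PMF.bind_map, PMF.map_bind, PMF.map_bind]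
  refine bind_congr_support fun tr htr => ?_
  obtain ⟨cs, rs, hd, htr⟩ := dealPMF_support F.samples hπ htr
  have hG' : (G.map (fillKey x.keys)).zip (tr.1.map fun it => it.2.1) = tr.1.map fun it => (fillKey x.keys it.1, it.2.1) := by
    have h1 : G = tr.1.map Prod.fst := by
      rw [htr, map_fst_encShares (by simp [shareList]) hd.length_rs]
    conv_lhs => rw [h1]
    rw [List.map_map, List.zip_map']; rfl
  have hmap : mapAll (fun q : Party × Val => if q.1.corrupt then PMF.pure none
      else ((genericPVSS E N₀ N₁ N₂).dec k x.pub q.1.pk q.1.sk q.2).map some)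
        ((G.map (fillKey x.keys)).zip (tr.1.map fun it => it.2.1)) = (mapAll f tr.1).map fun ds =>
        (tr.1.zip ds).map fun e : Item × Option Val => e.2.map fun pf => ((e.1.2.2 : par.F k), pf) := by
    rw [hG', mapAll_list_map, mapAll_zip_map]
    refine mapAll_congr fun it hit => ?_
    have hi := hd.honest (htr ▸ hit)
    simp only [hf, fillKey_corrupt]
    cases hc : it.1.corrupt with
    | true => simp only [if_true, PMF.pure_map]; rfl
    | false =>
      simp only [Bool.false_eq_true, if_false]
      rw [honest_dec henc hx hv hi hc ((hG.idx_lt hi.mem).trans_le (F.le k)) (hG.pk _ hi.mem hc), PMF.map_comp,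
        PMF.map_comp]
      rfl
  rw [Function.comp_apply]
  simp only
  rw [hmap, PMF.bind_map, PMF.map_comp, PMF.map_bind]
  refine bind_congr_support fun ds hds => ?_
  have hcts : (tr.1.zip ds).map (fun e : Item × Option Val => e.1.2.1) = tr.1.map fun it => it.2.1 := by
    conv_rhs => rw [← List.map_fst_zip (l₁ := tr.1) (l₂ := ds) (mapAll_support hds).length_eq.le, List.map_map]
    rfl
  have hshown : shownShares (tr.1.zip ds) = .ofList (((tr.1.zip ds).map fun e : Item × Option Val =>
      e.2.map fun pf => ((e.1.2.2 : par.F k), pf)).map fun o => .ofOption (o.map fun d => .pair (par.enc d.1) d.2)) := by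
    rw [shownShares, List.map_map]
    congr 1
    refine List.map_congr_left fun e he => ?_
    have hi := hd.honest (htr ▸ (List.of_mem_zip he).1)
    rw [Function.comp_apply, Option.map_map]
    congr 2
    funext pf
    rw [Function.comp_apply, Params.enc_natCast hi.lt]
  simp only [Function.comp_apply, PMF.pure_map]
  rw [hshown, Sess.view, hcts]
  rfl

section

variable (E N₀ N₁ N₂ SE A reveal b)

/-- The actual answer to the second message of an oracle call, with the record of a wrong share. -/
def actualClose (K : Sec) (par : Params) (pub : Val) (G : List Party) (a : Val × Option Sess) :
    Val × Option (Val × Val) :=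
  (a.2.elim (.num 0) fun ss => reconstruct N₂ K.k pub a.1 (G.map Party.pk) (ss.2.map fun e => e.1.2.1)
    (ss.shown par K.k), (closeCall N₂ K par pub a).2)

/-- The oracle phase with the actual reconstruction. -/
def actualAttack (K : Sec) (π : Provers) (pub : Val) (o : Val × List Party) :
    Comp (Val × (Option Sess × Option (Val × Val))) :=
  (A.attack.call (K, .pair o.1 (pubKeys o.2))).handle
    (Comp.twoPhase (openCall E SE reveal K π pub o.2) (actualClose N₂ K par pub o.2)) (none, none)

/-- The game with the actual reconstruction. -/
def actualGame (K : Sec) (π : Provers) (pub : Val) (pks : List Val) :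
    Comp Outcome :=
  keyStage (par := par) N₀ A K π pub pks >>= fun o =>
    o.elim (.ret (.num 0, (none, []))) fun o =>
      actualAttack E N₂ SE A reveal K π pub o >>= fun u =>
        (fun g => (g, (u.2.2, o.2))) <$> guessStage E SE A b K π pub o.2 u.1

/-- The privacy game after key generation. -/
def actualRest (D : Device) (k : ℕ) (pub st : Val) (d : D.State) (G : List Party) : PMF Bool :=
  (A.attack.execO D ((genericPVSS E N₀ N₁ N₂).oracle reveal k pub G) k (.pair st (pubKeys G)) d none).bind fun u =>
    ((genericPVSS E N₀ N₁ N₂).share k pub (G.map Party.pk) (par.dec k (u.1.get (if b then 1 else 0)))).bind fun tr =>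
      (A.guess.exec D k (.ofList [u.1.get 2, .ofList tr.1, tr.2]) u.2).bind fun v => PMF.pure (outBit v.1)

/-- The sessions of the game come from honest sharings. -/
def HonestState (K : Sec) (pub : Val) (G : List Party) (s : Option Sess × Option (Val × Val)) : Prop :=
  ∀ ss, s.1 = some ss → ss.1 < par.p K.k ∧ ∃ cs rs, Dealt E K pub G cs rs ∧
    ss.2.map Prod.fst = encShares E K pub G (shareList par K ss.1 cs G.length) rs

end

theorem honestState_twoPhase (hSE : Samples E SE) {K : Sec} {π : Provers} {pub : Val} {G : List Party}
    (o₁ : Val × Option Sess → Val × Option (Val × Val)) (s : Option Sess × Option (Val × Val)) (v : Val) :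
    (Comp.twoPhase (openCall E SE reveal K π pub G) o₁ s v).Sup D O fun u => HonestState E K pub G u.2 := by
  unfold twoPhase
  split_ifs
  · refine Sup.bind (p := fun u => HonestState E K pub G (some u.2, none)) ?_ fun u hu => .ret hu
    refine (deal_sup hSE K π pub G _).bind fun tr htr => Sup.map ((Sup.mapC (p := fun _ _ => True)
      fun _ _ => sup_true _).imp fun ds hds ss hss => ?_)
    obtain ⟨cs, rs, hd, htr⟩ := htr
    obtain rfl := Option.some.inj hss
    refine ⟨Nat.mod_lt _ (par.prime K.k).pos, cs, rs, hd, ?_⟩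
    rw [List.map_fst_zip hds.length_eq.le, htr]
  · exact .ret fun ss hss => by simp at hss

theorem actualAttack_rel (hSE : Samples E SE) {K : Sec} {π : Provers} {pub : Val} {pks : List Val}
    {o : Val × List Party} (hG : Qualified par N₀ K pub pks o.2) :
    Rel D O O (fun u => u.2.2 ≠ none) (attackStage E N₂ SE A reveal K π pub o)
      (actualAttack E N₂ SE A reveal K π pub o) := by
  have hn : o.2.length ≤ par.n K.k := by
    have := hG.sub.length_le
    rwa [List.length_map, List.length_range] at this
  have hB : ∀ (o₁ : Val × Option Sess → Val × Option (Val × Val)) (s : Option Sess × Option (Val × Val)) v,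
      s.2 ≠ none → (Comp.twoPhase (openCall E SE reveal K π pub o.2) o₁ s v).All fun u => u.2.2 ≠ none := by
    intro o₁ s v hs
    unfold twoPhase
    split_ifs
    · exact (all_true _).bind fun u _ => hs
    · show (s.2.or _) ≠ none
      cases h : s.2 with
      | none => exact absurd h hs
      | some r => simp
  refine Rel.handle (B := fun s => s.2 ≠ none) (I := HonestState E K pub o.2)
    (fun s v _ => honestState_twoPhase hSE _ s v) (fun s v hs => ⟨hB _ s v hs, hB _ s v hs⟩) (fun s v hI _ => ?_) _
    (s := (none, none)) (fun ss hss => by simp at hss) fun h => h rfl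
  unfold twoPhase
  split_ifs
  · exact Rel.refl _
  · by_cases hc : (closeCall N₂ K par pub (v, s.1)).2 = none
    · have : closeCall N₂ K par pub (v, s.1) = actualClose N₂ K par pub o.2 (v, s.1) := by
        refine Prod.ext ?_ rfl
        rw [actualClose]
        cases hs : s.1 with
        | none => rfl
        | some ss =>
          obtain ⟨h1, cs, rs, hd, h2⟩ := hI ss hs
          rw [hs] at hc
          exact (reconstruct_eq hd h2 h1 hn hc).symm
      rw [this]
      exact Rel.refl _
    · have h2 : ∀ r : Option (Val × Val), r.or (closeCall N₂ K par pub (v, s.1)).2 ≠ none := fun r => by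
        cases r with
        | none => exact hc
        | some r => simp
      exact Rel.of_all (c := .ret _) (c' := .ret _) (h2 _) (h2 _)

/-- Actual and ideal reconstruction agree until a wrong share passes verification. -/
theorem actualGame_rel (hSE : Samples E SE) {K : Sec} {π : Provers} {pub : Val} {pks : List Val} :
    Rel D O O (fun u => u.2.1 ≠ none) (game E N₀ N₂ SE A reveal b K π pub pks)
      (actualGame E N₀ N₂ SE A reveal b K π pub pks) := by
  refine Rel.bind_same (p := fun o => ∀ r, o = some r → Qualified par N₀ K pub pks r.2) (fun _ _ _ => rfl)
    (keyStage_sup K π pub pks) fun o ho => ?_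
  cases o with
  | none => exact Rel.refl _
  | some o =>
    exact (actualAttack_rel hSE (ho o rfl)).bind (sup_true _) (fun u _ _ => Rel.refl _) fun u hu =>
      ⟨(all_true _).bind fun _ _ => hu, (all_true _).bind fun _ _ => hu⟩

/-- The oracle phase of the privacy game. -/
theorem actualAttack_exec (henc : E.EncCorrect) (F : Setting E N₀ N₂ SE SK Nb) {k : ℕ} {x : World}
    (hx : x.Possible E Nb k) (hv : x.Valid E k) {o : Val × List Party}
    (hG : Qualified par N₀ ⟨k⟩ x.pub x.keys.public o.2) {π : Provers} (hπ : Actual E N₀ N₁ N₂ ⟨k⟩ x.pub x.keys π)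
    (w : Val) (d : D.State) :
    A.attack.execO D ((genericPVSS E N₀ N₁ N₂).oracle reveal k x.pub (o.2.map (fillKey x.keys))) k w d none =
      (((A.attack.call (⟨k⟩, w)).handle (Comp.twoPhase (openCall E SE reveal ⟨k⟩ π x.pub o.2)
        (actualClose N₂ ⟨k⟩ par x.pub o.2)) (none, none)).exec D noOracle d ()).map fun u => (u.1.1, u.2.1) := by
  have h := exec_handle (D := D) (O := noOracle) (I := fun _ => True)
    (h := Comp.twoPhase (openCall E SE reveal ⟨k⟩ π x.pub o.2) (actualClose N₂ ⟨k⟩ par x.pub o.2))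
    (Q := (genericPVSS E N₀ N₁ N₂).oracle reveal k x.pub (o.2.map (fillKey x.keys)))
    (φ := fun s => s.1.map (Sess.view par k)) (fun _ _ _ => sup_true _) (fun s v d _ => ?_)
    (A.attack.call (⟨k⟩, w)) d (none, none) trivial
  · rw [Code.exec_call]
    have h' : (A.attack.call (⟨k⟩, w)).exec D ((genericPVSS E N₀ N₁ N₂).oracle reveal k x.pub
      (o.2.map (fillKey x.keys))) d none = _ := h
    rw [h', PMF.map_comp]
    rfl
  · unfold twoPhase
    split_ifs with hv0
    · rw [← oracle_open henc F hx hv hG hπ hv0, exec_bind, PMF.map_bind]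
      simp only [exec_ret, PMF.pure_map]
      rfl
    · rw [oracle_close _ _ _ _ _ hv0, exec_ret, PMF.pure_map, PMF.pure_map]
      rfl

theorem pubKeys_fillKey (kps : Keys) (G : List Party) : pubKeys (G.map (fillKey kps)) = pubKeys G := by
  rw [pubKeys, pubKeys, List.map_map]
  congr 1
  refine List.map_congr_left fun q _ => ?_
  rw [Function.comp_apply, fillKey]
  split_ifs <;> rfl

theorem actualRest_eq (henc : E.EncCorrect) (F : Setting E N₀ N₂ SE SK Nb) {k : ℕ} {x : World}
    (hx : x.Possible E Nb k) (hv : x.Valid E k) {o : Val × List Party}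
    (hG : Qualified par N₀ ⟨k⟩ x.pub x.keys.public o.2) {π : Provers} (hπ : Actual E N₀ N₁ N₂ ⟨k⟩ x.pub x.keys π)
    (d : D.State) :
    actualRest E N₀ N₁ N₂ A reveal b D k x.pub o.1 d (o.2.map (fillKey x.keys)) =
      ((actualAttack E N₂ SE A reveal ⟨k⟩ π x.pub o >>= fun u => (fun g => ((g, (u.2.2, o.2)) :
        Outcome)) <$> guessStage E SE A b ⟨k⟩ π x.pub o.2 u.1).exec D noOracle d ()).map
          fun u => outBit u.1.1 := by
  have hpk : (o.2.map (fillKey x.keys)).map Party.pk = o.2.map Party.pk := by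
    rw [List.map_map]
    exact List.map_congr_left fun q _ => fillKey_pk x.keys q
  rw [actualRest, actualAttack_exec henc F hx hv hG hπ, pubKeys_fillKey, PMF.bind_map, bind_def, exec_bind,
    PMF.map_bind]
  refine bind_ext fun u => ?_
  have hsec : par.dec k (u.1.1.get (if b then 1 else 0)) = (challengeSecret par ⟨k⟩ b u.1.1 : par.F k) :=
    (ZMod.natCast_mod _ _).symm
  rw [Function.comp_apply, exec_map, PMF.map_comp, guessStage, bind_def, exec_bind_of_is (deal_is F.samples hπ _ _),
    hpk, hsec, share_eq ⟨k⟩, PMF.bind_map, PMF.map_bind]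
  refine bind_ext fun tr => ?_
  rw [Function.comp_apply, Code.exec, Code.exec_call, PMF.bind_map]
  rfl

/-- Key generation in the privacy game. -/
def actualKeys (E : PKE par) (N₀ N₁ N₂ : NIZK) (A : PrivacyAdversary) (reveal b : Bool) (D : Device) (k : ℕ) (pub : Val)
    (gen : (ℕ → Bool) → Val → PMF (List Party)) : PMF Bool :=
  (A.corrupt.exec D k pub D.init).bind fun u =>
    if par.t k < ((List.range (par.n k)).filter (corruptFlag u.1.fst)).length then PMF.pure false
    else (A.keys.exec D k u.1.snd u.2).bind fun w =>
      (gen (corruptFlag u.1.fst) w.1.fst).bind fun ps => actualRest E N₀ N₁ N₂ A reveal b D k pub w.1.snd w.2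
        (ps.filter fun q => N₀.verF (⟨k⟩, .ofList [pub.get 1, .pair (pub.get 0) q.pk, q.proof]))

open Classical in
theorem privacyGame_eq (k : ℕ) : (genericPVSS E N₀ N₁ N₂).privacyGame reveal D A b k =
    (E.setup k).bind fun pp => (N₀.setup k pp).bind fun c₀ => (N₁.setup k pp).bind fun c₁ =>
      (N₂.setup k pp).bind fun c₂ => actualKeys E N₀ N₁ N₂ A reveal b D k (publicParams pp c₀ c₁ c₂) fun C v =>
        mapAll (fun i => if C i then PMF.pure (Party.mk i true (v.get i).fst (.num 0) (v.get i).snd) else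
          (E.sampleKeyPair k pp).bind fun kp => (N₀.prove k c₀ (.pair pp kp.1.1) (.pair kp.1.2 kp.2)).map fun π =>
            Party.mk i false kp.1.1 (.pair kp.1.2 kp.2) π) (List.range (par.n k)) := by
  have hC : ∀ v : Val, (fun i => decide (v.get i ≠ .num 0)) = corruptFlag v := fun v => by
    funext i
    rw [corruptFlag]
    by_cases h : v.get i = .num 0 <;> simp [h]
  have hset : (genericPVSS E N₀ N₁ N₂).setup k = (E.setup k).bind fun pp => (N₀.setup k pp).bind fun c₀ =>
    (N₁.setup k pp).bind fun c₁ => (N₂.setup k pp).bind fun c₂ => PMF.pure (publicParams pp c₀ c₁ c₂) := rfl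
  have hgen : ∀ pp c₀ c₁ c₂ i, ((genericPVSS E N₀ N₁ N₂).keyGen k (publicParams pp c₀ c₁ c₂)).map
      (fun kp => Party.mk i false kp.1.1 kp.1.2 kp.2) = (E.sampleKeyPair k pp).bind fun kp =>
        (N₀.prove k c₀ (.pair pp kp.1.1) (.pair kp.1.2 kp.2)).map fun π =>
          Party.mk i false kp.1.1 (.pair kp.1.2 kp.2) π := by
    intro pp c₀ c₁ c₂ i
    refine (PMF.map_bind _ _ _).trans (bind_ext fun kp => ?_)
    refine (PMF.map_bind _ _ _).trans (bind_ext fun pf => PMF.pure_map _ _)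
  have h : (genericPVSS E N₀ N₁ N₂).privacyGame reveal D A b k = ((genericPVSS E N₀ N₁ N₂).setup k).bind fun pp =>
      actualKeys E N₀ N₁ N₂ A reveal b D k pp fun C v =>
        mapAll (fun i => if C i then PMF.pure (Party.mk i true (v.get i).fst (.num 0) (v.get i).snd) else
          ((genericPVSS E N₀ N₁ N₂).keyGen k pp).map fun kp => Party.mk i false kp.1.1 kp.1.2 kp.2)
            (List.range (par.n k)) := by
    refine bind_ext fun pp => ?_
    refine bind_ext fun u => ?_
    simp only [← hC]
    rfl
  rw [h, hset]
  simp only [PMF.bind_bind, PMF.pure_bind, hgen]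

/-- The key pairs may be sampled in advance. -/
theorem presample (k : ℕ) (pp pub : Val) (hNb : par.n k ≤ Nb.eval k) (c₀ : Val) :
    (actualKeys E N₀ N₁ N₂ A reveal b D k pub fun C v =>
        mapAll (fun i => if C i then PMF.pure (Party.mk i true (v.get i).fst (.num 0) (v.get i).snd) else
          (E.sampleKeyPair k pp).bind fun kp => (N₀.prove k c₀ (.pair pp kp.1.1) (.pair kp.1.2 kp.2)).map fun π =>
            Party.mk i false kp.1.1 (.pair kp.1.2 kp.2) π) (List.range (par.n k))) =
    (keysPMF E Nb k pp).bind fun kps => actualKeys E N₀ N₁ N₂ A reveal b D k pub fun C v =>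
        mapAll (fun i => if C i then PMF.pure (Party.mk i true (v.get i).fst (.num 0) (v.get i).snd) else
          (N₀.prove k c₀ (.pair pp (kps.at i).1.1) (.pair (kps.at i).1.2 (kps.at i).2)).map fun π =>
            Party.mk i false (kps.at i).1.1 (.pair (kps.at i).1.2 (kps.at i).2) π) (List.range (par.n k)) := by
  unfold actualKeys
  rw [PMF.bind_comm (keysPMF E Nb k pp)]
  refine bind_ext fun u => ?_
  split_ifs
  · rw [PMF.bind_const]
  · rw [PMF.bind_comm (keysPMF E Nb k pp)]
    refine bind_ext fun w => ?_
    rw [← PMF.bind_bind]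
    congr 1
    have h := mapAll_pick (fun _ => E.sampleKeyPair k pp) id (fun i (kp : (Val × Val) × Val) =>
      if corruptFlag u.1.fst i then PMF.pure (Party.mk i true (w.1.fst.get i).fst (.num 0) (w.1.fst.get i).snd) else
        (N₀.prove k c₀ (.pair pp kp.1.1) (.pair kp.1.2 kp.2)).map fun π =>
            Party.mk i false kp.1.1 (.pair kp.1.2 kp.2) π) ((.num 0, .num 0), .num 0)
      (L := List.range (Nb.eval k)) List.nodup_range (G := List.range (par.n k))
      (by rw [List.map_id]; exact List.range_sublist.2 hNb) Keys.at fun bs _ i hi => by rw [List.getElem_range]; rfl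
    refine Eq.trans (mapAll_congr fun i _ => ?_) h.symm
    split_ifs <;> simp

/-- Key generation in the game with given key pairs. -/
theorem actualKeys_eq {k : ℕ} {x : World} {π : Provers} (hπ : Actual E N₀ N₁ N₂ ⟨k⟩ x.pub x.keys π) :
    (actualKeys E N₀ N₁ N₂ A reveal b D k x.pub fun C v =>
        mapAll (fun i => if C i then PMF.pure (Party.mk i true (v.get i).fst (.num 0) (v.get i).snd) else
          (N₀.prove k x.crs₀.1 (.pair x.pp (x.keys.at i).1.1) (.pair (x.keys.at i).1.2 (x.keys.at i).2)).map fun π =>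
            Party.mk i false (x.keys.at i).1.1 (.pair (x.keys.at i).1.2 (x.keys.at i).2) π) (List.range (par.n k))) =
      ((keyStage (par := par) N₀ A ⟨k⟩ π x.pub x.keys.public).exec D noOracle D.init ()).bind fun o =>
        o.1.elim (PMF.pure false) fun r =>
          actualRest E N₀ N₁ N₂ A reveal b D k x.pub r.1 o.2.1 (r.2.map (fillKey x.keys)) := by
  rw [actualKeys, keyStage, Code.exec, Code.exec_call, PMF.bind_map, bind_def, exec_bind, PMF.bind_bind]
  refine bind_ext fun u => ?_
  rw [Function.comp_apply]
  have hn : par.count ⟨k⟩ = par.n k := rfl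
  have ht : par.thr ⟨k⟩ = par.t k := rfl
  rw [hn, ht]
  split_ifs
  · rw [exec_ret, PMF.pure_bind]; rfl
  · rw [Code.exec, Code.exec_call, PMF.bind_map, bind_def, exec_bind, PMF.bind_bind]
    refine bind_ext fun w => ?_
    set f : ℕ → PMF Party := fun i => if corruptFlag u.1.fst i then
        PMF.pure (Party.mk i true (w.1.fst.get i).fst (.num 0) (w.1.fst.get i).snd) else
      (N₀.prove k x.crs₀.1 (.pair x.pp (x.keys.at i).1.1) (.pair (x.keys.at i).1.2 (x.keys.at i).2)).map fun pf =>
        Party.mk i false (x.keys.public.getD i (.num 0)) (.num 0) pf with hf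
    have his : Is D noOracle (Comp.mapC (fun i => bif corruptFlag u.1.fst i then
          Comp.ret (Party.mk i true (w.1.fst.get i).fst (.num 0) (w.1.fst.get i).snd)
        else (fun pf => Party.mk i false (x.keys.public.getD i (.num 0)) (.num 0) pf) <$>
          π.key (i, x.keys.public.getD i (.num 0))) (List.range (par.n k))) (mapAll f (List.range (par.n k))) := by
      refine Is.mapC _ fun i _ => ?_
      simp only [hf]
      cases corruptFlag u.1.fst i with
      | true => exact Is.ret _
      | false =>
        have := hπ.key i (x.keys.public.getD i (.num 0)) D noOracle
        rw [Keys.public_getD] at this ⊢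
        exact Is.map this _
    have hf' : mapAll (fun i => if corruptFlag u.1.fst i then
        PMF.pure (Party.mk i true (w.1.fst.get i).fst (.num 0) (w.1.fst.get i).snd) else
        (N₀.prove k x.crs₀.1 (.pair x.pp (x.keys.at i).1.1) (.pair (x.keys.at i).1.2 (x.keys.at i).2)).map fun π =>
          Party.mk i false (x.keys.at i).1.1 (.pair (x.keys.at i).1.2 (x.keys.at i).2) π) (List.range (par.n k)) =
        (mapAll f (List.range (par.n k))).map fun ps => ps.map (fillKey x.keys) := by
      refine Eq.trans ?_ (mapAll_map f (fillKey x.keys) _)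
      refine mapAll_congr fun i _ => ?_
      simp only [hf]
      cases corruptFlag u.1.fst i with
      | true => simp only [if_true, PMF.pure_map]; rfl
      | false =>
        simp only [Bool.false_eq_true, if_false, PMF.map_comp, Keys.public_getD]
        rfl
    have e := Is.map his (fun ps => some (w.1.snd, ps.filter fun q =>
        N₀.verF (⟨k⟩, .ofList [x.pub.get 1, .pair (x.pub.get 0) q.pk, q.proof]))) w.2.1 ()
    rw [Function.comp_apply, hf', PMF.bind_map]
    refine Eq.trans ?_ (congrArg (fun p => PMF.bind p _) e.symm)
    rw [PMF.map_comp, PMF.bind_map]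
    refine bind_ext fun ps => ?_
    simp only [Function.comp_apply, Option.elim]
    congr 1
    rw [List.filter_map]
    congr 1
    refine List.filter_congr fun q _ => ?_
    rw [Function.comp_apply, fillKey]
    split_ifs <;> rfl

/-! ### Soundness of decryption proofs -/

/-- A statement about a wrong share is false: decryption with any valid secret key is correct. -/
theorem Honest.not_sound (henc : E.EncCorrect) {k : ℕ} {pub : Val} (hpp : pub.get 0 ∈ (E.setup k).support)
    {G : List Party} {it : Item} (hi : Honest E ⟨k⟩ pub G it) {y : ℕ} (hy : y ≠ it.2.2) :
    it.stmt pub y ∉ (decLang E Wzk Wsound).sound k (pub.get 0) := by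
  rintro ⟨pk, sk, c, s, w, hx, hdec, -, hver⟩
  obtain ⟨r, hr, hc⟩ := hi.enc
  simp only [Item.stmt, decStmt, Val.ofList, Params.enc, Val.pair.injEq, Val.num.injEq, and_true, true_and] at hx
  obtain ⟨rfl, rfl, rfl⟩ := hx
  have h := (henc k _ hpp _ _ hver (it.2.2 : par.F k) r hr).1
  have hc' : it.2.1 = E.enc k (pub.get 0) it.1.pk (it.2.2 : par.F k) r := hc
  rw [← hc', hdec] at h
  exact hy ((congrArg ZMod.val h).trans (ZMod.val_natCast_of_lt hi.lt))

/-- The record of a wrong share is a false statement with an accepting proof. -/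
theorem attackStage_sup (hSE : Samples E SE) (henc : E.EncCorrect) {k : ℕ} {π : Provers} {pub : Val}
    (hpp : pub.get 0 ∈ (E.setup k).support) (o : Val × List Party) :
    (attackStage E N₂ SE A reveal ⟨k⟩ π pub o).Sup D O fun u => ∀ r, u.2.2 = some r →
      r.1 ∉ (decLang E Wzk Wsound).sound k (pub.get 0) ∧ N₂.ver k (pub.get 3) r.1 r.2 = true := by
  let W : Option (Val × Val) → Prop := fun o => ∀ r, o = some r →
    r.1 ∉ (decLang E Wzk Wsound).sound k (pub.get 0) ∧ N₂.ver k (pub.get 3) r.1 r.2 = true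
  have hstep : ∀ (s : Option Sess × Option (Val × Val)) v, HonestState E ⟨k⟩ pub o.2 s → W s.2 →
      (Comp.twoPhase (openCall E SE reveal ⟨k⟩ π pub o.2) (closeCall N₂ ⟨k⟩ par pub) s v).Sup D O fun u => W u.2.2 := by
    intro s v hI hs
    unfold twoPhase
    split_ifs
    · exact Sup.bind (sup_true _) fun _ _ => .ret hs
    · refine .ret fun r hr => ?_
      rcases hs' : s.2 with _ | r'
      · simp only [hs', Option.none_or] at hr
        rcases hss : s.1 with _ | ss
        · simp [hss, closeCall] at hr
        · obtain ⟨-, cs, rs, hd, h2⟩ := hI ss hss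
          simp only [closeCall, hss, Option.elim, Option.map_eq_some_iff] at hr
          obtain ⟨e, he, rfl⟩ := hr
          obtain ⟨he, hne⟩ := List.mem_filter.1 (List.mem_of_mem_head? he)
          obtain ⟨he, hver⟩ := List.mem_filter.1 he
          obtain ⟨a, ha, rfl⟩ := List.mem_map.1 he
          have hit : a.1.1 ∈ ss.2.map Prod.fst := List.mem_map_of_mem (List.of_mem_zip ha).1
          rw [h2] at hit
          exact ⟨(hd.honest hit).not_sound henc hpp (by simpa using hne), hver⟩
      · simp only [hs', Option.some_or, Option.some.injEq] at hr
        exact hs _ (hs'.trans (congrArg some hr))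
  exact (Sup.handle (I := fun s => HonestState E ⟨k⟩ pub o.2 s ∧ W s.2)
    (fun s v hs d u hu => ⟨honestState_twoPhase hSE _ s v d u hu, hstep s v hs.1 hs.2 d u hu⟩) _
    ⟨fun ss h => by simp at h, fun r h => by simp at h⟩).imp fun u hu => hu.2

theorem game_sup (hSE : Samples E SE) (henc : E.EncCorrect) {k : ℕ} {π : Provers} {pub : Val} {pks : List Val}
    (hpp : pub.get 0 ∈ (E.setup k).support) :
    (game E N₀ N₂ SE A reveal b ⟨k⟩ π pub pks).Sup D O fun u => ∀ r, u.2.1 = some r →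
      r.1 ∉ (decLang E Wzk Wsound).sound k (pub.get 0) ∧ N₂.ver k (pub.get 3) r.1 r.2 = true := by
  refine (sup_true _).bind fun o _ => ?_
  cases o with
  | none => exact .ret (by simp)
  | some o => exact (attackStage_sup hSE henc hpp o).bind fun u hu => Sup.map ((sup_true _).imp fun _ _ => hu)

/-- The pair that a record consists of. -/
def ofRecord (o : Option (Val × Val)) : Val := o.elim (.num 0) fun r => .pair r.1 r.2

theorem pr_record_le {α σ : Type} {X : PMF ((Val × (Option (Val × Val) × α)) × σ)} {B : Val → Val → Prop}
    (h : ∀ u ∈ X.support, ∀ r, u.1.2.1 = some r → B r.1 r.2) : pr X (fun u => u.1.2.1 ≠ none) ≤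
      pr X fun u => B (ofRecord u.1.2.1).fst (ofRecord u.1.2.1).snd := by
  refine pr_mono fun u hu hn => ?_
  obtain ⟨r, hr⟩ := Option.ne_none_iff_exists'.1 hn
  rw [hr]
  exact h u hu r hr
open Classical in
/-- With negligible probability only, a wrong share passes verification. -/
theorem negl_wrong (F : Setting E N₀ N₂ SE SK Nb) (hA : A.PPT) (henc : E.EncCorrect)
    (hsound : N₂.AdaptiveSound D E.setup (decLang E Wzk Wsound)) {FN : Sec × Val → Comp Val}
    (hF : (N₂.system FN).Feasible) (h₀ : P₀.Feasible) (h₁ : P₁.Feasible) :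
    Negl fun k => pr (trial E N₀ N₂ SE Nb A reveal D P₀ P₁ (N₂.system FN) b k) fun u => u.2.2.1 ≠ none := by
  obtain ⟨G, hG, hG'⟩ := exists_materials F h₀ h₁
  -- the adversary that plays the game and outputs the record of a wrong share
  let adv : Sec × Val → Comp Val := fun e => G (e.1, e.2.fst) >>= fun m => (fun u => ofRecord u.2.1) <$>
    play E N₀ N₂ SE A reveal b e.1 (publicParams e.2.fst m.2.1.1 m.2.2.1 e.2.snd) m.1 (P₀.prove e.1 e.2.fst m.2.1)
      (P₁.prove e.1 e.2.fst m.2.2) ((N₂.system FN).prove e.1 e.2.fst (e.2.snd, .num 0))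
  have hadv : PP 0 adv := by
    have hplay := PP.play (w := 0) (b := b) (reveal := reveal) F hA (K := fun y : (Sec × Val) × Materials => y.1.1)
      (pub := fun y => publicParams y.1.2.fst y.2.2.1.1 y.2.2.2.1 y.1.2.snd) (kps := fun y => y.2.1)
      (p₀ := fun y => P₀.prove y.1.1 y.1.2.fst y.2.2.1) (p₁ := fun y => P₁.prove y.1.1 y.1.2.fst y.2.2.2)
      (p₂ := fun y => (N₂.system FN).prove y.1.1 y.1.2.fst (y.1.2.snd, .num 0))
      (h₀.prove_pp (α := (Sec × Val) × Materials) (K := fun y => y.1.1) (d := fun y => y.1.2.fst) (c := fun y => y.2.2.1))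
      (h₁.prove_pp (α := (Sec × Val) × Materials) (K := fun y => y.1.1) (d := fun y => y.1.2.fst) (c := fun y => y.2.2.2))
      (hF.prove_pp (α := (Sec × Val) × Materials) (K := fun y => y.1.1) (d := fun y => y.1.2.fst) (c := fun y => (y.1.2.snd, .num 0)))
    have hout : Det fun y : ((Sec × Val) × Materials) × Outcome => ofRecord y.2.2.1 :=
      Det.option_elim (g := fun (y : ((Sec × Val) × Materials) × Outcome) (r : Val × Val) => Val.pair r.1 r.2)
    exact PP.bind (hG.comp (f := fun y : Sec × Val => (y.1, y.2.fst)))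
      (PP.map (f := fun _ (u : Outcome) => ofRecord u.2.1) hplay)
  obtain ⟨c, hc, hc'⟩ := hadv.exists_ppt
  refine (hsound c hc).mono fun k => ?_
  rw [abs_of_nonneg (pr_nonneg _ _)]
  suffices h : pr (trial E N₀ N₂ SE Nb A reveal D P₀ P₁ (N₂.system FN) b k) (fun u => u.2.2.1 ≠ none) ≤
      (1 : ℕ) * prob ((E.setup k).bind fun d => (N₂.setup k d).bind fun crs =>
        (c.exec D k (.pair d crs) D.init).bind fun u => PMF.pure (decide (u.1.fst ∉ (decLang E Wzk Wsound).sound k d ∧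
          N₂.ver k crs u.1.fst u.1.snd = true))) by
    rw [Nat.cast_one, one_mul] at h
    exact h
  rw [prob_eq_pr]
  simp only [trial, world, PMF.bind_bind, PMF.pure_bind]
  refine pr_bind_le fun pp hpp => ?_
  have hex : ∀ crs, (c.exec D k (.pair pp crs) D.init) = (materials E Nb P₀ P₁ k pp).bind fun m =>
      ((play E N₀ N₂ SE A reveal b ⟨k⟩ (publicParams pp m.2.1.1 m.2.2.1 crs) m.1 (P₀.prove ⟨k⟩ pp m.2.1)
        (P₁.prove ⟨k⟩ pp m.2.2) ((N₂.system FN).prove ⟨k⟩ pp (crs, .num 0))).exec D noOracle D.init ()).map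
        fun u => (ofRecord u.1.2.1, u.2.1) := by
    intro crs
    rw [hc']
    simp only [adv]
    rw [bind_def, exec_bind_of_is (hG' _ _ _), PMF.map_bind]
    refine bind_ext fun m => ?_
    rw [exec_map, PMF.map_comp]
    rfl
  simp only [hex, materials, PMF.bind_bind, PMF.bind_map, PMF.pure_bind, PMF.bind_comm (N₂.setup k pp)]
  refine pr_bind_le fun kps _ => pr_bind_le fun c₀ _ => pr_bind_le fun c₁ _ => ?_
  have hcrs : (N₂.system FN).crs k pp = (N₂.setup k pp).map fun c => (c, .num 0) := rfl
  rw [hcrs, PMF.bind_map]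
  refine pr_bind_le fun crs _ => ?_
  rw [Function.comp_apply, pr_map, pr_out, World.play]
  have hs := game_sup (D := D) (O := noOracle) (A := A) (reveal := reveal) (b := b) (N₀ := N₀) (N₂ := N₂) (Wzk := Wzk)
    (Wsound := Wsound) F.samples henc
    (π := provers E ⟨k⟩ (publicParams pp c₀.1 c₁.1 crs) kps (P₀.prove ⟨k⟩ pp c₀) (P₁.prove ⟨k⟩ pp c₁)
      ((N₂.system FN).prove ⟨k⟩ pp (crs, .num 0))) (pub := publicParams pp c₀.1 c₁.1 crs) (pks := kps.public) hpp D.init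
  rw [Nat.cast_one, one_mul]
  refine (pr_record_le (B := fun x π => x ∉ (decLang E Wzk Wsound).sound k pp ∧ N₂.ver k crs x π = true) hs).trans
    (le_of_eq ?_)
  exact (pr_congr fun u _ => decide_eq_true_iff.symm).trans (pr_map _ _ fun a => a = true).symm

/-! ### Privacy -/

section

variable {F₀ F₁ F₂ : Sec × Val → Comp Val}

theorem actual_provers (h₀ : N₀.ProvedBy F₀) (h₁ : N₁.ProvedBy F₁) (h₂ : N₂.ProvedBy F₂) (k : ℕ) (x : World) :
    Actual E N₀ N₁ N₂ ⟨k⟩ x.pub x.keys (provers E ⟨k⟩ x.pub x.keys ((N₀.system F₀).prove ⟨k⟩ x.pp x.crs₀)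
      ((N₁.system F₁).prove ⟨k⟩ x.pp x.crs₁) ((N₂.system F₂).prove ⟨k⟩ x.pp x.crs₂)) where
  key _ _ D O := h₀ _ D O
  enc _ _ D O := h₁ _ D O
  dec _ D O := h₂ _ D O

/-- The privacy game with given random choices before the game. -/
def actualIn (E : PKE par) (N₀ N₁ N₂ : NIZK) (A : PrivacyAdversary) (reveal b : Bool) (D : Device) (k : ℕ)
    (x : World) : PMF Bool :=
  actualKeys E N₀ N₁ N₂ A reveal b D k x.pub fun C v =>
    mapAll (fun i => if C i then PMF.pure (Party.mk i true (v.get i).fst (.num 0) (v.get i).snd) else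
      (N₀.prove k x.crs₀.1 (.pair x.pp (x.keys.at i).1.1) (.pair (x.keys.at i).1.2 (x.keys.at i).2)).map fun π =>
        Party.mk i false (x.keys.at i).1.1 (.pair (x.keys.at i).1.2 (x.keys.at i).2) π) (List.range (par.n k))

/-- All random choices of the setup and all key pairs may be drawn before the game starts, also key
pairs that no honest participant uses. -/
theorem privacyGame_eq_world (hNb : ∀ k, par.n k ≤ Nb.eval k) (k : ℕ) :
    (genericPVSS E N₀ N₁ N₂).privacyGame reveal D A b k =
      (world E Nb (N₀.system F₀) (N₁.system F₁) (N₂.system F₂) k).bind (actualIn E N₀ N₁ N₂ A reveal b D k) := by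
  rw [privacyGame_eq]
  simp only [world, NIZK.system, PMF.bind_bind, PMF.bind_map, PMF.pure_bind, Function.comp_def]
  refine bind_ext fun pp => ?_
  simp only [presample k pp _ (hNb k)]
  rw [PMF.bind_comm (keysPMF E Nb k pp)]
  refine bind_ext fun c₀ => ?_
  rw [PMF.bind_comm (keysPMF E Nb k pp)]
  refine bind_ext fun c₁ => ?_
  rw [PMF.bind_comm (keysPMF E Nb k pp)]
  rfl

/-- For valid key pairs the game is the computation with actual reconstruction: honest participants
decrypt to the shares that the dealer has computed. -/
theorem actualIn_eq (henc : E.EncCorrect) (F : Setting E N₀ N₂ SE SK Nb) {k : ℕ} {x : World}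
    (hx : x.Possible E Nb k) (hv : x.Valid E k) {π : Provers} (hπ : Actual E N₀ N₁ N₂ ⟨k⟩ x.pub x.keys π) :
    actualIn E N₀ N₁ N₂ A reveal b D k x =
      ((actualGame E N₀ N₂ SE A reveal b ⟨k⟩ π x.pub x.keys.public).out D).map fun u => outBit u.1 := by
  rw [actualIn, actualKeys_eq hπ, Comp.out, PMF.map_comp, actualGame, bind_def, exec_bind, PMF.map_bind]
  refine bind_congr_support fun o ho => ?_
  have hq := keyStage_sup _ _ _ _ _ o ho
  obtain ⟨o, d, _⟩ := o
  cases o with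
  | none =>
    simp only [Option.elim, exec_ret, PMF.pure_map, Function.comp_apply]
    simp [outBit]
  | some o => exact actualRest_eq henc F hx hv (hq o rfl) hπ d

/-- Experiments that agree off a set of negligible probability are indistinguishable. -/
theorem Close.of_bind {α : Type} {p : ℕ → PMF α} {f g : ℕ → α → PMF Bool} {B : ℕ → α → Prop}
    (h : ∀ k, ∀ a ∈ (p k).support, ¬ B k a → f k a = g k a) (hB : Negl fun k => pr (p k) (B k)) :
    Close (fun k => (p k).bind (f k)) fun k => (p k).bind (g k) := by
  refine hB.mono fun k => ?_
  have e : ∀ f : α → PMF Bool, prob ((p k).bind f) =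
      pr ((p k).bind fun a => (f a).map (Prod.mk a)) fun u => u.2 = true := fun f => by
    rw [prob_eq_pr, ← pr_map _ Prod.snd (fun a => a = true), PMF.map_bind]
    simp only [PMF.map_comp]
    congr 2
    exact funext fun a => (PMF.map_id _).symm
  rw [abs_abs, e, e]
  refine (abs_pr_bind_sub_le (B := fun a _ => B k a) (fun a ha u hu => by rw [h k a ha hu]) fun _ u => u = true).trans ?_
  refine pr_bind_const_le fun a _ u hu hS => ?_
  rw [PMF.support_map] at hu
  obtain ⟨_, _, rfl⟩ := hu
  exact hS

/-- The privacy game is indistinguishable from the game with ideal reconstruction. -/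
theorem privacyGame_close (F : Setting E N₀ N₂ SE SK Nb) (hA : A.PPT) (hkey : E.KeyCorrect) (henc : E.EncCorrect)
    (hsound : N₂.AdaptiveSound D E.setup (decLang E Wzk Wsound)) (h₀ : N₀.ProvedBy F₀) (h₁ : N₁.ProvedBy F₁)
    (h₂ : N₂.ProvedBy F₂) (hF₀ : (N₀.system F₀).Feasible) (hF₁ : (N₁.system F₁).Feasible)
    (hF₂ : (N₂.system F₂).Feasible) :
    Close ((genericPVSS E N₀ N₁ N₂).privacyGame reveal D A b)
      (hybrid E N₀ N₂ SE Nb A reveal D (N₀.system F₀) (N₁.system F₁) (N₂.system F₂) b) := by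
  let π : ℕ → World → Provers := fun k x => provers E ⟨k⟩ x.pub x.keys ((N₀.system F₀).prove ⟨k⟩ x.pp x.crs₀)
      ((N₁.system F₁).prove ⟨k⟩ x.pp x.crs₁) ((N₂.system F₂).prove ⟨k⟩ x.pp x.crs₂)
  refine (Close.of_eq fun k => privacyGame_eq_world (F₀ := F₀) (F₁ := F₁) (F₂ := F₂) F.le k).trans <| (Close.of_bind
    (p := world E Nb (N₀.system F₀) (N₁.system F₁) (N₂.system F₂)) (B := fun k x => ¬ x.Valid E k)
    (g := fun k x => ((actualGame E N₀ N₂ SE A reveal b ⟨k⟩ (π k x) x.pub x.keys.public).out D).map fun u => outBit u.1)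
    (fun k x hx hv => actualIn_eq henc F (world_support hx) (not_not.1 hv) (actual_provers h₀ h₁ h₂ k x))
    (negl_invalid hkey)).trans ?_
  refine Close.symm ((negl_wrong (b := b) (reveal := reveal) F hA henc hsound hF₂ hF₀ hF₁).mono fun k => ?_)
  have e : ((world E Nb (N₀.system F₀) (N₁.system F₁) (N₂.system F₂) k).bind fun x =>
      ((actualGame E N₀ N₂ SE A reveal b ⟨k⟩ (π k x) x.pub x.keys.public).out D).map fun u => outBit u.1) =
      ((world E Nb (N₀.system F₀) (N₁.system F₁) (N₂.system F₂) k).bind fun x =>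
      ((actualGame E N₀ N₂ SE A reveal b ⟨k⟩ (π k x) x.pub x.keys.public).out D).map (Prod.mk x)).map
        fun u => outBit u.2.1 := by
    simp only [PMF.map_bind, PMF.map_comp]
    rfl
  beta_reduce
  rw [abs_abs, hybrid_eq_trial, e, prob_map, prob_map]
  exact abs_pr_bind_sub_le (S := fun _ u => outBit u.1 = true) (B := fun _ u => u.2.1 ≠ none)
    fun x _ u hu => (actualGame_rel F.samples).out hu

end

/-- All proofs may be replaced by simulated ones. -/
theorem exists_simulated {par : Params} {E : PKE par} {N₀ N₁ N₂ : NIZK} {SE : Sec × Val → Comp Val} {Nb : ℕ[X]}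
    {SK : Sec × Val → Comp ((Val × Val) × Val)} {D : Device} {Wzk Wsound : ℕ → Set Val}
    (F : Setting E N₀ N₂ SE SK Nb) (hkey : E.KeyCorrect) (henc : E.EncCorrect) (hW : ∀ k, E.wDec k ⊆ Wzk k)
    (hN₀ : N₀.Secure D E.setup (keyLang E)) (hN₁ : N₁.Secure D E.setup (encLang E Wzk))
    (hN₂ : N₂.Secure D E.setup (decLang E Wzk Wsound)) :
    ∃ Q₀ Q₁ Q₂ : ProofSystem, (Q₀.Feasible ∧ Q₁.Feasible ∧ Q₂.Feasible) ∧
      (∀ K d c x w w', Q₀.prove K d c (x, w) = Q₀.prove K d c (x, w')) ∧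
      (∀ K d c x w w', Q₁.prove K d c (x, w) = Q₁.prove K d c (x, w')) ∧
      (∀ K d c x w w', Q₂.prove K d c (x, w) = Q₂.prove K d c (x, w')) ∧
      ∀ (A : PrivacyAdversary), A.PPT → ∀ reveal b, Close ((genericPVSS E N₀ N₁ N₂).privacyGame reveal D A b)
        (hybrid E N₀ N₂ SE Nb A reveal D Q₀ Q₁ Q₂ b) := by
  obtain ⟨e₀, -, s₀, z₀⟩ := hN₀
  obtain ⟨e₁, -, -, z₁⟩ := hN₁
  obtain ⟨e₂, -, s₂, z₂⟩ := hN₂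
  obtain ⟨F₀, p₀, f₀⟩ := e₀.exists_prover
  obtain ⟨F₁, p₁, f₁⟩ := e₁.exists_prover
  obtain ⟨F₂, p₂, f₂⟩ := e₂.exists_prover
  obtain ⟨Q₀, q₀, w₀, i₀⟩ := z₀.exists_simulation e₀ p₀
  obtain ⟨Q₁, q₁, w₁, i₁⟩ := z₁.exists_simulation e₁ p₁
  obtain ⟨Q₂, q₂, w₂, i₂⟩ := z₂.exists_simulation e₂ p₂
  refine ⟨Q₀, Q₁, Q₂, ⟨q₀, q₁, q₂⟩, w₀, w₁, w₂, fun A hA reveal b => ?_⟩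
  refine (privacyGame_close F hA hkey henc s₂ p₀ p₁ p₂ f₀ f₁ f₂).trans ?_
  -- soundness of the key proofs is needed for the sharing proofs, so key proofs are simulated last
  refine (checked_enc F hA s₀ f₀ f₁ f₂ (Wzk := Wzk)).trans <| (hybrid_close₁ F hA i₁ f₀ f₂).trans <|
    (checked_enc F hA s₀ f₀ q₁ f₂).symm.trans ?_
  refine (checked_dec F hA hkey henc hW f₀ q₁ f₂).trans <| (hybrid_close₂ F hA i₂ f₀ q₁).trans <|
    (checked_dec F hA hkey henc hW f₀ q₁ q₂).symm.trans ?_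
  exact (checked_key F hA q₁ q₂ f₀).trans <| (hybrid_close₀ F hA i₀ q₁ q₂).trans
    (checked_key F hA q₁ q₂ q₀).symm

end PVSSPrivacy

end

theorem theorem5 (D : PVSSPrivacy.Device) (par : PVSSPrivacy.Params) (E : PVSSPrivacy.PKE par)
    (Wzk Wsound : ℕ → Set PVSSPrivacy.Val) (N₀ N₁ N₂ : PVSSPrivacy.NIZK)
    (hpar : par.Efficient) (hE : E.Efficient)
    (hkey : E.KeyCorrect) (henc : E.EncCorrect) (huniq : E.UniqueKey)
    (hcpa : E.MultiKeyINDCPA D)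
    (hW : ∀ k, E.wDec k ⊆ Wzk k) (hW' : ∀ k, Wzk k ⊆ Wsound k)
    (hN₀ : N₀.Secure D E.setup (PVSSPrivacy.keyLang E))
    (hN₁ : N₁.Secure D E.setup (PVSSPrivacy.encLang E Wzk))
    (hN₂ : N₂.Secure D E.setup (PVSSPrivacy.decLang E Wzk Wsound))
    (reveal : Bool) :
    (PVSSPrivacy.genericPVSS E N₀ N₁ N₂).IND2Privacy reveal D := by
  intro A hA
  obtain ⟨SE, SK, Nb, F⟩ := PVSSPrivacy.exists_setting hpar hE hN₀.1 hN₂.1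
  obtain ⟨Q₀, Q₁, Q₂, ⟨q₀, q₁, q₂⟩, w₀, w₁, w₂, h⟩ :=
    PVSSPrivacy.exists_simulated F hkey henc hW hN₀ hN₁ hN₂
  have hlast : ∀ b, PVSSPrivacy.Close (PVSSPrivacy.hybrid E N₀ N₂ SE Nb A reveal D Q₀ Q₁ Q₂ b)
      (PVSSPrivacy.lastHybrid E N₀ N₂ SE Nb A reveal D Q₀ Q₁ Q₂ false b) := fun b =>
    .of_eq (PVSSPrivacy.hybrid_eq_last F w₀ w₁ w₂)
  exact (h A hA reveal false).trans <| (hlast false).trans <|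
    (PVSSPrivacy.lastHybrid_close F hA q₀ q₁ q₂ hcpa).trans <| (hlast true).symm.trans (h A hA reveal true).symm
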